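/- All graphs are finite, undirected and loopless, and parallel edges are allowed. We consider two settings: unweighted graphs (every edge has weight $1$) and graphs with positive integer edge weights. For a vertex set $A$, the weight of the cut $(A,V\setminus A)$ is the total weight of the edges with exactly one endpoint in $A$; $\mathrm{mincut}_G(u,v)$ is the minimum weight of a cut with $u\in A$, $v\notin A$. A Gomory-Hu tree of $G=(V,E)$ is a tree $T$ on $V$ with nonnegative integer edge weights such that, for all distinct $u,v\in V$, every minimum $u$-$v$ cut $(A,V\setminus A)$ of $T$ is a minimum $u$-$v$ cut of $G$, of the same weight. A max-flow call takes a graph with two distinct vertices $s,t$ and returns a maximum (integral) $s$-$t$ flow. A $k$-SSC Verification call takes a graph $H$, an integer $k\ge 0$, a terminal set $X$, a source $s\in X$ and integers $\tilde\lambda_v$ with $\tilde\lambda_v\ge\min\{\mathrm{mincut}_H(s,v),k\}$ for $v\in X\setminus\{s\}$, and returns for every $v\in X\setminus\{s\}$ whether $\tilde\lambda_v=\min\{\mathrm{mincut}_H(s,v),k\}$. The value of $k$ may differ from call to call. Algorithms are programs for a word RAM with fair random bits and unit-cost arithmetic on words of $w$ bits. **Corollary.** In each of the two settings the following holds. For every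 $c\in\mathbb N$ there are a randomized algorithm and a constant $C$ such that for every graph $G$ of the setting with $n\ge 1$ vertices, $m$ edges and total edge weight $W$, for every word length $w$ with $2^w\ge(n+m+W+2)^C$, and for every pair of correct oracles for max-flow and for $k$-SSC Verification on graphs of the same setting: 1. for every outcome of the random bits, the algorithm on input $G$ halts, all its oracle calls are on graphs of the same setting, these graphs have in total at most $C\,n\,(\lfloor\log_2 n\rfloor+1)^C=\tilde O(n)$ vertices and at most $C\,m\,(\lfloor\log_2 n\rfloor+1)^C=\tilde O(m)$ edges, and the algorithm takes at most $C\,(n+m)\,(\lfloor\log_2 n\rfloor+1)^C$ steps outside of these calls (which is $\tilde O(m)$ if $G$ has no isolated vertices); 2. with probability at least $1-n^{-c}$ its output is a Gomory-Hu tree of $G$. -/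

import Mathlib

namespace GomoryHu

/-! ### Graphs, cuts, flows and Gomory-Hu trees -/

/-- An undirected loopless multigraph on the vertices `0, …, n-1` with `m` edges and natural
weights. Edge `e` joins `tail e` and `head e`; which endpoint is called the tail only fixes the
sign convention for flows. -/
structure MGraph (n m : ℕ) where
  tail : Fin m → Fin n
  head : Fin m → Fin n
  weight : Fin m → ℕ
  loopless : ∀ e, tail e ≠ head e

/-- The two settings: unweighted multigraphs and graphs with positive integer weights. -/
inductive Kind
  | unweighted
  | weighted

namespace MGraph

variable {n m : ℕ}

/-- `G` is an admissible graph in the setting `κ`. -/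
def OfKind (G : MGraph n m) : Kind → Prop
  | .unweighted => ∀ e, G.weight e = 1
  | .weighted => ∀ e, 0 < G.weight e

def totalWeight (G : MGraph n m) : ℕ := ∑ e, G.weight e

/-- Total weight of the edges with exactly one endpoint in `A`. -/
def cutWeight (G : MGraph n m) (A : Finset (Fin n)) : ℕ :=
  ∑ e with ¬(G.tail e ∈ A ↔ G.head e ∈ A), G.weight e

/-- The minimum weight of a cut separating `s` from `t` (used for `s ≠ t` only). -/
noncomputable def mincut (G : MGraph n m) (s t : Fin n) : ℕ :=
  sInf {c | ∃ A : Finset (Fin n), s ∈ A ∧ t ∉ A ∧ G.cutWeight A = c}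

/-- `(A, V \ A)` is a minimum cut separating `s ∈ A` from `t ∉ A`. -/
def IsMincut (G : MGraph n m) (s t : Fin n) (A : Finset (Fin n)) : Prop :=
  s ∈ A ∧ t ∉ A ∧ G.cutWeight A = G.mincut s t

/-- The underlying simple graph: zero-weight edges count as edges. -/
def toSimple (G : MGraph n m) : SimpleGraph (Fin n) :=
  SimpleGraph.fromRel fun u v => ∃ e, G.tail e = u ∧ G.head e = v

/-- `G` is a tree (the count of edges excludes parallel edges). -/
def IsTree (G : MGraph n m) : Prop := G.toSimple.IsTree ∧ m + 1 = n

/-- `T` is a Gomory-Hu tree of `G`: a weighted tree on the vertex set of `G` such that for all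
`u ≠ v`, every minimum `u`-`v` cut of `T` is a minimum `u`-`v` cut of `G`, of the same weight. -/
def IsGomoryHuTree {m' : ℕ} (G : MGraph n m) (T : MGraph n m') : Prop :=
  T.IsTree ∧ ∀ u v, u ≠ v → ∀ A, T.IsMincut u v A →
    G.IsMincut u v A ∧ G.cutWeight A = T.cutWeight A

/-- Net flow out of `v`, where `f e` is the (signed) flow along `e` from tail to head. -/
def netOut (G : MGraph n m) (f : Fin m → ℤ) (v : Fin n) : ℤ :=
  (∑ e with G.tail e = v, f e) - ∑ e with G.head e = v, f e

/-- `f` is an integral `s`-`t` flow in the undirected graph `G` with the weights as capacities. -/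
def IsFlow (G : MGraph n m) (s t : Fin n) (f : Fin m → ℤ) : Prop :=
  (∀ e, |f e| ≤ G.weight e) ∧ ∀ v, v ≠ s → v ≠ t → G.netOut f v = 0

def IsMaxFlow (G : MGraph n m) (s t : Fin n) (f : Fin m → ℤ) : Prop :=
  G.IsFlow s t f ∧ ∀ g, G.IsFlow s t g → G.netOut g s ≤ G.netOut f s

end MGraph

/-! ### The two oracle problems -/

/-- An instance of max-flow. -/
structure FlowQuery (n m : ℕ) where
  graph : MGraph n m
  source : Fin n
  sink : Fin n
  source_ne_sink : source ≠ sink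

/-- An instance of `k`-bounded single source connectivity verification: a graph, a bound `k`,
a terminal set `X`, a source `s ∈ X`, and estimates that are promised to be upper bounds. -/
structure SSCQuery (n m : ℕ) where
  graph : MGraph n m
  k : ℕ
  terminals : Finset (Fin n)
  source : Fin n
  source_mem : source ∈ terminals
  est : Fin n → ℕ
  promise : ∀ v ∈ terminals, v ≠ source → min (graph.mincut source v) k ≤ est v

/-- Answers to all max-flow and all verification instances. -/
structure Oracles where
  flow : ∀ {n m : ℕ}, FlowQuery n m → Fin m → ℤ
  verify : ∀ {n m : ℕ}, SSCQuery n m → Fin n → Bool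

/-- The answers are correct on all instances whose graph belongs to the setting `κ`: the first
oracle returns some maximum flow, and the second one decides for every terminal other than the
source whether its estimate equals `min {mincut, k}`. -/
structure Oracles.Correct (O : Oracles) (κ : Kind) : Prop where
  flow_correct : ∀ {n m : ℕ} (q : FlowQuery n m), q.graph.OfKind κ →
    q.graph.IsMaxFlow q.source q.sink (O.flow q)
  verify_correct : ∀ {n m : ℕ} (q : SSCQuery n m), q.graph.OfKind κ →
    ∀ v ∈ q.terminals, v ≠ q.source →
      (O.verify q v = true ↔ q.est v = min (q.graph.mincut q.source v) q.k)

/-! ### A randomized word RAM with oracle calls -/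

/-- Expressions over word variables and word arrays. -/
inductive Expr
  | const (c : ℕ)
  | var (x : ℕ)
  | load (a : ℕ) (i : Expr)
  | add (e₁ e₂ : Expr)
  | sub (e₁ e₂ : Expr)
  | mul (e₁ e₂ : Expr)
  | div (e₁ e₂ : Expr)
  | mod (e₁ e₂ : Expr)
  | lt (e₁ e₂ : Expr)
  | eq (e₁ e₂ : Expr)

/-- Programs. Variables and arrays are named by fixed numbers, so a program uses only finitely
many of them; `flip x` stores a fair random bit in the variable `x`. -/
inductive Prog
  | skip
  | assign (x : ℕ) (e : Expr)
  | store (a : ℕ) (i e : Expr)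
  | flip (x : ℕ)
  | seq (p q : Prog)
  | branch (e : Expr) (p q : Prog)
  | loop (e : Expr) (p : Prog)
  | callFlow
  | callVerify

/-- Memory, the number of random bits used, and the resources spent so far: elementary steps, and
total numbers of vertices and of edges of all graphs given to the oracles. -/
structure State where
  var : ℕ → ℕ
  arr : ℕ → ℕ → ℕ
  bits : ℕ
  time : ℕ
  vertices : ℕ
  edges : ℕ

/-- Value of an expression on a machine with words of `w` bits. -/
def Expr.eval (w : ℕ) (σ : State) : Expr → ℕ
  | .const c => c % 2 ^ w
  | .var x => σ.var x
  | .load a i => σ.arr a (i.eval w σ)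
  | .add e₁ e₂ => (e₁.eval w σ + e₂.eval w σ) % 2 ^ w
  | .sub e₁ e₂ => e₁.eval w σ - e₂.eval w σ
  | .mul e₁ e₂ => (e₁.eval w σ * e₂.eval w σ) % 2 ^ w
  | .div e₁ e₂ => e₁.eval w σ / e₂.eval w σ
  | .mod e₁ e₂ => e₁.eval w σ % e₂.eval w σ
  | .lt e₁ e₂ => if e₁.eval w σ < e₂.eval w σ then 1 % 2 ^ w else 0
  | .eq e₁ e₂ => if e₁.eval w σ = e₂.eval w σ then 1 % 2 ^ w else 0

namespace State

/-- One elementary step. -/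
def tick (σ : State) : State := { σ with time := σ.time + 1 }

def setVar (σ : State) (x v : ℕ) : State := { σ with var := Function.update σ.var x v }

def setArr (σ : State) (a i v : ℕ) : State :=
  { σ with arr := Function.update σ.arr a (Function.update (σ.arr a) i v) }

/-- Overwrite the first `l` cells of the array `a`. -/
def fillArr (σ : State) (a : ℕ) {l : ℕ} (f : Fin l → ℕ) : State :=
  { σ with arr := Function.update σ.arr a fun i => if h : i < l then f ⟨i, h⟩ else σ.arr a i }

/-- Charge for an oracle call on a graph with `n` vertices and `m` edges. -/
def charge (σ : State) (n m : ℕ) : State :=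
  { σ with vertices := σ.vertices + n, edges := σ.edges + m }

/-- The convention for storing a graph: the numbers of vertices and edges in the variables 0 and 1,
the tails, heads and weights of the edges in the arrays 0, 1 and 2. -/
def HoldsGraph (σ : State) {n m : ℕ} (G : MGraph n m) : Prop :=
  σ.var 0 = n ∧ σ.var 1 = m ∧
    ∀ e : Fin m, σ.arr 0 e = G.tail e ∧ σ.arr 1 e = G.head e ∧ σ.arr 2 e = G.weight e

/-- A max-flow instance: source and sink are in the variables 2 and 3. -/
def HoldsFlowQuery (σ : State) {n m : ℕ} (q : FlowQuery n m) : Prop :=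
  σ.HoldsGraph q.graph ∧ σ.var 2 = q.source ∧ σ.var 3 = q.sink

/-- A verification instance: source and `k` are in the variables 2 and 3, the indicator function of
the terminal set in the array 5, the estimates in the array 6. -/
def HoldsSSCQuery (σ : State) {n m : ℕ} (q : SSCQuery n m) : Prop :=
  σ.HoldsGraph q.graph ∧ σ.var 2 = q.source ∧ σ.var 3 = q.k ∧
    ∀ v : Fin n, σ.arr 5 v = (if v ∈ q.terminals then 1 else 0) ∧ σ.arr 6 v = q.est v

/-- The initial state on the input `G`: everything that does not hold the input is zero. -/
def start {n m : ℕ} (G : MGraph n m) : State :=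
  (((⟨fun _ => 0, fun _ _ => 0, 0, 0, 0, 0⟩ : State).setVar 0 n).setVar 1 m
    |>.fillArr 0 fun e => (G.tail e : ℕ))
    |>.fillArr 1 (fun e => (G.head e : ℕ))
    |>.fillArr 2 G.weight

end State

/-- `Exec κ w O ω p σ σ'`: on words of `w` bits, with the oracles `O` and the random bits `ω`, the
program `p` started in `σ` halts in `σ'`. Every assignment, store, coin flip, test and call takes
one step (a program is fixed, so its expressions have constant size). An oracle call is possible
only if the memory holds an instance with a graph of the setting `κ` (satisfying the promise);
otherwise the machine is stuck and there is no execution. The answer to a max-flow call is the flow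
from tail to head (array 3) and from head to tail (array 4) on every edge; the answer to a
verification call is one bit per vertex (array 7). -/
inductive Exec (κ : Kind) (w : ℕ) (O : Oracles) (ω : ℕ → Bool) : Prog → State → State → Prop
  | skip (σ : State) : Exec κ w O ω .skip σ σ
  | assign (x : ℕ) (e : Expr) (σ : State) :
      Exec κ w O ω (.assign x e) σ (σ.tick.setVar x (e.eval w σ))
  | store (a : ℕ) (i e : Expr) (σ : State) :
      Exec κ w O ω (.store a i e) σ (σ.tick.setArr a (i.eval w σ) (e.eval w σ))
  | flip (x : ℕ) (σ : State) :
      Exec κ w O ω (.flip x) σ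
        { σ.tick.setVar x (if ω σ.bits then 1 else 0) with bits := σ.bits + 1 }
  | seq {p q : Prog} {σ₁ σ₂ σ₃ : State} :
      Exec κ w O ω p σ₁ σ₂ → Exec κ w O ω q σ₂ σ₃ → Exec κ w O ω (.seq p q) σ₁ σ₃
  | branch_true {e : Expr} {p q : Prog} {σ σ' : State} :
      e.eval w σ ≠ 0 → Exec κ w O ω p σ.tick σ' → Exec κ w O ω (.branch e p q) σ σ'
  | branch_false {e : Expr} {p q : Prog} {σ σ' : State} :
      e.eval w σ = 0 → Exec κ w O ω q σ.tick σ' → Exec κ w O ω (.branch e p q) σ σ'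
  | loop_false {e : Expr} {p : Prog} {σ : State} :
      e.eval w σ = 0 → Exec κ w O ω (.loop e p) σ σ.tick
  | loop_true {e : Expr} {p : Prog} {σ₁ σ₂ σ₃ : State} :
      e.eval w σ₁ ≠ 0 → Exec κ w O ω p σ₁.tick σ₂ → Exec κ w O ω (.loop e p) σ₂ σ₃ →
        Exec κ w O ω (.loop e p) σ₁ σ₃
  | callFlow {n m : ℕ} (q : FlowQuery n m) {σ : State} :
      q.graph.OfKind κ → σ.HoldsFlowQuery q →
        Exec κ w O ω .callFlow σ
          (((σ.tick.charge n m).fillArr 3 fun e => (O.flow q e).toNat).fillArr 4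
            fun e => (-O.flow q e).toNat)
  | callVerify {n m : ℕ} (q : SSCQuery n m) {σ : State} :
      q.graph.OfKind κ → σ.HoldsSSCQuery q →
        Exec κ w O ω .callVerify σ
          ((σ.tick.charge n m).fillArr 7 fun v => if O.verify q v then 1 else 0)

/-- The law of an infinite sequence of independent fair bits. -/
noncomputable def coins : MeasureTheory.Measure (ℕ → Bool) :=
  MeasureTheory.Measure.infinitePi fun _ => (PMF.uniformOfFintype Bool).toMeasure

/-- The factor `(⌊log₂ n⌋ + 1) ^ C`. -/
def polylog (C n : ℕ) : ℕ := (Nat.log 2 n + 1) ^ C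

end GomoryHu

namespace GomoryHu

/-! The algorithm refines a partition tree. Its nodes, the instances, partition the vertices, and `D
j` is the set of vertices in the subtree of `j`. Every tree edge carries a certificate: some vertex
of `j` and some vertex of the parent of `j` (a pivot pair) for which `D j` is a minimum cut. Once
all instances are singletons, the pivot pairs are the ends of the tree edges and the tree is a
Gomory-Hu tree (`CfgInv.gomoryHu_of_injective`): an edge of the graph that crosses `A` also crosses
`D j` for some tree edge that crosses `A`, so no set is heavier in the graph than in the tree, and
the certificates bound the minimum cuts of the tree by those of the graph.

A round splits all instances at once. The contracted graph of an instance has its vertices, one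
vertex for each child and one for everything outside. Uncrossing with the certified cuts shows that
contraction does not change connectivities inside the instance (`CfgInv.exists_contracted_cut`), and
splitting along minimum cuts keeps the certificates (`Split.cfgInv`). To find such cuts, a random
source per instance and a random set of terminals are drawn. For each bit of the codes of the
terminals, one maximum flow in the union of all contracted graphs refines a labelling, and every
terminal `v` receives a candidate set. If the least minimum cut `M` between `v` and the source
contains neither another terminal nor the contracted outside, the candidate is `M`
(`Refinement.eq_set`). One verification call with all sources merged tells which candidates are
minimum cuts, and only those are used. So the tree is valid for every outcome of the random bits;
only the progress is random.

For progress, call `(s, v)` good if the least minimum cut `M` between them avoids the outside and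
has at most half of the `k` vertices of the instance. At least one eighth of all pairs are good
(`card_pairs_le_goodPairs`). With samples of random density, a good pair is singled out with
probability at least `1 / (256 B² k |M|)` (`singled_prob`), and then `|M| (k - |M|) ≥ k |M| / 2`
pairs are separated. The sizes cancel, so a round shrinks the expected number of unseparated pairs
by the factor `1 - 1 / (4096 B²)` (`expected_progress`). After `4096 (c + 2) B³` rounds the
expectation is below `n ^ (-c)`, and Markov's inequality finishes the argument (`card_bad_le`).

The queries stay small because each edge is recorded only in the one instance where its ends lie in
different blocks, while the remaining weight of a block is collected into edges to the outside. In
the unweighted setting these are unit edges; they are few because `D j` weighs no more than the cut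
of the pivot vertex of `j`, and different `j` have different pivot vertices
(`CfgInv.sum_portions_le`). A query has `3n + 4` vertices and at most `10m` edges, and a round makes
`B + 2` queries. The second half of the proof establishes these facts for an explicit word RAM
program. -/

/-! ### Cut functions of weighted edge families -/

/-- A finite family of weighted edges on the vertex type `α`. -/
structure Net (ι α : Type*) where
  s : Finset ι
  x : ι → α
  y : ι → α
  w : ι → ℕ

open Classical in
/-- Contribution of an edge `ab` to the cut of `Z` after every edge between different label classes
has been replaced by two edges to a sink outside of `Z`. -/
noncomputable def edgeCost {α : Type*} (lab : α → ℕ) (Z : Set α) (a b : α) : ℕ :=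
  if lab a = lab b then (if (a ∈ Z ↔ b ∈ Z) then 0 else 1)
  else (if a ∈ Z then 1 else 0) + (if b ∈ Z then 1 else 0)

namespace Net

variable {ι α : Type*} (N : Net ι α)

/-- An edge between two classes is charged at each of its ends in `Z`, so classes do not interact
and one minimization treats all of them simultaneously. The charge is realized by a sink outside of
`Z`. -/
noncomputable def fcut (lab : α → ℕ) (Z : Set α) : ℕ :=
  ∑ e ∈ N.s, N.w e * edgeCost lab Z (N.x e) (N.y e)

noncomputable def cut (Z : Set α) : ℕ := N.fcut (fun _ => 0) Z

variable {N}

/-- Edge by edge: an edge inside a class contributes a cut function, an edge between classes a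
modular function. -/
theorem fcut_submod (lab : α → ℕ) (A B : Set α) :
    N.fcut lab (A ∩ B) + N.fcut lab (A ∪ B) ≤ N.fcut lab A + N.fcut lab B := by
  unfold fcut
  rw [← Finset.sum_add_distrib, ← Finset.sum_add_distrib]
  refine Finset.sum_le_sum fun e _ => ?_
  rw [← mul_add, ← mul_add]
  refine Nat.mul_le_mul_left _ ?_
  unfold edgeCost
  by_cases h1 : N.x e ∈ A <;> by_cases h2 : N.x e ∈ B <;> by_cases h3 : N.y e ∈ A <;>
    by_cases h4 : N.y e ∈ B <;> by_cases h5 : lab (N.x e) = lab (N.y e) <;>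
    simp [h1, h2, h3, h4, h5]

theorem fcut_posimod (lab : α → ℕ) (A B : Set α) :
    N.fcut lab (A \ B) + N.fcut lab (B \ A) ≤ N.fcut lab A + N.fcut lab B := by
  unfold fcut
  rw [← Finset.sum_add_distrib, ← Finset.sum_add_distrib]
  refine Finset.sum_le_sum fun e _ => ?_
  rw [← mul_add, ← mul_add]
  refine Nat.mul_le_mul_left _ ?_
  unfold edgeCost
  by_cases h1 : N.x e ∈ A <;> by_cases h2 : N.x e ∈ B <;> by_cases h3 : N.y e ∈ A <;>
    by_cases h4 : N.y e ∈ B <;> by_cases h5 : lab (N.x e) = lab (N.y e) <;>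
    simp [h1, h2, h3, h4, h5]

/-- Edges that leave `T` join different classes and are therefore charged at their two ends
separately, so the cost is additive over `T` and its complement. -/
theorem fcut_split {lab : α → ℕ} {T : Set α}
    (hT : ∀ e ∈ N.s, ¬(N.x e ∈ T ↔ N.y e ∈ T) → lab (N.x e) ≠ lab (N.y e)) (Z : Set α) :
    N.fcut lab Z = N.fcut lab (Z ∩ T) + N.fcut lab (Z \ T) := by
  unfold fcut
  rw [← Finset.sum_add_distrib]
  refine Finset.sum_congr rfl fun e he => ?_
  rw [← mul_add]
  congr 1
  have := hT e he
  unfold edgeCost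
  by_cases h1 : N.x e ∈ Z <;> by_cases h2 : N.x e ∈ T <;> by_cases h3 : N.y e ∈ Z <;>
    by_cases h4 : N.y e ∈ T <;> by_cases h5 : lab (N.x e) = lab (N.y e) <;>
    simp_all

theorem fcut_eq_cut {lab : α → ℕ} {Z : Set α} {l : ℕ} (hZ : ∀ x ∈ Z, lab x = l) :
    N.fcut lab Z = N.cut Z := by
  unfold cut fcut
  refine Finset.sum_congr rfl fun e _ => ?_
  congr 1
  have h1 := hZ (N.x e)
  have h2 := hZ (N.y e)
  unfold edgeCost
  by_cases h1 : N.x e ∈ Z <;> by_cases h3 : N.y e ∈ Z <;>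
    by_cases h5 : lab (N.x e) = lab (N.y e) <;> simp_all

theorem cut_congr {Z Z' : Set α} (h : ∀ e ∈ N.s, (N.x e ∈ Z ↔ N.x e ∈ Z') ∧ (N.y e ∈ Z ↔ N.y e ∈ Z')) :
    N.cut Z = N.cut Z' := by
  unfold cut fcut
  refine Finset.sum_congr rfl fun e he => ?_
  have h1 := h e he
  by_cases h2 : N.x e ∈ Z' <;> by_cases h3 : N.y e ∈ Z' <;> simp_all [edgeCost]

theorem cut_compl (Z : Set α) : N.cut Zᶜ = N.cut Z := by
  unfold cut fcut
  refine Finset.sum_congr rfl fun e _ => ?_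
  by_cases h1 : N.x e ∈ Z <;> by_cases h3 : N.y e ∈ Z <;> simp [edgeCost, h1, h3]

theorem cut_submod (A B : Set α) : N.cut (A ∩ B) + N.cut (A ∪ B) ≤ N.cut A + N.cut B :=
  fcut_submod _ _ _

theorem cut_posimod (A B : Set α) : N.cut (A \ B) + N.cut (B \ A) ≤ N.cut A + N.cut B :=
  fcut_posimod _ _ _

variable (N) in
/-- `L` is a lower bound for the cuts between `a` and `b`. -/
def CutLB (a b : α) (L : ℕ) : Prop := ∀ X : Set α, a ∈ X → b ∉ X → L ≤ N.cut X

theorem CutLB.symm {a b : α} {L : ℕ} (h : N.CutLB a b L) : N.CutLB b a L := by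
  intro X h1 h2
  rw [← cut_compl]
  exact h _ h2 (by simpa using h1)

open Classical in
-- `Z` is a minimum cut between `b` and `a`. If `b ∈ X`, then `X ∩ Z` also separates them and
-- submodularity makes `X ∪ Z` no heavier than `X`. Otherwise `Z \ X` separates them and
-- posimodularity does the same for `X \ Z`.
theorem uncross {a b : α} {Z : Set α} (hb : b ∈ Z) (ha : a ∉ Z) (h : N.CutLB b a (N.cut Z))
    (X : Set α) : N.cut (if b ∈ X then X ∪ Z else X \ Z) ≤ N.cut X := by
  split_ifs with hX
  · have h1 := N.cut_submod X Z
    have h2 := h (X ∩ Z) ⟨hX, hb⟩ (fun h => ha h.2)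
    omega
  · have h1 := N.cut_posimod X Z
    have h2 := h (Z \ X) ⟨hb, hX⟩ (fun h => ha h.1)
    omega

open Classical in
-- The sets are uncrossed one after the other. As they are disjoint, uncrossing with some of them
-- does not change on which side the vertex `b i` of another one lies.
theorem uncross_family {κ : Type*} (P : Finset κ) (Z : κ → Set α) (a b : κ → α)
    (hdisj : ∀ i ∈ P, ∀ j ∈ P, i ≠ j → ∀ u, u ∈ Z i → u ∉ Z j)
    (hb : ∀ i ∈ P, b i ∈ Z i) (ha : ∀ i ∈ P, a i ∉ Z i)
    (h : ∀ i ∈ P, N.CutLB (b i) (a i) (N.cut (Z i))) (X : Set α) :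
    N.cut {u | (∃ j ∈ P, u ∈ Z j ∧ b j ∈ X) ∨ (u ∈ X ∧ ∀ j ∈ P, u ∉ Z j)} ≤ N.cut X := by
  induction P using Finset.induction_on with
  | empty => simp
  | insert i P hi ih =>
    refine le_trans ?_ (ih (fun i hi j hj => hdisj i (Finset.mem_insert_of_mem hi) j (Finset.mem_insert_of_mem hj))
      (fun i hi => hb i (Finset.mem_insert_of_mem hi)) (fun i hi => ha i (Finset.mem_insert_of_mem hi))
      (fun i hi => h i (Finset.mem_insert_of_mem hi)))
    have hi' := Finset.mem_insert_self i P
    refine le_trans (le_of_eq ?_) (uncross (hb i hi') (ha i hi') (h i hi') _)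
    have hni : ∀ j ∈ P, ∀ u, u ∈ Z i → u ∉ Z j := fun j hj u hu =>
      hdisj i hi' j (Finset.mem_insert_of_mem hj) (by rintro rfl; exact hi hj) u hu
    have hbi : (b i ∈ {u | (∃ j ∈ P, u ∈ Z j ∧ b j ∈ X) ∨ (u ∈ X ∧ ∀ j ∈ P, u ∉ Z j)}) ↔ b i ∈ X := by
      constructor
      · rintro (⟨j, hj, hu, _⟩ | h)
        · exact absurd hu (hni j hj _ (hb i hi'))
        · exact h.1
      · intro h
        exact Or.inr ⟨h, fun j hj => hni j hj _ (hb i hi')⟩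
    congr 1
    split_ifs with hX
    · rw [hbi] at hX
      ext u
      simp only [Set.mem_ofPred_eq, Set.mem_union, Finset.mem_insert, exists_eq_or_imp, forall_eq_or_imp]
      have := fun j hj => hni j hj u
      by_cases hu : u ∈ Z i
      · simp [hu, hX]
      · simp [hu]
    · rw [hbi] at hX
      ext u
      simp only [Set.mem_ofPred_eq, Set.mem_sdiff, Finset.mem_insert, exists_eq_or_imp, forall_eq_or_imp]
      have := fun j hj => hni j hj u
      by_cases hu : u ∈ Z i
      · simp only [hu, hX, and_false, not_true_eq_false, false_and, or_false, false_or, iff_false]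
        rintro ⟨j, hj, h1, _⟩
        exact this j hj hu h1
      · simp [hu]

/-- This repairs a pivot pair `b`, `a` that is separated by a new minimum cut `S`: the partner of
`b` becomes `v`. A cut between `v` and `b` may separate `a` from `b`, or `v` from `s` and then
weighs at least `cut S ≥ L`. In the remaining case uncrossing with `S` leaves `X ∪ S`, which
separates `b` from `a`. -/
theorem pivot_inside {a b v s : α} {S : Set α} {L : ℕ} (hv : v ∈ S) (hs : s ∉ S)
    (hS : N.CutLB v s (N.cut S)) (hb : b ∈ S) (ha : a ∉ S) (h : N.CutLB b a L) : N.CutLB v b L := by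
  intro X hvX hbX
  by_cases haX : a ∈ X
  · exact h.symm X haX hbX
  · have hL := h S hb ha
    by_cases hsX : s ∈ X
    · have h1 := N.cut_submod X S
      have h2 := hS (X ∩ S) ⟨hvX, hv⟩ (fun h => hs h.2)
      have h3 := h (X ∪ S) (Or.inr hb) (by simp [haX, ha])
      omega
    · exact hL.trans (hS X hvX hsX)

theorem pivot_outside {a b v s : α} {S : Set α} {L : ℕ} (hv : v ∈ S) (hs : s ∉ S)
    (hS : N.CutLB v s (N.cut S)) (hb : b ∉ S) (ha : a ∈ S) (h : N.CutLB b a L) : N.CutLB s b L :=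
  pivot_inside (S := Sᶜ) (v := s) (s := v) hs (by simpa using hv)
    (by rw [cut_compl]; exact hS.symm) hb (by simpa using ha) h

end Net

/-! ### Least minimizers and label refinement -/

/-- This is the minimizer that residual reachability from the source of a maximum flow computes. -/
structure IsLeastMin {α : Type*} (f : Set α → ℕ) (P : Set α → Prop) (X : Set α) : Prop where
  mem : P X
  le : ∀ Z, P Z → f X ≤ f Z
  least : ∀ Z, P Z → f Z ≤ f X → X ⊆ Z

/-- The sets `X b` are the least minimum cuts that successively separate the vertices of `TM` by
the bits of their codes `cd`, where previously separated classes are kept apart; `lab` collects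
the outcomes. -/
structure Refinement {ι α : Type*} (N : Net ι α) (TM : Set α) (cd : α → ℕ) (B : ℕ)
    (X : ℕ → Set α) (lab : ℕ → α → ℕ) : Prop where
  zero : ∀ x, lab 0 x = 0
  mem : ∀ b ≤ B, ∀ x, x ∈ X b → lab (b + 1) x = lab b x + 2 ^ b
  not_mem : ∀ b ≤ B, ∀ x, x ∉ X b → lab (b + 1) x = lab b x
  min : ∀ b ≤ B, IsLeastMin (N.fcut (lab b))
    (fun Z => ∀ x ∈ TM, (x ∈ Z ↔ (cd x).testBit b = true)) (X b)

theorem mod_two_pow_succ (c b : ℕ) :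
    c % 2 ^ (b + 1) = c % 2 ^ b + if c.testBit b = true then 2 ^ b else 0 := by
  rw [Nat.mod_pow_succ, Nat.testBit_eq_decide_div_mod_eq]
  rcases Nat.mod_two_eq_zero_or_one (c / 2 ^ b) with h | h <;> simp [h]

namespace Refinement

variable {ι α : Type*} {N : Net ι α} {TM : Set α} {cd : α → ℕ} {B : ℕ} {X : ℕ → Set α}
  {lab : ℕ → α → ℕ}

theorem lab_lt (h : Refinement N TM cd B X lab) : ∀ b ≤ B + 1, ∀ x, lab b x < 2 ^ b
  | 0, _, x => by simp [h.zero]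
  | b + 1, hb, x => by
    have := lab_lt h b (by omega) x
    by_cases hx : x ∈ X b
    · rw [h.mem b (by omega) x hx, pow_succ]; omega
    · rw [h.not_mem b (by omega) x hx, pow_succ]; omega

theorem lab_follow (h : Refinement N TM cd B X lab) {x : α} {c b : ℕ} (hb : b ≤ B)
    (hl : lab b x = c % 2 ^ b) (hx : x ∈ X b ↔ c.testBit b = true) :
    lab (b + 1) x = c % 2 ^ (b + 1) := by
  rw [mod_two_pow_succ]
  by_cases hxb : x ∈ X b
  · rw [h.mem b hb x hxb, hl, hx.1 hxb]; simp
  · have : c.testBit b = false := by simpa using mt hx.2 hxb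
    rw [h.not_mem b hb x hxb, hl, this]; simp

theorem lab_coded (h : Refinement N TM cd B X lab) {x : α} (hx : x ∈ TM) :
    ∀ b ≤ B + 1, lab b x = cd x % 2 ^ b
  | 0, _ => by simp [h.zero, Nat.mod_one]
  | b + 1, hb => h.lab_follow (by omega) (lab_coded h hx b (by omega))
      ((h.min b (by omega)).mem x hx)

theorem mem_last (h : Refinement N TM cd B X lab) {x : α} (hx : 2 ^ B ≤ lab (B + 1) x) :
    x ∈ X B := by
  by_contra hn
  rw [h.not_mem B le_rfl x hn] at hx
  exact absurd (h.lab_lt B (by omega) x) (by omega)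

/-- Removing `T` from `X B` costs nothing, since no edge joins `T` to the rest of its class, and it
violates no prescription, since no terminal in `T` must belong to `X B`. The least minimizer hence
avoids `T`. -/
theorem trim (h : Refinement N TM cd B X lab) {T : Set α}
    (hT : ∀ e ∈ N.s, ¬(N.x e ∈ T ↔ N.y e ∈ T) → lab B (N.x e) ≠ lab B (N.y e))
    (hTM : ∀ x ∈ TM, x ∈ T → (cd x).testBit B = false) {x : α} (hx : x ∈ X B) : x ∉ T := by
  have hm := h.min B le_rfl
  have : X B ⊆ X B \ T := by
    refine hm.least _ (fun z hz => ?_) ?_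
    · have := hm.mem z hz
      have h2 := hTM z hz
      by_cases hzT : z ∈ T
      · simp [hzT, h2]
      · simp [hzT, this]
    · rw [N.fcut_split hT (X B)]; omega
  exact (this hx).2

/-- No phase cuts through `M`. As long as `M` lies in one class, `fcut` is the plain cut on subsets
of `M`, and there `M` is the strict minimizer containing `v`. If the bit of `v` is set,
submodularity applied to `X b` and `M` gives `M ⊆ X b`; if not, posimodularity and leastness make `X
b` disjoint from `M`. -/
theorem follow_set (h : Refinement N TM cd B X lab) {M : Set α} {v : α} (hvTM : v ∈ TM) (hv : v ∈ M)
    (hM : ∀ x ∈ M, x ∈ TM → x = v)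
    (hstrict : ∀ Z ⊆ M, v ∈ Z → N.cut M ≤ N.cut Z ∧ (N.cut Z ≤ N.cut M → Z = M)) :
    ∀ b ≤ B + 1, ∀ x ∈ M, lab b x = cd v % 2 ^ b
  | 0, _, x, _ => by simp [h.zero, Nat.mod_one]
  | b + 1, hb, x, hx => by
    have ih := follow_set h hvTM hv hM hstrict b (by omega)
    refine h.lab_follow (by omega) (ih x hx) ?_
    have hm := h.min b (by omega)
    have hvb := hm.mem v hvTM
    by_cases hbit : (cd v).testBit b = true
    · simp only [hbit, iff_true]
      have hP := hm.le (X b ∪ M) (fun z hz => by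
        by_cases hzM : z ∈ M
        · simp [hM z hzM hz, hv, hbit]
        · simp [hzM, hm.mem z hz])
      have h1 := N.fcut_submod (lab b) (X b) M
      rw [N.fcut_eq_cut (Z := M) ih, N.fcut_eq_cut (Z := X b ∩ M) (fun z hz => ih z hz.2)] at h1
      have := (hstrict (X b ∩ M) Set.inter_subset_right ⟨hvb.2 hbit, hv⟩).2 (by omega)
      rw [← this] at hx
      exact hx.1
    · simp only [hbit, Bool.false_eq_true, iff_false]
      have hvX : v ∉ X b := mt hvb.1 hbit
      have h1 := N.fcut_posimod (lab b) (X b) M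
      rw [N.fcut_eq_cut (Z := M) ih, N.fcut_eq_cut (Z := M \ X b) (fun z hz => ih z hz.1)] at h1
      have h2 := (hstrict (M \ X b) Set.sdiff_subset ⟨hv, hvX⟩).1
      have := hm.least (X b \ M) (fun z hz => by
        by_cases hzM : z ∈ M
        · have := hM z hzM hz
          subst this
          simp [hv, hbit]
        · simp [hzM, hm.mem z hz]) (by omega)
      exact fun hxb => (this hxb).2 hx

/-- One inclusion is `follow_set`. For the other, the part of `X B` in the class `T` of the lower
bits of `v` contains `v` and only terminals with the top bit set, so by `hmin` it weighs at least as
much as `M` and may be exchanged for `M`; leastness excludes everything else. -/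
theorem eq_set (h : Refinement N TM cd B X lab) {M : Set α} {v : α} (hvTM : v ∈ TM) (hv : v ∈ M)
    (hM : ∀ x ∈ M, x ∈ TM → x = v)
    (hstrict : ∀ Z ⊆ M, v ∈ Z → N.cut M ≤ N.cut Z ∧ (N.cut Z ≤ N.cut M → Z = M))
    (hmin : ∀ Z, v ∈ Z → (∀ x ∈ TM, x ∈ Z → (cd x).testBit B = true) → N.cut M ≤ N.cut Z)
    (hvlt : cd v < 2 ^ (B + 1)) (hvB : (cd v).testBit B = true)
    (hinj : ∀ x ∈ TM, (cd x).testBit B = true → cd x % 2 ^ B = cd v % 2 ^ B → x = v) :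
    {x | lab (B + 1) x = cd v} = M := by
  have hf := h.follow_set hvTM hv hM hstrict
  have hm := h.min B le_rfl
  apply Set.Subset.antisymm
  · intro x hx
    have hxX : x ∈ X B := h.mem_last (by
      rw [show lab (B + 1) x = cd v from hx]; exact Nat.ge_two_pow_of_testBit hvB)
    have hxl : lab B x = cd v % 2 ^ B := by
      have h1 := h.mem B le_rfl x hxX
      have h2 := mod_two_pow_succ (cd v) B
      rw [Nat.mod_eq_of_lt hvlt, hvB] at h2
      simp only [Set.mem_ofPred_eq] at hx
      simp at h2
      omega
    set T : Set α := {x | lab B x = cd v % 2 ^ B} with hTdef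
    have hT : ∀ e ∈ N.s, ¬(N.x e ∈ T ↔ N.y e ∈ T) → lab B (N.x e) ≠ lab B (N.y e) := by
      intro e _ h1 h2
      simp [hTdef, h2] at h1
    have hMT : M ⊆ T := fun z hz => hf B (by omega) z hz
    have hMX : M ⊆ X B := by
      intro z hz
      have h1 := hf (B + 1) le_rfl z hz
      refine h.mem_last ?_
      rw [h1, Nat.mod_eq_of_lt hvlt]
      exact Nat.ge_two_pow_of_testBit hvB
    have hZ : (X B \ (T \ M)) ∩ T = M := by
      ext z
      constructor
      · rintro ⟨⟨h1, h2⟩, h3⟩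
        by_contra h4
        exact h2 ⟨h3, h4⟩
      · intro hz
        exact ⟨⟨hMX hz, fun h => h.2 hz⟩, hMT hz⟩
    have hZ2 : (X B \ (T \ M)) \ T = X B \ T := by
      ext z
      constructor
      · rintro ⟨⟨h1, h2⟩, h3⟩
        exact ⟨h1, h3⟩
      · rintro ⟨h1, h3⟩
        exact ⟨⟨h1, fun h => h3 h.1⟩, h3⟩
    -- This set agrees with `X B` outside of `T` and with `M` inside. It is admissible because `v`
    -- is the only terminal in `T` with the top bit set.
    have hsub := hm.least (X B \ (T \ M)) (fun z hz => by
        have := hm.mem z hz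
        by_cases hzT : z ∈ T \ M
        · constructor
          · rintro ⟨_, h2⟩; exact absurd hzT h2
          · intro hbit
            exfalso
            have h1 : cd z % 2 ^ B = cd v % 2 ^ B := by
              rw [← h.lab_coded hz B (by omega)]; exact hzT.1
            exact hzT.2 (hinj z hz hbit h1 ▸ hv)
        · simp only [Set.mem_sdiff, hzT, not_false_eq_true, and_true, this])
      (by
        rw [N.fcut_split hT (X B \ (T \ M)), N.fcut_split hT (X B), hZ, hZ2,
          N.fcut_eq_cut (Z := M) (fun z hz => hMT hz),
          N.fcut_eq_cut (Z := X B ∩ T) (fun z hz => hz.2)]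
        have := hmin (X B ∩ T) ⟨hMX hv, hMT hv⟩ (fun z hz hzX => (hm.mem z hz).1 hzX.1)
        omega)
    by_contra hxM
    exact (hsub hxX).2 ⟨hxl, hxM⟩
  · intro x hx
    have := hf (B + 1) le_rfl x hx
    rwa [Nat.mod_eq_of_lt hvlt] at this

end Refinement

/-! ### Maximum flows and least minimum cuts. -/

namespace MGraph

variable {n m : ℕ}

/-- The edges of a graph as a weighted edge family on `ℕ`. -/
def net (G : MGraph n m) : Net (Fin m) ℕ where
  s := Finset.univ
  x e := G.tail e
  y e := G.head e
  w := G.weight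

theorem cutWeight_eq_net (G : MGraph n m) (A : Finset (Fin n)) :
    G.cutWeight A = G.net.cut {u | ∃ v ∈ A, (v : ℕ) = u} := by
  unfold cutWeight Net.cut Net.fcut
  rw [Finset.sum_filter]
  refine Finset.sum_congr rfl fun e _ => ?_
  have h (u : Fin n) : (u : ℕ) ∈ {u : ℕ | ∃ v ∈ A, (v : ℕ) = u} ↔ u ∈ A := by
    constructor
    · rintro ⟨v, hv, h⟩
      rwa [← Fin.ext h]
    · exact fun h => ⟨u, h, rfl⟩
  simp only [net, edgeCost, if_true, h]
  by_cases h1 : G.tail e ∈ A <;> by_cases h2 : G.head e ∈ A <;> simp [h1, h2]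

open Classical in
theorem net_cut_eq (G : MGraph n m) (Z : Set ℕ) :
    G.net.cut Z = G.cutWeight (Finset.univ.filter fun u : Fin n => (u : ℕ) ∈ Z) := by
  rw [cutWeight_eq_net]
  refine Net.cut_congr fun e _ => ?_
  constructor <;>
  · simp only [net, Finset.mem_filter, Finset.mem_univ, true_and]
    constructor
    · exact fun h => ⟨_, h, rfl⟩
    · rintro ⟨v, hv, h⟩
      rwa [← h]

theorem mincut_le_cut (G : MGraph n m) {s t : Fin n} {Z : Set ℕ} (hs : (s : ℕ) ∈ Z)
    (ht : (t : ℕ) ∉ Z) : G.mincut s t ≤ G.net.cut Z := by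
  classical
  rw [net_cut_eq]
  exact Nat.sInf_le ⟨_, by simpa using hs, by simpa using ht, rfl⟩

theorem exists_mincut (G : MGraph n m) {s t : Fin n} (h : s ≠ t) :
    ∃ A : Finset (Fin n), G.IsMincut s t A := by
  have hne : {c | ∃ A : Finset (Fin n), s ∈ A ∧ t ∉ A ∧ G.cutWeight A = c}.Nonempty :=
    ⟨_, {s}, by simp, by simpa using h.symm, rfl⟩
  obtain ⟨A, h1, h2, h3⟩ := Nat.sInf_mem hne
  exact ⟨A, h1, h2, h3⟩

theorem le_mincut (G : MGraph n m) {s t : Fin n} (h : s ≠ t) {L : ℕ}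
    (hL : G.net.CutLB s t L) : L ≤ G.mincut s t := by
  obtain ⟨A, h1, h2, h3⟩ := G.exists_mincut h
  rw [← h3, cutWeight_eq_net]
  refine hL _ ⟨s, h1, rfl⟩ ?_
  rintro ⟨v, hv, h⟩
  exact h2 (Fin.ext h ▸ hv)

/-- `Z` is closed under the residual arcs of `f`. -/
def ResClosed (G : MGraph n m) (f : Fin m → ℤ) (Z : Set ℕ) : Prop :=
  ∀ e, ((G.tail e : ℕ) ∈ Z → f e < G.weight e → (G.head e : ℕ) ∈ Z) ∧
    ((G.head e : ℕ) ∈ Z → -f e < G.weight e → (G.tail e : ℕ) ∈ Z)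

theorem netOut_eq (G : MGraph n m) (f : Fin m → ℤ) (v : Fin n) :
    G.netOut f v =
      ∑ e, f e * ((if G.tail e = v then 1 else 0) - (if G.head e = v then 1 else 0)) := by
  unfold netOut
  rw [Finset.sum_filter, Finset.sum_filter, ← Finset.sum_sub_distrib]
  refine Finset.sum_congr rfl fun e _ => ?_
  split_ifs <;> simp

theorem netOut_update (G : MGraph n m) (f : Fin m → ℤ) (e : Fin m) (d : ℤ) (v : Fin n) :
    G.netOut (Function.update f e (f e + d)) v = G.netOut f v +
      d * ((if G.tail e = v then 1 else 0) - (if G.head e = v then 1 else 0)) := by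
  have hu : Function.update f e (f e + d) = fun e' => f e' + if e' = e then d else 0 := by
    ext e'
    by_cases h : e' = e
    · subst h; simp
    · simp [h]
  rw [netOut_eq, netOut_eq, hu]
  simp only [add_mul, Finset.sum_add_distrib, ite_mul, zero_mul, Finset.sum_ite_eq',
    Finset.mem_univ, if_true]

/-- Vertices reachable by at most `k` residual arcs. -/
def reachSet (G : MGraph n m) (f : Fin m → ℤ) (s : Fin n) : ℕ → Set ℕ
  | 0 => {x | x = s}
  | k + 1 => {y | y ∈ reachSet G f s k ∨
      (∃ e, (G.tail e : ℕ) ∈ reachSet G f s k ∧ (G.head e : ℕ) = y ∧ f e < G.weight e) ∨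
      (∃ e, (G.head e : ℕ) ∈ reachSet G f s k ∧ (G.tail e : ℕ) = y ∧ -f e < G.weight e)}

/-- One unit is sent from `s` to `x` along a residual path. The change is confined to edges inside
the layers reached so far, so the edge that leads to a new vertex still has its original residual
capacity. -/
theorem exists_augmentation (G : MGraph n m) (f : Fin m → ℤ) (s : Fin n)
    (hf : ∀ e, |f e| ≤ G.weight e) : ∀ (k : ℕ) (x : Fin n), (x : ℕ) ∈ G.reachSet f s k →
    ∃ f' : Fin m → ℤ, (∀ e, |f' e| ≤ G.weight e) ∧
      (∀ v, G.netOut f' v = G.netOut f v + (if v = s then 1 else 0) - (if v = x then 1 else 0)) ∧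
      ∀ e, ¬((G.tail e : ℕ) ∈ G.reachSet f s k ∧ (G.head e : ℕ) ∈ G.reachSet f s k) → f' e = f e
  | 0, x, hx => by
    have : x = s := Fin.ext hx
    subst this
    exact ⟨f, hf, fun v => by ring, fun _ _ => rfl⟩
  | k + 1, x, hx => by
    by_cases hxk : (x : ℕ) ∈ G.reachSet f s k
    · obtain ⟨f', h1, h2, h3⟩ := exists_augmentation G f s hf k x hxk
      exact ⟨f', h1, h2, fun e he => h3 e fun h => he ⟨Or.inl h.1, Or.inl h.2⟩⟩
    · rcases hx with hx | ⟨e, he1, he2, he3⟩ | ⟨e, he1, he2, he3⟩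
      · exact absurd hx hxk
      · obtain ⟨f', h1, h2, h3⟩ := exists_augmentation G f s hf k (G.tail e) he1
        have hx' : G.head e = x := Fin.ext he2
        have hfe : f' e = f e := h3 e fun h => hxk (he2 ▸ h.2)
        refine ⟨Function.update f' e (f' e + 1), fun e' => ?_, fun v => ?_, fun e' he' => ?_⟩
        · by_cases h : e' = e
          · subst h
            have := abs_le.1 (hf e')
            simp only [Function.update_self, hfe]
            rw [abs_le]; constructor <;> omega
          · simpa [h] using h1 e'
        · rw [netOut_update, h2, hx']
          by_cases ha : v = x
          · subst ha
            by_cases hb : v = G.tail e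
            · simp [hb]
            · simp [hb, Ne.symm hb]; ring
          · by_cases hb : v = G.tail e
            · subst hb; simp [ha, Ne.symm ha]
            · simp [ha, Ne.symm ha, hb, Ne.symm hb]
        · have hne : e' ≠ e := by
            rintro rfl
            exact he' ⟨Or.inl he1, Or.inr (Or.inl ⟨e', he1, rfl, he3⟩)⟩
          rw [Function.update_of_ne hne]
          exact h3 e' fun h => he' ⟨Or.inl h.1, Or.inl h.2⟩
      · obtain ⟨f', h1, h2, h3⟩ := exists_augmentation G f s hf k (G.head e) he1
        have hx' : G.tail e = x := Fin.ext he2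
        have hfe : f' e = f e := h3 e fun h => hxk (he2 ▸ h.1)
        refine ⟨Function.update f' e (f' e + (-1)), fun e' => ?_, fun v => ?_, fun e' he' => ?_⟩
        · by_cases h : e' = e
          · subst h
            have := abs_le.1 (hf e')
            simp only [Function.update_self, hfe]
            rw [abs_le]; constructor <;> omega
          · simpa [h] using h1 e'
        · rw [netOut_update, h2, hx']
          by_cases ha : v = x
          · subst ha
            by_cases hb : v = G.head e
            · simp [hb]
            · simp [hb, Ne.symm hb]; ring
          · by_cases hb : v = G.head e
            · subst hb; simp [ha, Ne.symm ha]
            · simp [ha, Ne.symm ha, hb, Ne.symm hb]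
        · have hne : e' ≠ e := by
            rintro rfl
            exact he' ⟨Or.inr (Or.inr ⟨e', he1, rfl, he3⟩), Or.inl he1⟩
          rw [Function.update_of_ne hne]
          exact h3 e' fun h => he' ⟨Or.inl h.1, Or.inl h.2⟩

open Classical in
theorem sum_netOut (G : MGraph n m) (f : Fin m → ℤ) (Z : Set ℕ) :
    ∑ v : Fin n, (if (v : ℕ) ∈ Z then G.netOut f v else 0) =
      ∑ e, f e * ((if (G.tail e : ℕ) ∈ Z then 1 else 0) - (if (G.head e : ℕ) ∈ Z then 1 else 0)) := by
  simp only [netOut_eq]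
  have h (v : Fin n) : (if (v : ℕ) ∈ Z then ∑ e, f e * ((if G.tail e = v then 1 else 0) -
      (if G.head e = v then 1 else 0)) else 0) = ∑ e, f e * ((if G.tail e = v then
        (if (v : ℕ) ∈ Z then 1 else 0) else 0) - (if G.head e = v then (if (v : ℕ) ∈ Z then 1 else 0) else 0)) := by
    split_ifs with h <;> simp
  rw [Finset.sum_congr rfl fun v _ => h v, Finset.sum_comm]
  refine Finset.sum_congr rfl fun e _ => ?_
  rw [← Finset.mul_sum, Finset.sum_sub_distrib]
  simp

open Classical in
theorem flow_value (G : MGraph n m) {s t : Fin n} {f : Fin m → ℤ} (hf : G.IsFlow s t f) {Z : Set ℕ}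
    (hs : (s : ℕ) ∈ Z) (ht : (t : ℕ) ∉ Z) : G.netOut f s =
      ∑ e, f e * ((if (G.tail e : ℕ) ∈ Z then 1 else 0) - (if (G.head e : ℕ) ∈ Z then 1 else 0)) := by
  rw [← sum_netOut, Finset.sum_eq_single s]
  · simp [hs]
  · intro v _ hv
    split_ifs with h
    · exact hf.2 v hv (by rintro rfl; exact ht h)
    · rfl
  · simp

open Classical in
theorem net_cut_cast (G : MGraph n m) (Z : Set ℕ) : (G.net.cut Z : ℤ) =
    ∑ e, (G.weight e : ℤ) * (if ((G.tail e : ℕ) ∈ Z ↔ (G.head e : ℕ) ∈ Z) then 0 else 1) := by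
  unfold Net.cut Net.fcut
  push_cast
  refine Finset.sum_congr rfl fun e _ => ?_
  by_cases h1 : (G.tail e : ℕ) ∈ Z <;> by_cases h2 : (G.head e : ℕ) ∈ Z <;>
    simp [net, edgeCost, h1, h2]

/-- `X` is the set of vertices reachable in the residual graph. Reaching `t` would allow an
augmentation. Edges leaving `X` are saturated, so the flow value is the weight of `X`. A cut `Z` of
the same weight is saturated too, hence closed under residual arcs, hence contains `X`. -/
theorem least_mincut_of_maxFlow (G : MGraph n m) {s t : Fin n} {f : Fin m → ℤ}
    (hf : G.IsMaxFlow s t f) (hst : s ≠ t) {X : Set ℕ} (hs : (s : ℕ) ∈ X)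
    (hX : G.ResClosed f X) (hmin : ∀ Z, (s : ℕ) ∈ Z → G.ResClosed f Z → X ⊆ Z) :
    (t : ℕ) ∉ X ∧ ∀ Z : Set ℕ, (s : ℕ) ∈ Z → (t : ℕ) ∉ Z →
      G.net.cut X ≤ G.net.cut Z ∧ (G.net.cut Z ≤ G.net.cut X → X ⊆ Z) := by
  classical
  have ht : (t : ℕ) ∉ X := by
    intro ht
    have : X ⊆ {x | ∃ k, x ∈ G.reachSet f s k} := by
      refine hmin _ ⟨0, rfl⟩ fun e => ⟨?_, ?_⟩
      · rintro ⟨k, hk⟩ h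
        exact ⟨k + 1, Or.inr (Or.inl ⟨e, hk, rfl, h⟩)⟩
      · rintro ⟨k, hk⟩ h
        exact ⟨k + 1, Or.inr (Or.inr ⟨e, hk, rfl, h⟩)⟩
    obtain ⟨k, hk⟩ := this ht
    obtain ⟨f', h1, h2, -⟩ := G.exists_augmentation f s hf.1.1 k t hk
    have h3 := hf.2 f' ⟨h1, fun v hvs hvt => by simp [h2, hvs, hvt, hf.1.2 v hvs hvt]⟩
    simp [h2, hst] at h3
  have hval : G.netOut f s = G.net.cut X := by
    rw [G.flow_value hf.1 hs ht, net_cut_cast]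
    refine Finset.sum_congr rfl fun e _ => ?_
    have h1 := hX e
    have h2 := abs_le.1 (hf.1.1 e)
    by_cases h3 : (G.tail e : ℕ) ∈ X <;> by_cases h4 : (G.head e : ℕ) ∈ X
    · simp [h3, h4]
    · simp only [h3, h4]
      have : ¬ f e < G.weight e := fun h => h4 (h1.1 h3 h)
      simp; omega
    · simp only [h3, h4]
      have : ¬ -f e < G.weight e := fun h => h3 (h1.2 h4 h)
      simp; omega
    · simp [h3, h4]
  refine ⟨ht, fun Z hsZ htZ => ?_⟩
  have hZ := G.flow_value hf.1 hsZ htZ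
  have hle : ∀ e ∈ Finset.univ, f e * ((if (G.tail e : ℕ) ∈ Z then 1 else 0) -
      (if (G.head e : ℕ) ∈ Z then 1 else 0)) ≤
      (G.weight e : ℤ) * (if ((G.tail e : ℕ) ∈ Z ↔ (G.head e : ℕ) ∈ Z) then 0 else 1) := by
    intro e _
    have h2 := abs_le.1 (hf.1.1 e)
    by_cases h3 : (G.tail e : ℕ) ∈ Z <;> by_cases h4 : (G.head e : ℕ) ∈ Z <;>
      simp [h3, h4] <;> omega
  have hsum := Finset.sum_le_sum hle
  rw [← hZ, ← net_cut_cast, hval] at hsum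
  refine ⟨by exact_mod_cast hsum, fun heq => hmin Z hsZ fun e => ?_⟩
  have hsum' : ∑ e, f e * ((if (G.tail e : ℕ) ∈ Z then 1 else 0) -
      (if (G.head e : ℕ) ∈ Z then 1 else 0)) = ∑ e,
      (G.weight e : ℤ) * (if ((G.tail e : ℕ) ∈ Z ↔ (G.head e : ℕ) ∈ Z) then 0 else 1) := by
    rw [← hZ, ← net_cut_cast, hval]
    have : G.net.cut X = G.net.cut Z := le_antisymm (by exact_mod_cast hsum) heq
    rw [this]
  -- The flow over each edge is at most its contribution to the cut; equal sums force equality on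
  -- every edge, which is saturation.
  have := (Finset.sum_eq_sum_iff_of_le hle).1 hsum' e (Finset.mem_univ e)
  constructor
  · intro h3 h
    by_contra h4
    simp [h3, h4] at this
    omega
  · intro h4 h
    by_contra h3
    simp [h3, h4] at this
    omega

end MGraph

/-! ### Partition trees -/

/-- A partition tree over the vertices `0, …, n-1` with instances `0, …, cnt-1` and root `0`. The
vertex `x < n` lies in the instance `loc x`; the instance `j ≠ 0` is a child of `loc (n + j)`, where
it is represented by the contracted vertex `n + j`. The weights of the blocks are in `dg`, and the
edge `e` of the graph joins the blocks `ex e` and `ey e` of an instance. -/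
structure Cfg where
  loc : ℕ → ℕ
  dg : ℕ → ℕ
  ex : ℕ → ℕ
  ey : ℕ → ℕ
  cnt : ℕ

/-- `x` is a vertex or the contraction of a non-root instance. -/
def Valid (n cnt x : ℕ) : Prop := x < n + cnt ∧ x ≠ n

/-- The vertices represented by `x`, where `D j` is the set of vertices below the instance `j`. -/
def blk (n : ℕ) (D : ℕ → Set ℕ) (x : ℕ) : Set ℕ := {u | if x < n then u = x else u ∈ D (x - n)}

theorem mem_blk_of_lt {n : ℕ} {D : ℕ → Set ℕ} {x u : ℕ} (h : x < n) : u ∈ blk n D x ↔ u = x := by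
  simp [blk, h]

theorem mem_blk_add {n : ℕ} {D : ℕ → Set ℕ} {j u : ℕ} : u ∈ blk n D (n + j) ↔ u ∈ D j := by
  simp [blk]

theorem blk_add {n : ℕ} {D : ℕ → Set ℕ} {j : ℕ} : blk n D (n + j) = D j := by
  ext u; simp [blk]

theorem Valid.cases {n cnt x : ℕ} (h : Valid n cnt x) :
    x < n ∨ ∃ j, 1 ≤ j ∧ j < cnt ∧ x = n + j := by
  rcases Nat.lt_or_ge x n with h1 | h1
  · exact Or.inl h1
  · exact Or.inr ⟨x - n, by have := h.2; omega, by have := h.1; omega, by omega⟩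

theorem valid_of_lt {n cnt x : ℕ} (h : x < n) : Valid n cnt x := ⟨by omega, by omega⟩

theorem valid_add {n cnt j : ℕ} (h : 1 ≤ j) (h' : j < cnt) : Valid n cnt (n + j) :=
  ⟨by omega, by omega⟩

/-- `pivot` is the certificate of the tree edge above `j`. By `edge_valid` and `edge_unique` an edge
is recorded in exactly the instance in which its ends lie in different blocks. `dg_zero` allows
loops over all indices below `2 * n` without testing validity. -/
structure CfgInv {n m : ℕ} (G : MGraph n m) (c : Cfg) (D : ℕ → Set ℕ) : Prop where
  cnt_pos : 0 < c.cnt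
  loc_lt : ∀ x, Valid n c.cnt x → c.loc x < c.cnt
  nonempty : ∀ j < c.cnt, ∃ u < n, c.loc u = j
  root : ∀ u < n, u ∈ D 0
  sub : ∀ j < c.cnt, ∀ u ∈ D j, u < n
  mem_iff : ∀ i < c.cnt, ∀ u, u ∈ D i ↔ ∃ x, Valid n c.cnt x ∧ c.loc x = i ∧ u ∈ blk n D x
  unique : ∀ x x' u, Valid n c.cnt x → Valid n c.cnt x' → c.loc x = c.loc x' →
    u ∈ blk n D x → u ∈ blk n D x' → x = x'
  dg_eq : ∀ x, Valid n c.cnt x → c.dg x = G.net.cut (blk n D x)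
  dg_zero : ∀ x < 2 * n, ¬Valid n c.cnt x → c.dg x = 0
  pivot : ∀ j, 1 ≤ j → j < c.cnt → ∃ a b, a < n ∧ b < n ∧ c.loc a = j ∧ c.loc b = c.loc (n + j) ∧
    G.net.CutLB a b (G.net.cut (D j))
  edge_valid : ∀ e : Fin m, Valid n c.cnt (c.ex e) ∧ Valid n c.cnt (c.ey e) ∧ c.ex e ≠ c.ey e ∧
    c.loc (c.ex e) = c.loc (c.ey e) ∧ (G.tail e : ℕ) ∈ blk n D (c.ex e) ∧
    (G.head e : ℕ) ∈ blk n D (c.ey e)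
  edge_unique : ∀ (e : Fin m) (x y : ℕ), Valid n c.cnt x → Valid n c.cnt y → x ≠ y →
    c.loc x = c.loc y → (G.tail e : ℕ) ∈ blk n D x → (G.head e : ℕ) ∈ blk n D y →
    c.ex e = x ∧ c.ey e = y

/-- The vertices of the contracted graph of the instance `i`. -/
def Comp (n : ℕ) (c : Cfg) (i : ℕ) : Set ℕ :=
  {x | (Valid n c.cnt x ∧ c.loc x = i) ∨ x = 2 * n + i}

/-- Total weight of the edges recorded at the block `x`. -/
def recorded {n m : ℕ} (G : MGraph n m) (c : Cfg) (x : ℕ) : ℕ :=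
  ∑ e : Fin m, G.weight e * ((if c.ex e = x then 1 else 0) + (if c.ey e = x then 1 else 0))

/-- `H` is the disjoint union of the contracted graphs of all instances; the contraction of the
vertices that are not below the instance `i` is the vertex `2 * n + i`. -/
structure IsContraction {n m : ℕ} {ι : Type*} (G : MGraph n m) (c : Cfg) (H : Net ι ℕ) : Prop where
  sum_eq : ∀ ψ : ℕ → ℕ → ℕ, ∑ k ∈ H.s, H.w k * ψ (H.x k) (H.y k) =
    ∑ e : Fin m, G.weight e * ψ (c.ex e) (c.ey e) +
      ∑ x ∈ Finset.range (2 * n), (c.dg x - recorded G c x) * ψ x (2 * n + c.loc x)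
  edges : ∀ k ∈ H.s, (∃ e : Fin m, H.x k = c.ex e ∧ H.y k = c.ey e) ∨
    (H.x k < 2 * n ∧ H.y k = 2 * n + c.loc (H.x k) ∧ 0 < c.dg (H.x k))

namespace CfgInv

variable {n m : ℕ} {G : MGraph n m} {c : Cfg} {D : ℕ → Set ℕ}

theorem mem_self (h : CfgInv G c D) {u : ℕ} (hu : u < n) : u ∈ D (c.loc u) :=
  (h.mem_iff _ (h.loc_lt u (valid_of_lt hu)) u).2 ⟨u, valid_of_lt hu, rfl, by simp [blk, hu]⟩

theorem cnt_le (h : CfgInv G c D) : c.cnt ≤ n := by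
  have := Finset.card_le_card_of_surjOn (s := Finset.range n) (t := Finset.range c.cnt) c.loc
    (fun j hj => by
      obtain ⟨u, hu, rfl⟩ := h.nonempty j (by simpa using hj)
      exact ⟨u, by simpa using hu, rfl⟩)
  simpa using this

theorem valid_lt (h : CfgInv G c D) {x : ℕ} (hx : Valid n c.cnt x) : x < 2 * n := by
  have := h.cnt_le
  have := hx.1
  omega

theorem blk_sub (h : CfgInv G c D) {x u : ℕ} (hx : Valid n c.cnt x) (hu : u ∈ blk n D x) :
    u ∈ D (c.loc x) :=
  (h.mem_iff _ (h.loc_lt x hx) u).2 ⟨x, hx, rfl, hu⟩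

theorem parent_not_mem (h : CfgInv G c D) {j b : ℕ} (hj : 1 ≤ j) (hj' : j < c.cnt) (hb : b < n)
    (hl : c.loc b = c.loc (n + j)) : b ∉ D j := by
  intro hbD
  have := h.unique b (n + j) b (valid_of_lt hb) (valid_add hj hj') hl (by simp [blk, hb])
    (mem_blk_add.2 hbD)
  omega

open Classical in
theorem recorded_le_cross (h : CfgInv G c D) {x : ℕ} (hx : Valid n c.cnt x) (e : Fin m) :
    (if c.ex e = x then 1 else 0) + (if c.ey e = x then 1 else 0) ≤
      edgeCost (fun _ => 0) (blk n D x) (G.tail e : ℕ) (G.head e : ℕ) := by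
  obtain ⟨h1, h2, h3, h4, h5, h6⟩ := h.edge_valid e
  by_cases hex : c.ex e = x
  · have hey : c.ey e ≠ x := fun h => h3 (hex.trans h.symm)
    have ht : (G.tail e : ℕ) ∈ blk n D x := hex ▸ h5
    have hh : (G.head e : ℕ) ∉ blk n D x := fun hh =>
      hey (h.unique _ _ _ h2 hx (by rw [← h4, hex]) h6 hh)
    simp [edgeCost, hex, hey, ht, hh]
  · by_cases hey : c.ey e = x
    · have ht : (G.head e : ℕ) ∈ blk n D x := hey ▸ h6
      have hh : (G.tail e : ℕ) ∉ blk n D x := fun hh =>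
        hex (h.unique _ _ _ h1 hx (by rw [h4, hey]) h5 hh)
      simp [edgeCost, hex, hey, ht, hh]
    · simp [hex, hey]

/-- By this bound the truncated difference `c.dg x - recorded G c x` is a true difference; it is the
weight of the edges from the block to the outside of the instance. -/
theorem recorded_le (h : CfgInv G c D) {x : ℕ} (hx : Valid n c.cnt x) : recorded G c x ≤ c.dg x := by
  rw [h.dg_eq x hx]
  unfold recorded Net.cut Net.fcut
  exact Finset.sum_le_sum fun e _ => Nat.mul_le_mul_left _ (h.recorded_le_cross hx e)

open Classical in
-- An edge is counted by every block that it leaves. If its ends are in two blocks of `Z`, it is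
-- recorded at both of them and the counts cancel. If exactly one end is below `Z`, it is counted
-- once and crosses the union once, and a record at that block matches the crossing of `Z` itself.
theorem edge_cost_blocks (h : CfgInv G c D) {i : ℕ} {Z : Set ℕ}
    (hZ : ∀ x ∈ Z, Valid n c.cnt x ∧ c.loc x = i) (e : Fin m) (K : Finset ℕ)
    (hK : ∀ x, x ∈ K ↔ x ∈ Z) :
    edgeCost (fun _ => 0) Z (c.ex e) (c.ey e) +
      ∑ x ∈ K, edgeCost (fun _ => 0) (blk n D x) (G.tail e : ℕ) (G.head e : ℕ) =
    edgeCost (fun _ => 0) {u | ∃ x ∈ Z, u ∈ blk n D x} (G.tail e : ℕ) (G.head e : ℕ) +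
      ∑ x ∈ K, ((if c.ex e = x then 1 else 0) + (if c.ey e = x then 1 else 0)) := by
  obtain ⟨h1, h2, h3, h4, h5, h6⟩ := h.edge_valid e
  have huniq : ∀ u, ∀ x₁ ∈ Z, u ∈ blk n D x₁ → ∀ x ∈ K, (u ∈ blk n D x ↔ x = x₁) := by
    intro u x₁ hx₁ hu x hx
    refine ⟨fun hu' => h.unique _ _ _ (hZ x ((hK x).1 hx)).1 (hZ x₁ hx₁).1 ?_ hu' hu, ?_⟩
    · rw [(hZ x ((hK x).1 hx)).2, (hZ x₁ hx₁).2]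
    · rintro rfl; exact hu
  rw [Finset.sum_add_distrib]
  simp only [Finset.sum_ite_eq, hK]
  set Zh : Set ℕ := {u | ∃ x ∈ Z, u ∈ blk n D x} with hZh
  have hexZ : c.ex e ∈ Z → (G.tail e : ℕ) ∈ Zh := fun hx => ⟨_, hx, h5⟩
  have heyZ : c.ey e ∈ Z → (G.head e : ℕ) ∈ Zh := fun hx => ⟨_, hx, h6⟩
  by_cases ht : (G.tail e : ℕ) ∈ Zh <;> by_cases hh : (G.head e : ℕ) ∈ Zh
  · obtain ⟨x₁, hx₁, ht₁⟩ := ht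
    obtain ⟨x₂, hx₂, hh₂⟩ := hh
    have ht : (G.tail e : ℕ) ∈ Zh := ⟨x₁, hx₁, ht₁⟩
    have hh : (G.head e : ℕ) ∈ Zh := ⟨x₂, hx₂, hh₂⟩
    have hs : ∑ x ∈ K, edgeCost (fun _ => 0) (blk n D x) (G.tail e : ℕ) (G.head e : ℕ) =
        ∑ x ∈ K, if (x = x₁ ↔ x = x₂) then 0 else 1 := by
      refine Finset.sum_congr rfl fun x hx => ?_
      simp only [edgeCost, if_true, huniq _ _ hx₁ ht₁ x hx, huniq _ _ hx₂ hh₂ x hx]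
    rw [hs]
    by_cases hx : x₁ = x₂
    · subst hx
      have : ¬(c.ex e ∈ Z ∧ c.ey e ∈ Z) := by
        rintro ⟨ha, hb⟩
        exact h3 (((huniq _ _ hx₁ ht₁ _ ((hK _).2 ha)).1 h5).trans
          ((huniq _ _ hx₁ hh₂ _ ((hK _).2 hb)).1 h6).symm)
      by_cases ha : c.ex e ∈ Z <;> by_cases hb : c.ey e ∈ Z <;>
        simp_all [edgeCost]
    · obtain ⟨ha, hb⟩ := h.edge_unique e x₁ x₂ (hZ _ hx₁).1 (hZ _ hx₂).1 hx
        (by rw [(hZ _ hx₁).2, (hZ _ hx₂).2]) ht₁ hh₂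
      have : ∀ x, (if (x = x₁ ↔ x = x₂) then 0 else 1) =
          (if x = x₁ then 1 else 0) + (if x = x₂ then 1 else 0) := by
        intro x
        by_cases h1 : x = x₁
        · subst h1; simp [hx]
        · simp [h1]
      simp only [this, Finset.sum_add_distrib, Finset.sum_ite_eq', hK, hx₁, hx₂, if_true]
      simp [edgeCost, ha, hb, hx₁, hx₂, ht, hh]
  · obtain ⟨x₁, hx₁, ht₁⟩ := ht
    have ht : (G.tail e : ℕ) ∈ Zh := ⟨x₁, hx₁, ht₁⟩
    have hs : ∑ x ∈ K, edgeCost (fun _ => 0) (blk n D x) (G.tail e : ℕ) (G.head e : ℕ) =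
        ∑ x ∈ K, if x = x₁ then 1 else 0 := by
      refine Finset.sum_congr rfl fun x hx => ?_
      have : (G.head e : ℕ) ∉ blk n D x := fun h => hh ⟨x, (hK x).1 hx, h⟩
      simp only [edgeCost, if_true, huniq _ _ hx₁ ht₁ x hx, this]
      by_cases hx' : x = x₁ <;> simp [hx']
    rw [hs]
    have : c.ey e ∉ Z := fun h => hh (heyZ h)
    by_cases ha : c.ex e ∈ Z <;> simp [edgeCost, ha, this, hK, hx₁, ht, hh]
  · obtain ⟨x₁, hx₁, ht₁⟩ := hh
    have hh : (G.head e : ℕ) ∈ Zh := ⟨x₁, hx₁, ht₁⟩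
    have hs : ∑ x ∈ K, edgeCost (fun _ => 0) (blk n D x) (G.tail e : ℕ) (G.head e : ℕ) =
        ∑ x ∈ K, if x = x₁ then 1 else 0 := by
      refine Finset.sum_congr rfl fun x hx => ?_
      have : (G.tail e : ℕ) ∉ blk n D x := fun h => ht ⟨x, (hK x).1 hx, h⟩
      simp only [edgeCost, if_true, huniq _ _ hx₁ ht₁ x hx, this]
      by_cases hx' : x = x₁ <;> simp [hx']
    rw [hs]
    have : c.ex e ∉ Z := fun h => ht (hexZ h)
    by_cases ha : c.ey e ∈ Z <;> simp [edgeCost, ha, this, hK, hx₁, ht, hh]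
  · have hs : ∑ x ∈ K, edgeCost (fun _ => 0) (blk n D x) (G.tail e : ℕ) (G.head e : ℕ) = 0 := by
      refine Finset.sum_eq_zero fun x hx => ?_
      have h1 : (G.tail e : ℕ) ∉ blk n D x := fun h => ht ⟨x, (hK x).1 hx, h⟩
      have h2 : (G.head e : ℕ) ∉ blk n D x := fun h => hh ⟨x, (hK x).1 hx, h⟩
      simp [edgeCost, h1, h2]
    have ha : c.ex e ∉ Z := fun h => ht (hexZ h)
    have hb : c.ey e ∉ Z := fun h => hh (heyZ h)
    rw [hs]
    simp [edgeCost, ha, hb, ht, hh]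

variable {ι : Type*} {H : Net ι ℕ}

/-- The contracted graphs represent the cuts that respect the blocks. -/
theorem contraction_cut (h : CfgInv G c D) (hH : IsContraction G c H) {i : ℕ} {Z : Set ℕ}
    (hZ : ∀ x ∈ Z, Valid n c.cnt x ∧ c.loc x = i) :
    H.cut Z = G.net.cut {u | ∃ x ∈ Z, u ∈ blk n D x} := by
  classical
  have h1 : H.cut Z = _ := hH.sum_eq (edgeCost (fun _ => 0) Z)
  rw [h1]
  set K : Finset ℕ := (Finset.range (2 * n)).filter (· ∈ Z) with hKdef
  have hK : ∀ x, x ∈ K ↔ x ∈ Z := by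
    intro x
    simp only [hKdef, Finset.mem_filter, Finset.mem_range, and_iff_right_iff_imp]
    exact fun hx => h.valid_lt (hZ x hx).1
  have h2 : ∑ x ∈ Finset.range (2 * n), (c.dg x - recorded G c x) *
      edgeCost (fun _ => 0) Z x (2 * n + c.loc x) = ∑ x ∈ K, (c.dg x - recorded G c x) := by
    rw [hKdef, Finset.sum_filter]
    refine Finset.sum_congr rfl fun x _ => ?_
    have : 2 * n + c.loc x ∉ Z := fun hx => by
      have := h.valid_lt (hZ _ hx).1
      omega
    by_cases hx : x ∈ Z <;> simp [edgeCost, hx, this]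
  have h3 : ∑ x ∈ K, (c.dg x - recorded G c x) + ∑ x ∈ K, recorded G c x =
      ∑ x ∈ K, G.net.cut (blk n D x) := by
    rw [← Finset.sum_add_distrib]
    refine Finset.sum_congr rfl fun x hx => ?_
    have hv := (hZ x ((hK x).1 hx)).1
    rw [Nat.sub_add_cancel (h.recorded_le hv), h.dg_eq x hv]
  have h4 : ∑ x ∈ K, recorded G c x = ∑ e : Fin m, G.weight e *
      ∑ x ∈ K, ((if c.ex e = x then 1 else 0) + (if c.ey e = x then 1 else 0)) := by
    unfold recorded
    rw [Finset.sum_comm]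
    exact Finset.sum_congr rfl fun e _ => (Finset.mul_sum _ _ _).symm
  have h5 : ∑ x ∈ K, G.net.cut (blk n D x) = ∑ e : Fin m, G.weight e *
      ∑ x ∈ K, edgeCost (fun _ => 0) (blk n D x) (G.tail e : ℕ) (G.head e : ℕ) := by
    unfold Net.cut Net.fcut
    rw [Finset.sum_comm]
    exact Finset.sum_congr rfl fun e _ => (Finset.mul_sum _ _ _).symm
  have h6 : G.net.cut {u | ∃ x ∈ Z, u ∈ blk n D x} = ∑ e : Fin m, G.weight e *
    edgeCost (fun _ => 0) {u | ∃ x ∈ Z, u ∈ blk n D x} (G.tail e : ℕ) (G.head e : ℕ) := rfl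
  have h7 : ∑ e : Fin m, G.weight e * edgeCost (fun _ => 0) Z (c.ex e) (c.ey e) +
      ∑ x ∈ K, G.net.cut (blk n D x) =
      G.net.cut {u | ∃ x ∈ Z, u ∈ blk n D x} + ∑ x ∈ K, recorded G c x := by
    rw [h4, h5, h6, ← Finset.sum_add_distrib, ← Finset.sum_add_distrib]
    refine Finset.sum_congr rfl fun e _ => ?_
    rw [← mul_add, ← mul_add, h.edge_cost_blocks hZ e K hK]
  rw [h2]
  omega

/-- The contracted graphs of different instances are unions of different components of `H`, so one
query can serve all instances. -/
theorem contraction_edge (h : CfgInv G c D) (hH : IsContraction G c H) {k : ι} (hk : k ∈ H.s)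
    (i : ℕ) : (H.x k ∈ Comp n c i ↔ H.y k ∈ Comp n c i) := by
  rcases hH.edges k hk with ⟨e, h1, h2⟩ | ⟨h1, h2, h3⟩
  · obtain ⟨h3, h4, h5, h6, -⟩ := h.edge_valid e
    have := h.valid_lt h3
    have := h.valid_lt h4
    simp only [Comp, Set.mem_ofPred_eq, h1, h2, h3, h4, h6, true_and]
    constructor <;> rintro (h | h) <;> first | exact Or.inl h | omega
  · have hv : Valid n c.cnt (H.x k) := by
      by_contra hv
      have := h.dg_zero _ h1 hv
      omega
    have : ¬Valid n c.cnt (H.y k) := fun hv => by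
      have := h.valid_lt hv
      omega
    constructor
    · rintro (⟨-, h⟩ | h)
      · exact Or.inr (by omega)
      · omega
    · rintro (⟨h, -⟩ | h)
      · exact absurd h this
      · exact Or.inl ⟨hv, by omega⟩

theorem cut_inter_comp_le (h : CfgInv G c D) (hH : IsContraction G c H) (i : ℕ) (Z : Set ℕ) :
    H.cut (Z ∩ Comp n c i) ≤ H.cut Z := by
  have := H.fcut_split (lab := fun _ => 0) (T := Comp n c i)
    (fun k hk hne => absurd (h.contraction_edge hH hk i) hne) Z
  unfold Net.cut
  omega

theorem cut_comp_diff (h : CfgInv G c D) (hH : IsContraction G c H) (i : ℕ) (Z : Set ℕ) :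
    H.cut (Comp n c i \ Z) = H.cut (Z ∩ Comp n c i) := by
  unfold Net.cut Net.fcut
  refine Finset.sum_congr rfl fun k hk => ?_
  have := h.contraction_edge hH hk i
  by_cases h1 : H.x k ∈ Comp n c i <;> by_cases h2 : H.y k ∈ Comp n c i <;>
    by_cases h3 : H.x k ∈ Z <;> by_cases h4 : H.y k ∈ Z <;> simp_all [edgeCost]

/-- The vertices that are represented by the vertices in `Z` of the contracted graph of `i`. -/
def pre (n : ℕ) (c : Cfg) (D : ℕ → Set ℕ) (i : ℕ) (Z : Set ℕ) : Set ℕ :=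
  {u | (∃ x, Valid n c.cnt x ∧ c.loc x = i ∧ x ∈ Z ∧ u ∈ blk n D x) ∨ (u ∉ D i ∧ 2 * n + i ∈ Z)}

/-- If the outside belongs to `Z`, complementing within the component leads back to a set of blocks
of the instance. -/
theorem contraction_cut_pre (h : CfgInv G c D) (hH : IsContraction G c H) {i : ℕ} (hi : i < c.cnt)
    (Z : Set ℕ) : H.cut (Z ∩ Comp n c i) = G.net.cut (pre n c D i Z) := by
  have key : ∀ Z : Set ℕ, 2 * n + i ∉ Z → H.cut (Z ∩ Comp n c i) = G.net.cut (pre n c D i Z) := by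
    intro Z hp
    rw [h.contraction_cut hH (i := i)]
    · congr 1
      ext u
      simp only [pre, Comp, Set.mem_ofPred_eq, Set.mem_inter_iff, hp, and_false, or_false]
      constructor
      · rintro ⟨x, ⟨hxZ, hx | rfl⟩, hu⟩
        · exact ⟨x, hx.1, hx.2, hxZ, hu⟩
        · exact absurd hxZ hp
      · rintro ⟨x, h1, h2, h3, h4⟩
        exact ⟨x, ⟨h3, Or.inl ⟨h1, h2⟩⟩, h4⟩
    · rintro x ⟨hxZ, hx | rfl⟩
      · exact hx
      · exact absurd hxZ hp
  by_cases hp : 2 * n + i ∈ Z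
  · have := key Zᶜ (by simpa using hp)
    rw [← h.cut_comp_diff hH, ← G.net.cut_compl]
    rw [show Comp n c i \ Z = Zᶜ ∩ Comp n c i by ext; simp [and_comm], this]
    refine Net.cut_congr ?_
    have hu : ∀ u : ℕ, u ∈ pre n c D i Zᶜ ↔ u ∈ (pre n c D i Z)ᶜ := by
      intro u
      simp only [pre, Set.mem_compl_iff, Set.mem_ofPred_eq, hp, not_true_eq_false, and_false,
        or_false, and_true, not_or, not_not]
      constructor
      · rintro ⟨x, h1, h2, h3, h4⟩
        refine ⟨?_, (h.mem_iff i hi u).2 ⟨x, h1, h2, h4⟩⟩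
        rintro ⟨x', h1', h2', h3', h4'⟩
        exact h3 (h.unique _ _ _ h1 h1' (by rw [h2, h2']) h4 h4' ▸ h3')
      · rintro ⟨h1, h2⟩
        obtain ⟨x, h3, h4, h5⟩ := (h.mem_iff i hi u).1 h2
        exact ⟨x, h3, h4, fun hxZ => h1 ⟨x, h3, h4, hxZ, h5⟩, h5⟩
    exact fun e _ => ⟨hu _, hu _⟩
  · exact key Z hp

/-- A cut between two vertices of an instance is no lighter than some cut between them in the
contracted graph. -/
theorem exists_contracted_cut (h : CfgInv G c D) (hH : IsContraction G c H) {v s : ℕ} (hv : v < n)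
    (hs : s < n) (hvs : c.loc v = c.loc s) {X : Set ℕ} (hvX : v ∈ X) (hsX : s ∉ X) :
    ∃ Z ⊆ Comp n c (c.loc v), v ∈ Z ∧ s ∉ Z ∧ H.cut Z ≤ G.net.cut X := by
  classical
  have hi := h.loc_lt v (valid_of_lt hv)
  generalize hidef : c.loc v = i at *
  have hpiv : ∀ j, ∃ a b, 1 ≤ j → j < c.cnt → a < n ∧ b < n ∧ c.loc a = j ∧
      c.loc b = c.loc (n + j) ∧ G.net.CutLB a b (G.net.cut (D j)) := by
    intro j
    by_cases hj : 1 ≤ j ∧ j < c.cnt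
    · obtain ⟨a, b, hab⟩ := h.pivot j hj.1 hj.2
      exact ⟨a, b, fun _ _ => hab⟩
    · exact ⟨0, 0, fun h1 h2 => absurd ⟨h1, h2⟩ hj⟩
  choose a b hab using hpiv
  -- The index `0` is never a child, so it is free to stand for the outside `(D i)ᶜ`; the other
  -- indices are the children of `i`. These sets are disjoint and are minimum cuts of pivot pairs,
  -- so `X` can be uncrossed with all of them and then respects the blocks of the instance.
  set P : Finset ℕ := (Finset.range c.cnt).filter fun j =>
    (j = 0 ∧ i ≠ 0) ∨ (j ≠ 0 ∧ c.loc (n + j) = i) with hP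
  set Zf : ℕ → Set ℕ := fun j => if j = 0 then (D i)ᶜ else D j with hZf
  set bf : ℕ → ℕ := fun j => if j = 0 then b i else a j with hbf
  set af : ℕ → ℕ := fun j => if j = 0 then a i else b j with haf
  have hsub : ∀ j < c.cnt, j ≠ 0 → c.loc (n + j) = i → ∀ u ∈ D j, u ∈ D i := by
    intro j hj hj0 hl u hu
    have := h.blk_sub (valid_add (n := n) (by omega) hj) (u := u) (mem_blk_add.2 hu)
    rwa [hl] at this
  have hmemP : ∀ j ∈ P, (j = 0 ∧ 1 ≤ i) ∨ (j ≠ 0 ∧ 1 ≤ j ∧ j < c.cnt ∧ c.loc (n + j) = i) := by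
    intro j hj
    simp only [hP, Finset.mem_filter, Finset.mem_range] at hj
    rcases hj.2 with h | h
    · exact Or.inl ⟨h.1, by omega⟩
    · exact Or.inr ⟨h.1, by omega, hj.1, h.2⟩
  have hunc := G.net.uncross_family P Zf af bf ?_ ?_ ?_ ?_ X
  · set Z : Set ℕ := {x | (Valid n c.cnt x ∧ c.loc x = i ∧
      ((x < n ∧ x ∈ X) ∨ (n < x ∧ a (x - n) ∈ X))) ∨ (x = 2 * n + i ∧ i ≠ 0 ∧ b i ∈ X)} with hZ
    have hZC : Z ⊆ Comp n c i := by
      rintro x (⟨h1, h2, -⟩ | ⟨h1, -⟩)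
      · exact Or.inl ⟨h1, h2⟩
      · exact Or.inr h1
    refine ⟨Z, hZC, Or.inl ⟨valid_of_lt hv, hidef, Or.inl ⟨hv, hvX⟩⟩, ?_, ?_⟩
    · rintro (⟨h1, h2, h3 | h3⟩ | ⟨h1, -⟩)
      · exact hsX h3.2
      · omega
      · omega
    · refine le_trans (le_of_eq ?_) hunc
      rw [← Set.inter_eq_left.2 hZC, h.contraction_cut_pre hH hi]
      refine Net.cut_congr ?_
      have hpin : 2 * n + i ∈ Z ↔ i ≠ 0 ∧ b i ∈ X := by
        constructor
        · rintro (⟨h1, -⟩ | ⟨-, h1⟩)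
          · have := h.valid_lt h1
            omega
          · exact h1
        · exact fun h => Or.inr ⟨rfl, h⟩
      have hu : ∀ u < n, (u ∈ pre n c D i Z ↔ u ∈ {u | (∃ j ∈ P, u ∈ Zf j ∧ bf j ∈ X) ∨
          (u ∈ X ∧ ∀ j ∈ P, u ∉ Zf j)}) := by
        intro u hun
        simp only [pre, Set.mem_ofPred_eq, hpin]
        by_cases huD : u ∈ D i
        · obtain ⟨x, hx1, hx2, hx3⟩ := (h.mem_iff i hi u).1 huD
          have hL : ((∃ x, Valid n c.cnt x ∧ c.loc x = i ∧ x ∈ Z ∧ u ∈ blk n D x) ∨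
              (u ∉ D i ∧ i ≠ 0 ∧ b i ∈ X)) ↔ x ∈ Z := by
            constructor
            · rintro (⟨x', h1, h2, h3, h4⟩ | ⟨h1, -⟩)
              · rwa [h.unique x x' u hx1 h1 (by rw [hx2, h2]) hx3 h4]
              · exact absurd huD h1
            · exact fun hxZ => Or.inl ⟨x, hx1, hx2, hxZ, hx3⟩
          rw [hL]
          have hZf0 : ∀ j ∈ P, u ∈ Zf j → j ≠ 0 ∧ x = n + j := by
            intro j hj huj
            rcases hmemP j hj with ⟨rfl, -⟩ | ⟨hj0, h1, h2, h3⟩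
            · simp [hZf, huD] at huj
            · simp only [hZf, hj0, if_false] at huj
              exact ⟨hj0, h.unique x (n + j) u hx1 (valid_add h1 h2) (by rw [hx2, h3]) hx3
                (mem_blk_add.2 huj)⟩
          rcases hx1.cases with hxn | ⟨j, h1, h2, rfl⟩
          · have hxu : u = x := (mem_blk_of_lt hxn).1 hx3
            subst hxu
            have hno : ∀ j ∈ P, u ∉ Zf j := fun j hj huj => by
              have := (hZf0 j hj huj).2
              omega
            constructor
            · rintro (⟨-, -, h3 | h3⟩ | ⟨h1, -⟩)
              · exact Or.inr ⟨h3.2, hno⟩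
              · omega
              · omega
            · rintro (⟨j, hj, huj, -⟩ | ⟨h1, -⟩)
              · exact absurd huj (hno j hj)
              · exact Or.inl ⟨hx1, hx2, Or.inl ⟨hxn, h1⟩⟩
          · have hj0 : j ≠ 0 := by omega
            have hjP : j ∈ P := by simp [hP, h2, hj0, hx2]
            have huj : u ∈ Zf j := by
              simp only [hZf, hj0, if_false]
              exact mem_blk_add.1 hx3
            constructor
            · rintro (⟨-, -, h3 | h3⟩ | ⟨h1, -⟩)
              · omega
              · exact Or.inl ⟨j, hjP, huj, by simpa [hbf, hj0] using h3.2⟩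
              · have := h.valid_lt hx1
                omega
            · rintro (⟨j', hj', huj', hb⟩ | ⟨-, h1⟩)
              · obtain ⟨h3, h4⟩ := hZf0 j' hj' huj'
                obtain rfl : j = j' := by omega
                exact Or.inl ⟨hx1, hx2, Or.inr ⟨by omega, by simpa [hbf, hj0] using hb⟩⟩
              · exact absurd huj (h1 j hjP)
        · have hi0 : i ≠ 0 := by
            rintro rfl
            exact huD (h.root u hun)
          have h0P : 0 ∈ P := by simp [hP, hi0]; omega
          have hZ0 : u ∈ Zf 0 := by simpa [hZf] using huD
          constructor
          · rintro (⟨x, h1, h2, -, h4⟩ | ⟨-, -, h1⟩)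
            · exact absurd ((h.mem_iff i hi u).2 ⟨x, h1, h2, h4⟩) huD
            · exact Or.inl ⟨0, h0P, hZ0, by simpa [hbf] using h1⟩
          · rintro (⟨j, hj, huj, hb⟩ | ⟨-, h1⟩)
            · rcases hmemP j hj with ⟨rfl, -⟩ | ⟨hj0, h1, h2, h3⟩
              · exact Or.inr ⟨huD, hi0, by simpa [hbf] using hb⟩
              · simp only [hZf, hj0, if_false] at huj
                exact absurd (hsub j h2 hj0 h3 u huj) huD
            · exact absurd hZ0 (h1 0 h0P)
      exact fun e _ => ⟨hu _ (G.tail e).2, hu _ (G.head e).2⟩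
  · intro j hj j' hj' hne u huj huj'
    rcases hmemP j hj with ⟨rfl, -⟩ | ⟨hj0, h1, h2, h3⟩ <;>
      rcases hmemP j' hj' with ⟨rfl, -⟩ | ⟨hj0', h1', h2', h3'⟩
    · exact hne rfl
    · simp only [hZf, if_true, hj0', if_false] at huj huj'
      exact huj (hsub j' h2' hj0' h3' u huj')
    · simp only [hZf, if_true, hj0, if_false] at huj huj'
      exact huj' (hsub j h2 hj0 h3 u huj)
    · simp only [hZf, hj0', hj0, if_false] at huj huj'
      have := h.unique (n + j) (n + j') u (valid_add h1 h2) (valid_add h1' h2') (by rw [h3, h3'])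
        (mem_blk_add.2 huj) (mem_blk_add.2 huj')
      omega
  · intro j hj
    rcases hmemP j hj with ⟨rfl, h1⟩ | ⟨hj0, h1, h2, h3⟩
    · obtain ⟨-, h3, -, h5, -⟩ := hab i h1 hi
      simp only [hbf, hZf, if_true]
      exact h.parent_not_mem h1 hi h3 h5
    · obtain ⟨h4, -, h5, -⟩ := hab j h1 h2
      simp only [hbf, hZf, hj0, if_false]
      have := h.mem_self h4
      rwa [h5] at this
  · intro j hj
    rcases hmemP j hj with ⟨rfl, h1⟩ | ⟨hj0, h1, h2, h3⟩
    · obtain ⟨h4, -, h5, -⟩ := hab i h1 hi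
      simp only [haf, hZf, if_true, Set.mem_compl_iff, not_not]
      have := h.mem_self h4
      rwa [h5] at this
    · obtain ⟨-, h4, -, h5, -⟩ := hab j h1 h2
      simp only [haf, hZf, hj0, if_false]
      exact h.parent_not_mem h1 h2 h4 h5
  · intro j hj
    rcases hmemP j hj with ⟨rfl, h1⟩ | ⟨hj0, h1, h2, h3⟩
    · obtain ⟨-, -, -, -, h5⟩ := hab i h1 hi
      simp only [haf, hbf, hZf, if_true, Net.cut_compl]
      exact h5.symm
    · obtain ⟨-, -, -, -, h5⟩ := hab j h1 h2
      simp only [haf, hbf, hZf, hj0, if_false]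
      exact h5

end CfgInv

/-! ### Splitting instances along minimum cuts -/

/-- Every instance `i < cnt` has a source `src i`; for `cnt ≤ j < cnt'` the vertices `x` with
`mv x = j` of a contracted graph form a minimum cut between `hd j` and the source of its
instance, and they are moved to the new instance `j`. Vertices with `mv x = 0` stay. -/
structure Split {n : ℕ} {ι : Type*} (c : Cfg) (H : Net ι ℕ) (src mv hd : ℕ → ℕ) (cnt' : ℕ) :
    Prop where
  le : c.cnt ≤ cnt'
  src_lt : ∀ i < c.cnt, src i < n
  src_loc : ∀ i < c.cnt, c.loc (src i) = i
  mv_src : ∀ i < c.cnt, mv (src i) = 0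
  mv_range : ∀ x, mv x = 0 ∨ (c.cnt ≤ mv x ∧ mv x < cnt')
  mv_valid : ∀ x, mv x ≠ 0 → Valid n c.cnt x ∧ c.loc x = c.loc (hd (mv x))
  hd_lt : ∀ j, c.cnt ≤ j → j < cnt' → hd j < n
  mv_hd : ∀ j, c.cnt ≤ j → j < cnt' → mv (hd j) = j
  min : ∀ j, c.cnt ≤ j → j < cnt' → ∀ Z ⊆ Comp n c (c.loc (hd j)), hd j ∈ Z →
    src (c.loc (hd j)) ∉ Z → H.cut {x | mv x = j} ≤ H.cut Z

/-- The partition tree `c'` arises from `c` by moving vertices to new instances. -/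
structure Step {n m : ℕ} {ι : Type*} (c c' : Cfg) (H : Net ι ℕ) (mv hd : ℕ → ℕ) : Prop where
  loc_old : ∀ x, Valid n c.cnt x → c'.loc x = if mv x = 0 then c.loc x else mv x
  loc_new : ∀ j, c.cnt ≤ j → j < c'.cnt → c'.loc (n + j) = c.loc (hd j)
  dg_old : ∀ x, Valid n c.cnt x → c'.dg x = c.dg x
  dg_new : ∀ j, c.cnt ≤ j → j < c'.cnt → c'.dg (n + j) = H.cut {x | mv x = j}
  dg_zero : ∀ x < 2 * n, ¬Valid n c'.cnt x → c'.dg x = 0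
  ex_eq : ∀ e < m, c'.ex e =
    if mv (c.ex e) ≠ mv (c.ey e) ∧ mv (c.ex e) ≠ 0 then n + mv (c.ex e) else c.ex e
  ey_eq : ∀ e < m, c'.ey e =
    if mv (c.ex e) ≠ mv (c.ey e) ∧ mv (c.ey e) ≠ 0 then n + mv (c.ey e) else c.ey e

/-- The vertices below the instances after a split. -/
def splitD (n : ℕ) (c : Cfg) (D : ℕ → Set ℕ) (mv : ℕ → ℕ) (j : ℕ) : Set ℕ :=
  {u | if j < c.cnt then u ∈ D j else ∃ x, Valid n c.cnt x ∧ mv x = j ∧ u ∈ blk n D x}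

namespace Split

variable {n m : ℕ} {ι : Type*} {G : MGraph n m} {c c' : Cfg} {D : ℕ → Set ℕ} {H : Net ι ℕ}
  {src mv hd : ℕ → ℕ}

theorem splitD_new {j : ℕ} (hj : c.cnt ≤ j) :
    splitD n c D mv j = {u | ∃ x ∈ {x | mv x = j ∧ Valid n c.cnt x}, u ∈ blk n D x} := by
  ext u
  simp only [splitD, Set.mem_ofPred_eq, Nat.not_lt.2 hj, if_false]
  constructor
  · rintro ⟨x, h1, h2, h3⟩; exact ⟨x, ⟨h2, h1⟩, h3⟩
  · rintro ⟨x, ⟨h2, h1⟩, h3⟩; exact ⟨x, h1, h2, h3⟩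

theorem set_eq {cnt' : ℕ} (s : Split (n := n) c H src mv hd cnt') (h : CfgInv G c D) {j : ℕ}
    (hj : c.cnt ≤ j) : {x | mv x = j ∧ Valid n c.cnt x} = {x | mv x = j} := by
  have := h.cnt_pos
  ext x
  simp only [Set.mem_ofPred_eq, and_iff_left_iff_imp]
  exact fun hx => (s.mv_valid x (by omega)).1

theorem cut_splitD {cnt' : ℕ} (s : Split (n := n) c H src mv hd cnt') (h : CfgInv G c D)
    (hH : IsContraction G c H) {j : ℕ} (hj : c.cnt ≤ j) :
    G.net.cut (splitD n c D mv j) = H.cut {x | mv x = j} := by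
  have := h.cnt_pos
  rw [splitD_new hj, ← h.contraction_cut hH (i := c.loc (hd j)), s.set_eq h hj]
  rintro x ⟨h1, h2⟩
  refine ⟨h2, ?_⟩
  have := (s.mv_valid x (by omega)).2
  rwa [h1] at this

theorem hd_mem {cnt' : ℕ} (s : Split (n := n) c H src mv hd cnt') {j : ℕ}
    (hj : c.cnt ≤ j) (hj' : j < cnt') : hd j ∈ splitD n c D mv j := by
  rw [splitD_new hj]
  have h1 := s.hd_lt j hj hj'
  exact ⟨hd j, ⟨s.mv_hd j hj hj', valid_of_lt h1⟩, (mem_blk_of_lt h1).2 rfl⟩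

theorem mem_splitD_of_lt {cnt' : ℕ} (s : Split (n := n) c H src mv hd cnt') (h : CfgInv G c D)
    {j u : ℕ} (hj : c.cnt ≤ j) (hu : u < n) (hl : c.loc u = c.loc (hd j)) :
    u ∈ splitD n c D mv j ↔ mv u = j := by
  have := h.cnt_pos
  rw [splitD_new hj]
  constructor
  · rintro ⟨x, ⟨h1, h2⟩, h3⟩
    have h4 := (s.mv_valid x (by omega)).2
    rw [h1] at h4
    rw [h.unique u x u (valid_of_lt hu) h2 (by rw [hl, h4]) ((mem_blk_of_lt hu).2 rfl) h3, h1]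
  · intro h1
    exact ⟨u, ⟨h1, valid_of_lt hu⟩, (mem_blk_of_lt hu).2 rfl⟩

theorem splitD_sub {cnt' : ℕ} (s : Split (n := n) c H src mv hd cnt') (h : CfgInv G c D)
    {j u : ℕ} (hj : c.cnt ≤ j) (hu : u ∈ splitD n c D mv j) : u ∈ D (c.loc (hd j)) := by
  have := h.cnt_pos
  rw [splitD_new hj] at hu
  obtain ⟨x, ⟨h1, h2⟩, h3⟩ := hu
  have h4 := (s.mv_valid x (by omega)).2
  rw [h1] at h4
  rw [← h4]
  exact h.blk_sub h2 h3

/-- Minimality holds by assumption only in the contracted graph. It carries over to `G` since every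
cut of `G` yields a contracted cut that is no heavier. -/
theorem mincut_splitD {cnt' : ℕ} (s : Split (n := n) c H src mv hd cnt') (h : CfgInv G c D)
    (hH : IsContraction G c H) {j : ℕ} (hj : c.cnt ≤ j) (hj' : j < cnt') :
    G.net.CutLB (hd j) (src (c.loc (hd j))) (G.net.cut (splitD n c D mv j)) := by
  intro X h1 h2
  have hv := s.hd_lt j hj hj'
  have hl := h.loc_lt _ (valid_of_lt hv)
  obtain ⟨Z, h3, h4, h5, h6⟩ := h.exists_contracted_cut hH hv (s.src_lt _ hl)
    (s.src_loc _ hl).symm h1 h2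
  rw [s.cut_splitD h hH hj]
  exact (s.min j hj hj' Z h3 h4 h5).trans h6

/-- After the split, every end of a pivot pair can be replaced by one in a given part of its
instance. -/
theorem replace_pivot {cnt' : ℕ} (s : Split (n := n) c H src mv hd cnt') (h : CfgInv G c D)
    (hH : IsContraction G c H) {x b a L : ℕ} (hx : Valid n c.cnt x) (hb : b < n)
    (hl : c.loc b = c.loc x) (ha : a ∈ blk n D x ∨ ((∀ i, mv x = i → i = 0) ∧ a ∉ D (c.loc x)))
    (hLB : G.net.CutLB b a L) : ∃ b' < n, mv b' = mv x ∧ c.loc b' = c.loc x ∧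
      G.net.CutLB b' a L := by
  have hcp := h.cnt_pos
  have haj : ∀ j, c.cnt ≤ j → c.loc (hd j) = c.loc x → (a ∈ splitD n c D mv j ↔ mv x = j) := by
    intro j hj hlj
    rcases ha with ha | ⟨ha, ha'⟩
    · rw [splitD_new hj]
      constructor
      · rintro ⟨x', ⟨h1, h2⟩, h3⟩
        have h4 := (s.mv_valid x' (by omega)).2
        rw [h1] at h4
        rw [h.unique x x' a hx h2 (by rw [h4, hlj]) ha h3, h1]
      · exact fun h1 => ⟨x, ⟨h1, hx⟩, ha⟩
    · constructor
      · intro h1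
        have := s.splitD_sub h hj h1
        rw [hlj] at this
        exact absurd this ha'
      · intro h1
        have := ha j h1
        omega
  by_cases hbx : mv b = mv x
  · exact ⟨b, hb, hbx, hl, hLB⟩
  -- Here the required part is the one of the source, and `b` was moved away with a minimum cut that
  -- does not contain `a`. The source takes the place of `b`.
  · by_cases hx0 : mv x = 0
    · have hb0 : mv b ≠ 0 := fun h => hbx (h.trans hx0.symm)
      obtain ⟨h1, h2⟩ := (s.mv_range b).resolve_left hb0
      have h3 := (s.mv_valid b hb0).2
      have hil := h.loc_lt b (valid_of_lt hb)
      refine ⟨src (c.loc x), s.src_lt _ (hl ▸ hil), ?_, s.src_loc _ (hl ▸ hil), ?_⟩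
      · rw [hx0, s.mv_src _ (hl ▸ hil)]
      · have hsrc : src (c.loc x) ∉ splitD n c D mv (mv b) := by
          rw [s.mem_splitD_of_lt h h1 (s.src_lt _ (hl ▸ hil)), s.mv_src _ (hl ▸ hil)]
          · exact hb0.symm
          · rw [s.src_loc _ (hl ▸ hil), ← h3, hl]
        have hmc := s.mincut_splitD h hH h1 h2
        rw [← h3, hl] at hmc
        have haS : a ∉ splitD n c D mv (mv b) := by
          rw [haj _ h1 (by rw [← h3, hl])]
          exact fun h => hbx h.symm
        have hbS : b ∈ splitD n c D mv (mv b) := (s.mem_splitD_of_lt h h1 hb h3).2 rfl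
        exact (Net.pivot_outside (s.hd_mem h1 h2) hsrc hmc haS hbS hLB.symm)
    -- Here the required part is a new instance that does not contain `b`. Its head takes the place
    -- of `b`.
    · obtain ⟨h1, h2⟩ := (s.mv_range x).resolve_left hx0
      have h3 := (s.mv_valid x hx0).2
      have hv := s.hd_lt _ h1 h2
      have hil := h.loc_lt x hx
      refine ⟨hd (mv x), hv, s.mv_hd _ h1 h2, h3.symm, ?_⟩
      have hmc := s.mincut_splitD h hH h1 h2
      have hsrc : src (c.loc (hd (mv x))) ∉ splitD n c D mv (mv x) := by
        rw [← h3, s.mem_splitD_of_lt h h1 (s.src_lt _ hil) (by rw [s.src_loc _ hil, h3]),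
          s.mv_src _ hil]
        exact fun h => hx0 h.symm
      have hbS : b ∉ splitD n c D mv (mv x) := by
        rw [s.mem_splitD_of_lt h h1 hb (by rw [hl, h3])]
        exact hbx
      exact Net.pivot_inside (s.hd_mem h1 h2) hsrc hmc ((haj _ h1 h3.symm).2 rfl) hbS hLB.symm

theorem blk_old {x : ℕ} (hx : Valid n c.cnt x) :
    blk n (splitD n c D mv) x = blk n D x := by
  ext u
  rcases hx.cases with h | ⟨j, h1, h2, rfl⟩
  · rw [mem_blk_of_lt h, mem_blk_of_lt h]
  · rw [mem_blk_add, mem_blk_add]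
    simp [splitD, h2]

/-- This reduces the structure of the new tree to the old one. A new block is an old one or the
contraction of a new part; in the latter case each of its vertices is in an old block of that part,
whose former instance now holds the contraction. -/
theorem block_cases (s : Split (n := n) c H src mv hd c'.cnt) (h : CfgInv G c D)
    (t : Step (n := n) (m := m) c c' H mv hd) {x' u : ℕ} (hx' : Valid n c'.cnt x')
    (hu : u ∈ blk n (splitD n c D mv) x') : ∃ x, Valid n c.cnt x ∧ u ∈ blk n D x ∧
      ((x' = x ∧ c'.loc x' = if mv x = 0 then c.loc x else mv x) ∨
        (mv x ≠ 0 ∧ x' = n + mv x ∧ c'.loc x' = c.loc x)) := by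
  have hcp := h.cnt_pos
  rcases hx'.cases with hl | ⟨j, h1, h2, rfl⟩
  · have hv : Valid n c.cnt x' := valid_of_lt hl
    exact ⟨x', hv, blk_old hv ▸ hu, Or.inl ⟨rfl, t.loc_old x' hv⟩⟩
  · by_cases hj : j < c.cnt
    · have hv : Valid n c.cnt (n + j) := valid_add h1 hj
      exact ⟨_, hv, blk_old hv ▸ hu, Or.inl ⟨rfl, t.loc_old _ hv⟩⟩
    · rw [blk_add, splitD_new (Nat.not_lt.1 hj)] at hu
      obtain ⟨x, ⟨rfl, h4⟩, h5⟩ := hu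
      refine ⟨x, h4, h5, Or.inr ⟨by omega, rfl, ?_⟩⟩
      rw [t.loc_new _ (Nat.not_lt.1 hj) h2, (s.mv_valid x (by omega)).2]

theorem exists_block (s : Split (n := n) c H src mv hd c'.cnt) (h : CfgInv G c D)
    (t : Step (n := n) (m := m) c c' H mv hd) {x u : ℕ} (hx : Valid n c.cnt x)
    (hu : u ∈ blk n D x) : ∃ x', Valid n c'.cnt x' ∧ c'.loc x' = c.loc x ∧
      u ∈ blk n (splitD n c D mv) x' := by
  have hcp := h.cnt_pos
  by_cases h0 : mv x = 0
  · refine ⟨x, ⟨by have := hx.1; have := s.le; omega, hx.2⟩, ?_, ?_⟩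
    · rw [t.loc_old x hx, if_pos h0]
    · rwa [blk_old hx]
  · obtain ⟨h1, h2⟩ := (s.mv_range x).resolve_left h0
    refine ⟨n + mv x, valid_add (by omega) h2, ?_, ?_⟩
    · rw [t.loc_new _ h1 h2, (s.mv_valid x h0).2]
    · rw [blk_add, splitD_new h1]
      exact ⟨x, ⟨rfl, hx⟩, hu⟩

theorem valid_mono (s : Split (n := n) c H src mv hd c'.cnt) {x : ℕ} (hx : Valid n c.cnt x) :
    Valid n c'.cnt x := ⟨by have := hx.1; have := s.le; omega, hx.2⟩

/-- Blocks that share an instance after the split shared one before it. Either both are old blocks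
with the same destination, or at least one is the contraction of a part that left the instance. -/
theorem same_loc (s : Split (n := n) c H src mv hd c'.cnt) (h : CfgInv G c D) {x y x' y' : ℕ}
    (hx : Valid n c.cnt x) (hy : Valid n c.cnt y)
    (hx' : (x' = x ∧ c'.loc x' = if mv x = 0 then c.loc x else mv x) ∨
        (mv x ≠ 0 ∧ x' = n + mv x ∧ c'.loc x' = c.loc x))
    (hy' : (y' = y ∧ c'.loc y' = if mv y = 0 then c.loc y else mv y) ∨
        (mv y ≠ 0 ∧ y' = n + mv y ∧ c'.loc y' = c.loc y)) (hl : c'.loc x' = c'.loc y') :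
    c.loc x = c.loc y ∧ ((x' = x ∧ y' = y ∧ mv x = mv y) ∨ (x' = x ∧ mv x = 0 ∧ mv y ≠ 0 ∧ y' = n + mv y) ∨
      (mv x ≠ 0 ∧ x' = n + mv x ∧ y' = y ∧ mv y = 0) ∨
      (mv x ≠ 0 ∧ x' = n + mv x ∧ mv y ≠ 0 ∧ y' = n + mv y)) := by
  have h1 := h.loc_lt x hx
  have h2 := h.loc_lt y hy
  have h3 := s.mv_range x
  have h4 := s.mv_range y
  rcases hx' with ⟨rfl, hx'⟩ | ⟨hx0, rfl, hx'⟩ <;> rcases hy' with ⟨rfl, hy'⟩ | ⟨hy0, rfl, hy'⟩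
  · rw [hx', hy'] at hl
    split_ifs at hl with h5 h6 h6
    · exact ⟨hl, Or.inl ⟨rfl, rfl, by rw [h5, h6]⟩⟩
    · omega
    · omega
    · refine ⟨?_, Or.inl ⟨rfl, rfl, hl⟩⟩
      rw [(s.mv_valid _ h5).2, (s.mv_valid _ h6).2, hl]
  · rw [hx', hy'] at hl
    split_ifs at hl with h5
    · exact ⟨hl, Or.inr (Or.inl ⟨rfl, h5, hy0, rfl⟩)⟩
    · omega
  · rw [hx', hy'] at hl
    split_ifs at hl with h5
    · exact ⟨hl, Or.inr (Or.inr (Or.inl ⟨hx0, rfl, rfl, h5⟩))⟩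
    · omega
  · rw [hx', hy'] at hl
    exact ⟨hl, Or.inr (Or.inr (Or.inr ⟨hx0, rfl, hy0, rfl⟩))⟩

/-- Splitting along minimum cuts preserves the invariants of partition trees. -/
theorem cfgInv (s : Split (n := n) c H src mv hd c'.cnt) (h : CfgInv G c D)
    (hH : IsContraction G c H) (t : Step (n := n) (m := m) c c' H mv hd) :
    CfgInv G c' (splitD n c D mv) := by
  have hcp := h.cnt_pos
  have hle := s.le
  have hloc_hd : ∀ j, c.cnt ≤ j → j < c'.cnt → c.loc (hd j) < c.cnt := fun j h1 h2 =>
    h.loc_lt _ (valid_of_lt (s.hd_lt j h1 h2))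
  refine ⟨by omega, ?_, ?_, ?_, ?_, ?_, ?_, ?_, t.dg_zero, ?_, ?_, ?_⟩
  · intro x hx
    by_cases hx' : Valid n c.cnt x
    · rw [t.loc_old x hx']
      split_ifs with h0
      · have := h.loc_lt x hx'; omega
      · exact ((s.mv_range x).resolve_left h0).2
    · rcases hx.cases with h1 | ⟨j, h1, h2, rfl⟩
      · exact absurd (valid_of_lt h1) hx'
      · have h3 : c.cnt ≤ j := by
          by_contra h3
          exact hx' (valid_add h1 (by omega))
        rw [t.loc_new j h3 h2]
        have := hloc_hd j h3 h2
        omega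
  · intro j hj
    by_cases hj' : j < c.cnt
    · refine ⟨src j, s.src_lt j hj', ?_⟩
      rw [t.loc_old _ (valid_of_lt (s.src_lt j hj')), if_pos (s.mv_src j hj'), s.src_loc j hj']
    · have h1 := s.hd_lt j (by omega) hj
      refine ⟨hd j, h1, ?_⟩
      have h2 := s.mv_hd j (by omega) hj
      rw [t.loc_old _ (valid_of_lt h1), h2, if_neg (by omega)]
  · intro u hu
    simp only [splitD, Set.mem_ofPred_eq, hcp, if_true]
    exact h.root u hu
  · intro j hj u hu
    by_cases hj' : j < c.cnt
    · simp only [splitD, Set.mem_ofPred_eq, hj', if_true] at hu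
      exact h.sub j hj' u hu
    · exact h.sub _ (hloc_hd j (by omega) hj) u (s.splitD_sub h (by omega) hu)
  · intro i hi u
    by_cases hi' : i < c.cnt
    · have : u ∈ splitD n c D mv i ↔ u ∈ D i := by simp [splitD, hi']
      rw [this, h.mem_iff i hi']
      constructor
      · rintro ⟨x, h1, h2, h3⟩
        obtain ⟨x', h4, h5, h6⟩ := s.exists_block h t h1 h3
        exact ⟨x', h4, h5.trans h2, h6⟩
      · rintro ⟨x', h1, h2, h3⟩
        obtain ⟨x, h4, h5, ⟨rfl, h6⟩ | ⟨h6, rfl, h7⟩⟩ := s.block_cases h t h1 h3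
        · refine ⟨x', h4, ?_, h5⟩
          have := s.mv_range x'
          split_ifs at h6 <;> omega
        · exact ⟨x, h4, by omega, h5⟩
    · rw [splitD_new (by omega)]
      constructor
      · rintro ⟨x, ⟨rfl, h2⟩, h3⟩
        refine ⟨x, s.valid_mono h2, ?_, ?_⟩
        · rw [t.loc_old x h2, if_neg (by omega)]
        · rwa [blk_old h2]
      · rintro ⟨x', h1, h2, h3⟩
        obtain ⟨x, h4, h5, ⟨rfl, h6⟩ | ⟨h6, rfl, h7⟩⟩ := s.block_cases h t h1 h3
        · refine ⟨x', ⟨?_, h4⟩, h5⟩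
          have := h.loc_lt x' h4
          split_ifs at h6 <;> omega
        · have := h.loc_lt x h4
          omega
  · intro x' y' u hx' hy' hl hux huy
    obtain ⟨x, h1, h2, h3⟩ := s.block_cases h t hx' hux
    obtain ⟨y, h4, h5, h6⟩ := s.block_cases h t hy' huy
    obtain ⟨h7, h8⟩ := s.same_loc h h1 h4 h3 h6 hl
    obtain rfl := h.unique x y u h1 h4 h7 h2 h5
    omega
  · intro x hx
    by_cases hx' : Valid n c.cnt x
    · rw [t.dg_old x hx', h.dg_eq x hx', blk_old hx']
    · rcases hx.cases with h1 | ⟨j, h1, h2, rfl⟩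
      · exact absurd (valid_of_lt h1) hx'
      · have h3 : c.cnt ≤ j := by
          by_contra h3
          exact hx' (valid_add h1 (by omega))
        rw [t.dg_new j h3 h2, blk_add, s.cut_splitD h hH h3]
  · intro j hj1 hj
    by_cases hj' : j < c.cnt
    · obtain ⟨a, b, h1, h2, h3, h4, h5⟩ := h.pivot j hj1 hj'
      have hvj : Valid n c.cnt (n + j) := valid_add hj1 hj'
      have hbD := h.parent_not_mem hj1 hj' h2 h4
      have hD : splitD n c D mv j = D j := by ext u; simp [splitD, hj']
      -- The end in the child stays with the source, the one in the parent follows the child.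
      obtain ⟨a', ha1, ha2, ha3⟩ : ∃ a' < n, mv a' = 0 ∧ c.loc a' = j ∧
          G.net.CutLB a' b (G.net.cut (D j)) := by
        obtain ⟨a', h6, h7, h8, h9⟩ := s.replace_pivot h hH (x := src j) (b := a) (a := b)
          (valid_of_lt (s.src_lt j hj')) h1 (by rw [h3, s.src_loc j hj'])
          (Or.inr ⟨fun i hi => by rw [← hi, s.mv_src j hj'], by rwa [s.src_loc j hj']⟩) h5
        exact ⟨a', h6, by rw [h7, s.mv_src j hj'], by rw [h8, s.src_loc j hj'], h9⟩
      obtain ⟨b', hb1, hb2, hb3, hb4⟩ := s.replace_pivot h hH (x := n + j) (b := b) (a := a')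
        hvj h2 h4 (Or.inl (by
          rw [mem_blk_add]
          have := h.mem_self ha1
          rwa [ha3.1] at this)) ha3.2.symm
      refine ⟨a', b', ha1, hb1, ?_, ?_, ?_⟩
      · rw [t.loc_old _ (valid_of_lt ha1), if_pos ha2, ha3.1]
      · rw [t.loc_old _ (valid_of_lt hb1), t.loc_old _ hvj, hb2, hb3]
      · rw [hD]
        exact hb4.symm
    · have h1 := s.hd_lt j (by omega) hj
      have h2 := s.mv_hd j (by omega) hj
      have h3 := hloc_hd j (by omega) hj
      refine ⟨hd j, src (c.loc (hd j)), h1, s.src_lt _ h3, ?_, ?_,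
        s.mincut_splitD h hH (by omega) hj⟩
      · rw [t.loc_old _ (valid_of_lt h1), h2, if_neg (by omega)]
      · rw [t.loc_old _ (valid_of_lt (s.src_lt _ h3)), if_pos (s.mv_src _ h3), s.src_loc _ h3,
          t.loc_new j (by omega) hj]
  -- If both ends go to the same part, the edge goes with them. Otherwise it stays in the old
  -- instance, and an end that was moved is represented by the contraction of its part.
  · intro e
    obtain ⟨h1, h2, h3, h4, h5, h6⟩ := h.edge_valid e
    have hx := s.mv_range (c.ex e)
    have hy := s.mv_range (c.ey e)
    have hxl := t.loc_old _ h1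
    have hyl := t.loc_old _ h2
    have hx1 := h1.1
    have hy1 := h2.1
    have hnew : ∀ x, Valid n c.cnt x → mv x ≠ 0 → Valid n c'.cnt (n + mv x) ∧
        c'.loc (n + mv x) = c.loc x ∧ ∀ u ∈ blk n D x, u ∈ blk n (splitD n c D mv) (n + mv x) := by
      intro x hx h0
      obtain ⟨h1, h2⟩ := (s.mv_range x).resolve_left h0
      refine ⟨valid_add (by omega) h2, by rw [t.loc_new _ h1 h2, (s.mv_valid x h0).2], ?_⟩
      intro u hu
      rw [blk_add, splitD_new h1]
      exact ⟨x, ⟨rfl, hx⟩, hu⟩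
    rw [t.ex_eq e e.2, t.ey_eq e e.2]
    by_cases hab : mv (c.ex e) = mv (c.ey e)
    · simp only [hab, ne_eq, not_true_eq_false, false_and, if_false]
      refine ⟨s.valid_mono h1, s.valid_mono h2, h3, by rw [hxl, hyl, hab, h4], ?_, ?_⟩
      · rwa [blk_old h1]
      · rwa [blk_old h2]
    · by_cases ha : mv (c.ex e) = 0
      · have hb : mv (c.ey e) ≠ 0 := fun h => hab (ha.trans h.symm)
        simp only [ha, ne_eq, hb, hb.symm, not_true_eq_false, and_false, if_false,
          not_false_eq_true, and_self, if_true]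
        obtain ⟨h7, h8, h9⟩ := hnew _ h2 hb
        refine ⟨s.valid_mono h1, h7, by omega, by rw [hxl, if_pos ha, h8, h4], ?_, h9 _ h6⟩
        rwa [blk_old h1]
      · obtain ⟨h7, h8, h9⟩ := hnew _ h1 ha
        by_cases hb : mv (c.ey e) = 0
        · simp only [hb, ne_eq, ha, not_true_eq_false, and_false, if_false,
            not_false_eq_true, and_self, if_true]
          refine ⟨h7, s.valid_mono h2, by omega, by rw [hyl, if_pos hb, h8, h4], h9 _ h5, ?_⟩
          rwa [blk_old h2]
        · obtain ⟨h10, h11, h12⟩ := hnew _ h2 hb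
          simp only [hab, hb, ne_eq, ha, not_false_eq_true, and_self, if_true]
          exact ⟨h7, h10, by omega, by rw [h8, h11, h4], h9 _ h5, h12 _ h6⟩
  · intro e x' y' hx' hy' hne hl hux huy
    obtain ⟨x, h1, h2, h3⟩ := s.block_cases h t hx' hux
    obtain ⟨y, h4, h5, h6⟩ := s.block_cases h t hy' huy
    obtain ⟨h7, h8⟩ := s.same_loc h h1 h4 h3 h6 hl
    have hxy : x ≠ y := by
      rintro rfl
      omega
    obtain ⟨h9, h10⟩ := h.edge_unique e x y h1 h4 hxy h7 h2 h5
    rw [t.ex_eq e e.2, t.ey_eq e e.2, h9, h10]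
    rcases h8 with ⟨rfl, rfl, h8⟩ | ⟨rfl, h8, h11, rfl⟩ | ⟨h8, rfl, rfl, h11⟩ | ⟨h8, rfl, h11, rfl⟩
    · simp [h8]
    · simp [h8, h11, Ne.symm h11]
    · simp [h8, h11]
    · have : mv x ≠ mv y := fun h => hne (by rw [h])
      simp [h8, h11, this]

end Split

/-! ### Fully split partition trees are Gomory-Hu trees -/

namespace CfgInv

variable {n m : ℕ} {G : MGraph n m} {c : Cfg} {D : ℕ → Set ℕ}

theorem finite_below (h : CfgInv G c D) {j : ℕ} (hj : j < c.cnt) : (D j).Finite :=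
  (Set.finite_lt_nat n).subset fun u hu => h.sub j hj u hu

theorem below_sub (h : CfgInv G c D) {j : ℕ} (hj : 1 ≤ j) (hj' : j < c.cnt) :
    D j ⊆ D (c.loc (n + j)) := fun u hu =>
  h.blk_sub (valid_add (n := n) hj hj') (u := u) (mem_blk_add.2 hu)

/-- The number of vertices below an instance replaces depth as induction measure. It grows strictly
towards the root because the parent contains a vertex of its own. -/
theorem ncard_below_lt (h : CfgInv G c D) {j : ℕ} (hj : 1 ≤ j) (hj' : j < c.cnt) :
    (D j).ncard < (D (c.loc (n + j))).ncard := by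
  have hl := h.loc_lt _ (valid_add (n := n) hj hj')
  refine Set.ncard_lt_ncard ⟨h.below_sub hj hj', fun hs => ?_⟩ (h.finite_below hl)
  obtain ⟨b, hb, hb'⟩ := h.nonempty _ hl
  have := h.mem_self hb
  rw [hb'] at this
  exact h.parent_not_mem hj hj' hb hb' (hs this)

theorem loc_or_child (h : CfgInv G c D) {i u : ℕ} (hi : i < c.cnt) (hu : u ∈ D i) :
    c.loc u = i ∨ ∃ j, 1 ≤ j ∧ j < c.cnt ∧ c.loc (n + j) = i ∧ u ∈ D j := by
  obtain ⟨x, h1, h2, h3⟩ := (h.mem_iff i hi u).1 hu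
  rcases h1.cases with h4 | ⟨j, h4, h5, rfl⟩
  · rw [mem_blk_of_lt h4] at h3
    exact Or.inl (h3 ▸ h2)
  · exact Or.inr ⟨j, h4, h5, h2, mem_blk_add.1 h3⟩

theorem below_loc_sub (h : CfgInv G c D) : ∀ (k i u : ℕ), (D i).ncard < k → i < c.cnt → u ∈ D i →
    D (c.loc u) ⊆ D i
  | 0, _, _, hk, _, _ => by omega
  | k + 1, i, u, hk, hi, hu => by
    rcases h.loc_or_child hi hu with rfl | ⟨j, h1, h2, rfl, h4⟩
    · exact subset_rfl
    · exact (below_loc_sub h k j u (by have := h.ncard_below_lt h1 h2; omega) h2 h4).trans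
        (h.below_sub h1 h2)

theorem mem_parent_of_mem (h : CfgInv G c D) {k r b : ℕ} (hk : 1 ≤ k) (hk' : k < c.cnt)
    (hr : c.loc r = k) (hb : b < n) (hbl : c.loc b = c.loc (n + k)) :
    ∀ (N i : ℕ), (D i).ncard < N → i < c.cnt → i ≠ k → r ∈ D i → b ∈ D i
  | 0, _, hN, _, _, _ => by omega
  | N + 1, i, hN, hi, hik, hu => by
    rcases h.loc_or_child hi hu with rfl | ⟨j, h1, h2, rfl, h4⟩
    · exact absurd hr hik
    · by_cases hjk : j = k
      · subst hjk
        rw [← hbl]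
        exact h.mem_self hb
      · exact h.below_sub h1 h2 (mem_parent_of_mem h hk hk' hr hb hbl N j
          (by have := h.ncard_below_lt h1 h2; omega) h2 hjk h4)

/-- The subtree of `i` separates the ends of the tree edge above `i` and of no other tree edge. -/
theorem mem_iff_parent (h : CfgInv G c D) {k r b i : ℕ} (hk : 1 ≤ k) (hk' : k < c.cnt)
    (hrn : r < n) (hr : c.loc r = k) (hb : b < n) (hbl : c.loc b = c.loc (n + k)) (hi : i < c.cnt)
    (hik : i ≠ k) : r ∈ D i ↔ b ∈ D i := by
  refine ⟨h.mem_parent_of_mem hk hk' hr hb hbl _ i (Nat.lt_succ_self _) hi hik, fun hbi => ?_⟩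
  refine h.below_loc_sub _ i b (Nat.lt_succ_self _) hi hbi ?_
  rw [hbl]
  refine h.below_sub hk hk' ?_
  have := h.mem_self hrn
  rwa [hr] at this

theorem not_mem_of_ncard_le (h : CfgInv G c D) {u v : ℕ} (hu : u < n)
    (hne : c.loc u ≠ c.loc v) (hsz : (D (c.loc u)).ncard ≤ (D (c.loc v)).ncard) :
    v ∉ D (c.loc u) := by
  intro hmem
  rcases h.loc_or_child (h.loc_lt u (valid_of_lt hu)) hmem with h1 | ⟨j, h1, h2, h3, h4⟩
  · exact hne h1.symm
  · have h5 := h.below_loc_sub _ j v (Nat.lt_succ_self _) h2 h4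
    have h6 := Set.ncard_le_ncard h5 (h.finite_below h2)
    have h7 := h.ncard_below_lt h1 h2
    rw [h3] at h7
    omega

/-- If every tree edge that separates `u` from `v` joins vertices on the same side of `X`, then
`u` and `v` are on the same side of `X`. -/
theorem same_side (h : CfgInv G c D) (hinj : ∀ u < n, ∀ v < n, c.loc u = c.loc v → u = v)
    (X : Set ℕ) : ∀ (N u v : ℕ), 2 * n - (D (c.loc u)).ncard - (D (c.loc v)).ncard < N → u < n → v < n →
    (∀ j, 1 ≤ j → j < c.cnt → ¬(u ∈ D j ↔ v ∈ D j) → ∀ r < n, ∀ b < n, c.loc r = j →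
      c.loc b = c.loc (n + j) → (r ∈ X ↔ b ∈ X)) → (u ∈ X ↔ v ∈ X)
  | 0, _, _, hN, _, _, _ => by omega
  | N + 1, u, v, hN, hu, hv, hX => by
    by_cases huv : u = v
    · rw [huv]
    have hne : c.loc u ≠ c.loc v := fun h => huv (hinj u hu v hv h)
    have hszn : ∀ w < n, (D (c.loc w)).ncard ≤ n := by
      intro w hw
      have := Set.ncard_le_ncard (s := D (c.loc w)) (t := ↑(Finset.range n))
        (fun x hx => by simpa using h.sub _ (h.loc_lt w (valid_of_lt hw)) x hx)
        (Finset.finite_toSet _)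
      rwa [Set.ncard_coe_finset, Finset.card_range] at this
    -- The vertex with the smaller subtree is replaced by its parent. Its subtree does not contain
    -- the other vertex, so the edge to the parent separates the pair and may be used; the subtree
    -- sizes grow.
    have key : ∀ u v, u < n → v < n → c.loc u ≠ c.loc v →
        (D (c.loc u)).ncard ≤ (D (c.loc v)).ncard →
        2 * n - (D (c.loc u)).ncard - (D (c.loc v)).ncard < N + 1 →
        (∀ j, 1 ≤ j → j < c.cnt → ¬(u ∈ D j ↔ v ∈ D j) → ∀ r < n, ∀ b < n, c.loc r = j →
          c.loc b = c.loc (n + j) → (r ∈ X ↔ b ∈ X)) → (u ∈ X ↔ v ∈ X) := by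
      intro u v hu hv hne hsz hN hX
      have hnm := h.not_mem_of_ncard_le hu hne hsz
      have hk := h.loc_lt u (valid_of_lt hu)
      have hk1 : 1 ≤ c.loc u := by
        by_contra h0
        rw [show c.loc u = 0 by omega] at hnm
        exact hnm (h.root v hv)
      have hpl := h.loc_lt _ (valid_add (n := n) hk1 hk)
      obtain ⟨b, hb, hbl⟩ := h.nonempty _ hpl
      have h1 := hX _ hk1 hk (by simp [hnm, h.mem_self hu]) u hu b hb rfl hbl
      have h2 := h.ncard_below_lt hk1 hk
      rw [← hbl] at h2
      have h3 := hszn b hb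
      have h4 := hszn v hv
      rw [h1]
      refine same_side h hinj X N b v (by omega) hb hv fun j hj1 hj2 hj3 r hr b' hb' hl hl' => ?_
      refine hX j hj1 hj2 ?_ r hr b' hb' hl hl'
      by_cases hjk : j = c.loc u
      · exfalso
        subst hjk
        exact hj3 (iff_of_false (h.parent_not_mem hk1 hk hb hbl) hnm)
      · rwa [h.mem_iff_parent hk1 hk hu rfl hb hbl hj2 hjk]
    rcases le_total (D (c.loc u)).ncard (D (c.loc v)).ncard with hsz | hsz
    · exact key u v hu hv hne hsz hN hX
    · exact (key v u hv hu hne.symm hsz (by omega)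
        fun j h1 h2 h3 => hX j h1 h2 fun h => h3 h.symm).symm

/-- In a tree of singletons the pivot pair of `j` consists of the ends of the edge above `j`. With
`hle` and `hmin`, a minimum `u`-`v` cut `A` of `T` satisfies `G(A) ≤ T(A) = mincut_T ≤ mincut_G ≤
G(A)`, so equality holds throughout. -/
theorem gomoryHu_of_injective (h : CfgInv G c D) (hn : 0 < n)
    (hinj : ∀ u < n, ∀ v < n, c.loc u = c.loc v → u = v) (T : MGraph n (n - 1))
    (hT : ∀ e : Fin (n - 1), c.loc (T.tail e) = e + 1 ∧ c.loc (T.head e) = c.loc (n + (e + 1)) ∧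
      T.weight e = c.dg (n + (e + 1))) : G.IsGomoryHuTree T := by
  classical
  have hcnt : c.cnt = n := by
    refine le_antisymm h.cnt_le ?_
    have := Finset.card_le_card_of_injOn (s := Finset.range n) (t := Finset.range c.cnt) c.loc
      (fun u hu => by simpa using h.loc_lt u (valid_of_lt (by simpa using hu)))
      (fun u hu v hv => hinj u (by simpa using hu) v (by simpa using hv))
    simpa using this
  -- A separated pair is separated by a tree edge on their path that is also crossed by the cut.
  have hsep : ∀ (X : Set ℕ) (u v : Fin n), ¬((u : ℕ) ∈ X ↔ (v : ℕ) ∈ X) → ∃ e : Fin (n - 1),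
      ¬((u : ℕ) ∈ D (e + 1) ↔ (v : ℕ) ∈ D (e + 1)) ∧ ¬((T.tail e : ℕ) ∈ X ↔ (T.head e : ℕ) ∈ X) := by
    intro X u v huv
    by_contra hcon
    refine huv (h.same_side hinj X _ u v (Nat.lt_succ_self _) u.2 v.2 ?_)
    intro j hj1 hj2 hj3 r hr b hb hl hl'
    have := not_exists.1 hcon ⟨j - 1, by omega⟩
    obtain ⟨h1, h2, -⟩ := hT ⟨j - 1, by omega⟩
    simp only [show j - 1 + 1 = j by omega] at this h1 h2
    rw [hinj r hr _ (T.tail ⟨j - 1, by omega⟩).2 (by rw [hl, h1]),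
      hinj b hb _ (T.head ⟨j - 1, by omega⟩).2 (by rw [hl', h2])]
    by_contra h5
    exact this ⟨hj3, h5⟩
  have hpos : ∀ e : Fin (n - 1), (e : ℕ) + 1 < c.cnt := fun e => by have := e.2; omega
  have hwt : ∀ e : Fin (n - 1), T.weight e = G.net.cut (D (e + 1)) := by
    intro e
    rw [(hT e).2.2, h.dg_eq _ (valid_add (by omega) (hpos e)), blk_add]
  have hedge : ∀ e : Fin (n - 1), (T.tail e : ℕ) ∈ D (e + 1) ∧ (T.head e : ℕ) ∉ D (e + 1) := by
    intro e
    obtain ⟨h1, h2, -⟩ := hT e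
    refine ⟨?_, h.parent_not_mem (by omega) (hpos e) (T.head e).2 h2⟩
    have := h.mem_self (T.tail e).2
    rwa [h1] at this
  have hcut : ∀ e : Fin (n - 1), T.net.cut (D (e + 1)) = G.net.cut (D (e + 1)) := by
    intro e
    unfold Net.cut Net.fcut
    rw [Finset.sum_eq_single e]
    · have := hwt e
      unfold Net.cut Net.fcut at this
      simp only [MGraph.net, edgeCost, hedge e, if_true, if_false, this] at *
      simp
    · intro e' _ hne
      obtain ⟨h1, h2, -⟩ := hT e'
      have := h.mem_iff_parent (by omega) (hpos e') (T.tail e').2 h1 (T.head e').2 h2 (hpos e)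
        (fun h => hne (Fin.ext (by omega)))
      simp [MGraph.net, edgeCost, this]
    · simp [MGraph.net]
  have hmin : ∀ u v : Fin n, ∀ X : Set ℕ, (u : ℕ) ∈ X → (v : ℕ) ∉ X →
      T.mincut u v ≤ G.net.cut X := by
    intro u v X hu hv
    obtain ⟨e, he1, he2⟩ := hsep X u v (by simp [hu, hv])
    have h1 : T.mincut u v ≤ T.net.cut (D (e + 1)) := by
      by_cases hue : (u : ℕ) ∈ D (e + 1)
      · exact T.mincut_le_cut hue (fun h => he1 (iff_of_true hue h))
      · rw [← Net.cut_compl]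
        refine T.mincut_le_cut hue ?_
        simp only [Set.mem_compl_iff, not_not]
        by_contra h
        exact he1 (iff_of_false hue h)
    refine h1.trans ?_
    rw [hcut]
    obtain ⟨a, b, ha, hb, hla, hlb, hLB⟩ := h.pivot (e + 1) (by omega) (hpos e)
    obtain rfl := hinj a ha _ (T.tail e).2 (by rw [hla, (hT e).1])
    obtain rfl := hinj b hb _ (T.head e).2 (by rw [hlb, (hT e).2.1])
    by_cases hue : (T.tail e : ℕ) ∈ X
    · exact hLB X hue (fun h => he2 (iff_of_true hue h))
    · refine hLB.symm X ?_ hue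
      by_contra h
      exact he2 (iff_of_false hue h)
  -- The weight of a tree edge is the weight in `G` of the set below it, so `T(A)` is a double sum
  -- over edges of `G` and of `T`. An edge of `G` that crosses `A` appears in it because of `hsep`.
  have hle : ∀ A : Set ℕ, G.net.cut A ≤ T.net.cut A := by
    intro A
    have h1 : T.net.cut A = ∑ g : Fin m, ∑ e : Fin (n - 1), G.weight g *
        (edgeCost (fun _ => 0) A (T.tail e : ℕ) (T.head e : ℕ) *
          edgeCost (fun _ => 0) (D (e + 1)) (G.tail g : ℕ) (G.head g : ℕ)) := by
      rw [Finset.sum_comm]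
      unfold Net.cut Net.fcut
      refine Finset.sum_congr rfl fun e _ => ?_
      change T.weight e * _ = _
      rw [hwt e]
      unfold Net.cut Net.fcut
      rw [Finset.sum_mul]
      refine Finset.sum_congr rfl fun g _ => ?_
      simp only [MGraph.net]
      ring
    rw [h1]
    unfold Net.cut Net.fcut
    refine Finset.sum_le_sum fun g _ => ?_
    simp only [MGraph.net]
    by_cases hg : ((G.tail g : ℕ) ∈ A ↔ (G.head g : ℕ) ∈ A)
    · simp [edgeCost, hg]
    · obtain ⟨e, he1, he2⟩ := hsep A _ _ hg
      refine le_trans ?_ (Finset.single_le_sum (fun _ _ => Nat.zero_le _) (Finset.mem_univ e))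
      simp [edgeCost, hg, he1, he2]
  refine ⟨⟨?_, by omega⟩, ?_⟩
  · have : Nonempty (Fin n) := ⟨⟨0, hn⟩⟩
    have hconn : T.toSimple.Connected := by
      refine ⟨fun u v => ?_⟩
      by_contra hr
      -- A connected component is crossed by no tree edge, but `hsep` finds one if it separates two
      -- vertices.
      set X : Set ℕ := {x | ∃ y : Fin n, (y : ℕ) = x ∧ T.toSimple.Reachable u y} with hX
      have hmemX : ∀ y : Fin n, (y : ℕ) ∈ X ↔ T.toSimple.Reachable u y := by
        intro y
        constructor
        · rintro ⟨z, hz, hz'⟩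
          rwa [← Fin.ext hz]
        · exact fun h => ⟨y, rfl, h⟩
      obtain ⟨e, -, he⟩ := hsep X u v (by
        rw [hmemX, hmemX]
        exact fun h => hr (h.1 (SimpleGraph.Reachable.refl _)))
      rw [hmemX, hmemX] at he
      have hadj : T.toSimple.Adj (T.tail e) (T.head e) := by
        rw [MGraph.toSimple, SimpleGraph.fromRel_adj]
        exact ⟨T.loopless e, Or.inl ⟨e, rfl, rfl⟩⟩
      exact he ⟨fun h => h.trans hadj.reachable, fun h => h.trans hadj.symm.reachable⟩
    rw [SimpleGraph.isTree_iff_connected_and_card]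
    refine ⟨hconn, le_antisymm ?_ ?_⟩
    · have hsurj : ∀ x ∈ T.toSimple.edgeSet, ∃ e : Fin (n - 1), s(T.tail e, T.head e) = x := by
        intro x
        induction x with
        | _ a b =>
          intro hx
          rw [SimpleGraph.mem_edgeSet, MGraph.toSimple, SimpleGraph.fromRel_adj] at hx
          rcases hx.2 with ⟨e, rfl, rfl⟩ | ⟨e, rfl, rfl⟩
          · exact ⟨e, rfl⟩
          · exact ⟨e, Sym2.eq_swap⟩
      have hadj : ∀ e, s(T.tail e, T.head e) ∈ T.toSimple.edgeSet := by
        intro e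
        rw [SimpleGraph.mem_edgeSet, MGraph.toSimple, SimpleGraph.fromRel_adj]
        exact ⟨T.loopless e, Or.inl ⟨e, rfl, rfl⟩⟩
      have := Nat.card_le_card_of_surjective
        (fun e : Fin (n - 1) => (⟨s(T.tail e, T.head e), hadj e⟩ : T.toSimple.edgeSet))
        (fun ⟨x, hx⟩ => by
          obtain ⟨e, he⟩ := hsurj x hx
          exact ⟨e, Subtype.ext he⟩)
      rw [Nat.card_fin] at this
      have h' : Nat.card T.toSimple.edgeSet ≤ n - 1 := this
      rw [Nat.card_fin]
      omega
    · exact hconn.card_vert_le_card_edgeSet_add_one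
  · intro u v huv A hA
    obtain ⟨h1, h2, h3⟩ := hA
    obtain ⟨B, hB1, hB2, hB3⟩ := G.exists_mincut huv
    have hmem : ∀ (S : Finset (Fin n)) (x : Fin n), (x : ℕ) ∈ {u : ℕ | ∃ v ∈ S, (v : ℕ) = u} ↔ x ∈ S := by
      intro S x
      constructor
      · rintro ⟨y, hy, hy'⟩
        rwa [← Fin.ext hy']
      · exact fun h => ⟨x, h, rfl⟩
    have h4 := hle {u : ℕ | ∃ v ∈ A, (v : ℕ) = u}
    have h5 := hmin u v {u : ℕ | ∃ v ∈ B, (v : ℕ) = u} ((hmem _ _).2 hB1) (mt (hmem _ _).1 hB2)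
    rw [← MGraph.cutWeight_eq_net, ← MGraph.cutWeight_eq_net] at h4
    rw [← MGraph.cutWeight_eq_net] at h5
    have h6 : G.mincut u v ≤ G.cutWeight A := Nat.sInf_le ⟨A, h1, h2, rfl⟩
    exact ⟨⟨h1, h2, by omega⟩, by omega⟩

end CfgInv

/-! ### Least minimum cuts and progress -/

/-- `M` is the least minimum cut separating `v` from `s` in the contracted graphs `H`. -/
structure LeastCut {ι : Type*} (n : ℕ) (c : Cfg) (H : Net ι ℕ) (s v : ℕ) (M : Set ℕ) : Prop where
  mem : v ∈ M
  not_mem : s ∉ M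
  sub : M ⊆ Comp n c (c.loc v)
  min : ∀ Z : Set ℕ, v ∈ Z → s ∉ Z → H.cut M ≤ H.cut Z
  least : ∀ Z : Set ℕ, v ∈ Z → s ∉ Z → H.cut Z ≤ H.cut M → M ⊆ Z

open Classical in
/-- Number of vertices (not counting contracted ones) in `M`. -/
noncomputable def vsize (n : ℕ) (M : Set ℕ) : ℕ := ((Finset.range n).filter (· ∈ M)).card

def members (n : ℕ) (c : Cfg) (i : ℕ) : Finset ℕ := (Finset.range n).filter fun u => c.loc u = i

/-- The least minimum cut between `v` and `s` avoids the contraction of the outside and contains at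
most half of the vertices of the instance. -/
structure GoodCut {ι : Type*} (n : ℕ) (c : Cfg) (H : Net ι ℕ) (s v : ℕ) (M : Set ℕ) : Prop where
  least : LeastCut n c H s v M
  outside : 2 * n + c.loc v ∉ M
  small : 2 * vsize n M ≤ (members n c (c.loc v)).card

section

variable {n m : ℕ} {ι : Type*} {G : MGraph n m} {c c' : Cfg} {D : ℕ → Set ℕ} {H : Net ι ℕ}

theorem mem_members {i u : ℕ} : u ∈ members n c i ↔ u < n ∧ c.loc u = i := by simp [members]

/-- Cuts are symmetric, so the complement of `M'` is a minimum cut for the problem that `M` solves,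
and the least solution is contained in it. -/
theorem LeastCut.disjoint {s v : ℕ} {M M' : Set ℕ} (h : LeastCut n c H s v M)
    (h' : LeastCut n c H v s M') : ∀ x ∈ M, x ∉ M' := by
  have h1 := h'.min Mᶜ h.not_mem (by simpa using h.mem)
  rw [Net.cut_compl] at h1
  exact h.least M'ᶜ h'.not_mem (by simpa using h'.mem) (by rwa [Net.cut_compl])

theorem comp_finite (h : CfgInv G c D) (i : ℕ) : (Comp n c i).Finite := by
  refine (Set.finite_lt_nat (2 * n + i + 1)).subset ?_
  rintro x (⟨h1, -⟩ | h1)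
  · have := h.valid_lt h1
    simp only [Set.mem_ofPred_eq]
    omega
  · simp only [Set.mem_ofPred_eq]
    omega

/-- A minimum cut inside the component with the fewest elements is least: by submodularity its
intersection with any other minimum cut is a minimum cut as well. Restricting to the component only
removes weight. -/
theorem exists_leastCut (h : CfgInv G c D) (hH : IsContraction G c H) {s v : ℕ} (hv : v < n)
    (hsv : s ≠ v) : ∃ M, LeastCut n c H s v M := by
  set F : Set (Set ℕ) := {Z | v ∈ Z ∧ s ∉ Z ∧ Z ⊆ Comp n c (c.loc v)} with hF
  have hvC : v ∈ Comp n c (c.loc v) := Or.inl ⟨valid_of_lt hv, rfl⟩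
  have hne : F.Nonempty := ⟨{v}, rfl, hsv, by simpa using hvC⟩
  obtain ⟨M₀, hM₀, hmin₀⟩ := (measure fun Z => H.cut Z).wf.has_min F hne
  set F' : Set (Set ℕ) := {Z | Z ∈ F ∧ H.cut Z ≤ H.cut M₀} with hF'
  obtain ⟨M, hM, hmin⟩ := (measure fun Z : Set ℕ => Z.ncard).wf.has_min F' ⟨M₀, hM₀, le_rfl⟩
  have hmin₀' : ∀ Z ∈ F, H.cut M₀ ≤ H.cut Z := fun Z hZ => Nat.le_of_not_lt (hmin₀ Z hZ)
  have hall : ∀ Z : Set ℕ, v ∈ Z → s ∉ Z → H.cut M ≤ H.cut Z := by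
    intro Z h1 h2
    refine le_trans hM.2 (le_trans (hmin₀' (Z ∩ Comp n c (c.loc v)) ⟨⟨h1, hvC⟩, fun h => h2 h.1,
      Set.inter_subset_right⟩) (h.cut_inter_comp_le hH _ Z))
  refine ⟨M, hM.1.1, hM.1.2.1, hM.1.2.2, hall, fun Z h1 h2 h3 => ?_⟩
  have h4 := H.cut_submod M Z
  have h5 := hall (M ∪ Z) (Or.inr h1) (by simp [hM.1.2.1, h2])
  have h6 : M ∩ Z ∈ F' := ⟨⟨⟨hM.1.1, h1⟩, fun h => h2 h.2, Set.inter_subset_left.trans hM.1.2.2⟩, by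
    have := hM.2; omega⟩
  have h7 : M.ncard ≤ (M ∩ Z).ncard := Nat.le_of_not_lt (hmin _ h6)
  have h8 := Set.eq_of_subset_of_ncard_le Set.inter_subset_left h7
    ((comp_finite h (c.loc v)).subset hM.1.2.2)
  exact Set.inter_eq_left.1 h8

theorem vsize_lt {M M' : Set ℕ} (h : M ⊆ M') {u : ℕ} (hu : u < n) (h1 : u ∈ M') (h2 : u ∉ M) :
    vsize n M < vsize n M' := by
  classical
  refine Finset.card_lt_card ⟨fun x hx => ?_, fun hs => ?_⟩
  · simp only [Finset.mem_filter] at hx ⊢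
    exact ⟨hx.1, h hx.2⟩
  · have := hs (Finset.mem_filter.2 ⟨Finset.mem_range.2 hu, h1⟩)
    exact h2 (Finset.mem_filter.1 this).2

open Classical in
/-- The pairs of vertices of the instance `i` with a good cut. -/
noncomputable def goodPairs {ι : Type*} (n : ℕ) (c : Cfg) (H : Net ι ℕ) (i : ℕ) : Finset (ℕ × ℕ) :=
  (members n c i).offDiag.filter fun p => ∃ M, GoodCut n c H p.1 p.2 M

/-- The factor two arises because only one of the two orders of a pair needs to be good. -/
theorem card_le_goodPairs {i : ℕ} {T : Finset ℕ} (hT : T ⊆ members n c i)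
    (h : ∀ u ∈ T, ∀ v ∈ T, u ≠ v → (∃ M, GoodCut n c H u v M) ∨ ∃ M, GoodCut n c H v u M) :
    T.card * T.card - T.card ≤ 2 * (goodPairs n c H i).card := by
  classical
  rw [← Finset.offDiag_card]
  have : T.offDiag ⊆ goodPairs n c H i ∪ (goodPairs n c H i).image Prod.swap := by
    rintro ⟨u, v⟩ huv
    rw [Finset.mem_offDiag] at huv
    obtain ⟨hu, hv, hne⟩ := huv
    simp only [Finset.mem_union, Finset.mem_image, goodPairs, Finset.mem_filter, Finset.mem_offDiag]
    rcases h u hu v hv hne with h | h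
    · exact Or.inl ⟨⟨hT hu, hT hv, hne⟩, h⟩
    · exact Or.inr ⟨(v, u), ⟨⟨hT hv, hT hu, Ne.symm hne⟩, h⟩, rfl⟩
  refine (Finset.card_le_card this).trans ((Finset.card_union_le _ _).trans ?_)
  have := Finset.card_image_le (s := goodPairs n c H i) (f := Prod.swap)
  omega

/-- A constant fraction of the pairs of an instance has a good cut. -/
theorem card_pairs_le_goodPairs (h : CfgInv G c D) (hH : IsContraction G c H) (i : ℕ) :
    (members n c i).card * (members n c i).card - (members n c i).card ≤
      8 * (goodPairs n c H i).card := by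
  classical
  set k := (members n c i).card with hk
  have hloc : ∀ u ∈ members n c i, u < n ∧ c.loc u = i := fun u hu => mem_members.1 hu
  -- If some least cut avoids the outside but has more than half of the vertices, let `S` be one
  -- with the fewest vertices. Two vertices of `S` have a least cut properly inside `S` for one of
  -- their orders, and by the choice of `S` it is small.
  by_cases hbig : ∃ z s v M, z = vsize n M ∧ s ∈ members n c i ∧ v ∈ members n c i ∧ s ≠ v ∧
      LeastCut n c H s v M ∧ 2 * n + i ∉ M ∧ k < 2 * vsize n M
  · obtain ⟨s₀, v₀, S, hz, hs₀, hv₀, hne, hS, hp, hlarge⟩ := Nat.find_spec hbig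
    have hmin : ∀ s v M, s ∈ members n c i → v ∈ members n c i → s ≠ v → LeastCut n c H s v M →
        2 * n + i ∉ M → vsize n M < vsize n S → 2 * vsize n M ≤ k := by
      intro s v M h1 h2 h3 h4 h5 h6
      by_contra h7
      exact Nat.find_min hbig (by rw [hz]; exact h6) ⟨s, v, M, rfl, h1, h2, h3, h4, h5, by omega⟩
    have hScut : H.CutLB s₀ v₀ (H.cut Sᶜ) := by
      rw [Net.cut_compl]
      exact Net.CutLB.symm hS.min
    set T := (Finset.range n).filter (· ∈ S) with hT
    have hTm : T ⊆ members n c i := by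
      intro u hu
      simp only [hT, Finset.mem_filter, Finset.mem_range] at hu
      refine mem_members.2 ⟨hu.1, ?_⟩
      rcases hS.sub hu.2 with h1 | h1
      · rw [h1.2, (hloc _ hv₀).2]
      · omega
    have hgood := card_le_goodPairs (H := H) hTm (by
      intro u hu v hv huv
      have hum := hTm hu
      have hvm := hTm hv
      simp only [hT, Finset.mem_filter, Finset.mem_range] at hu hv
      obtain ⟨X, hX⟩ := exists_leastCut h hH (s := u) hv.1 huv
      obtain ⟨Y, hY⟩ := exists_leastCut h hH (s := v) hu.1 huv.symm
      -- `Sᶜ` is a minimum cut containing `s₀`. If `s₀ ∈ X`, then `X ∪ Sᶜ` is no heavier than `X`,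
      -- and leastness puts `Y` into its complement `S \ X`. Otherwise `X \ Sᶜ` is no heavier and
      -- leastness of `X` gives `X ⊆ S`.
      have hunc := Net.uncross (N := H) (Z := Sᶜ) hS.not_mem (by simpa using hS.mem) hScut X
      split_ifs at hunc with hsX
      · right
        refine ⟨Y, hY, ?_, ?_⟩
        all_goals
          have hYS : Y ⊆ S \ X := by
            refine hY.least _ ⟨hu.2, hX.not_mem⟩ (fun h => h.2 hX.mem) ?_
            rw [← Net.cut_compl, show (S \ X)ᶜ = X ∪ Sᶜ by
              ext z; simp only [Set.mem_compl_iff, Set.mem_sdiff, Set.mem_union]; tauto]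
            refine hunc.trans ?_
            rw [← Net.cut_compl (Z := Y)]
            exact hX.min _ hY.not_mem (by simpa using hY.mem)
        · rw [(hloc _ hum).2]
          exact fun h => hp (hYS h).1
        · rw [(hloc _ hum).2]
          refine hmin v u Y hvm hum huv.symm hY (fun h => hp (hYS h).1) ?_
          exact vsize_lt (fun x hx => (hYS hx).1) hv.1 hv.2 hY.not_mem
      · left
        refine ⟨X, hX, ?_, ?_⟩
        all_goals
          have hXS : X ⊆ S := by
            have := hX.least (X \ Sᶜ) ⟨hX.mem, by simpa using hv.2⟩ (fun h => hX.not_mem h.1) hunc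
            exact fun x hx => by simpa using (this hx).2
        · rw [(hloc _ hvm).2]
          exact fun h => hp (hXS h)
        · rw [(hloc _ hvm).2]
          refine hmin u v X hum hvm huv hX (fun h => hp (hXS h)) ?_
          exact vsize_lt hXS hu.1 hu.2 hX.not_mem)
    have hTc : T.card = vsize n S := rfl
    rw [hTc] at hgood
    obtain ⟨q, hq⟩ : ∃ q, vsize n S = q := ⟨_, rfl⟩
    rw [hq] at hgood hlarge
    obtain ⟨q', rfl⟩ : ∃ q', q = q' + 1 := ⟨q - 1, by omega⟩
    have h1 : (q' + 1) * (q' + 1) - (q' + 1) = (q' + 1) * q' := by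
      rw [← Nat.mul_sub_one]; simp
    have h2 : k * k - k = k * (k - 1) := by rw [Nat.mul_sub_one]
    rw [h1] at hgood
    rw [h2]
    -- With `|S| = q' + 1 > k / 2` we have `k ≤ 2q' + 1`, and `(2q' + 1) 2q' ≤ 4 (q' + 1) q'`, which
    -- is at most eight times the number of good pairs.
    have h3 : k * (k - 1) ≤ (2 * q' + 1) * (2 * q') := Nat.mul_le_mul (by omega) (by omega)
    nlinarith
  · have := card_le_goodPairs (H := H) (subset_refl (members n c i)) (by
      intro u hu v hv huv
      obtain ⟨X, hX⟩ := exists_leastCut h hH (s := u) (hloc v hv).1 huv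
      obtain ⟨Y, hY⟩ := exists_leastCut h hH (s := v) (hloc u hu).1 huv.symm
      -- The two least cuts of a pair are disjoint, so one of them avoids the outside, and in this
      -- case all such cuts are small.
      by_cases hp : 2 * n + i ∈ X
      · have hp' : 2 * n + i ∉ Y := hX.disjoint hY _ hp
        right
        refine ⟨Y, hY, by rwa [(hloc _ hu).2], ?_⟩
        rw [(hloc _ hu).2]
        by_contra hlt
        exact hbig ⟨_, v, u, Y, rfl, hv, hu, huv.symm, hY, hp', by omega⟩
      · left
        refine ⟨X, hX, by rwa [(hloc _ hv).2], ?_⟩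
        rw [(hloc _ hv).2]
        by_contra hlt
        exact hbig ⟨_, u, v, X, rfl, hu, hv, huv, hX, hp, by omega⟩)
    simp only [← hk] at this
    omega

/-- The ordered pairs of distinct vertices that are still in the same instance. -/
def unsplit (n : ℕ) (c : Cfg) : Finset (ℕ × ℕ) :=
  (Finset.range n).offDiag.filter fun p => c.loc p.1 = c.loc p.2

open Classical in
-- A realized pair `(s, v)` separates every vertex of `M` from every other vertex of the instance.
-- No separated pair `(a, b)` is counted twice: the part of `a` determines `v` as its head, and the
-- old instance of `a` determines `s` as its source.
theorem unsplit_step {src mv hd : ℕ → ℕ} (s : Split (n := n) c H src mv hd c'.cnt)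
    (h : CfgInv G c D) (t : Step (n := n) (m := m) c c' H mv hd) (F : Finset (ℕ × ℕ))
    (M : ℕ × ℕ → Set ℕ) (hF : ∀ p ∈ F, p.1 < n ∧ p.2 < n ∧ GoodCut n c H p.1 p.2 (M p) ∧
      src (c.loc p.2) = p.1 ∧ mv p.2 ≠ 0 ∧ {x | mv x = mv p.2} = M p ∧ hd (mv p.2) = p.2) :
    (unsplit n c').card + ∑ p ∈ F, vsize n (M p) *
      ((members n c (c.loc p.2)).card - vsize n (M p)) ≤ (unsplit n c).card := by
  have hcp := h.cnt_pos
  set sep := (unsplit n c).filter fun p => c'.loc p.1 ≠ c'.loc p.2 with hsep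
  have hsub : ∀ p ∈ unsplit n c', p ∈ unsplit n c := by
    rintro ⟨a, b⟩ hp
    simp only [unsplit, Finset.mem_filter, Finset.mem_offDiag, Finset.mem_range] at hp ⊢
    obtain ⟨⟨ha, hb, hne⟩, hl⟩ := hp
    refine ⟨⟨ha, hb, hne⟩, ?_⟩
    exact (s.same_loc h (valid_of_lt ha) (valid_of_lt hb)
      (Or.inl ⟨rfl, t.loc_old a (valid_of_lt ha)⟩) (Or.inl ⟨rfl, t.loc_old b (valid_of_lt hb)⟩) hl).1
  have h1 : (unsplit n c').card + sep.card ≤ (unsplit n c).card := by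
    rw [← Finset.card_union_of_disjoint]
    · refine Finset.card_le_card fun p hp => ?_
      rcases Finset.mem_union.1 hp with hp | hp
      · exact hsub p hp
      · exact (Finset.mem_filter.1 hp).1
    · rw [Finset.disjoint_left]
      intro p hp hp'
      exact (Finset.mem_filter.1 hp').2 (Finset.mem_filter.1 hp).2
  refine le_trans (Nat.add_le_add_left ?_ _) h1
  set A : ℕ × ℕ → Finset ℕ := fun p => (Finset.range n).filter (· ∈ M p) with hA
  have hAm : ∀ p ∈ F, A p ⊆ members n c (c.loc p.2) := by
    intro p hp a ha
    obtain ⟨h1, h2, h3, -⟩ := hF p hp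
    simp only [hA, Finset.mem_filter, Finset.mem_range] at ha
    refine mem_members.2 ⟨ha.1, ?_⟩
    rcases h3.least.sub ha.2 with h5 | h5
    · exact h5.2
    · omega
  have hcard : ∀ p ∈ F, vsize n (M p) * ((members n c (c.loc p.2)).card - vsize n (M p)) =
      (A p ×ˢ (members n c (c.loc p.2) \ A p)).card := by
    intro p hp
    rw [Finset.card_product, Finset.card_sdiff_of_subset (hAm p hp)]
    rfl
  rw [Finset.sum_congr rfl hcard, ← Finset.card_sigma]
  have hmem : ∀ p ∈ F, ∀ a b, (a, b) ∈ A p ×ˢ (members n c (c.loc p.2) \ A p) →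
      a < n ∧ b < n ∧ c.loc a = c.loc p.2 ∧ c.loc b = c.loc p.2 ∧ mv a = mv p.2 ∧ mv b ≠ mv p.2 := by
    intro p hp a b hab
    rw [Finset.mem_product, Finset.mem_sdiff] at hab
    obtain ⟨ha, hb, hb'⟩ := hab
    have h2 := mem_members.1 (hAm p hp ha)
    have h3 := mem_members.1 hb
    obtain ⟨-, -, -, -, -, hM, -⟩ := hF p hp
    simp only [hA, Finset.mem_filter, Finset.mem_range, ← hM, Set.mem_ofPred_eq] at ha hb'
    exact ⟨h2.1, h3.1, h2.2, h3.2, ha.2, fun h => hb' ⟨h3.1, h⟩⟩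
  refine Finset.card_le_card_of_injOn (fun x => x.2) ?_ ?_
  · rintro ⟨p, a, b⟩ hx
    simp only [Finset.mem_coe, Finset.mem_sigma] at hx
    obtain ⟨hp, hab⟩ := hx
    obtain ⟨h2, h3, h4, h5, h6, h7⟩ := hmem p hp a b hab
    obtain ⟨-, -, -, -, h8, -⟩ := hF p hp
    have h9 := (s.mv_range p.2).resolve_left h8
    have h10 := h.loc_lt b (valid_of_lt h3)
    simp only [hsep, unsplit, Finset.coe_filter, Set.mem_ofPred_eq, Finset.mem_filter,
      Finset.mem_offDiag, Finset.mem_range]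
    refine ⟨⟨⟨h2, h3, ?_⟩, by rw [h4, h5]⟩, ?_⟩
    · rintro rfl
      exact h7 h6
    · rw [t.loc_old a (valid_of_lt h2), t.loc_old b (valid_of_lt h3), h6, if_neg h8]
      split_ifs
      · omega
      · exact fun h => h7 h.symm
  · rintro ⟨p, a, b⟩ hx ⟨p', a', b'⟩ hx' heq
    simp only at heq
    obtain ⟨rfl, rfl⟩ := Prod.mk.inj heq
    simp only [Finset.mem_coe, Finset.mem_sigma] at hx hx'
    obtain ⟨h2, h3, h4, h5, h6, h7⟩ := hmem p hx.1 a b hx.2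
    obtain ⟨h2', h3', h4', h5', h6', h7'⟩ := hmem p' hx'.1 a b hx'.2
    obtain ⟨-, -, -, h8, -, -, h9⟩ := hF p hx.1
    obtain ⟨-, -, -, h8', -, -, h9'⟩ := hF p' hx'.1
    have : p = p' := Prod.ext (by rw [← h8, ← h8', ← h4, ← h4']) (by rw [← h9, ← h9', ← h6, ← h6'])
    subst this
    rfl

end

/-! ### Random samples -/

/-- The number with the binary digits `β o, …, β (o + K - 1)`. -/
def level (β : ℕ → Bool) (o : ℕ) : ℕ → ℕ
  | 0 => 0
  | K + 1 => 2 * level β o K + if β (o + K) then 1 else 0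

/-- The vertex `u` is in the sample of the bits `β` from the offset `o` on: its first `i` among `B`
bits are all set, where `i` is given by the first `K` bits. -/
def Sampled (β : ℕ → Bool) (o K B u : ℕ) : Prop :=
  ∀ t < B, t < level β o K → β (o + K + u * B + t) = true

theorem level_congr {β β' : ℕ → Bool} {o o' : ℕ} : ∀ {K : ℕ},
    (∀ i < K, β (o + i) = β' (o' + i)) → level β o K = level β' o' K
  | 0, _ => rfl
  | K + 1, h => by
    simp only [level]
    rw [level_congr (K := K) fun i hi => h i (by omega), h K (by omega)]

theorem sampled_congr {β β' : ℕ → Bool} {o o' K B n u : ℕ} (hu : u < n)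
    (h : ∀ i < K + n * B, β (o + i) = β' (o' + i)) : Sampled β o K B u ↔ Sampled β' o' K B u := by
  unfold Sampled
  rw [level_congr (β := β) (β' := β') (o' := o') fun i hi => h i (by omega)]
  refine forall_congr' fun t => forall_congr' fun ht => ?_
  have : u * B + B ≤ n * B := by
    rw [← Nat.succ_mul]
    exact Nat.mul_le_mul_right _ hu
  have h2 := h (K + u * B + t) (by omega)
  rw [show o + K + u * B + t = o + (K + u * B + t) by ring,
    show o' + K + u * B + t = o' + (K + u * B + t) by ring, h2]

/-- Extension of a finite bit vector by zeros. -/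
def extend {N : ℕ} (b : Fin N → Bool) (i : ℕ) : Bool := if h : i < N then b ⟨i, h⟩ else false

theorem exists_level {K i : ℕ} (hi : i < 2 ^ K) :
    ∃ β : ℕ → Bool, level β 0 K = i := by
  refine ⟨fun j => i.testBit (K - 1 - j), ?_⟩
  have : ∀ k ≤ K, level (fun j => i.testBit (K - 1 - j)) 0 k = i / 2 ^ (K - k) := by
    intro k
    induction k with
    | zero => intro _; rw [Nat.sub_zero, Nat.div_eq_of_lt hi]; rfl
    | succ k ih =>
      intro hk
      have h1 : K - k = (K - (k + 1)) + 1 := by omega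
      have h2 : K - 1 - k = K - (k + 1) := by omega
      simp only [level, ih (by omega), zero_add, h2]
      simp only [Nat.testBit_eq_decide_div_mod_eq, decide_eq_true_eq]
      rw [h1, pow_succ, ← Nat.div_div_eq_div_mul]
      split_ifs with h <;> omega
  simpa using this K le_rfl

/-- This is `(1 + 1/y) ^ k ≤ e`. For `y = 2 ^ i - 1` it says that up to `2 ^ i - 1` vertices all
miss a sample of density `2 ^ (-i)` with probability at least `1/4`. -/
theorem succ_pow_le {y k : ℕ} (h : k ≤ y) : (y + 1) ^ k ≤ 4 * y ^ k := by
  rcases Nat.eq_zero_or_pos y with rfl | hy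
  · obtain rfl : k = 0 := by omega
    simp
  have hy' : (0 : ℝ) < y := by exact_mod_cast hy
  have h1 : ((1 : ℝ) + 1 / y) ^ k ≤ 4 := by
    calc ((1 : ℝ) + 1 / y) ^ k ≤ (Real.exp (1 / y)) ^ k := by
          gcongr
          rw [add_comm]
          exact Real.add_one_le_exp _
      _ = Real.exp (k * (1 / y)) := (Real.exp_nat_mul _ _).symm
      _ ≤ Real.exp 1 := by
          apply Real.exp_le_exp.2
          rw [mul_one_div, div_le_one hy']
          exact_mod_cast h
      _ ≤ 4 := by
          have := Real.exp_one_lt_d9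
          linarith
  have h2 : ((y : ℝ) + 1) ^ k ≤ 4 * (y : ℝ) ^ k := by
    have h3 : (y : ℝ) + 1 = (1 + 1 / y) * y := by field_simp
    rw [h3, mul_pow]
    gcongr
  exact_mod_cast h2

open Classical in
theorem card_leading_ones (B i : ℕ) (hi : i ≤ B) :
    (Finset.univ.filter fun x : Fin B → Bool => ∀ t : Fin B, (t : ℕ) < i → x t = true).card =
      2 ^ (B - i) := by
  have h1 : (Finset.univ.filter fun x : Fin B → Bool => ∀ t : Fin B, (t : ℕ) < i → x t = true) =
      Fintype.piFinset fun t : Fin B => if (t : ℕ) < i then {true} else Finset.univ := by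
    ext x
    simp only [Finset.mem_filter, Finset.mem_univ, true_and, Fintype.mem_piFinset]
    refine forall_congr' fun t => ?_
    split_ifs with h <;> simp [h]
  rw [h1, Fintype.card_piFinset]
  have h2 : ∀ t : Fin B, (if (t : ℕ) < i then ({true} : Finset Bool) else Finset.univ).card =
      (fun t : ℕ => if t < i then 1 else 2) t := by
    intro t
    dsimp only
    split_ifs <;> simp
  rw [Finset.prod_congr rfl fun t _ => h2 t,
    Fin.prod_univ_eq_prod_range (fun t : ℕ => if t < i then 1 else 2)]
  obtain ⟨d, rfl⟩ := Nat.exists_eq_add_of_le hi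
  rw [Finset.prod_range_add, Finset.prod_eq_one fun t ht => by simp [Finset.mem_range.1 ht]]
  simp

open Classical in
/-- A sample meets a given set of `q` vertices in a given vertex of this set with probability at
least `1 / (16 B q)`. -/
theorem sample_prob {n K B : ℕ} (hn : n < 2 ^ B) (hK : 2 ^ K ≤ 2 * B) (hBK : B < 2 ^ K)
    {T : Finset ℕ} (hT : T ⊆ Finset.range n) {v : ℕ} (hv : v ∈ T) :
    2 ^ (K + n * B) ≤ 16 * B * T.card * (Finset.univ.filter fun b : Fin (K + n * B) → Bool =>
      ∀ u ∈ T, (Sampled (extend b) 0 K B u ↔ u = v)).card := by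
  set q := T.card with hq
  have hq1 : 1 ≤ q := Finset.card_pos.2 ⟨v, hv⟩
  have hqn : q ≤ n := by simpa using Finset.card_le_card hT
  -- The right density is about `1 / q`. The level `i` has probability at least `1 / (2B)`, the
  -- vertex `v` is then taken with probability at least `1 / (2q)`, and the other vertices of `T`
  -- are missed with probability at least `1/4`; together this is `1 / (16 B q)`.
  obtain ⟨i, hqi, hiq, hiB⟩ : ∃ i, q ≤ 2 ^ i ∧ 2 ^ i ≤ 2 * q ∧ i ≤ B := by
    refine ⟨Nat.clog 2 q, Nat.le_pow_clog (by norm_num) q, ?_, ?_⟩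
    · rcases Nat.lt_or_ge 1 q with h | h
      · have h1 := Nat.pow_pred_clog_lt_self (b := 2) (by norm_num) h
        have h2 := Nat.clog_pos (b := 2) (by norm_num) h
        obtain ⟨z, hz⟩ : ∃ z, Nat.clog 2 q = z + 1 := ⟨Nat.clog 2 q - 1, by omega⟩
        rw [hz] at h1 ⊢
        simp at h1
        rw [pow_succ]
        omega
      · have : Nat.clog 2 q = 0 := Nat.clog_of_right_le_one (by omega) 2
        rw [this]
        omega
    · exact Nat.clog_le_of_le_pow (by omega)
  obtain ⟨β₀, hβ₀⟩ := exists_level (i := i) (K := K) (by omega)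
  set P : ℕ → (Fin B → Bool) → Prop := fun u x =>
    u ∈ T → ((∀ t : Fin B, (t : ℕ) < i → x t = true) ↔ u = v) with hP
  -- Bit vectors with the level `i` and prescribed blocks.
  set S := Fintype.piFinset fun u : Fin n => Finset.univ.filter (P u) with hS
  have hBpos : ∀ j : ℕ, j < K + n * B → K ≤ j → 0 < B := by
    intro j h1 h2
    by_contra h
    rw [show B = 0 by omega] at h1
    omega
  have hdiv : ∀ j : ℕ, j < K + n * B → K ≤ j → (j - K) / B < n := by
    intro j h1 h2
    rw [Nat.div_lt_iff_lt_mul (hBpos j h1 h2)]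
    omega
  set f : (Fin n → Fin B → Bool) → Fin (K + n * B) → Bool := fun g j =>
    if h : K ≤ (j : ℕ) then g ⟨((j : ℕ) - K) / B, hdiv j j.2 h⟩
      ⟨((j : ℕ) - K) % B, Nat.mod_lt _ (hBpos j j.2 h)⟩ else β₀ j with hf
  have hbound : ∀ u : Fin n, ∀ t : Fin B, K + (u : ℕ) * B + t < K + n * B := by
    intro u t
    have : (u : ℕ) * B + B ≤ n * B := by
      rw [← Nat.succ_mul]
      exact Nat.mul_le_mul_right _ u.2
    omega
  have hfg : ∀ g (u : Fin n) (t : Fin B), extend (f g) (K + (u : ℕ) * B + t) = g u t := by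
    intro g u t
    have hB : 0 < B := by have := t.2; omega
    have h1 : (K + (u : ℕ) * B + t - K) / B = u := by
      rw [show K + (u : ℕ) * B + t - K = t + B * u by rw [mul_comm]; omega,
        Nat.add_mul_div_left _ _ hB, Nat.div_eq_of_lt t.2, zero_add]
    have h2 : (K + (u : ℕ) * B + t - K) % B = t := by
      rw [show K + (u : ℕ) * B + t - K = t + B * u by rw [mul_comm]; omega,
        Nat.add_mul_mod_self_left, Nat.mod_eq_of_lt t.2]
    have h3 : K ≤ K + (u : ℕ) * B + t := by omega
    simp only [extend, hbound u t, dif_pos, hf, h3]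
    exact congrArg₂ g (Fin.ext h1) (Fin.ext h2)
  have hlev : ∀ g, level (extend (f g)) 0 K = i := by
    intro g
    rw [← hβ₀]
    refine level_congr fun j hj => ?_
    have h1 : 0 + j < K + n * B := by omega
    have h2 : ¬K ≤ 0 + j := by omega
    simp only [extend, h1, dif_pos, hf, h2, dif_neg, not_false_eq_true]
  have hcount : S.card ≤ (Finset.univ.filter fun b : Fin (K + n * B) → Bool =>
      ∀ u ∈ T, (Sampled (extend b) 0 K B u ↔ u = v)).card := by
    refine Finset.card_le_card_of_injOn f (fun g hg => ?_) (fun g _ g' _ h => ?_)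
    · simp only [Finset.coe_filter, Finset.mem_univ, true_and, Set.mem_ofPred_eq]
      intro u hu
      have hun : u < n := Finset.mem_range.1 (hT hu)
      have h1 := Fintype.mem_piFinset.1 hg ⟨u, hun⟩
      simp only [Finset.mem_filter, Finset.mem_univ, true_and, hP] at h1
      rw [← h1 hu]
      unfold Sampled
      rw [hlev]
      constructor
      · intro h t ht
        rw [← hfg g ⟨u, hun⟩ t]
        simpa using h t t.2 ht
      · intro h t ht hti
        have := hfg g ⟨u, hun⟩ ⟨t, ht⟩
        simp only [zero_add] at this ⊢
        rw [this]
        exact h ⟨t, ht⟩ hti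
    · funext u t
      rw [← hfg g u t, ← hfg g' u t, h]
  have hcard : S.card = ∏ u ∈ Finset.range n, if u ∈ T then
      (if u = v then 2 ^ (B - i) else 2 ^ B - 2 ^ (B - i)) else 2 ^ B := by
    rw [hS, Fintype.card_piFinset, ← Fin.prod_univ_eq_prod_range (fun u => if u ∈ T then
      (if u = v then 2 ^ (B - i) else 2 ^ B - 2 ^ (B - i)) else 2 ^ B)]
    refine Finset.prod_congr rfl fun u _ => ?_
    by_cases hu : (u : ℕ) ∈ T
    · by_cases huv : (u : ℕ) = v
      · simp only [hP, huv, iff_true, if_true]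
        rw [if_pos hv]
        simp only [hv, forall_true_left]
        exact card_leading_ones B i hiB
      · simp only [hP, hu, huv, iff_false, forall_true_left, if_true, if_false]
        rw [← card_leading_ones B i hiB, Finset.filter_not, Finset.card_sdiff_of_subset
          (Finset.filter_subset _ _)]
        simp
    · simp [hP, hu]
  have hprod : S.card = 2 ^ (B - i) * (2 ^ B - 2 ^ (B - i)) ^ (q - 1) * (2 ^ B) ^ (n - q) := by
    rw [hcard, Finset.prod_ite]
    have h1 : (Finset.range n).filter (· ∈ T) = T := by
      ext u
      simp only [Finset.mem_filter, and_iff_right_iff_imp]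
      exact fun h => hT h
    have h2 : ((Finset.range n).filter (· ∉ T)).card = n - q := by
      rw [Finset.filter_not, h1, Finset.card_sdiff_of_subset hT]
      simp [hq]
    rw [h1, Finset.prod_const, h2, Finset.prod_ite, Finset.prod_const, Finset.prod_const]
    have h3 : T.filter (· = v) = {v} := by
      ext u
      simp only [Finset.mem_filter, Finset.mem_singleton]
      exact ⟨fun h => h.2, fun h => ⟨h ▸ hv, h⟩⟩
    have h4 : (T.filter (¬ · = v)).card = q - 1 := by
      rw [Finset.filter_not, h3, Finset.card_sdiff_of_subset (by simpa using hv)]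
      simp [hq]
    rw [h3, h4]
    simp
  refine le_trans ?_ (Nat.mul_le_mul_left _ hcount)
  rw [hprod]
  obtain ⟨d, rfl⟩ := Nat.exists_eq_add_of_le hiB
  obtain ⟨p, hp⟩ := Nat.exists_eq_add_of_le hqn
  obtain ⟨q', hq'⟩ : ∃ q', q = q' + 1 := ⟨q - 1, by omega⟩
  obtain ⟨y, hy⟩ : ∃ y, 2 ^ i = y + 1 := ⟨2 ^ i - 1, by have := Nat.two_pow_pos i; omega⟩
  have h1 : 2 ^ (i + d) - 2 ^ (i + d - i) = y * 2 ^ d := by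
    rw [pow_add, hy, add_tsub_cancel_left, add_mul, one_mul, add_tsub_cancel_right]
  have h2 := succ_pow_le (y := y) (k := q') (by omega)
  rw [h1, add_tsub_cancel_left, hp, add_tsub_cancel_left, hq', Nat.add_sub_cancel, pow_add 2 K,
    add_mul, pow_add 2 ((q' + 1) * (i + d)), mul_comm p (i + d), pow_mul 2 (i + d) p]
  have h3 : 2 ^ ((q' + 1) * (i + d)) = (2 ^ i * 2 ^ d) * ((y + 1) ^ q' * (2 ^ d) ^ q') := by
    rw [mul_comm, pow_mul, pow_succ, pow_add, mul_pow, ← hy]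
    ring
  rw [h3, mul_pow]
  calc 2 ^ K * ((2 ^ i * 2 ^ d) * ((y + 1) ^ q' * (2 ^ d) ^ q') * (2 ^ (i + d)) ^ p)
      ≤ (2 * (i + d)) * (((2 * (q' + 1)) * 2 ^ d) * ((4 * y ^ q') * (2 ^ d) ^ q') *
          (2 ^ (i + d)) ^ p) := by
        have h4 : 2 ^ i ≤ 2 * (q' + 1) := by omega
        gcongr
    _ = 16 * (i + d) * (q' + 1) * (2 ^ d * (y ^ q' * (2 ^ d) ^ q') * (2 ^ (i + d)) ^ p) := by ring

/-- The two samples of a round single out the source `s` of an instance and the vertex `v` of `M`. -/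
def Singled (n : ℕ) (c : Cfg) (Q R : ℕ → Prop) (s v : ℕ) (M : Set ℕ) : Prop :=
  (∀ u ∈ members n c (c.loc v), (Q u ↔ u = s)) ∧ ∀ u < n, u ∈ M → (R u ↔ u = v)

open Classical in
-- The two samples read disjoint blocks of bits, so the numbers of favourable bit vectors multiply.
theorem singled_prob {n K B : ℕ} (hn : n < 2 ^ B) (hK : 2 ^ K ≤ 2 * B) (hBK : B < 2 ^ K) {c : Cfg}
    {s v : ℕ} {M : Set ℕ} (hv : v < n) (hs : s ∈ members n c (c.loc v)) (hvM : v ∈ M) :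
    2 ^ (K + n * B + (K + n * B)) ≤ 256 * B ^ 2 * (members n c (c.loc v)).card * vsize n M *
      (Finset.univ.filter fun b : Fin (K + n * B + (K + n * B)) → Bool =>
        Singled n c (Sampled (extend b) 0 K B) (Sampled (extend b) (K + n * B) K B) s v M).card := by
  have h1 := sample_prob hn hK hBK (T := members n c (c.loc v)) (Finset.filter_subset _ _) hs
  have h2 := sample_prob hn hK hBK (T := (Finset.range n).filter (· ∈ M)) (Finset.filter_subset _ _)
    (v := v) (by simp [hv, hvM])
  set N := K + n * B with hN
  set S₁ := Finset.univ.filter fun b : Fin N → Bool =>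
      ∀ u ∈ members n c (c.loc v), (Sampled (extend b) 0 K B u ↔ u = s) with hS₁
  set S₂ := Finset.univ.filter fun b : Fin N → Bool =>
      ∀ u ∈ (Finset.range n).filter (· ∈ M), (Sampled (extend b) 0 K B u ↔ u = v) with hS₂
  have h3 : S₁.card * S₂.card ≤ (Finset.univ.filter fun b : Fin (N + N) → Bool =>
        Singled n c (Sampled (extend b) 0 K B) (Sampled (extend b) N K B) s v M).card := by
    rw [← Finset.card_product]
    refine Finset.card_le_card_of_injOn (fun p => Fin.append p.1 p.2) ?_ ?_
    · rintro ⟨b₁, b₂⟩ hb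
      simp only [Finset.coe_product, Set.mem_prod, Finset.mem_coe, hS₁, hS₂, Finset.mem_filter,
        Finset.mem_univ, true_and, Finset.mem_range] at hb
      simp only [Finset.coe_filter, Finset.mem_univ, true_and, Set.mem_ofPred_eq]
      constructor
      · intro u hu
        rw [← hb.1 u hu]
        refine sampled_congr (n := n) (mem_members.1 hu).1 fun i hi => ?_
        have h4 : i < N + N := by omega
        have h5 : i < N := hi
        simp only [extend, zero_add, h4, h5, dif_pos]
        exact Fin.append_left b₁ b₂ ⟨i, h5⟩
      · intro u hu huM
        rw [← hb.2 u ⟨hu, huM⟩]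
        refine sampled_congr (n := n) hu fun i hi => ?_
        have h4 : N + i < N + N := by omega
        have h5 : i < N := hi
        simp only [extend, zero_add, h4, h5, dif_pos]
        exact Fin.append_right b₁ b₂ ⟨i, h5⟩
    · rintro ⟨b₁, b₂⟩ _ ⟨b₁', b₂'⟩ _ h
      simp only at h
      have ha : b₁ = b₁' := by
        funext i
        have := congrFun h (Fin.castAdd N i)
        simpa using this
      have hb : b₂ = b₂' := by
        funext i
        have := congrFun h (Fin.natAdd N i)
        rwa [Fin.append_right, Fin.append_right] at this
      rw [ha, hb]
  have hvs : ((Finset.range n).filter (· ∈ M)).card = vsize n M := rfl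
  rw [hvs] at h2
  rw [pow_add]
  calc 2 ^ N * 2 ^ N ≤ (16 * B * (members n c (c.loc v)).card * S₁.card) *
        (16 * B * vsize n M * S₂.card) := Nat.mul_le_mul h1 h2
    _ = 256 * B ^ 2 * (members n c (c.loc v)).card * vsize n M * (S₁.card * S₂.card) := by ring
    _ ≤ _ := Nat.mul_le_mul_left _ h3

/-- The effect of a round with the samples `Q` and `R`. -/
def RoundResult {ι : Type*} (n m : ℕ) (c c' : Cfg) (H : Net ι ℕ)
    (Q R : ℕ → Prop) : Prop :=
  ∃ src mv hd : ℕ → ℕ, Split (n := n) c H src mv hd c'.cnt ∧ Step (n := n) (m := m) c c' H mv hd ∧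
    ∀ s v M, v < n → s ∈ members n c (c.loc v) → GoodCut n c H s v M → Singled n c Q R s v M →
      src (c.loc v) = s ∧ mv v ≠ 0 ∧ {x | mv x = mv v} = M ∧ hd (mv v) = v

/-- In expectation a round separates a fraction of `1 / (4096 B ^ 2)` of the pairs. -/
theorem expected_progress {n m : ℕ} {ι : Type*} {G : MGraph n m} {c : Cfg} {D : ℕ → Set ℕ}
    {H : Net ι ℕ} (h : CfgInv G c D) (hH : IsContraction G c H) {K B : ℕ} (hn : n < 2 ^ B)
    (hK : 2 ^ K ≤ 2 * B) (hBK : B < 2 ^ K) (c' : (Fin (K + n * B + (K + n * B)) → Bool) → Cfg)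
    (hc' : ∀ b, RoundResult n m c (c' b) H (Sampled (extend b) 0 K B)
      (Sampled (extend b) (K + n * B) K B)) :
    4096 * B ^ 2 * ∑ b, (unsplit n (c' b)).card + 2 ^ (K + n * B + (K + n * B)) * (unsplit n c).card ≤
      4096 * B ^ 2 * (2 ^ (K + n * B + (K + n * B)) * (unsplit n c).card) := by
  classical
  set E := (Finset.range c.cnt).biUnion fun i => goodPairs n c H i with hE
  have hEm : ∀ p ∈ E, p.1 ∈ members n c (c.loc p.2) ∧ p.2 < n ∧ ∃ M, GoodCut n c H p.1 p.2 M := by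
    intro p hp
    simp only [hE, Finset.mem_biUnion, goodPairs, Finset.mem_filter, Finset.mem_offDiag] at hp
    obtain ⟨i, -, ⟨h1, h2, -⟩, h3⟩ := hp
    have h4 := mem_members.1 h2
    exact ⟨by rw [h4.2]; exact h1, h4.1, h3⟩
  have hMex : ∀ p : ℕ × ℕ, ∃ M, p ∈ E → GoodCut n c H p.1 p.2 M := by
    intro p
    by_cases hp : p ∈ E
    · obtain ⟨M, hM⟩ := (hEm p hp).2.2
      exact ⟨M, fun _ => hM⟩
    · exact ⟨∅, fun h => absurd h hp⟩
  choose M hM using hMex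
  set w : ℕ × ℕ → ℕ := fun p => vsize n (M p) * ((members n c (c.loc p.2)).card - vsize n (M p))
  set Ev : ℕ × ℕ → (Fin (K + n * B + (K + n * B)) → Bool) → Prop := fun p b =>
    Singled n c (Sampled (extend b) 0 K B) (Sampled (extend b) (K + n * B) K B) p.1 p.2 (M p)
  have hround : ∀ b, (unsplit n (c' b)).card + ∑ p ∈ E, (if Ev p b then w p else 0) ≤
      (unsplit n c).card := by
    intro b
    obtain ⟨src, mv, hd, hs, ht, hg⟩ := hc' b
    rw [← Finset.sum_filter]
    refine unsplit_step hs h ht (E.filter fun p => Ev p b) M fun p hp => ?_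
    rw [Finset.mem_filter] at hp
    obtain ⟨h1, h2, -⟩ := hEm p hp.1
    obtain ⟨h3, h4, h5, h6⟩ := hg p.1 p.2 (M p) h2 h1 (hM p hp.1) hp.2
    exact ⟨(mem_members.1 h1).1, h2, hM p hp.1, h3, h4, h5, h6⟩
  have hsum := Finset.sum_le_sum fun b (_ : b ∈ (Finset.univ : Finset (Fin (K + n * B + (K + n * B)) → Bool))) => hround b
  rw [Finset.sum_add_distrib, Finset.sum_comm, Finset.sum_const, smul_eq_mul, Finset.card_univ,
    Fintype.card_fun, Fintype.card_fin, Fintype.card_bool] at hsum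
  have hp : ∀ p ∈ E, 2 ^ (K + n * B + (K + n * B)) ≤ 512 * B ^ 2 * ∑ b, (if Ev p b then w p else 0) := by
    intro p hp
    obtain ⟨h1, h2, -⟩ := hEm p hp
    have h3 := hM p hp
    have h4 := singled_prob hn hK hBK h2 h1 h3.least.mem
    refine h4.trans ?_
    rw [← Finset.sum_filter, Finset.sum_const, smul_eq_mul]
    -- Since `M` has at most half of the vertices, the number of pairs that it separates is at least
    -- `k |M| / 2`. This cancels the factor `k |M|` lost in the sampling.
    have h5 : (members n c (c.loc p.2)).card ≤
        2 * ((members n c (c.loc p.2)).card - vsize n (M p)) := by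
      have := h3.small
      omega
    have h6 := Nat.mul_le_mul_left (256 * B ^ 2 * vsize n (M p) *
      (Finset.univ.filter fun b => Ev p b).card) h5
    calc _ = _ := by ring
      _ ≤ _ := h6
      _ = _ := by ring
  have hpairs : (unsplit n c).card ≤ 8 * E.card := by
    have h1 : unsplit n c ⊆ (Finset.range c.cnt).biUnion fun i => (members n c i).offDiag := by
      rintro ⟨a, b⟩ hab
      simp only [unsplit, Finset.mem_filter, Finset.mem_offDiag, Finset.mem_range] at hab
      simp only [Finset.mem_biUnion, Finset.mem_range, Finset.mem_offDiag, mem_members]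
      exact ⟨c.loc a, h.loc_lt a (valid_of_lt hab.1.1), ⟨hab.1.1, rfl⟩, ⟨hab.1.2.1, hab.2.symm⟩,
        hab.1.2.2⟩
    refine (Finset.card_le_card h1).trans (Finset.card_biUnion_le.trans ?_)
    rw [hE, Finset.card_biUnion]
    · rw [Finset.mul_sum]
      refine Finset.sum_le_sum fun i _ => ?_
      rw [Finset.offDiag_card]
      exact card_pairs_le_goodPairs h hH i
    · intro i _ j _ hij
      rw [Function.onFun, Finset.disjoint_left]
      intro p hp hp'
      simp only [goodPairs, Finset.mem_filter, Finset.mem_offDiag, mem_members] at hp hp'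
      exact hij (hp.1.1.2.symm.trans hp'.1.1.2)
  have hE2 := Finset.sum_le_sum hp
  rw [Finset.sum_const, smul_eq_mul, ← Finset.mul_sum] at hE2
  -- `4096 = 8 · 512`: one pair out of eight is good, and a good pair contributes at least `1 / (512
  -- B ^ 2)` in expectation.
  have h7 : 2 ^ (K + n * B + (K + n * B)) * (unsplit n c).card ≤ 4096 * B ^ 2 * ∑ p ∈ E, ∑ b, (if Ev p b then w p else 0) := by
    calc 2 ^ (K + n * B + (K + n * B)) * (unsplit n c).card ≤ 2 ^ (K + n * B + (K + n * B)) * (8 * E.card) := Nat.mul_le_mul_left _ hpairs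
      _ = 8 * (E.card * 2 ^ (K + n * B + (K + n * B))) := by ring
      _ ≤ 8 * (512 * B ^ 2 * ∑ p ∈ E, ∑ b, (if Ev p b then w p else 0)) := Nat.mul_le_mul_left _ hE2
      _ = _ := by ring
  calc _ ≤ 4096 * B ^ 2 * ∑ b, (unsplit n (c' b)).card +
        4096 * B ^ 2 * ∑ p ∈ E, ∑ b, (if Ev p b then w p else 0) := Nat.add_le_add_left h7 _
    _ = 4096 * B ^ 2 * (∑ b, (unsplit n (c' b)).card +
        ∑ p ∈ E, ∑ b, (if Ev p b then w p else 0)) := by ring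
    _ ≤ _ := Nat.mul_le_mul_left _ hsum

/-! ### Reasoning about programs -/

/-- All memory cells hold words of `w` bits. -/
structure State.Fits (w : ℕ) (σ : State) : Prop where
  var : ∀ x, σ.var x < 2 ^ w
  arr : ∀ a i, σ.arr a i < 2 ^ w

theorem State.Fits.setVar {w : ℕ} {σ : State} (h : σ.Fits w) {x v : ℕ} (hv : v < 2 ^ w) :
    (σ.setVar x v).Fits w := by
  refine ⟨fun y => ?_, h.arr⟩
  simp only [State.setVar, Function.update_apply]
  split_ifs
  exacts [hv, h.var y]

theorem State.Fits.setArr {w : ℕ} {σ : State} (h : σ.Fits w) {a i v : ℕ} (hv : v < 2 ^ w) :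
    (σ.setArr a i v).Fits w := by
  refine ⟨h.var, fun b j => ?_⟩
  by_cases hb : b = a
  · subst hb
    by_cases hj : j = i <;> simp [State.setArr, hj, hv, h.arr]
  · simp [State.setArr, hb, h.arr]

theorem State.Fits.fillArr {w : ℕ} {σ : State} (h : σ.Fits w) {a l : ℕ} {f : Fin l → ℕ}
    (hv : ∀ i, f i < 2 ^ w) : (σ.fillArr a f).Fits w := by
  refine ⟨h.var, fun b j => ?_⟩
  by_cases hb : b = a
  · subst hb
    by_cases hj : j < l <;> simp [State.fillArr, hj, hv, h.arr]
  · simp [State.fillArr, hb, h.arr]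

theorem State.Fits.tick {w : ℕ} {σ : State} (h : σ.Fits w) : σ.tick.Fits w := ⟨h.var, h.arr⟩

theorem Expr.eval_lt {w : ℕ} {σ : State} (h : σ.Fits w) : ∀ e : Expr, e.eval w σ < 2 ^ w
  | .const c => Nat.mod_lt _ (by positivity)
  | .var x => h.var x
  | .load a i => h.arr _ _
  | .add _ _ => Nat.mod_lt _ (by positivity)
  | .sub e _ => lt_of_le_of_lt (Nat.sub_le _ _) (eval_lt h e)
  | .mul _ _ => Nat.mod_lt _ (by positivity)
  | .div e _ => lt_of_le_of_lt (Nat.div_le_self _ _) (eval_lt h e)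
  | .mod e _ => lt_of_le_of_lt (Nat.mod_le _ _) (eval_lt h e)
  | .lt _ _ => by
    simp only [Expr.eval]; split_ifs
    exacts [Nat.mod_lt _ (by positivity), by positivity]
  | .eq _ _ => by
    simp only [Expr.eval]; split_ifs
    exacts [Nat.mod_lt _ (by positivity), by positivity]

/-- `if p = q then a else b`. -/
def Expr.ifEq (p q a b : Expr) : Expr :=
  .add (.mul (.eq p q) a) (.mul (.sub (.const 1) (.eq p q)) b)

/-- `if p < q then a else b`. -/
def Expr.ifLt (p q a b : Expr) : Expr :=
  .add (.mul (.lt p q) a) (.mul (.sub (.const 1) (.lt p q)) b)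

theorem Expr.eval_ifEq {w : ℕ} {σ : State} (hw : 1 < 2 ^ w) (h : σ.Fits w) (p q a b : Expr) :
    (Expr.ifEq p q a b).eval w σ = if p.eval w σ = q.eval w σ then a.eval w σ else b.eval w σ := by
  have h1 := Expr.eval_lt h a
  have h2 := Expr.eval_lt h b
  simp only [Expr.ifEq, Expr.eval, Nat.mod_eq_of_lt hw]
  split_ifs <;> simp [Nat.mod_eq_of_lt, h1, h2]

theorem Expr.eval_ifLt {w : ℕ} {σ : State} (hw : 1 < 2 ^ w) (h : σ.Fits w) (p q a b : Expr) :
    (Expr.ifLt p q a b).eval w σ = if p.eval w σ < q.eval w σ then a.eval w σ else b.eval w σ := by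
  have h1 := Expr.eval_lt h a
  have h2 := Expr.eval_lt h b
  simp only [Expr.ifLt, Expr.eval, Nat.mod_eq_of_lt hw]
  split_ifs <;> simp [Nat.mod_eq_of_lt, h1, h2]

/-- `e` depends neither on the variable `x` nor on the array `a`, except for the cell of `a` with the
index `i` if this is given. -/
def Expr.indep (V A : ℕ → Bool) : Expr → Bool
  | .const _ => true
  | .var x => !V x
  | .load a i => !A a && i.indep V A
  | .add e f | .sub e f | .mul e f | .div e f | .mod e f | .lt e f | .eq e f =>
    e.indep V A && f.indep V A

theorem Expr.eval_indep {w : ℕ} {V A : ℕ → Bool} {σ σ' : State}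
    (hV : ∀ x, V x = false → σ'.var x = σ.var x) (hA : ∀ a, A a = false → σ'.arr a = σ.arr a) :
    ∀ e : Expr, e.indep V A = true → e.eval w σ' = e.eval w σ := by
  intro e
  induction e with
  | const => simp [Expr.eval]
  | var x => intro h; exact hV x (by simpa [indep] using h)
  | load a i ih =>
    intro h
    simp only [indep, Bool.and_eq_true, Bool.not_eq_true'] at h
    simp only [Expr.eval]
    rw [ih h.2, hA a h.1]
  | _ e f ihe ihf =>
    intro h
    simp only [indep, Bool.and_eq_true] at h
    simp only [Expr.eval, ihe h.1, ihf h.2]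

/-- The array `a` is read in `e` only at the index stored in the variable `x`. -/
def Expr.only (a x : ℕ) : Expr → Bool
  | .const _ => true
  | .var _ => true
  | .load b i => (a != b && i.only a x) || (match i with | .var y => x == y | _ => false)
  | .add e f | .sub e f | .mul e f | .div e f | .mod e f | .lt e f | .eq e f =>
    e.only a x && f.only a x

theorem Expr.eval_only {w : ℕ} {a x : ℕ} {σ σ' : State} (hv : σ'.var = σ.var)
    (hA : ∀ b, b ≠ a → σ'.arr b = σ.arr b) (ha : σ'.arr a (σ.var x) = σ.arr a (σ.var x)) :
    ∀ e : Expr, e.only a x = true → e.eval w σ' = e.eval w σ := by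
  intro e
  induction e with
  | const => simp [Expr.eval]
  | var x => simp [Expr.eval, hv]
  | load b i ih =>
    intro h
    simp only [only, Bool.or_eq_true, Bool.and_eq_true, bne_iff_ne, ne_eq] at h
    simp only [Expr.eval]
    rcases h with h | h
    · rw [ih h.2, hA b (Ne.symm h.1)]
    · cases i <;> simp at h
      subst h
      simp only [Expr.eval, hv]
      by_cases hb : b = a
      · rw [hb, ha]
      · rw [hA b hb]
  | _ e f ihe ihf =>
    intro h
    simp only [only, Bool.and_eq_true] at h
    simp only [Expr.eval, ihe h.1, ihf h.2]

/-- The program may assign to the variable `x`. -/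
def Prog.setsVar : Prog → ℕ → Bool
  | .skip, _ | .store .., _ | .callFlow, _ | .callVerify, _ => false
  | .assign y _, x | .flip y, x => y == x
  | .seq p q, x | .branch _ p q, x => p.setsVar x || q.setsVar x
  | .loop _ p, x => p.setsVar x

/-- The program may write to the array `a`. -/
def Prog.setsArr : Prog → ℕ → Bool
  | .skip, _ | .assign .., _ | .flip .., _ => false
  | .store b _ _, a => b == a
  | .callFlow, a => 3 == a || 4 == a
  | .callVerify, a => 7 == a
  | .seq p q, a | .branch _ p q, a => p.setsArr a || q.setsArr a
  | .loop _ p, a => p.setsArr a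

/-- The program flips no coins. -/
def Prog.flipless : Prog → Bool
  | .skip | .store .. | .assign .. | .callFlow | .callVerify => true
  | .flip _ => false
  | .seq p q | .branch _ p q => p.flipless && q.flipless
  | .loop _ p => p.flipless

/-- The program calls no oracles. -/
def Prog.callless : Prog → Bool
  | .skip | .store .. | .assign .. | .flip _ => true
  | .callFlow | .callVerify => false
  | .seq p q | .branch _ p q => p.callless && q.callless
  | .loop _ p => p.callless

/-- What a program does not change. -/
structure Frame (p : Prog) (σ σ' : State) : Prop where
  var : ∀ x, p.setsVar x = false → σ'.var x = σ.var x
  arr : ∀ a, p.setsArr a = false → σ'.arr a = σ.arr a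
  bits : p.flipless = true → σ'.bits = σ.bits
  vertices : p.callless = true → σ'.vertices = σ.vertices
  edges : p.callless = true → σ'.edges = σ.edges

theorem Frame.trans {p q r : Prog} {σ₁ σ₂ σ₃ : State} (h : Frame p σ₁ σ₂) (h' : Frame q σ₂ σ₃)
    (hv : ∀ x, r.setsVar x = false → p.setsVar x = false ∧ q.setsVar x = false)
    (ha : ∀ x, r.setsArr x = false → p.setsArr x = false ∧ q.setsArr x = false)
    (hf : r.flipless = true → p.flipless = true ∧ q.flipless = true)
    (hc : r.callless = true → p.callless = true ∧ q.callless = true) : Frame r σ₁ σ₃ where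
  var x hx := (h'.var x (hv x hx).2).trans (h.var x (hv x hx).1)
  arr x hx := (h'.arr x (ha x hx).2).trans (h.arr x (ha x hx).1)
  bits hx := (h'.bits (hf hx).2).trans (h.bits (hf hx).1)
  vertices hx := (h'.vertices (hc hx).2).trans (h.vertices (hc hx).1)
  edges hx := (h'.edges (hc hx).2).trans (h.edges (hc hx).1)

theorem Frame.refl (p : Prog) (σ : State) : Frame p σ σ := 
  ⟨fun _ _ => rfl, fun _ _ => rfl, fun _ => rfl, fun _ => rfl, fun _ => rfl⟩

theorem Frame.of_tick {p : Prog} {σ σ' : State} (h : Frame p σ.tick σ') : Frame p σ σ' :=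
  ⟨h.var, h.arr, h.bits, h.vertices, h.edges⟩

theorem Frame.tick {p : Prog} {σ σ' : State} (h : Frame p σ σ') : Frame p σ σ'.tick :=
  ⟨h.var, h.arr, h.bits, h.vertices, h.edges⟩

/-- The conditions on `p` are computable, so `rfl` decides for a concrete program that it preserves
a given variable or array. -/
theorem Exec.frame {κ : Kind} {w : ℕ} {O : Oracles} {ω : ℕ → Bool} {p : Prog} {σ σ' : State}
    (h : Exec κ w O ω p σ σ') : Frame p σ σ' := by
  induction h with
  | skip => exact Frame.refl _ _
  | assign x e σ =>
    exact ⟨fun y hy => Function.update_of_ne (Ne.symm (by simpa [Prog.setsVar] using hy)) _ _,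
      fun _ _ => rfl, fun _ => rfl, fun _ => rfl, fun _ => rfl⟩
  | store x e σ =>
    exact ⟨fun _ _ => rfl,
      fun y hy => Function.update_of_ne (Ne.symm (by simpa [Prog.setsArr] using hy)) _ _,
      fun _ => rfl, fun _ => rfl, fun _ => rfl⟩
  | flip x σ =>
    exact ⟨fun y hy => Function.update_of_ne (Ne.symm (by simpa [Prog.setsVar] using hy)) _ _,
      fun _ _ => rfl, by simp [Prog.flipless], fun _ => rfl, fun _ => rfl⟩
  | seq _ _ h1 h2 =>
    exact h1.trans h2 (by simp [Prog.setsVar]) (by simp [Prog.setsArr])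
      (by simp [Prog.flipless]) (by simp [Prog.callless])
  | branch_true _ _ h1 | branch_false _ _ h1 =>
    refine Frame.trans (p := .skip) (Frame.refl _ _) h1.of_tick (by simp +contextual [Prog.setsVar])
      (by simp +contextual [Prog.setsArr])
      (by simp +contextual [Prog.flipless]) (by simp +contextual [Prog.callless])
  | loop_false => exact (Frame.refl _ _).tick
  | loop_true _ _ _ h1 h2 =>
    exact h1.of_tick.trans h2 (by simp [Prog.setsVar]) (by simp [Prog.setsArr])
      (by simp [Prog.flipless]) (by simp [Prog.callless])
  | callFlow q h1 h2 =>
    refine ⟨fun _ _ => rfl, fun a ha => ?_, fun _ => rfl, by simp [Prog.callless],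
      by simp [Prog.callless]⟩
    simp only [Prog.setsArr, Bool.or_eq_false_iff, beq_eq_false_iff_ne, ne_eq] at ha
    simp [State.tick, State.fillArr, State.charge, Ne.symm ha.1, Ne.symm ha.2]
  | callVerify q h1 h2 =>
    refine ⟨fun _ _ => rfl, fun a ha => ?_, fun _ => rfl, by simp [Prog.callless],
      by simp [Prog.callless]⟩
    simp only [Prog.setsArr, beq_eq_false_iff_ne, ne_eq] at ha
    simp [State.tick, State.fillArr, State.charge, Ne.symm ha]

/-- Answers of the flow oracle fit into words because the flow on an edge is bounded by its weight,
which is itself stored in a word. -/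
theorem Exec.fits {κ : Kind} {w : ℕ} {O : Oracles} (hO : O.Correct κ) (hw : 1 < 2 ^ w)
    {ω : ℕ → Bool} {p : Prog} {σ σ' : State} (h : Exec κ w O ω p σ σ') (hσ : σ.Fits w) :
    σ'.Fits w := by
  induction h with
  | skip => exact hσ
  | assign x e σ => exact hσ.tick.setVar (Expr.eval_lt hσ e)
  | store x e σ => exact hσ.tick.setArr (Expr.eval_lt hσ _)
  | flip x σ =>
    have := hσ.tick.setVar (x := x) (v := if ω σ.bits then 1 else 0) (by split_ifs <;> omega)
    exact ⟨this.var, this.arr⟩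
  | seq _ _ h1 h2 => exact h2 (h1 hσ)
  | branch_true _ _ h1 | branch_false _ _ h1 => exact h1 hσ.tick
  | loop_false => exact hσ.tick
  | loop_true _ _ _ h1 h2 => exact h2 (h1 hσ.tick)
  | @callFlow n m q σ h1 h2 =>
    have hf : ∀ e, |O.flow q e| < 2 ^ w := fun e => by
      have h3 := (hO.flow_correct q h1).1.1 e
      have h4 := hσ.arr 2 e
      rw [(h2.1.2.2 e).2.2] at h4
      exact lt_of_le_of_lt h3 (by exact_mod_cast h4)
    have h0 : (σ.tick.charge n m).Fits w := ⟨hσ.var, hσ.arr⟩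
    refine (h0.fillArr fun e => ?_).fillArr fun e => ?_
    · have := abs_lt.1 (hf e); zify; omega
    · have := abs_lt.1 (hf e); zify; omega
  | @callVerify n m q σ h1 h2 =>
    have h0 : (σ.tick.charge n m).Fits w := ⟨hσ.var, hσ.arr⟩
    exact h0.fillArr fun e => by split_ifs <;> omega

theorem Exec.bits_mono {κ : Kind} {w : ℕ} {O : Oracles} {ω : ℕ → Bool} {p : Prog} {σ σ' : State}
    (h : Exec κ w O ω p σ σ') : σ.bits ≤ σ'.bits := by
  induction h with
  | flip => exact Nat.le_succ _
  | seq _ _ h1 h2 | loop_true _ _ _ h1 h2 => exact h1.trans h2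
  | branch_true _ _ h1 | branch_false _ _ h1 => exact h1
  | _ => exact le_rfl

/-- Only the random bits that are used matter. -/
theorem Exec.congr {κ : Kind} {w : ℕ} {O : Oracles} {ω ω' : ℕ → Bool} {p : Prog} {σ σ' : State}
    (h : Exec κ w O ω p σ σ') (hω : ∀ i, σ.bits ≤ i → i < σ'.bits → ω i = ω' i) :
    Exec κ w O ω' p σ σ' := by
  induction h with
  | skip => exact .skip _
  | assign => exact .assign ..
  | store => exact .store ..
  | flip x σ => rw [hω σ.bits le_rfl (Nat.lt_succ_self _)]; exact .flip ..
  | seq h1 h2 ih1 ih2 =>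
    have := h1.bits_mono; have := h2.bits_mono
    exact .seq (ih1 fun i _ _ => hω i (by omega) (by omega))
      (ih2 fun i _ _ => hω i (by omega) (by omega))
  | branch_true he h1 ih => exact .branch_true he (ih hω)
  | branch_false he h1 ih => exact .branch_false he (ih hω)
  | loop_false he => exact .loop_false he
  | @loop_true _ _ σ₁ _ _ he h1 h2 ih1 ih2 =>
    have : σ₁.bits ≤ _ := h1.bits_mono; have := h2.bits_mono
    exact .loop_true he (ih1 fun i _ _ => hω i (by assumption) (by omega))
      (ih2 fun i _ _ => hω i (by omega) (by omega))
  | callFlow q h1 h2 => exact .callFlow q h1 h2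
  | callVerify q h1 h2 => exact .callVerify q h1 h2

/-! ### Loops -/

/-- A word size, correct oracles and random bits. -/
structure Machine (κ : Kind) where
  w : ℕ
  O : Oracles
  ω : ℕ → Bool
  correct : O.Correct κ
  one_lt : 1 < 2 ^ w

/-- From `σ` the program `p` halts within `t` steps in a state satisfying `Q`. -/
def Machine.Runs {κ : Kind} (M : Machine κ) (p : Prog) (σ : State) (t : ℕ) (Q : State → Prop) :
    Prop :=
  ∃ σ', Exec κ M.w M.O M.ω p σ σ' ∧ Frame p σ σ' ∧ σ'.Fits M.w ∧ σ'.time ≤ σ.time + t ∧ Q σ'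

section

variable {κ : Kind} {M : Machine κ} {p q : Prog} {σ : State} {t : ℕ} {Q R : State → Prop}

theorem Machine.Runs.mono (h : M.Runs p σ t Q) {t' : ℕ} (ht : t ≤ t')
    (hQ : ∀ σ', Frame p σ σ' → σ'.Fits M.w → Q σ' → R σ') : M.Runs p σ t' R := by
  obtain ⟨σ', h1, h2, h3, h4, h5⟩ := h
  exact ⟨σ', h1, h2, h3, by omega, hQ σ' h2 h3 h5⟩

theorem Machine.runs_of_exec {σ' : State} (h : Exec κ M.w M.O M.ω p σ σ') (hσ : σ.Fits M.w)
    (ht : σ'.time ≤ σ.time + t) (hQ : Q σ') : M.Runs p σ t Q :=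
  ⟨σ', h, h.frame, h.fits M.correct M.one_lt hσ, ht, hQ⟩

theorem Machine.Runs.seq {t₁ t₂ : ℕ} (h : M.Runs p σ t₁ R)
    (h' : ∀ σ₁, Frame p σ σ₁ → σ₁.Fits M.w → R σ₁ → M.Runs q σ₁ t₂ fun σ' => Q σ') :
    M.Runs (.seq p q) σ (t₁ + t₂) Q := by
  obtain ⟨σ₁, h1, h2, h3, h4, h5⟩ := h
  obtain ⟨σ₂, h6, h7, h8, h9, h10⟩ := h' σ₁ h2 h3 h5
  exact ⟨σ₂, h1.seq h6, (h1.seq h6).frame, h8, by omega, h10⟩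

theorem Machine.runs_assign (hσ : σ.Fits M.w) {x : ℕ} {e : Expr}
    (hQ : Q (σ.tick.setVar x (e.eval M.w σ))) : M.Runs (.assign x e) σ 1 Q :=
  Machine.runs_of_exec (.assign ..) hσ le_rfl hQ

theorem Machine.runs_store (hσ : σ.Fits M.w) {a : ℕ} {i e : Expr}
    (hQ : Q (σ.tick.setArr a (i.eval M.w σ) (e.eval M.w σ))) : M.Runs (.store a i e) σ 1 Q :=
  Machine.runs_of_exec (.store ..) hσ le_rfl hQ

theorem Machine.runs_skip (hσ : σ.Fits M.w) (hQ : Q σ) : M.Runs .skip σ 0 Q :=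
  Machine.runs_of_exec (.skip ..) hσ le_rfl hQ

theorem Machine.runs_branch {e : Expr}
    (h1 : e.eval M.w σ ≠ 0 → M.Runs p σ.tick t Q) (h2 : e.eval M.w σ = 0 → M.Runs q σ.tick t Q) :
    M.Runs (.branch e p q) σ (t + 1) Q := by
  by_cases he : e.eval M.w σ = 0
  · obtain ⟨σ', h3, h4, h5, h6, h7⟩ := h2 he
    have := Exec.branch_false (p := p) he h3
    simp only [State.tick] at h6
    exact ⟨σ', this, this.frame, h5, by omega, h7⟩
  · obtain ⟨σ', h3, h4, h5, h6, h7⟩ := h1 he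
    have := Exec.branch_true (q := q) he h3
    simp only [State.tick] at h6
    exact ⟨σ', this, this.frame, h5, by omega, h7⟩

/-- A loop, every iteration of which decreases the potential `μ` and takes at most `c` steps. -/
theorem Machine.runs_loop {e : Expr} {c : ℕ} (Inv : State → Prop) (μ : State → ℕ)
    (hσ : σ.Fits M.w) (h0 : Inv σ)
    (hstep : ∀ σ₁, σ₁.Fits M.w → Frame p σ σ₁ → Inv σ₁ → e.eval M.w σ₁ ≠ 0 →
      M.Runs p σ₁.tick c fun σ₂ => Inv σ₂ ∧ μ σ₂ < μ σ₁)
    (hQ : ∀ σ₁, σ₁.Fits M.w → Frame p σ σ₁ → Inv σ₁ → e.eval M.w σ₁ = 0 → Q σ₁.tick) :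
    M.Runs (.loop e p) σ (μ σ * (c + 1) + 1) Q := by
  suffices H : ∀ k σ₁, μ σ₁ ≤ k → σ₁.Fits M.w → Frame p σ σ₁ → Inv σ₁ →
      ∃ σ', Exec κ M.w M.O M.ω (.loop e p) σ₁ σ' ∧ σ'.time ≤ σ₁.time + (k * (c + 1) + 1) ∧
        Q σ' by
    obtain ⟨σ', h1, h2, h3⟩ := H (μ σ) σ le_rfl hσ (Frame.refl _ _) h0
    exact ⟨σ', h1, h1.frame, h1.fits M.correct M.one_lt hσ, h2, h3⟩
  have hself : ∀ {σ₁ σ₂ : State}, Frame p σ σ₁ → Frame p σ₁ σ₂ → Frame p σ σ₂ := fun h h' =>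
    h.trans h' (fun _ h => ⟨h, h⟩) (fun _ h => ⟨h, h⟩) (fun h => ⟨h, h⟩) (fun h => ⟨h, h⟩)
  intro k
  induction k with
  | zero =>
    intro σ₁ hk h1 h2 h3
    by_cases he : e.eval M.w σ₁ = 0
    · exact ⟨_, .loop_false he, by simp [State.tick], hQ σ₁ h1 h2 h3 he⟩
    · obtain ⟨σ₂, -, -, -, -, -, h5⟩ := hstep σ₁ h1 h2 h3 he
      omega
  | succ k ih =>
    intro σ₁ hk h1 h2 h3
    by_cases he : e.eval M.w σ₁ = 0
    · exact ⟨_, .loop_false he, by simp [State.tick], hQ σ₁ h1 h2 h3 he⟩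
    · obtain ⟨σ₂, h4, h5, h6, h7, h8, h9⟩ := hstep σ₁ h1 h2 h3 he
      obtain ⟨σ', h10, h11, h12⟩ := ih σ₂ (by omega) h6 (hself h2 h5.of_tick) h8
      refine ⟨σ', .loop_true he h4 h10, ?_, h12⟩
      simp only [State.tick] at h7
      rw [Nat.succ_mul]
      omega

/-- `for x < e do p`. -/
def Prog.for (x : ℕ) (e : Expr) (p : Prog) : Prog :=
  .seq (.assign x (.const 0))
    (.loop (.lt (.var x) e) (.seq p (.assign x (.add (.var x) (.const 1)))))

@[simp] theorem State.tick_var (σ : State) : σ.tick.var = σ.var := rfl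
@[simp] theorem State.tick_arr (σ : State) : σ.tick.arr = σ.arr := rfl
@[simp] theorem State.tick_bits (σ : State) : σ.tick.bits = σ.bits := rfl
@[simp] theorem State.setVar_arr (σ : State) (x v : ℕ) : (σ.setVar x v).arr = σ.arr := rfl
@[simp] theorem State.setVar_bits (σ : State) (x v : ℕ) : (σ.setVar x v).bits = σ.bits := rfl
@[simp] theorem State.setArr_var (σ : State) (a i v : ℕ) : (σ.setArr a i v).var = σ.var := rfl
@[simp] theorem State.setArr_bits (σ : State) (a i v : ℕ) : (σ.setArr a i v).bits = σ.bits := rfl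

theorem State.setVar_var (σ : State) (x v y : ℕ) :
    (σ.setVar x v).var y = if y = x then v else σ.var y := by
  simp [State.setVar, Function.update_apply]

theorem State.setArr_arr (σ : State) (a i v b j : ℕ) :
    (σ.setArr a i v).arr b j = if b = a ∧ j = i then v else σ.arr b j := by
  by_cases hb : b = a
  · subst hb; simp [State.setArr, Function.update_apply]
  · simp [State.setArr, hb]

/-- Programs without branches, loops, coin flips and calls. -/
def Prog.straight : Prog → Bool
  | .skip | .assign .. | .store .. => true
  | .seq p q => p.straight && q.straight
  | _ => false

/-- The final state of a straight-line program. -/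
def Prog.run (w : ℕ) : Prog → State → State
  | .assign x e, σ => σ.tick.setVar x (e.eval w σ)
  | .store a i e, σ => σ.tick.setArr a (i.eval w σ) (e.eval w σ)
  | .seq p q, σ => q.run w (p.run w σ)
  | _, σ => σ

/-- The running time of a straight-line program. -/
def Prog.steps : Prog → ℕ
  | .assign .. | .store .. => 1
  | .seq p q => p.steps + q.steps
  | _ => 0

theorem Machine.runs_straight (hσ : σ.Fits M.w) (hp : p.straight = true)
    (hQ : (p.run M.w σ).Fits M.w → Q (p.run M.w σ)) : M.Runs p σ p.steps Q := by
  suffices H : ∀ p σ, p.straight = true → σ.Fits M.w →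
      M.Runs p σ p.steps fun σ' => σ' = p.run M.w σ from
    (H p σ hp hσ).mono le_rfl fun σ' _ hf h => h ▸ hQ (h ▸ hf)
  intro r
  induction r with
  | assign x e => exact fun σ _ hσ => Machine.runs_assign hσ rfl
  | store a i e => exact fun σ _ hσ => Machine.runs_store hσ rfl
  | skip => exact fun σ _ hσ => Machine.runs_skip hσ rfl
  | seq p q ihp ihq =>
    intro σ hp hσ
    simp only [Prog.straight, Bool.and_eq_true] at hp
    rw [Prog.steps]
    refine (ihp σ hp.1 hσ).seq fun σ₁ _ hf h1 => ?_
    rw [Prog.run, ← h1]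
    exact ihq σ₁ hp.2 hf
  | _ => simp [Prog.straight]

/-- The invariant `Inv i` holds at the beginning of the `i`-th iteration. -/
theorem Machine.runs_for {x : ℕ} {e : Expr} {c K : ℕ} (Inv : ℕ → State → Prop)
    (hσ : σ.Fits M.w) (hK : e.eval M.w σ = K)
    (he : e.indep (fun y => x == y || p.setsVar y) p.setsArr = true) (hx : p.setsVar x = false)
    (h0 : Inv 0 (σ.tick.setVar x 0))
    (hstep : ∀ i < K, ∀ σ₁, σ₁.Fits M.w → Frame (.seq p (.assign x e)) σ σ₁ → σ₁.var x = i →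
      Inv i σ₁ → M.Runs p σ₁.tick c fun σ₂ => Inv (i + 1) (σ₂.tick.setVar x (i + 1)))
    (hQ : ∀ σ₁, σ₁.Fits M.w → Frame (.seq p (.assign x e)) σ σ₁ → Inv K σ₁ → Q σ₁.tick) :
    M.Runs (.for x e p) σ (K * (c + 2) + 2) Q := by
  have hKlt : K < 2 ^ M.w := hK ▸ Expr.eval_lt hσ e
  have h1 := M.one_lt
  have hfr : ∀ {σ₁ σ₂ : State}, Frame (.seq p (.assign x e)) σ σ₁ →
      Frame (.seq p (.assign x (.add (.var x) (.const 1)))) σ₁ σ₂ →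
      Frame (.seq p (.assign x e)) σ σ₂ := fun h h' =>
    h.trans h' (fun _ h => ⟨h, h⟩) (fun _ h => ⟨h, h⟩) (fun h => ⟨h, h⟩) (fun h => ⟨h, h⟩)
  have hev : ∀ σ₁, Frame (.seq p (.assign x e)) σ σ₁ → e.eval M.w σ₁ = K := by
    intro σ₁ hf
    rw [← hK]
    refine Expr.eval_indep (fun y hy => hf.var y ?_) (fun a ha => hf.arr a ?_) e he
    · simpa [Prog.setsVar, Bool.or_comm, and_comm] using hy
    · simpa [Prog.setsArr] using ha
  have hF0 : Frame (.seq p (.assign x e)) σ (σ.tick.setVar x 0) :=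
    ⟨fun y hy => Function.update_of_ne (by
      simp only [Prog.setsVar, Bool.or_eq_false_iff, beq_eq_false_iff_ne, ne_eq] at hy
      exact Ne.symm hy.2) _ _, fun _ _ => rfl, fun _ => rfl, fun _ => rfl, fun _ => rfl⟩
  have hasg : M.Runs (.assign x (.const 0)) σ 1 fun σ₁ => σ₁ = σ.tick.setVar x 0 :=
    Machine.runs_assign hσ (by simp [Expr.eval])
  refine (hasg.seq (t₂ := K * (c + 2) + 1) ?_).mono (by omega) fun σ' _ _ h => h
  rintro _ - hσ1 rfl
  have hl := Machine.runs_loop (M := M) (p := .seq p (.assign x (.add (.var x) (.const 1))))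
    (e := .lt (.var x) e) (c := c + 1) (Q := Q)
    (fun σ₁ => Frame (.seq p (.assign x e)) σ σ₁ ∧ ∃ i ≤ K, σ₁.var x = i ∧ Inv i σ₁)
    (fun σ₁ => K - σ₁.var x) hσ1
    ⟨hF0, 0, Nat.zero_le _, by simp [State.setVar], h0⟩ ?_ ?_
  · simpa [State.setVar, Nat.add_assoc] using hl
  · rintro σ₁ hf - ⟨hfr1, i, hi, hxi, hInv⟩ hc
    simp only [Expr.eval, hev σ₁ hfr1, hxi] at hc
    have hiK : i < K := by by_contra h; simp [h] at hc
    refine (hstep i hiK σ₁ hf hfr1 hxi hInv).seq (t₂ := 1) ?_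
    intro σ₂ hf2 hfit2 h2
    have hx2 : σ₂.var x = i := (hf2.var x hx).trans hxi
    refine Machine.runs_assign hfit2 ?_
    have hval : (Expr.add (.var x) (.const 1)).eval M.w σ₂ = i + 1 := by
      simp only [Expr.eval, hx2, Nat.mod_eq_of_lt h1]
      exact Nat.mod_eq_of_lt (by omega)
    rw [hval]
    refine ⟨⟨?_, i + 1, hiK, by simp [State.setVar], h2⟩, by simp [State.setVar, hxi]; omega⟩
    have hF2 : Frame (.seq p (.assign x e)) σ₁ (σ₂.tick.setVar x (i + 1)) := by
      have := hf2.of_tick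
      refine ⟨fun y hy => ?_, fun a ha => ?_, fun hb => ?_, fun hb => ?_, fun hb => ?_⟩
      · simp only [Prog.setsVar, Bool.or_eq_false_iff, beq_eq_false_iff_ne, ne_eq] at hy
        rw [State.setVar_var, if_neg (Ne.symm hy.2)]
        exact this.var y hy.1
      · exact this.arr a (by simpa [Prog.setsArr] using ha)
      · exact this.bits (by simpa [Prog.flipless] using hb)
      · exact this.vertices (by simpa [Prog.callless] using hb)
      · exact this.edges (by simpa [Prog.callless] using hb)
    exact hfr1.trans hF2 (fun _ h => ⟨h, h⟩) (fun _ h => ⟨h, h⟩) (fun h => ⟨h, h⟩) (fun h => ⟨h, h⟩)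
  · rintro σ₁ hf - ⟨hfr1, i, hi, hxi, hInv⟩ hc
    simp only [Expr.eval, hev σ₁ hfr1, hxi] at hc
    have hiK : ¬i < K := by
      intro h; simp only [h, if_true, Nat.mod_eq_of_lt h1] at hc; omega
    obtain rfl : i = K := by omega
    exact hQ σ₁ hf hfr1 hInv

/-- `for x < e do a[x] := f`. -/
def Prog.map (a x : ℕ) (e f : Expr) : Prog := .for x e (.store a (.var x) f)

/-- The expression `f` may read the array that is being overwritten, but only at the current index,
where the old value is still present. This covers updates in place. -/
theorem Machine.runs_map {a x : ℕ} {e f : Expr} {K : ℕ} (F : ℕ → ℕ) (hσ : σ.Fits M.w)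
    (hK : e.eval M.w σ = K) (he : e.indep (fun y => x == y) (fun b => a == b) = true)
    (hf : f.only a x = true)
    (hF : ∀ i < K, (σ.setVar x i).Fits M.w → f.eval M.w (σ.setVar x i) = F i)
    (hQ : ∀ σ', σ'.Fits M.w → Frame (.map a x e f) σ σ' → (∀ i < K, σ'.arr a i = F i) →
      (∀ i, K ≤ i → σ'.arr a i = σ.arr a i) → Q σ') :
    M.Runs (.map a x e f) σ (K * 3 + 2) Q := by
  have hKlt : K < 2 ^ M.w := hK ▸ Expr.eval_lt hσ e
  obtain ⟨σ', h1, h2, h3, h4, h5⟩ := Machine.runs_for (M := M) (σ := σ) (x := x) (e := e) (c := 1)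
    (K := K) (p := .store a (.var x) f)
    (Q := fun σ' => ∀ i, σ'.arr a i = if i < K then F i else σ.arr a i)
    (fun i σ₁ => ∀ j, σ₁.arr a j = if j < i then F j else σ.arr a j) hσ hK
    (by simpa [Prog.setsVar, Prog.setsArr] using he) rfl (by simp) (by
      intro i hi σ₁ hfit hfr hx hInv
      refine Machine.runs_store hfit.tick fun j => ?_
      have hval : f.eval M.w σ₁.tick = F i := by
        rw [← hF i hi (hσ.setVar (by omega))]
        have hv : σ₁.tick.var = (σ.setVar x i).var := by
          funext y
          rw [State.setVar_var]
          split_ifs with hy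
          · rw [hy]; exact hx
          · exact hfr.var y (by simpa [Prog.setsVar] using Ne.symm hy)
        refine Expr.eval_only (a := a) (x := x) hv (fun b hb => ?_) ?_ f hf
        · exact hfr.arr b (by simpa [Prog.setsArr] using Ne.symm hb)
        · simp [State.setVar_var, hInv]
      rw [hval]
      simp only [State.setVar_arr, State.tick_arr, State.setArr_arr, Expr.eval, State.tick_var, hx,
        hInv, true_and]
      by_cases hj : j = i
      · simp [hj]
      · simp only [hj, if_false]
        congr 1
        exact propext (by omega))
    (fun σ₁ _ _ h => h)
  exact ⟨σ', h1, h2, h3, h4, hQ σ' h3 h2 (fun i hi => by simp [h5, hi])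
    (fun i hi => by simp [h5, Nat.not_lt.2 hi])⟩

/-- `for x < e do a[i] := f`. -/
def Prog.scatter (a x : ℕ) (e i f : Expr) : Prog := .for x e (.store a i f)

/-- `for x < e do a[i] := a[i] + f`. -/
def Prog.collect (a x : ℕ) (e i f : Expr) : Prog := .for x e (.store a i (.add (.load a i) f))

/-- If several iterations write to one cell, the conclusion leaves open which value survives; only
membership in the instance is ever needed. -/
theorem Machine.runs_scatter {a x : ℕ} {e f g : Expr} {K : ℕ} (I F : ℕ → ℕ) (hσ : σ.Fits M.w)
    (hK : e.eval M.w σ = K) (he : e.indep (fun y => x == y) (fun b => a == b) = true)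
    (hg : g.indep (fun _ => false) (fun b => a == b) = true)
    (hf : f.indep (fun _ => false) (fun b => a == b) = true)
    (hI : ∀ i < K, (σ.setVar x i).Fits M.w → g.eval M.w (σ.setVar x i) = I i)
    (hF : ∀ i < K, (σ.setVar x i).Fits M.w → f.eval M.w (σ.setVar x i) = F i)
    (hQ : ∀ σ', σ'.Fits M.w → Frame (.scatter a x e g f) σ σ' →
      (∀ j, (σ'.arr a j = σ.arr a j ∧ ∀ i < K, I i ≠ j) ∨ ∃ i < K, I i = j ∧ σ'.arr a j = F i) →
      Q σ') :
    M.Runs (.scatter a x e g f) σ (K * 3 + 2) Q := by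
  have hKlt : K < 2 ^ M.w := hK ▸ Expr.eval_lt hσ e
  obtain ⟨σ', h1, h2, h3, h4, h5⟩ := Machine.runs_for (M := M) (σ := σ) (x := x) (e := e) (c := 1)
    (K := K) (p := .store a g f)
    (Q := fun σ' => ∀ j, (σ'.arr a j = σ.arr a j ∧ ∀ i < K, I i ≠ j) ∨
      ∃ i < K, I i = j ∧ σ'.arr a j = F i)
    (fun k σ₁ => ∀ j, (σ₁.arr a j = σ.arr a j ∧ ∀ i < k, I i ≠ j) ∨
      ∃ i < k, I i = j ∧ σ₁.arr a j = F i) hσ hK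
    (by simpa [Prog.setsVar, Prog.setsArr] using he) rfl (by simp) (by
      intro i hi σ₁ hfit hfr hx hInv
      refine Machine.runs_store hfit.tick fun j => ?_
      have hev : ∀ e : Expr, e.indep (fun _ => false) (fun b => a == b) = true →
          e.eval M.w σ₁.tick = e.eval M.w (σ.setVar x i) := by
        intro e he
        refine Expr.eval_indep (fun y _ => ?_) (fun b hb => ?_) e he
        · rw [State.setVar_var]
          split_ifs with hy
          · rw [hy]; exact hx
          · exact hfr.var y (by simpa [Prog.setsVar] using Ne.symm hy)
        · exact hfr.arr b (by simpa [Prog.setsArr] using hb)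
      rw [hev g hg, hev f hf, hI i hi (hσ.setVar (by omega)), hF i hi (hσ.setVar (by omega))]
      simp only [State.setVar_arr, State.tick_arr, State.setArr_arr, true_and]
      by_cases hj : j = I i
      · exact Or.inr ⟨i, by omega, hj.symm, by simp [hj]⟩
      · simp only [hj, if_false]
        rcases hInv j with h | ⟨k, h⟩
        · refine Or.inl ⟨h.1, fun k hk => ?_⟩
          rcases Nat.lt_succ_iff_lt_or_eq.1 hk with h' | rfl
          exacts [h.2 k h', Ne.symm hj]
        · exact Or.inr ⟨k, by omega, h.2⟩)
    (fun σ₁ _ _ h => h)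
  exact ⟨σ', h1, h2, h3, h4, hQ σ' h3 h2 h5⟩

/-- The bound `hlt` on the final sums excludes overflow of all partial sums, since the terms are
nonnegative. -/
theorem Machine.runs_collect {a x : ℕ} {e f g : Expr} {K : ℕ} (I F : ℕ → ℕ) (hσ : σ.Fits M.w)
    (hK : e.eval M.w σ = K) (he : e.indep (fun y => x == y) (fun b => a == b) = true)
    (hg : g.indep (fun _ => false) (fun b => a == b) = true)
    (hf : f.indep (fun _ => false) (fun b => a == b) = true)
    (hI : ∀ i < K, (σ.setVar x i).Fits M.w → g.eval M.w (σ.setVar x i) = I i)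
    (hF : ∀ i < K, (σ.setVar x i).Fits M.w → f.eval M.w (σ.setVar x i) = F i)
    (hlt : ∀ j, σ.arr a j + ∑ i ∈ Finset.range K, (if I i = j then F i else 0) < 2 ^ M.w)
    (hQ : ∀ σ', σ'.Fits M.w → Frame (.collect a x e g f) σ σ' →
      (∀ j, σ'.arr a j = σ.arr a j + ∑ i ∈ Finset.range K, if I i = j then F i else 0) → Q σ') :
    M.Runs (.collect a x e g f) σ (K * 3 + 2) Q := by
  have hKlt : K < 2 ^ M.w := hK ▸ Expr.eval_lt hσ e
  obtain ⟨σ', h1, h2, h3, h4, h5⟩ := Machine.runs_for (M := M) (σ := σ) (x := x) (e := e) (c := 1)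
    (K := K) (p := .store a g (.add (.load a g) f))
    (Q := fun σ' => ∀ j, σ'.arr a j =
      σ.arr a j + ∑ i ∈ Finset.range K, if I i = j then F i else 0)
    (fun k σ₁ => ∀ j, σ₁.arr a j = σ.arr a j + ∑ i ∈ Finset.range k, if I i = j then F i else 0)
    hσ hK (by simpa [Prog.setsVar, Prog.setsArr] using he) rfl (by simp) (by
      intro i hi σ₁ hfit hfr hx hInv
      refine Machine.runs_store hfit.tick fun j => ?_
      have hev : ∀ e : Expr, e.indep (fun _ => false) (fun b => a == b) = true →
          e.eval M.w σ₁.tick = e.eval M.w (σ.setVar x i) := by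
        intro e he
        refine Expr.eval_indep (fun y _ => ?_) (fun b hb => ?_) e he
        · rw [State.setVar_var]
          split_ifs with hy
          · rw [hy]; exact hx
          · exact hfr.var y (by simpa [Prog.setsVar] using Ne.symm hy)
        · exact hfr.arr b (by simpa [Prog.setsArr] using hb)
      simp only [Expr.eval]
      rw [hev g hg, hev f hf, hI i hi (hσ.setVar (by omega)), hF i hi (hσ.setVar (by omega))]
      simp only [State.setVar_arr, State.tick_arr, State.setArr_arr, true_and]
      rw [Finset.sum_range_succ, hInv, hInv]
      by_cases hj : j = I i
      · subst hj
        simp only [if_true]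
        rw [Nat.mod_eq_of_lt, Nat.add_assoc]
        refine lt_of_le_of_lt ?_ (hlt (I i))
        rw [Nat.add_assoc]
        refine Nat.add_le_add_left ?_ _
        calc _ = ∑ k ∈ Finset.range (i + 1), if I k = I i then F k else 0 := by
              rw [Finset.sum_range_succ]; simp
          _ ≤ _ := Finset.sum_le_sum_of_subset (Finset.range_subset_range.2 hi)
      · simp [hj, Ne.symm hj])
    (fun σ₁ _ _ h => h)
  exact ⟨σ', h1, h2, h3, h4, hQ σ' h3 h2 h5⟩

end

/-! ### The program

Variables: 0-3 query, 4 `n`, 5 `m`, 6 `B`, 7 `2 ^ B`, 8 number of rounds, 9 number of instances,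
10 number of edges of the contracted graph, 11 total weight, 12 round, 13 phase, 14 `2 ^ phase`,
15-19 auxiliary.

Arrays: 0-7 queries and answers, 10 and 11 blocks of the endpoints of the edges, 12 weights,
13 weights of blocks, 14 instances of blocks, 15 and 16 samples, 17 sources, 18 weights of the
edges to the outside, 19-21 contracted graph, 22 coded vertices, 23 codes, 24 labels,
25 vertices of the query, 26-29 adjacency lists of residual arcs, 30 visited vertices, 31 stack,
32 owners, 33 new instances, 34-37 auxiliary. -/

section

/-- Sample into the array `a`. -/
def sampleProg (a : ℕ) : Prog :=
  .seq (.assign 16 (.const 0)) <| .seq (.assign 17 (.const 1)) <|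
  .seq (.loop (.lt (.var 17) (.add (.var 6) (.const 1)))
    (.seq (.flip 18) <| .seq (.assign 16 (.add (.mul (.const 2) (.var 16)) (.var 18))) <|
      .assign 17 (.mul (.const 2) (.var 17)))) <|
  .for 15 (.var 4) (.seq (.store a (.var 15) (.const 1)) <|
    .for 19 (.var 6) (.seq (.flip 18) <|
      .store a (.var 15) (.ifLt (.var 19) (.var 16)
        (.mul (.load a (.var 15)) (.var 18)) (.load a (.var 15)))))

/-- The first pass provides every instance with some vertex. The second overwrites it by a sampled
vertex if there is one; unsampled vertices are written to the index `n`, which is no instance. -/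
def sourcesProg : Prog :=
  .seq (.scatter 17 15 (.var 4) (.load 14 (.var 15)) (.var 15)) <|
  .scatter 17 15 (.var 4) (.ifEq (.load 15 (.var 15)) (.const 1) (.load 14 (.var 15)) (.var 4))
    (.var 15)

/-- Twice the number of vertices. -/
def two_n : Expr := .mul (.const 2) (.var 4)

/-- Three times the number of vertices. -/
def three_n : Expr := .mul (.const 3) (.var 4)

def remaindersProg : Prog :=
  .seq (.map 36 15 two_n (.const 0)) <|
  .seq (.collect 36 15 (.var 5) (.load 10 (.var 15)) (.load 12 (.var 15))) <|
  .seq (.collect 36 15 (.var 5) (.load 11 (.var 15)) (.load 12 (.var 15))) <|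
  .map 18 15 two_n (.sub (.load 13 (.var 15)) (.load 36 (.var 15)))

/-- The weight of the next edge to the outside. -/
def portion : Kind → Expr
  | .unweighted => .const 1
  | .weighted => .load 18 (.var 15)

/-- The index advances only when the remaining weight of the block is zero. So a block emits one
edge in the weighted setting and as many unit edges as its remaining weight in the unweighted one.
-/
def outsideProg (κ : Kind) : Prog :=
  .loop (.lt (.var 15) two_n) <|
    .branch (.eq (.load 18 (.var 15)) (.const 0)) (.assign 15 (.add (.var 15) (.const 1))) <|
    .seq (.store 19 (.var 10) (.var 15)) <|
    .seq (.store 20 (.var 10) (.add two_n (.load 14 (.var 15)))) <|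
    .seq (.store 21 (.var 10) (portion κ)) <|
    .seq (.store 18 (.var 15) (.sub (.load 18 (.var 15)) (.load 21 (.var 10)))) <|
    .assign 10 (.add (.var 10) (.const 1))

def contractProg (κ : Kind) : Prog :=
  .seq (.map 19 15 (.var 5) (.load 10 (.var 15))) <|
  .seq (.map 20 15 (.var 5) (.load 11 (.var 15))) <|
  .seq (.map 21 15 (.var 5) (.load 12 (.var 15))) <|
  .seq (.assign 10 (.var 5)) <|
  .seq (.assign 15 (.const 0)) <|
  outsideProg κ

/-- If the vertex `15` is the source of its instance then `e` else `f`. -/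
def ifSource (e f : Expr) : Expr := .ifEq (.load 17 (.load 14 (.var 15))) (.var 15) e f

/-- Sources and outside vertices have the code `0`, a terminal `x` has the code `2 ^ B + x`. The
lower `B` bits tell terminals apart; the top bit separates them from the sources, even for `x = 0`.
-/
def codesProg : Prog :=
  .seq (.map 22 15 three_n (.ifLt (.var 15) (.var 4)
    (ifSource (.const 1) (.load 16 (.var 15)))
    (.ifLt (.var 15) two_n (.const 0) (.const 1)))) <|
  .seq (.map 23 15 three_n (.ifLt (.var 15) (.var 4)
    (ifSource (.const 0)
      (.ifEq (.load 16 (.var 15)) (.const 1) (.add (.var 7) (.var 15)) (.const 0)))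
    (.const 0))) <|
  .map 24 15 three_n (.const 0)

/-- The edge of the contracted graph that gives rise to the edge `15` of the query. -/
def parentEdge : Expr := .div (.var 15) (.const 2)

def firstEnd : Expr :=
  .ifEq (.mod (.var 15) (.const 2)) (.const 0) (.load 25 (.load 19 parentEdge))
    (.load 25 (.load 20 parentEdge))

def secondEnd : Expr :=
  .ifEq (.load 24 (.load 19 parentEdge)) (.load 24 (.load 20 parentEdge))
    (.load 25 (.load 20 parentEdge)) (.add three_n (.const 1))

/-- Edges within a class of labels are kept, and doubled as loops that are moved to the two vertices
`3n+2` and `3n+3`. Other edges are replaced by two edges to `3n+1`. -/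
def buildProg : Prog :=
  .seq (.map 0 15 (.mul (.const 2) (.var 10))
    (.ifEq firstEnd secondEnd (.add three_n (.const 2)) firstEnd)) <|
  .seq (.map 1 15 (.mul (.const 2) (.var 10))
    (.ifEq firstEnd secondEnd (.add three_n (.const 3)) secondEnd)) <|
  .seq (.map 2 15 (.mul (.const 2) (.var 10)) (.load 21 parentEdge)) <|
  .seq (.assign 0 (.add three_n (.const 4))) <|
  .seq (.assign 1 (.mul (.const 2) (.var 10))) <|
  .assign 2 three_n

/-- `e` if the residual arc `15` exists and `f` otherwise. -/
def ifResidual (e f : Expr) : Expr :=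
  .ifEq (.mod (.var 15) (.const 2)) (.const 0)
    (.ifLt (.load 3 parentEdge) (.add (.load 2 parentEdge) (.load 4 parentEdge)) e f)
    (.ifLt (.load 4 parentEdge) (.add (.load 2 parentEdge) (.load 3 parentEdge)) e f)

def linkProg : Prog :=
  .for 15 (.mul (.const 2) (.var 1))
    (.seq (.store 28 (.var 15) (.load 29 (.load 26 (.var 15)))) <|
      .store 29 (.load 26 (.var 15)) (.add (.var 15) (.const 1)))

/-- Array 29 serves as an iterator: it points to the first arc of each list that has not yet been
followed, with indices shifted by one so that `0` means the end. -/
def visitProg : Prog :=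
  .loop (.lt (.const 0) (.var 16)) <|
    .seq (.assign 17 (.load 31 (.sub (.var 16) (.const 1)))) <|
    .seq (.assign 18 (.load 29 (.var 17))) <|
    .branch (.eq (.var 18) (.const 0)) (.assign 16 (.sub (.var 16) (.const 1))) <|
    .seq (.store 29 (.var 17) (.load 28 (.sub (.var 18) (.const 1)))) <|
    .seq (.assign 19 (.load 27 (.sub (.var 18) (.const 1)))) <|
    .branch (.eq (.load 30 (.var 19)) (.const 0))
      (.seq (.store 30 (.var 19) (.const 1)) <|
       .seq (.store 31 (.var 16) (.var 19)) <|
       .assign 16 (.add (.var 16) (.const 1)))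
      .skip

/-- Residual reachability from the source of the flow. -/
def searchProg : Prog :=
  .seq (.map 26 15 (.mul (.const 2) (.var 1)) (ifResidual
    (.ifEq (.mod (.var 15) (.const 2)) (.const 0) (.load 0 parentEdge) (.load 1 parentEdge))
    (.var 0))) <|
  .seq (.map 27 15 (.mul (.const 2) (.var 1))
    (.ifEq (.mod (.var 15) (.const 2)) (.const 0) (.load 1 parentEdge) (.load 0 parentEdge))) <|
  .seq (.map 29 15 (.add (.var 0) (.const 1)) (.const 0)) <|
  .seq (.map 30 15 (.var 0) (.const 0)) <|
  .seq linkProg <|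
  .seq (.store 31 (.const 0) (.var 2)) <|
  .seq (.store 30 (.var 2) (.const 1)) <|
  .seq (.assign 16 (.const 1)) <|
  visitProg

/-- Coded vertices are merged into the flow source `3n` or the sink `3n+1` according to the current
bit. The sink is also the vertex that receives the edges between different classes. -/
def phaseProg : Prog :=
  .seq (.map 25 15 three_n (.ifEq (.load 22 (.var 15)) (.const 1)
    (.ifEq (.mod (.div (.load 23 (.var 15)) (.var 14)) (.const 2)) (.const 1)
      three_n (.add three_n (.const 1))) (.var 15))) <|
  .seq buildProg <|
  .seq (.assign 3 (.add three_n (.const 1))) <|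
  .seq .callFlow <|
  .seq searchProg <|
  .seq (.map 24 15 three_n (.ifEq (.load 30 (.load 25 (.var 15))) (.const 1)
    (.add (.load 24 (.var 15)) (.var 14)) (.load 24 (.var 15)))) <|
  .assign 14 (.mul (.const 2) (.var 14))

def refineProg : Prog :=
  .seq (.assign 14 (.const 1)) <| .for 13 (.add (.var 6) (.const 1)) phaseProg

/-- Labels with the top bit name the owner of a candidate set by the remaining bits; all other
vertices get the dummy owner `n`. Array 6 collects the cut weights of the candidate sets. -/
def ownersProg : Prog :=
  .seq (.map 32 15 three_n (.ifLt (.load 24 (.var 15)) (.var 7) (.var 4)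
    (.sub (.load 24 (.var 15)) (.var 7)))) <|
  .seq (.map 6 15 (.add three_n (.const 4)) (.const 0)) <|
  .seq (.collect 6 15 (.var 10) (.load 32 (.load 19 (.var 15)))
    (.ifEq (.load 32 (.load 19 (.var 15))) (.load 32 (.load 20 (.var 15))) (.const 0)
      (.load 21 (.var 15)))) <|
  .collect 6 15 (.var 10) (.load 32 (.load 20 (.var 15)))
    (.ifEq (.load 32 (.load 19 (.var 15))) (.load 32 (.load 20 (.var 15))) (.const 0)
      (.load 21 (.var 15)))

/-- With all labels zero no edge is redirected to the sink. Merging the sources of all instances is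
harmless because the instances lie in different components. The bound `k` is the total weight, which
no estimate exceeds. -/
def verifyProg : Prog :=
  .seq (.map 25 15 three_n (.ifLt (.var 15) (.var 4) (ifSource three_n (.var 15)) (.var 15))) <|
  .seq (.map 24 15 three_n (.const 0)) <|
  .seq buildProg <|
  .seq (.map 5 15 (.add three_n (.const 4)) (.ifEq (.var 15) three_n (.const 1)
    (.ifLt (.var 15) (.var 4) (.ifEq (.load 22 (.var 15)) (.const 1)
      (ifSource (.const 0) (.const 1)) (.const 0)) (.const 0)))) <|
  .seq (.assign 3 (.var 11)) <|
  .callVerify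

/-- Array 33 is cleared beyond `n` because an owner is any number below `2 ^ B ≤ 2n`; the value `0`
means that the set is not moved. -/
def acceptProg : Prog :=
  .seq (.map 33 15 (.add three_n (.const 1)) (.const 0)) <|
  .for 15 (.var 4) <| .branch (.mul (.load 5 (.var 15)) (.load 7 (.var 15)))
    (.seq (.store 33 (.var 15) (.var 9)) <|
     .seq (.store 14 (.add (.var 4) (.var 9)) (.load 14 (.var 15))) <|
     .seq (.store 13 (.add (.var 4) (.var 9)) (.load 6 (.var 15))) <|
     .assign 9 (.add (.var 9) (.const 1)))
    .skip

/-- The new block of an endpoint in the block `e` of an edge whose other endpoint lies in `f`. -/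
def newBlock (e f : Expr) : Expr :=
  .ifEq (.load 33 (.load 32 e)) (.load 33 (.load 32 f)) e
    (.ifEq (.load 33 (.load 32 e)) (.const 0) e (.add (.var 4) (.load 33 (.load 32 e))))

/-- The new block of either end depends on the old blocks of both ends, which is why the results
pass through temporary arrays. -/
def updateProg : Prog :=
  .seq (.map 34 15 (.var 5) (newBlock (.load 10 (.var 15)) (.load 11 (.var 15)))) <|
  .seq (.map 35 15 (.var 5) (newBlock (.load 11 (.var 15)) (.load 10 (.var 15)))) <|
  .seq (.map 10 15 (.var 5) (.load 34 (.var 15))) <|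
  .seq (.map 11 15 (.var 5) (.load 35 (.var 15))) <|
  .map 14 15 two_n (.ifEq (.load 33 (.load 32 (.var 15))) (.const 0) (.load 14 (.var 15))
    (.load 33 (.load 32 (.var 15))))

def roundProg (κ : Kind) : Prog :=
  .seq (sampleProg 15) <| .seq (sampleProg 16) <| .seq sourcesProg <| .seq remaindersProg <|
  .seq (contractProg κ) <| .seq codesProg <| .seq refineProg <| .seq ownersProg <|
  .seq verifyProg <| .seq acceptProg updateProg

/-- `B` becomes the least exponent with `n < 2 ^ B`, and the number of rounds is `r * B ^ 3`. -/
def initProg (r : ℕ) : Prog :=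
  .seq (.assign 4 (.var 0)) <| .seq (.assign 5 (.var 1)) <|
  .seq (.map 10 15 (.var 5) (.load 0 (.var 15))) <|
  .seq (.map 11 15 (.var 5) (.load 1 (.var 15))) <|
  .seq (.map 12 15 (.var 5) (.load 2 (.var 15))) <|
  .seq (.collect 13 15 (.var 5) (.load 10 (.var 15)) (.load 12 (.var 15))) <|
  .seq (.collect 13 15 (.var 5) (.load 11 (.var 15)) (.load 12 (.var 15))) <|
  .seq (.collect 37 15 (.var 5) (.const 0) (.load 12 (.var 15))) <|
  .seq (.assign 11 (.load 37 (.const 0))) <|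
  .seq (.assign 9 (.const 1)) <|
  .seq (.assign 7 (.const 1)) <|
  .seq (.loop (.lt (.var 7) (.add (.var 4) (.const 1)))
    (.seq (.assign 7 (.mul (.const 2) (.var 7))) (.assign 6 (.add (.var 6) (.const 1))))) <|
  .assign 8 (.mul (.const r) (.mul (.var 6) (.mul (.var 6) (.var 6))))

def outputProg : Prog :=
  .seq (.scatter 35 15 (.var 4) (.load 14 (.var 15)) (.var 15)) <|
  .seq (.map 0 15 (.sub (.var 4) (.const 1)) (.load 35 (.add (.var 15) (.const 1)))) <|
  .seq (.map 1 15 (.sub (.var 4) (.const 1))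
    (.load 35 (.load 14 (.add (.var 4) (.add (.var 15) (.const 1)))))) <|
  .seq (.map 2 15 (.sub (.var 4) (.const 1))
    (.load 13 (.add (.var 4) (.add (.var 15) (.const 1))))) <|
  .seq (.assign 0 (.var 4)) <|
  .assign 1 (.sub (.var 4) (.const 1))

def mainProg (κ : Kind) (r : ℕ) : Prog :=
  .seq (initProg r) <| .seq (.for 12 (.var 8) (roundProg κ)) outputProg

end

/-! ### Sampling and sources -/

/-- The values of the registers that are fixed after the initialization. -/
structure Regs (w : ℕ) (σ : State) (n m B P W : ℕ) : Prop where
  fits : σ.Fits w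
  n_eq : σ.var 4 = n
  m_eq : σ.var 5 = m
  B_eq : σ.var 6 = B
  pow_eq : σ.var 7 = P
  two_pow : P = 2 ^ B
  lt_pow : n < P
  pow_le : P ≤ 2 * n
  W_eq : σ.var 11 = W
  pos : 0 < n
  big : 100 * (n + m + W + P + B + 2) ≤ 2 ^ w
  prod : 8 * ((n + 1) * (W + 1)) ≤ 2 ^ w

theorem Regs.frame {w : ℕ} {σ σ' : State} {n m B P W : ℕ} (h : Regs w σ n m B P W) {p : Prog}
    (hf : Frame p σ σ') (hfit : σ'.Fits w) (hp : (p.setsVar 4 || p.setsVar 5 || p.setsVar 6 ||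
      p.setsVar 7 || p.setsVar 11) = false) : Regs w σ' n m B P W := by
  simp only [Bool.or_eq_false_iff] at hp
  obtain ⟨⟨⟨⟨h4, h5⟩, h6⟩, h7⟩, h11⟩ := hp
  exact ⟨hfit, (hf.var _ h4).trans h.n_eq, (hf.var _ h5).trans h.m_eq, (hf.var _ h6).trans h.B_eq,
    (hf.var _ h7).trans h.pow_eq, h.two_pow,
    h.lt_pow, h.pow_le, (hf.var _ h11).trans h.W_eq, h.pos, h.big, h.prod⟩

section

variable {κ : Kind} {M : Machine κ} {σ : State} {n m B P W : ℕ}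

theorem runs_sources (hr : Regs M.w σ n m B P W)
    (hne : ∀ i < σ.var 9, ∃ u < n, σ.arr 14 u = i)
    (hcnt : σ.var 9 ≤ n) :
    M.Runs sourcesProg σ (n * 6 + 4) fun σ' => ∀ i < σ.var 9,
      σ'.arr 17 i < n ∧ σ.arr 14 (σ'.arr 17 i) = i ∧
      ((∃ u < n, σ.arr 14 u = i ∧ σ.arr 15 u = 1) → σ.arr 15 (σ'.arr 17 i) = 1) := by
  have hbig := hr.big
  refine (Machine.Runs.seq (t₁ := n * 3 + 2) (t₂ := n * 3 + 2)
    (Machine.runs_scatter (K := n) (fun u => σ.arr 14 u) (fun u => u) hr.fits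
    (by simp [Expr.eval, hr.n_eq]) rfl rfl rfl
    (by intro i hi hf; simp [Expr.eval, State.setVar_var])
    (by intro i hi hf; simp [Expr.eval, State.setVar_var])
    (fun σ₁ hf hfr h => h)) ?_).mono (by omega) fun _ _ _ h => h
  intro σ₁ hfr hfit h1
  have hr1 := hr.frame hfr hfit rfl
  have e14 : σ₁.arr 14 = σ.arr 14 := hfr.arr 14 rfl
  have e15 : σ₁.arr 15 = σ.arr 15 := hfr.arr 15 rfl
  refine Machine.runs_scatter (K := n) (fun u => if σ.arr 15 u = 1 then σ.arr 14 u else n)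
    (fun u => u) hfit
    (by simp [Expr.eval, hr1.n_eq]) rfl rfl rfl
    (by
      intro i hi hf
      simp (disch := omega) [Expr.eval, Expr.eval_ifEq M.one_lt hf, State.setVar_var, e14, e15,
        hr1.n_eq, Nat.mod_eq_of_lt])
    (by intro i hi hf; simp [Expr.eval, State.setVar_var]) ?_
  intro σ₂ hf2 hfr2 h2 i hi
  rcases h2 i with ⟨h3, h4⟩ | ⟨u, hu, h3, h4⟩
  · rw [h3]
    have hnot : ¬∃ u < n, σ.arr 14 u = i ∧ σ.arr 15 u = 1 := by
      rintro ⟨u, hu, h5, h6⟩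
      exact h4 u hu (by simp [h5, h6])
    rcases h1 i with ⟨-, h5⟩ | ⟨u, hu, h5, h6⟩
    · obtain ⟨u, hu, h6⟩ := hne i hi
      exact absurd h6 (h5 u hu)
    · rw [h6]
      exact ⟨hu, h5, fun h => absurd h hnot⟩
  · rw [h4]
    by_cases h15 : σ.arr 15 u = 1
    · simp only [h15, if_true] at h3
      exact ⟨hu, h3, fun _ => h15⟩
    · simp only [h15, if_false] at h3
      omega

end

section

variable {κ : Kind} {M : Machine κ} {p : Prog} {σ : State} {Q : State → Prop} {n m B P W : ℕ}

theorem Machine.runs_flip (hσ : σ.Fits M.w) {x : ℕ}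
    (hQ : Q { σ.tick.setVar x (if M.ω σ.bits then 1 else 0) with bits := σ.bits + 1 }) :
    M.Runs (.flip x) σ 1 Q :=
  Machine.runs_of_exec (.flip ..) hσ le_rfl hQ

theorem level_lt (β : ℕ → Bool) (o : ℕ) : ∀ K, level β o K < 2 ^ K
  | 0 => by simp [level]
  | K + 1 => by
    have := level_lt β o K
    rw [level, pow_succ]
    split_ifs <;> omega

/-- The assumptions say `2 ^ (K - 1) ≤ B < 2 ^ K`, so the doubling loop flips exactly `K` coins. The
number of coins used is the same for all outcomes, which later permits counting over bit vectors of
fixed length. -/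
theorem runs_sample {a : ℕ} (hr : Regs M.w σ n m B P W) {K : ℕ} (hK : 2 ^ K ≤ 2 * B)
    (hBK : B < 2 ^ K) :
    M.Runs (sampleProg a) σ (100 * (n * B + K + n + 1)) fun σ' =>
      σ'.bits = σ.bits + (K + n * B) ∧ ∀ u < n, σ'.arr a u ≤ 1 ∧
        (σ'.arr a u = 1 ↔ Sampled M.ω σ.bits K B u) := by
  have hbig := hr.big
  have hone := M.one_lt
  have h0 : M.Runs (.assign 16 (.const 0)) σ 1 fun σ' => σ' = σ.tick.setVar 16 0 :=
    Machine.runs_assign hr.fits (by simp [Expr.eval])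
  refine (h0.seq (t₂ := 1 + (K * 4 + 1 + (n * (1 + (B * 4 + 2) + 2) + 2))) ?_).mono
    (by ring_nf; omega) fun _ _ _ h => h
  rintro _ hf1 hfit1 rfl
  have h0 : M.Runs (.assign 17 (.const 1)) (σ.tick.setVar 16 0) 1 fun σ' =>
      σ' = (σ.tick.setVar 16 0).tick.setVar 17 1 :=
    Machine.runs_assign hfit1 (by simp (disch := omega) [Expr.eval, Nat.mod_eq_of_lt])
  refine h0.seq ?_
  rintro _ hf2 hfit2 rfl
  refine Machine.Runs.seq (R := fun σ₁ => σ₁.var 16 = level M.ω σ.bits K ∧ σ₁.bits = σ.bits + K ∧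
      σ₁.var 6 = B ∧ σ₁.var 4 = n) ?_ ?_
  · have hl := Machine.runs_loop (M := M) (c := 3) (σ := (σ.tick.setVar 16 0).tick.setVar 17 1)
      (e := .lt (.var 17) (.add (.var 6) (.const 1)))
      (p := .seq (.flip 18) <| .seq (.assign 16 (.add (.mul (.const 2) (.var 16)) (.var 18))) <|
        .assign 17 (.mul (.const 2) (.var 17)))
      (Q := fun σ₁ => σ₁.var 16 = level M.ω σ.bits K ∧ σ₁.bits = σ.bits + K ∧
        σ₁.var 6 = B ∧ σ₁.var 4 = n)
      (fun σ₁ => ∃ k ≤ K, σ₁.var 16 = level M.ω σ.bits k ∧ σ₁.var 17 = 2 ^ k ∧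
        σ₁.bits = σ.bits + k ∧ σ₁.var 6 = B ∧ σ₁.var 4 = n) (fun σ₁ => K - (σ₁.bits - σ.bits)) hfit2
      ⟨0, Nat.zero_le _, by simp [State.setVar_var, level, hr.n_eq, hr.B_eq]⟩ ?_ ?_
    · simpa using hl
    · rintro σ₁ hfit hfr ⟨k, hk, h16, h17, hb, h6, h4⟩ hc
      simp (disch := omega) only [Expr.eval, h17, h6, Nat.mod_eq_of_lt] at hc
      have hkB : 2 ^ k ≤ B := by by_contra h; simp [show ¬2 ^ k < B + 1 by omega] at hc
      have hkK : k < K := by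
        by_contra h
        obtain rfl : k = K := by omega
        omega
      have hlev := level_lt M.ω σ.bits k
      refine Machine.Runs.seq (t₁ := 1) (t₂ := 2) (Machine.runs_flip hfit.tick
        (Q := fun σ₂ => σ₂ = { σ₁.tick.tick.setVar 18 (if M.ω σ₁.tick.bits then 1 else 0) with
          bits := σ₁.tick.bits + 1 }) rfl) ?_
      rintro _ - hfit3 rfl
      refine Machine.Runs.seq (t₁ := 1) (t₂ := 1) (Machine.runs_assign hfit3
        (Q := fun σ₃ => σ₃.var 16 = level M.ω σ.bits (k + 1) ∧ σ₃.var 17 = 2 ^ k ∧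
          σ₃.bits = σ.bits + (k + 1) ∧ σ₃.var 6 = B ∧ σ₃.var 4 = n) ?_) ?_
      · refine ⟨?_, ?_, ?_, ?_, ?_⟩
        · have : (if M.ω (σ.bits + k) = true then 1 else 0) ≤ 1 := by split_ifs <;> omega
          simp (disch := omega) [Expr.eval, State.setVar_var, h16, hb, level, Nat.mod_eq_of_lt]
        · simpa [State.setVar_var] using h17
        · simp [hb]; omega
        · simpa [State.setVar_var] using h6
        · simpa [State.setVar_var] using h4
      · rintro σ₃ hf3 hfit3 ⟨h16, h17, hb3, h6, h4⟩
        refine Machine.runs_assign hfit3 ⟨⟨k + 1, hkK, ?_, ?_, ?_, ?_, ?_⟩, ?_⟩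
        · simpa [State.setVar_var] using h16
        · simp (disch := omega) [Expr.eval, State.setVar_var, h17, Nat.mod_eq_of_lt, pow_succ,
            Nat.mul_comm]
        · simpa using hb3
        · simpa [State.setVar_var] using h6
        · simpa [State.setVar_var] using h4
        · simp [hb3, hb]; omega
    · rintro σ₁ hfit hfr ⟨k, hk, h16, h17, hb, h6, h4⟩ hc
      simp (disch := omega) only [Expr.eval, h17, h6, Nat.mod_eq_of_lt] at hc
      have hkB : B < 2 ^ k := by
        by_contra h; simp [show 2 ^ k < B + 1 by omega] at hc
      have hkK : k = K := by
        by_contra h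
        have : 2 ^ (k + 1) ≤ 2 ^ K := Nat.pow_le_pow_right (by omega) (by omega)
        rw [pow_succ] at this
        omega
      subst hkK
      exact ⟨h16, hb, h6, h4⟩
  · rintro σ₁ hfr hfit ⟨h16, hb, h6, h4⟩
    refine Machine.runs_for (K := n) (fun x σ₂ => σ₂.bits = σ.bits + K + x * B ∧
      ∀ u < x, σ₂.arr a u ≤ 1 ∧ (σ₂.arr a u = 1 ↔ Sampled M.ω σ.bits K B u)) hfit
      (by simp [Expr.eval, h4]) (by simp [Expr.indep, Prog.setsVar, Prog.for])
      (by simp [Prog.setsVar, Prog.for])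
      (by simp [hb]) ?_ ?_
    · rintro x hx σ₂ hfit2 hfr2 hx2 ⟨hb2, h2⟩
      have e6 : σ₂.var 6 = B := (hfr2.var 6 rfl).trans h6
      have e16 : σ₂.var 16 = level M.ω σ.bits K := (hfr2.var 16 rfl).trans h16
      refine Machine.Runs.seq (t₁ := 1) (Machine.runs_store hfit2.tick
        (Q := fun σ₃ => (∀ u < x, σ₃.arr a u = σ₂.arr a u) ∧ σ₃.arr a x = 1 ∧
          σ₃.var = σ₂.var ∧ σ₃.bits = σ₂.bits) ?_) ?_
      · simp (disch := omega) [Expr.eval, State.setArr_arr, hx2, Nat.mod_eq_of_lt]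
        intro u hu; omega
      rintro σ₃ - hfit3 ⟨h3, h3x, h3v, h3b⟩
      refine Machine.runs_for (K := B) (c := 2)
        (fun t σ₄ => σ₄.bits = σ.bits + K + x * B + t ∧ (∀ u < x, σ₄.arr a u = σ₂.arr a u) ∧
          σ₄.arr a x ≤ 1 ∧ (σ₄.arr a x = 1 ↔ ∀ t' < t, t' < level M.ω σ.bits K →
            M.ω (σ.bits + K + x * B + t') = true)) hfit3
        (by simp [Expr.eval, h3v, e6]) rfl rfl ?_ ?_ ?_
      · simp [h3b, hb2, h3x]
        exact h3
      · rintro t ht σ₄ hfit4 hfr4 ht4 ⟨hb4, h4, h4x, h4s⟩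
        have e15 : σ₄.var 15 = x := (hfr4.var 15 rfl).trans (by rw [h3v, hx2])
        have e16' : σ₄.var 16 = level M.ω σ.bits K := (hfr4.var 16 rfl).trans (by rw [h3v, e16])
        refine Machine.Runs.seq (t₁ := 1) (t₂ := 1) (Machine.runs_flip hfit4.tick
          (Q := fun σ₅ => σ₅.var 15 = x ∧ σ₅.var 16 = level M.ω σ.bits K ∧ σ₅.var 19 = t ∧
            σ₅.var 18 = (if M.ω (σ.bits + K + x * B + t) then 1 else 0) ∧ σ₅.arr = σ₄.arr ∧
            σ₅.bits = σ.bits + K + x * B + t + 1)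
          (by simp [State.setVar_var, e15, e16', ht4, hb4])) ?_
        rintro σ₅ - hfit5 ⟨v15, v16, v19, v18, harr, hb5⟩
        refine Machine.runs_store hfit5 ⟨?_, ?_, ?_⟩
        · simp [hb5]; omega
        · intro u hu
          simp [State.setArr_arr, Expr.eval, v15, show u ≠ x by omega, harr, h4 u hu]
        · have hstep : (∀ t' < t + 1, t' < level M.ω σ.bits K →
              M.ω (σ.bits + K + x * B + t') = true) ↔
              (∀ t' < t, t' < level M.ω σ.bits K → M.ω (σ.bits + K + x * B + t') = true) ∧
              (t < level M.ω σ.bits K → M.ω (σ.bits + K + x * B + t) = true) := by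
            constructor
            · exact fun h => ⟨fun t' h' => h t' (by omega), h t (by omega)⟩
            · rintro ⟨h, h'⟩ t' ht'
              rcases Nat.lt_succ_iff_lt_or_eq.1 ht' with h1 | rfl
              exacts [h t' h1, h']
          rw [hstep, ← h4s]
          simp only [State.setVar_arr, State.tick_arr, State.setArr_arr, Expr.eval,
            Expr.eval_ifLt M.one_lt hfit5, v15, v16, v18, v19, harr, true_and, if_true]
          by_cases hlt : t < level M.ω σ.bits K
          · by_cases hω : M.ω (σ.bits + K + x * B + t) = true
            · simp (disch := omega) [hlt, hω, h4x, Nat.mod_eq_of_lt]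
            · simp [hlt, hω]
          · simp [hlt, h4x]
      · rintro σ₄ hfit4 hfr4 ⟨hb4, h4, h4x, h4s⟩
        refine ⟨by simp [hb4]; ring, fun u hu => ?_⟩
        rcases Nat.lt_succ_iff_lt_or_eq.1 hu with h1 | rfl
        · have := h2 u h1
          simpa [h4 u h1] using this
        · exact ⟨h4x, h4s⟩
    · rintro σ₂ hfit2 hfr2 ⟨hb2, h2⟩
      exact ⟨by simp [hb2]; ring, h2⟩

end

/-! ### Contracted graphs -/

/-- Number of edges to the outside that make up the total weight `d`. -/
def portions : Kind → ℕ → ℕ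
  | .unweighted, d => d
  | .weighted, d => if d = 0 then 0 else 1

theorem portions_mono (κ : Kind) {d d' : ℕ} (h : d ≤ d') : portions κ d ≤ portions κ d' := by
  cases κ
  · exact h
  · simp only [portions]; split_ifs <;> omega

section

variable {n m : ℕ} {G : MGraph n m} {c : Cfg} {D : ℕ → Set ℕ} {κ : Kind}

theorem portions_cut_le (hG : G.OfKind κ) (u : ℕ) : portions κ (G.net.cut {u}) ≤
    ∑ e : Fin m, ((if (G.tail e : ℕ) = u then 1 else 0) + if (G.head e : ℕ) = u then 1 else 0) := by
  have hc : ∀ e : Fin m, edgeCost (fun _ => 0) {u} (G.tail e : ℕ) (G.head e : ℕ) ≤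
      (if (G.tail e : ℕ) = u then 1 else 0) + if (G.head e : ℕ) = u then 1 else 0 := by
    intro e
    by_cases h1 : (G.tail e : ℕ) = u <;> by_cases h2 : (G.head e : ℕ) = u <;>
      simp [edgeCost, h1, h2]
  cases κ
  · simp only [portions]
    unfold Net.cut Net.fcut
    refine Finset.sum_le_sum fun e _ => ?_
    have : G.net.w e = 1 := hG e
    rw [this, one_mul]
    exact hc e
  · simp only [portions]
    split_ifs with h
    · exact Nat.zero_le _
    · have : ∃ e ∈ G.net.s, G.net.w e * edgeCost (fun _ => 0) {u} (G.net.x e) (G.net.y e) ≠ 0 := by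
        by_contra! h'
        exact h (Finset.sum_eq_zero h')
      obtain ⟨e, -, he⟩ := this
      have h1 := hc e
      have h2 : edgeCost (fun _ => 0) {u} (G.tail e : ℕ) (G.head e : ℕ) ≠ 0 := by
        intro h; exact he (by rw [show edgeCost _ _ (G.net.x e) (G.net.y e) = 0 from h, mul_zero])
      refine le_trans ?_ (Finset.single_le_sum (fun _ _ => Nat.zero_le _) (Finset.mem_univ e))
      omega

theorem sum_incident_le (T : Finset ℕ) : ∑ u ∈ T, ∑ e : Fin m,
    ((if (G.tail e : ℕ) = u then 1 else 0) + if (G.head e : ℕ) = u then 1 else 0) ≤ 2 * m := by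
  rw [Finset.sum_comm]
  refine (Finset.sum_le_card_nsmul _ _ 2 fun e _ => ?_).trans (by simp [mul_comm])
  rw [Finset.sum_add_distrib, Finset.sum_ite_eq, Finset.sum_ite_eq]
  split_ifs <;> omega

theorem cut_le_totalWeight (Z : Set ℕ) : G.net.cut Z ≤ G.totalWeight := by
  unfold Net.cut Net.fcut
  refine Finset.sum_le_sum fun e _ => ?_
  have : edgeCost (fun _ => 0) Z (G.net.x e) (G.net.y e) ≤ 1 := by
    simp only [edgeCost, if_true]; split_ifs <;> omega
  calc _ ≤ G.net.w e * 1 := Nat.mul_le_mul_left _ this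
    _ = _ := mul_one _

theorem CfgInv.dg_le (h : CfgInv G c D) {x : ℕ} (hx : x < 2 * n) : c.dg x ≤ G.totalWeight := by
  by_cases hv : Valid n c.cnt x
  · rw [h.dg_eq x hv]; exact cut_le_totalWeight _
  · rw [h.dg_zero x hx hv]; exact Nat.zero_le _

/-- For the vertices the bound is the sum of the degrees, `2m`. The contraction of a child `j`
weighs `cut (D j) ≤ cut {a}`, where `a` is the pivot vertex in `j`. Distinct children have distinct
pivot vertices, so this half is at most `2m` as well. -/
theorem CfgInv.sum_portions_le (h : CfgInv G c D) (hG : G.OfKind κ) :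
    ∑ x ∈ Finset.range (2 * n), portions κ (c.dg x - recorded G c x) ≤ 4 * m := by
  have h0 : portions κ 0 = 0 := by cases κ <;> rfl
  rw [two_mul, Finset.sum_range_add]
  have hA : ∑ x ∈ Finset.range n, portions κ (c.dg x - recorded G c x) ≤ 2 * m := by
    refine le_trans (Finset.sum_le_sum fun u hu => ?_) (sum_incident_le (G := G) (Finset.range n))
    have hu := Finset.mem_range.1 hu
    refine le_trans (portions_mono κ (Nat.sub_le _ _)) ?_
    rw [h.dg_eq u (valid_of_lt hu), show blk n D u = {u} by ext; simp [blk, hu]]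
    exact portions_cut_le hG u
  have hB : ∑ j ∈ Finset.range n, portions κ (c.dg (n + j) - recorded G c (n + j)) ≤ 2 * m := by
    have hpiv : ∀ j, ∃ a, Valid n c.cnt (n + j) →
        c.loc a = j ∧ G.net.cut (D j) ≤ G.net.cut {a} := by
      intro j
      by_cases hv : Valid n c.cnt (n + j)
      · have h1 := hv.1
        have h2 := hv.2
        obtain ⟨a, b, ha, hb, hla, hlb, hlb'⟩ := h.pivot j (by omega) (by omega)
        refine ⟨a, fun _ => ⟨hla, hlb' {a} rfl fun hba => ?_⟩⟩
        have hba : b = a := hba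
        subst hba
        exact h.parent_not_mem (by omega) (by omega) hb hlb (hla ▸ h.mem_self hb)
      · exact ⟨0, fun h => absurd h hv⟩
    choose a ha using hpiv
    classical
    have hfil : ∑ j ∈ (Finset.range n).filter (fun j => Valid n c.cnt (n + j)),
        portions κ (c.dg (n + j) - recorded G c (n + j)) =
        ∑ j ∈ Finset.range n, portions κ (c.dg (n + j) - recorded G c (n + j)) := by
      refine Finset.sum_filter_of_ne fun j hj hne => ?_
      by_contra hv
      refine hne ?_
      rw [h.dg_zero _ (by have := Finset.mem_range.1 hj; omega) hv, Nat.zero_sub, h0]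
    rw [← hfil]
    refine le_trans (Finset.sum_le_sum fun j hj => ?_) (le_trans (Finset.sum_image (f := fun u =>
      ∑ e : Fin m, ((if (G.tail e : ℕ) = u then 1 else 0) + if (G.head e : ℕ) = u then 1 else 0))
      (g := a) ?_).ge (sum_incident_le _))
    · have hv := (Finset.mem_filter.1 hj).2
      refine le_trans (portions_mono κ (Nat.sub_le _ _)) ?_
      rw [h.dg_eq _ hv, blk_add]
      exact (portions_mono κ (ha j hv).2).trans (portions_cut_le hG _)
    · intro j hj j' hj' hjj
      rw [← (ha j (Finset.mem_filter.1 hj).2).1, ← (ha j' (Finset.mem_filter.1 hj').2).1, hjj]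
  omega

end

/-- The partition tree in the memory. -/
def State.cfg (σ : State) : Cfg := ⟨σ.arr 14, σ.arr 13, σ.arr 10, σ.arr 11, σ.var 9⟩

@[simp] theorem State.cfg_loc (σ : State) : σ.cfg.loc = σ.arr 14 := rfl
@[simp] theorem State.cfg_dg (σ : State) : σ.cfg.dg = σ.arr 13 := rfl
@[simp] theorem State.cfg_ex (σ : State) : σ.cfg.ex = σ.arr 10 := rfl
@[simp] theorem State.cfg_ey (σ : State) : σ.cfg.ey = σ.arr 11 := rfl
@[simp] theorem State.cfg_cnt (σ : State) : σ.cfg.cnt = σ.var 9 := rfl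

/-- The contracted graph in the memory. -/
def State.net (σ : State) : Net ℕ ℕ := ⟨Finset.range (σ.var 10), σ.arr 19, σ.arr 20, σ.arr 21⟩

theorem sum_change {N x : ℕ} {f g : ℕ → ℕ} (hx : x < N) (h : ∀ y, y ≠ x → f y = g y) :
    ∑ y ∈ Finset.range N, f y + g x = ∑ y ∈ Finset.range N, g y + f x := by
  have hx := Finset.mem_range.2 hx
  have e : ∑ y ∈ (Finset.range N).erase x, f y = ∑ y ∈ (Finset.range N).erase x, g y :=
    Finset.sum_congr rfl fun y hy => h y (Finset.ne_of_mem_erase hy)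
  rw [← Finset.add_sum_erase _ f hx, ← Finset.add_sum_erase _ g hx, e]
  ring

section

variable {κ : Kind} {M : Machine κ} {σ : State} {n m B P W : ℕ} {G : MGraph n m} {D : ℕ → Set ℕ}

theorem runs_remainders (hr : Regs M.w σ n m B P W) (h : CfgInv G σ.cfg D)
    (hw : ∀ e : Fin m, σ.arr 12 e = G.weight e) (hW : W = G.totalWeight) :
    M.Runs remaindersProg σ (12 * n + 6 * m + 8) fun σ' =>
      ∀ x < 2 * n, σ'.arr 18 x = σ.cfg.dg x - recorded G σ.cfg x := by
  have hbig := hr.big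
  have hex : ∀ e < m, σ.arr 10 e < 2 * n ∧ σ.arr 11 e < 2 * n := fun e he =>
    ⟨h.valid_lt (h.edge_valid ⟨e, he⟩).1, h.valid_lt (h.edge_valid ⟨e, he⟩).2.1⟩
  have hsum : ∀ (f : ℕ → ℕ) (x : ℕ), (∑ e ∈ Finset.range m, if f e = x then σ.arr 12 e else 0) ≤ W := by
    intro f x
    rw [Finset.sum_range, hW]
    refine Finset.sum_le_sum fun e _ => ?_
    split_ifs
    exacts [(hw e).le, Nat.zero_le _]
  have hzero : ∀ a, a = 10 ∨ a = 11 → ∀ x, 2 * n ≤ x →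
      (∑ e ∈ Finset.range m, if σ.arr a e = x then σ.arr 12 e else 0) = 0 := by
    intro a ha x hx
    refine Finset.sum_eq_zero fun e he => if_neg ?_
    have := hex e (Finset.mem_range.1 he)
    rcases ha with rfl | rfl <;> omega
  refine ((Machine.runs_map (K := 2 * n) (fun _ => 0) hr.fits
    (by simp (disch := omega) [two_n, Expr.eval, hr.n_eq, Nat.mod_eq_of_lt]) rfl rfl
    (by simp [Expr.eval]) (Q := fun σ₁ => (∀ i < 2 * n, σ₁.arr 36 i = 0) ∧
      ∀ i, 2 * n ≤ i → σ₁.arr 36 i = σ.arr 36 i) (fun σ₁ hfit hfr h1 h2 => ⟨h1, h2⟩)).seq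
    (t₂ := (m * 3 + 2) + ((m * 3 + 2) + (2 * n * 3 + 2))) ?_).mono (by omega) fun _ _ _ h => h
  rintro σ₁ hfr hfit ⟨h1, h1'⟩
  have hr1 := hr.frame hfr hfit rfl
  have e10 : σ₁.arr 10 = σ.arr 10 := hfr.arr 10 rfl
  have e11 : σ₁.arr 11 = σ.arr 11 := hfr.arr 11 rfl
  have e12 : σ₁.arr 12 = σ.arr 12 := hfr.arr 12 rfl
  have e13 : σ₁.arr 13 = σ.arr 13 := hfr.arr 13 rfl
  refine (Machine.runs_collect (K := m) (σ.arr 10) (σ.arr 12) hfit (by simp [Expr.eval, hr1.m_eq])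
    rfl rfl rfl (by intro i hi hf; simp [Expr.eval, State.setVar_var, e10])
    (by intro i hi hf; simp [Expr.eval, State.setVar_var, e12]) (fun j => ?_)
    (fun σ₂ _ _ h => h)).seq ?_
  · by_cases hj : j < 2 * n
    · rw [h1 j hj]; have := hsum (σ.arr 10) j; omega
    · rw [hzero 10 (Or.inl rfl) j (by omega)]
      exact hfit.arr _ _
  clear hfr
  rintro σ₂ hfr hfit2 h2
  have hr2 := hr1.frame hfr hfit2 rfl
  have e10 : σ₂.arr 10 = σ.arr 10 := (hfr.arr 10 rfl).trans e10
  have e11 : σ₂.arr 11 = σ.arr 11 := (hfr.arr 11 rfl).trans e11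
  have e12 : σ₂.arr 12 = σ.arr 12 := (hfr.arr 12 rfl).trans e12
  have e13 : σ₂.arr 13 = σ.arr 13 := (hfr.arr 13 rfl).trans e13
  refine (Machine.runs_collect (K := m) (σ.arr 11) (σ.arr 12) hfit2 (by simp [Expr.eval, hr2.m_eq])
    rfl rfl rfl (by intro i hi hf; simp [Expr.eval, State.setVar_var, e11])
    (by intro i hi hf; simp [Expr.eval, State.setVar_var, e12]) (fun j => ?_)
    (fun σ₂ _ _ h => h)).seq ?_
  · by_cases hj : j < 2 * n
    · rw [h2, h1 j hj]
      have := hsum (σ.arr 10) j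
      have := hsum (σ.arr 11) j
      omega
    · rw [hzero 11 (Or.inr rfl) j (by omega)]
      exact hfit2.arr _ _
  clear hfr
  rintro σ₃ hfr hfit3 h3
  have hr3 := hr2.frame hfr hfit3 rfl
  have e13 : σ₃.arr 13 = σ.arr 13 := (hfr.arr 13 rfl).trans e13
  refine Machine.runs_map (K := 2 * n) (fun x => σ.arr 13 x - σ₃.arr 36 x) hfit3
    (by simp (disch := omega) [two_n, Expr.eval, hr3.n_eq, Nat.mod_eq_of_lt]) rfl rfl
    (by intro i hi hf; simp [Expr.eval, State.setVar_var, e13]) (fun σ₄ _ _ h4 _ x hx => ?_)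
  rw [h4 x hx, h3, h2, h1 x hx, Finset.sum_range, Finset.sum_range, zero_add,
    ← Finset.sum_add_distrib]
  rw [State.cfg_dg, recorded]
  congr 1
  refine Finset.sum_congr rfl fun e _ => ?_
  rw [hw e, State.cfg_ex, State.cfg_ey]
  by_cases h5 : σ.arr 10 e = x <;> by_cases h6 : σ.arr 11 e = x <;> simp [h5, h6, mul_two]

end

/-- Weights that are possible in the setting `κ`. -/
def Kind.Allows (κ : Kind) (w : ℕ) : Prop := 0 < w ∧ (κ = .unweighted → w = 1)

theorem MGraph.ofKind_iff {n m : ℕ} {G : MGraph n m} {κ : Kind} :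
    G.OfKind κ ↔ ∀ e, κ.Allows (G.weight e) := by
  cases κ
  · simp only [OfKind, Kind.Allows]
    exact forall_congr' fun e => ⟨fun h => ⟨by omega, fun _ => h⟩, fun h => h.2 trivial⟩
  · simp [OfKind, Kind.Allows]

/-- The contracted graph of the partition tree `c` is in the memory. -/
structure Contracted (κ : Kind) {n m : ℕ} (G : MGraph n m) (c : Cfg) (σ : State) : Prop where
  le : σ.var 10 ≤ 5 * m
  isContraction : IsContraction G c σ.net
  allows : ∀ k < σ.var 10, κ.Allows (σ.arr 21 k)
  x_lt : ∀ k < σ.var 10, σ.arr 19 k < 2 * n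
  y_lt : ∀ k < σ.var 10, σ.arr 20 k < 3 * n
  ne : ∀ k < σ.var 10, σ.arr 19 k ≠ σ.arr 20 k
  total : ∑ k ∈ Finset.range (σ.var 10), σ.arr 21 k ≤ (2 * n + 1) * G.totalWeight

theorem Contracted.frame {κ : Kind} {n m : ℕ} {G : MGraph n m} {c : Cfg} {σ σ' : State}
    (h : Contracted κ G c σ) {p : Prog} (hf : Frame p σ σ')
    (hp : (p.setsVar 10 || p.setsArr 19 || p.setsArr 20 || p.setsArr 21) = false) :
    Contracted κ G c σ' := by
  simp only [Bool.or_eq_false_iff] at hp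
  obtain ⟨⟨⟨h10, h19⟩, h20⟩, h21⟩ := hp
  have e10 := hf.var _ h10
  have e19 := hf.arr _ h19
  have e20 := hf.arr _ h20
  have e21 := hf.arr _ h21
  have en : σ'.net = σ.net := by simp only [State.net, e10, e19, e20, e21]
  constructor
  · rw [e10]; exact h.le
  · rw [en]; exact h.isContraction
  all_goals first | rw [e10, e21] | rw [e10, e19, e20] | rw [e10, e19] | rw [e10, e20]
  · exact h.allows
  · exact h.x_lt
  · exact h.y_lt
  · exact h.ne
  · exact h.total

section

variable {κ : Kind} {M : Machine κ} {σ : State} {n m B P W : ℕ} {G : MGraph n m} {D : ℕ → Set ℕ}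
  {c : Cfg}

/-- The invariant balances, for every `ψ`, the weight already emitted against the weight still in
array 18. The potential counts the indices left and the edges still to be emitted. -/
theorem runs_outside (hr : Regs M.w σ n m B P W) (r : ℕ → ℕ) (h15 : σ.var 15 = 0)
    (h10 : σ.var 10 = m) (hrem : ∀ x < 2 * n, σ.arr 18 x = r x)
    (hloc : ∀ x < 2 * n, 0 < r x → σ.arr 14 x < n)
    (hsum : ∑ x ∈ Finset.range (2 * n), portions κ (r x) ≤ 4 * m) :
    M.Runs (outsideProg κ) σ (14 * n + 28 * m + 1) fun σ' =>
      m ≤ σ'.var 10 ∧ σ'.var 10 ≤ 5 * m ∧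
      (∀ k < m, σ'.arr 19 k = σ.arr 19 k ∧ σ'.arr 20 k = σ.arr 20 k ∧ σ'.arr 21 k = σ.arr 21 k) ∧
      (∀ k, m ≤ k → k < σ'.var 10 → σ'.arr 19 k < 2 * n ∧ 0 < r (σ'.arr 19 k) ∧
        σ'.arr 20 k = 2 * n + σ.arr 14 (σ'.arr 19 k) ∧ κ.Allows (σ'.arr 21 k)) ∧
      ∀ ψ : ℕ → ℕ → ℕ, ∑ k ∈ Finset.range (σ'.var 10 - m),
          σ'.arr 21 (m + k) * ψ (σ'.arr 19 (m + k)) (σ'.arr 20 (m + k)) =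
        ∑ x ∈ Finset.range (2 * n), r x * ψ x (2 * n + σ.arr 14 x) := by
  have hbig := hr.big
  have hone := M.one_lt
  have h0 : portions κ 0 = 0 := by cases κ <;> rfl
  have hps : ∀ σ₁ : State, (∀ x < 2 * n, σ₁.arr 18 x = r x) →
      ∑ x ∈ Finset.range (2 * n), portions κ (σ₁.arr 18 x) =
        ∑ x ∈ Finset.range (2 * n), portions κ (r x) := fun σ₁ h =>
    Finset.sum_congr rfl fun x hx => by rw [h x (Finset.mem_range.1 hx)]
  have key := Machine.runs_loop (M := M) (σ := σ) (c := 6) (e := .lt (.var 15) two_n)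
    (p := .branch (.eq (.load 18 (.var 15)) (.const 0)) (.assign 15 (.add (.var 15) (.const 1))) <|
    .seq (.store 19 (.var 10) (.var 15)) <|
    .seq (.store 20 (.var 10) (.add two_n (.load 14 (.var 15)))) <|
    .seq (.store 21 (.var 10) (portion κ)) <|
    .seq (.store 18 (.var 15) (.sub (.load 18 (.var 15)) (.load 21 (.var 10)))) <|
    .assign 10 (.add (.var 10) (.const 1)))
    (Q := fun σ' =>
      m ≤ σ'.var 10 ∧ σ'.var 10 ≤ 5 * m ∧
      (∀ k < m, σ'.arr 19 k = σ.arr 19 k ∧ σ'.arr 20 k = σ.arr 20 k ∧ σ'.arr 21 k = σ.arr 21 k) ∧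
      (∀ k, m ≤ k → k < σ'.var 10 → σ'.arr 19 k < 2 * n ∧ 0 < r (σ'.arr 19 k) ∧
        σ'.arr 20 k = 2 * n + σ.arr 14 (σ'.arr 19 k) ∧ κ.Allows (σ'.arr 21 k)) ∧
      ∀ ψ : ℕ → ℕ → ℕ, ∑ k ∈ Finset.range (σ'.var 10 - m),
          σ'.arr 21 (m + k) * ψ (σ'.arr 19 (m + k)) (σ'.arr 20 (m + k)) =
        ∑ x ∈ Finset.range (2 * n), r x * ψ x (2 * n + σ.arr 14 x))
    (fun σ' => σ'.var 15 ≤ 2 * n ∧ (∀ x < σ'.var 15, σ'.arr 18 x = 0) ∧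
      (∀ x < 2 * n, σ'.arr 18 x ≤ r x) ∧ m ≤ σ'.var 10 ∧
      (∀ k < m, σ'.arr 19 k = σ.arr 19 k ∧ σ'.arr 20 k = σ.arr 20 k ∧ σ'.arr 21 k = σ.arr 21 k) ∧
      (∀ k, m ≤ k → k < σ'.var 10 → σ'.arr 19 k < 2 * n ∧ 0 < r (σ'.arr 19 k) ∧
        σ'.arr 20 k = 2 * n + σ.arr 14 (σ'.arr 19 k) ∧ κ.Allows (σ'.arr 21 k)) ∧
      (∀ ψ : ℕ → ℕ → ℕ, ∑ k ∈ Finset.range (σ'.var 10 - m),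
          σ'.arr 21 (m + k) * ψ (σ'.arr 19 (m + k)) (σ'.arr 20 (m + k)) +
          ∑ x ∈ Finset.range (2 * n), σ'.arr 18 x * ψ x (2 * n + σ.arr 14 x) =
        ∑ x ∈ Finset.range (2 * n), r x * ψ x (2 * n + σ.arr 14 x)) ∧
      σ'.var 10 - m + ∑ x ∈ Finset.range (2 * n), portions κ (σ'.arr 18 x) =
        ∑ x ∈ Finset.range (2 * n), portions κ (r x))
    (fun σ' => (2 * n - σ'.var 15) + ∑ x ∈ Finset.range (2 * n), portions κ (σ'.arr 18 x))
    hr.fits ?_ ?_ ?_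
  · refine key.mono ?_ fun _ _ _ h => h
    rw [hps σ hrem, h15]
    omega
  · refine ⟨by omega, by omega, fun x hx => (hrem x hx).le, h10.ge, fun k hk => ⟨rfl, rfl, rfl⟩,
      fun k hk hk' => by omega, fun ψ => ?_, ?_⟩
    · rw [h10, Nat.sub_self, Finset.range_zero, Finset.sum_empty, zero_add]
      exact Finset.sum_congr rfl fun x hx => by rw [hrem x (Finset.mem_range.1 hx)]
    · rw [hps σ hrem, h10]; omega
  · rintro σ₁ hfit hfr ⟨i1, i2, i3, i4, i5, i6, i7, i8⟩ hc
    have e4 : σ₁.var 4 = n := (hfr.var 4 rfl).trans hr.n_eq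
    have e14 : σ₁.arr 14 = σ.arr 14 := hfr.arr 14 (by cases κ <;> rfl)
    simp (disch := omega) only [Expr.eval, two_n, e4, Nat.mod_eq_of_lt] at hc
    have hx : σ₁.var 15 < 2 * n := by by_contra h; simp [h] at hc
    refine Machine.runs_branch (t := 5) (fun he => ?_) (fun he => ?_)
    · have hz : σ₁.arr 18 (σ₁.var 15) = 0 := by
        by_contra h
        simp [Expr.eval, h] at he
      refine Machine.Runs.mono (t := 1) (Machine.runs_assign hfit.tick.tick
        (Q := fun σ₂ => σ₂ = σ₁.tick.tick.tick.setVar 15 (σ₁.var 15 + 1)) ?_) (by omega) ?_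
      · simp (disch := omega) [Expr.eval, Nat.mod_eq_of_lt]
      rintro _ - - rfl
      have e10 : (σ₁.tick.tick.tick.setVar 15 (σ₁.var 15 + 1)).var 10 = σ₁.var 10 := by
        simp [State.setVar_var]
      refine ⟨⟨?_, ?_, i3, e10 ▸ i4, i5, e10 ▸ i6, e10 ▸ i7, e10 ▸ i8⟩, ?_⟩
      · simp [State.setVar_var]; omega
      · intro x hx'
        simp only [State.setVar_var, if_true] at hx'
        rcases Nat.lt_succ_iff_lt_or_eq.1 hx' with h | rfl
        exacts [i2 x h, hz]
      · simp [State.setVar_var]; omega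
    · have hz : 0 < σ₁.arr 18 (σ₁.var 15) := by
        by_contra h
        have h : σ₁.arr 18 (σ₁.var 15) = 0 := by omega
        simp (disch := omega) [Expr.eval, h, Nat.mod_eq_of_lt] at he
      have hr0 := i3 _ hx
      have hl := hloc _ hx (by omega)
      have hle : σ₁.var 10 ≤ 5 * m := by omega
      -- `d` is the weight of the emitted edge: one unit, or all that remains. Either choice lowers
      -- `portions` by exactly one.
      obtain ⟨d, hd, hdq, hdp⟩ : ∃ d, d = (match κ with
            | .unweighted => 1
            | .weighted => σ₁.arr 18 (σ₁.var 15)) ∧ κ.Allows d ∧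
          d ≤ σ₁.arr 18 (σ₁.var 15) ∧ portions κ (σ₁.arr 18 (σ₁.var 15) - d) + 1 =
            portions κ (σ₁.arr 18 (σ₁.var 15)) := by
        cases κ
        · refine ⟨1, rfl, ⟨by simp, by simp⟩, hz, ?_⟩
          simp only [portions]; omega
        · refine ⟨_, rfl, ⟨hz, by simp⟩, le_rfl, ?_⟩
          simp [portions, hz.ne']
      refine Machine.Runs.mono (t' := 5) (t := 1 + (1 + (1 + (1 + 1))))
        (Q := fun σ₂ => σ₂.var 15 = σ₁.var 15 ∧ σ₂.var 10 = σ₁.var 10 + 1 ∧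
          (∀ x, σ₂.arr 18 x = if x = σ₁.var 15 then σ₁.arr 18 x - d else σ₁.arr 18 x) ∧
          (∀ k, σ₂.arr 19 k = if k = σ₁.var 10 then σ₁.var 15 else σ₁.arr 19 k) ∧
          (∀ k, σ₂.arr 20 k =
            if k = σ₁.var 10 then 2 * n + σ.arr 14 (σ₁.var 15) else σ₁.arr 20 k) ∧
          (∀ k, σ₂.arr 21 k = if k = σ₁.var 10 then d else σ₁.arr 21 k)) ?_ (by omega) ?_
      · refine Machine.runs_straight hfit.tick.tick (by cases κ <;> rfl) fun _ => ?_
        cases κ <;> simp only at hd <;> subst hd <;>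
          simp (disch := omega) [Prog.run, Expr.eval, State.setVar_var, State.setArr_arr, portion,
            two_n, e4, e14, Nat.mod_eq_of_lt]
        all_goals
          intro x
          split_ifs with h <;> simp [h]
      · rintro σ₂ - - ⟨j15, j10, j18, j19, j20, j21⟩
        have hp := sum_change (f := fun x => portions κ (σ₂.arr 18 x))
          (g := fun x => portions κ (σ₁.arr 18 x)) hx (fun y hy => by simp [j18, hy])
        simp only [j18 (σ₁.var 15), if_true] at hp
        refine ⟨⟨by omega, ?_, ?_, by omega, ?_, ?_, ?_, ?_⟩, ?_⟩
        · intro x hx'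
          rw [j18, if_neg (by omega)]
          exact i2 x (by omega)
        · intro x hx'
          rw [j18]
          have := i3 x hx'
          split_ifs <;> omega
        · intro k hk
          rw [j19, j20, j21, if_neg (by omega), if_neg (by omega), if_neg (by omega)]
          exact i5 k hk
        · intro k hk hk'
          by_cases hkk : k = σ₁.var 10
          · rw [j19, j20, j21, if_pos hkk, if_pos hkk, if_pos hkk]
            exact ⟨hx, by omega, rfl, hdq⟩
          · rw [j19, j20, j21, if_neg hkk, if_neg hkk, if_neg hkk]
            exact i6 k hk (by omega)
        · intro ψ
          rw [← i7 ψ, j10, show σ₁.var 10 + 1 - m = (σ₁.var 10 - m) + 1 by omega,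
            Finset.sum_range_succ, show m + (σ₁.var 10 - m) = σ₁.var 10 by omega]
          have hs := sum_change (f := fun x => σ₂.arr 18 x * ψ x (2 * n + σ.arr 14 x))
            (g := fun x => σ₁.arr 18 x * ψ x (2 * n + σ.arr 14 x)) hx
            (fun y hy => by simp [j18, hy])
          simp only [j18 (σ₁.var 15), if_true, Nat.sub_mul] at hs
          have hle2 := Nat.mul_le_mul_right (ψ (σ₁.var 15) (2 * n + σ.arr 14 (σ₁.var 15))) hdp.1
          have hc : ∑ k ∈ Finset.range (σ₁.var 10 - m),
              σ₂.arr 21 (m + k) * ψ (σ₂.arr 19 (m + k)) (σ₂.arr 20 (m + k)) =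
            ∑ k ∈ Finset.range (σ₁.var 10 - m),
              σ₁.arr 21 (m + k) * ψ (σ₁.arr 19 (m + k)) (σ₁.arr 20 (m + k)) := by
            refine Finset.sum_congr rfl fun k hk => ?_
            have := Finset.mem_range.1 hk
            rw [j19, j20, j21, if_neg (by omega), if_neg (by omega), if_neg (by omega)]
          rw [hc, j19, j20, j21, if_pos rfl, if_pos rfl, if_pos rfl]
          omega
        · omega
        · rw [j15]; omega
  · rintro σ₁ hfit hfr ⟨i1, i2, i3, i4, i5, i6, i7, i8⟩ hc
    have e4 : σ₁.var 4 = n := (hfr.var 4 rfl).trans hr.n_eq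
    simp (disch := omega) only [Expr.eval, two_n, e4, Nat.mod_eq_of_lt] at hc
    have hx : 2 * n ≤ σ₁.var 15 := by
      by_contra h; simp [show σ₁.var 15 < 2 * n by omega] at hc
    refine ⟨i4, by simp only [State.tick_var]; omega, i5, i6, fun ψ => ?_⟩
    rw [← i7 ψ]
    simp only [State.tick_var, State.tick_arr]
    rw [Finset.sum_eq_zero (s := Finset.range (2 * n)) fun x hx' => by
      rw [i2 x (by have := Finset.mem_range.1 hx'; omega), zero_mul], add_zero]

end

section

variable {κ : Kind} {M : Machine κ} {σ : State} {n m B P W : ℕ} {G : MGraph n m} {D : ℕ → Set ℕ}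
  {c : Cfg}

theorem runs_contract (hr : Regs M.w σ n m B P W) (h : CfgInv G σ.cfg D) (hG : G.OfKind κ)
    (hw : ∀ e : Fin m, σ.arr 12 e = G.weight e)
    (hrem : ∀ x < 2 * n, σ.arr 18 x = σ.cfg.dg x - recorded G σ.cfg x) :
    M.Runs (contractProg κ) σ (14 * n + 37 * m + 9) fun σ' => Contracted κ G σ.cfg σ' := by
  have hbig := hr.big
  refine (Machine.Runs.seq (t₁ := m * 3 + 2) (R := fun σ₁ => ∀ e < m, σ₁.arr 19 e = σ.arr 10 e)
    (t₂ := (m * 3 + 2) + ((m * 3 + 2) + (1 + (1 + (14 * n + 28 * m + 1)))))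
    (Machine.runs_map (K := m) (σ.arr 10) hr.fits (by simp [Expr.eval, hr.m_eq]) rfl rfl
      (by simp [Expr.eval, State.setVar_var]) fun σ₁ _ _ h _ => h) ?_).mono (by omega) fun _ _ _ h => h
  intro σ₁ hf1 hfit1 h19
  have hr1 := hr.frame hf1 hfit1 rfl
  refine Machine.Runs.seq (R := fun σ₂ => ∀ e < m, σ₂.arr 20 e = σ.arr 11 e)
    (Machine.runs_map (K := m) (σ.arr 11) hfit1 (by simp [Expr.eval, hr1.m_eq]) rfl rfl
      (by simp [Expr.eval, State.setVar_var, hf1.arr 11 rfl]) fun σ₁ _ _ h _ => h) ?_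
  intro σ₂ hf2 hfit2 h20
  have hr2 := hr1.frame hf2 hfit2 rfl
  refine Machine.Runs.seq (R := fun σ₂ => ∀ e < m, σ₂.arr 21 e = σ.arr 12 e)
    (Machine.runs_map (K := m) (σ.arr 12) hfit2 (by simp [Expr.eval, hr2.m_eq]) rfl rfl
      (by simp [Expr.eval, State.setVar_var, hf2.arr 12 rfl, hf1.arr 12 rfl])
      fun σ₁ _ _ h _ => h) ?_
  intro σ₃ hf3 hfit3 h21
  have hr3 := hr2.frame hf3 hfit3 rfl
  have e14 : σ₃.arr 14 = σ.arr 14 := by rw [hf3.arr 14 rfl, hf2.arr 14 rfl, hf1.arr 14 rfl]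
  have e18 : σ₃.arr 18 = σ.arr 18 := by rw [hf3.arr 18 rfl, hf2.arr 18 rfl, hf1.arr 18 rfl]
  have e19 : σ₃.arr 19 = σ₁.arr 19 := by rw [hf3.arr 19 rfl, hf2.arr 19 rfl]
  have e20 : σ₃.arr 20 = σ₂.arr 20 := by rw [hf3.arr 20 rfl]
  refine Machine.Runs.seq (R := fun σ' => σ' = σ₃.tick.setVar 10 m)
    (Machine.runs_assign hfit3 (by simp [Expr.eval, hr3.m_eq])) ?_
  rintro _ hf4 hfit4 rfl
  refine Machine.Runs.seq (R := fun σ' => σ' = (σ₃.tick.setVar 10 m).tick.setVar 15 0)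
    (Machine.runs_assign hfit4 (by simp [Expr.eval])) ?_
  rintro _ hf5 hfit5 rfl
  have hr5 := (hr3.frame hf4 hfit4 rfl).frame hf5 hfit5 rfl
  have hvalid : ∀ x < 2 * n, 0 < σ.cfg.dg x - recorded G σ.cfg x → Valid n σ.cfg.cnt x := by
    intro x hx hpos
    by_contra hv
    rw [h.dg_zero x hx hv] at hpos
    omega
  have hcnt := h.cnt_le
  have hloc : ∀ x < 2 * n, 0 < σ.cfg.dg x - recorded G σ.cfg x → σ.arr 14 x < n :=
    fun x hx hpos => (h.loc_lt x (hvalid x hx hpos)).trans_le h.cnt_le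
  refine (runs_outside hr5 (fun x => σ.cfg.dg x - recorded G σ.cfg x)
    (by simp [State.setVar_var]) (by simp [State.setVar_var])
    (by simpa [e18] using hrem) (by simpa [e14] using hloc) (h.sum_portions_le hG)).mono le_rfl ?_
  rintro σ' - - ⟨g1, g2, g3, g4, g5⟩
  simp only [State.setVar_arr, State.tick_arr, e14, e19, e20] at g3 g4 g5
  have g3 : ∀ k < m, σ'.arr 19 k = σ.arr 10 k ∧ σ'.arr 20 k = σ.arr 11 k ∧
      σ'.arr 21 k = σ.arr 12 k := fun k hk => by
    obtain ⟨a1, a2, a3⟩ := g3 k hk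
    exact ⟨a1.trans (h19 k hk), a2.trans (h20 k hk), a3.trans (h21 k hk)⟩
  clear h19 h20 h21
  have hsum : ∀ ψ : ℕ → ℕ → ℕ, ∑ k ∈ Finset.range (σ'.var 10),
      σ'.arr 21 k * ψ (σ'.arr 19 k) (σ'.arr 20 k) =
      ∑ e : Fin m, G.weight e * ψ (σ.cfg.ex e) (σ.cfg.ey e) +
      ∑ x ∈ Finset.range (2 * n), (σ.cfg.dg x - recorded G σ.cfg x) * ψ x (2 * n + σ.cfg.loc x) := by
    intro ψ
    have hs : σ'.var 10 = m + (σ'.var 10 - m) := by omega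
    rw [hs, Finset.sum_range_add, g5 ψ, Finset.sum_range]
    congr 1
    refine Finset.sum_congr rfl fun e _ => ?_
    obtain ⟨a1, a2, a3⟩ := g3 e e.2
    rw [a1, a2, a3, hw e]
    rfl
  constructor
  · exact g2
  · refine ⟨hsum, fun k hk => ?_⟩
    have hk : k < σ'.var 10 := by simpa [State.net] using hk
    by_cases hkm : k < m
    · obtain ⟨a1, a2, a3⟩ := g3 k hkm
      exact Or.inl ⟨⟨k, hkm⟩, a1, a2⟩
    · obtain ⟨a1, a2, a3, a4⟩ := g4 k (by omega) hk
      exact Or.inr ⟨a1, a3, by have : 0 < _ - _ := a2; exact Nat.pos_of_ne_zero (by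
        intro h0
        have h0 : σ.cfg.dg (σ'.arr 19 k) = 0 := h0
        omega)⟩
  · intro k hk
    by_cases hkm : k < m
    · obtain ⟨a1, a2, a3⟩ := g3 k hkm
      rw [a3, hw ⟨k, hkm⟩]
      exact MGraph.ofKind_iff.1 hG _
    · exact (g4 k (by omega) hk).2.2.2
  · intro k hk
    by_cases hkm : k < m
    · rw [(g3 k hkm).1]; exact h.valid_lt (h.edge_valid ⟨k, hkm⟩).1
    · exact (g4 k (by omega) hk).1
  · intro k hk
    by_cases hkm : k < m
    · rw [(g3 k hkm).2.1]
      have := h.valid_lt (h.edge_valid ⟨k, hkm⟩).2.1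
      simp only [State.cfg_ey] at this
      omega
    · obtain ⟨a1, a2, a3, a4⟩ := g4 k (by omega) hk
      have := hloc _ a1 a2
      omega
  · intro k hk
    by_cases hkm : k < m
    · rw [(g3 k hkm).1, (g3 k hkm).2.1]; exact (h.edge_valid ⟨k, hkm⟩).2.2.1
    · obtain ⟨a1, a2, a3, a4⟩ := g4 k (by omega) hk
      omega
  · have h1 := hsum fun _ _ => 1
    simp only [mul_one] at h1
    rw [h1]
    have h2 : ∑ x ∈ Finset.range (2 * n), (σ.cfg.dg x - recorded G σ.cfg x) ≤
        ∑ x ∈ Finset.range (2 * n), G.totalWeight :=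
      Finset.sum_le_sum fun x hx => (Nat.sub_le _ _).trans (h.dg_le (Finset.mem_range.1 hx))
    rw [Finset.sum_const, Finset.card_range, smul_eq_mul] at h2
    have h3 : ∑ e, G.weight e = G.totalWeight := rfl
    rw [h3, add_mul]
    omega

theorem runs_codes (hr : Regs M.w σ n m B P W) :
    M.Runs codesProg σ (27 * n + 6) fun σ' => ∀ x < 3 * n,
      σ'.arr 22 x = (if x < n then (if σ.arr 17 (σ.arr 14 x) = x then 1 else σ.arr 16 x)
        else if x < 2 * n then 0 else 1) ∧
      σ'.arr 23 x = (if x < n then (if σ.arr 17 (σ.arr 14 x) = x then 0 else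
        if σ.arr 16 x = 1 then P + x else 0) else 0) ∧
      σ'.arr 24 x = 0 := by
  have hbig := hr.big
  refine (Machine.Runs.seq (t₁ := 3 * n * 3 + 2) (t₂ := (3 * n * 3 + 2) + (3 * n * 3 + 2))
    (Machine.runs_map (K := 3 * n) (fun x => if x < n then (if σ.arr 17 (σ.arr 14 x) = x then 1
      else σ.arr 16 x) else if x < 2 * n then 0 else 1) hr.fits
    (by simp (disch := omega) [three_n, Expr.eval, hr.n_eq, Nat.mod_eq_of_lt]) rfl rfl
    (fun i hi hf => by
      simp (disch := omega) [Expr.eval, Expr.eval_ifEq M.one_lt hf, Expr.eval_ifLt M.one_lt hf,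
        State.setVar_var, hr.n_eq, ifSource, two_n, Nat.mod_eq_of_lt])
    fun σ₁ _ _ h _ => h) ?_).mono (by omega) fun _ _ _ h => h
  intro σ₁ hf1 hfit1 h1
  have hr1 := hr.frame hf1 hfit1 rfl
  refine Machine.Runs.seq
    (Machine.runs_map (K := 3 * n) (fun x => if x < n then (if σ.arr 17 (σ.arr 14 x) = x then 0 else
        if σ.arr 16 x = 1 then P + x else 0) else 0) hfit1
    (by simp (disch := omega) [three_n, Expr.eval, hr1.n_eq, Nat.mod_eq_of_lt]) rfl rfl
    (fun i hi hf => by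
      simp (disch := omega) [Expr.eval, Expr.eval_ifEq M.one_lt hf, Expr.eval_ifLt M.one_lt hf,
        State.setVar_var, hr1.n_eq, hr1.pow_eq, ifSource, Nat.mod_eq_of_lt, hf1.arr 14 rfl,
        hf1.arr 16 rfl, hf1.arr 17 rfl])
    fun σ₁ _ _ h _ => h) ?_
  intro σ₂ hf2 hfit2 h2
  have hr2 := hr1.frame hf2 hfit2 rfl
  refine Machine.runs_map (K := 3 * n) (fun x => 0) hfit2
    (by simp (disch := omega) [three_n, Expr.eval, hr2.n_eq, Nat.mod_eq_of_lt]) rfl rfl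
    (fun i hi hf => by simp [Expr.eval]) fun σ₃ _ hf3 h _ x hx => ?_
  rw [hf3.arr 22 rfl, hf2.arr 22 rfl, hf3.arr 23 rfl]
  exact ⟨h1 x hx, h2 x hx, h x hx⟩

end

/-! ### Oracle queries -/

theorem sum_range_two_mul (f : ℕ → ℕ) : ∀ N, ∑ j ∈ Finset.range (2 * N), f j =
    ∑ k ∈ Finset.range N, (f (2 * k) + f (2 * k + 1))
  | 0 => by simp
  | N + 1 => by
    rw [show 2 * (N + 1) = 2 * N + 1 + 1 by ring, Finset.sum_range_succ, Finset.sum_range_succ,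
      sum_range_two_mul f N, Finset.sum_range_succ]
    ring

open Classical in
-- Loops are moved to the edge `de`. Such an edge can only add to the cut, so the inequality needs
-- no assumption on `d` and `e`.
theorem edgeCost_query_le {Z : Set ℕ} {p : Prop} [Decidable p] {t d e a b : ℕ} (ht : t ∉ Z) :
    (if p then (if (a ∈ Z ↔ b ∈ Z) then 0 else 1) else
      (if a ∈ Z then 1 else 0) + if b ∈ Z then 1 else 0) ≤
    edgeCost (fun _ => 0) Z (if a = (if p then b else t) then d else a)
      (if a = (if p then b else t) then e else (if p then b else t)) +
    edgeCost (fun _ => 0) Z (if b = (if p then b else t) then d else b)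
      (if b = (if p then b else t) then e else (if p then b else t)) := by
  by_cases hp : p
  · by_cases hab : a = b <;> simp [edgeCost, hp, hab]
  · simp only [hp, if_false]
    gcongr
    · by_cases hat : a = t
      · simp [hat, ht]
      · by_cases ha : a ∈ Z <;> simp [edgeCost, ha, hat, ht]
    · by_cases hat : b = t
      · simp [hat, ht]
      · by_cases ha : b ∈ Z <;> simp [edgeCost, ha, hat, ht]

open Classical in
theorem edgeCost_query_eq {Z : Set ℕ} {p : Prop} [Decidable p] {t d e a b : ℕ} (ht : t ∉ Z)
    (hd : d ∉ Z) (he : e ∉ Z) :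
    edgeCost (fun _ => 0) Z (if a = (if p then b else t) then d else a)
      (if a = (if p then b else t) then e else (if p then b else t)) +
    edgeCost (fun _ => 0) Z (if b = (if p then b else t) then d else b)
      (if b = (if p then b else t) then e else (if p then b else t)) =
    (if p then (if (a ∈ Z ↔ b ∈ Z) then 0 else 1) else
      (if a ∈ Z then 1 else 0) + if b ∈ Z then 1 else 0) := by
  by_cases hp : p
  · by_cases hab : a = b <;> simp [edgeCost, hp, hab, hd, he]
  · simp only [hp, if_false]
    congr 1
    · by_cases hat : a = t
      · simp [edgeCost, hat, ht, hd, he]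
      · by_cases ha : a ∈ Z <;> simp [edgeCost, ha, hat, ht]
    · by_cases hat : b = t
      · simp [edgeCost, hat, ht, hd, he]
      · by_cases ha : b ∈ Z <;> simp [edgeCost, ha, hat, ht]

/-- The graph `q` is in the memory as a query. Its cuts are those of the contracted graph in the
memory, with the edges between different classes of the labels `lab` replaced by two edges to the
vertex `3 * n + 1` and the vertex `x` replaced by `f x`. -/
structure IsQuery (κ : Kind) (n : ℕ) (H : Net ℕ ℕ) (lab f : ℕ → ℕ) {N K : ℕ} (q : MGraph N K)
    (σ : State) : Prop where
  holds : σ.HoldsGraph q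
  kind : q.OfKind κ
  weight : ∀ e, ∃ k ∈ H.s, q.weight e = H.w k
  le_cut : ∀ Z : Set ℕ, 3 * n + 1 ∉ Z → H.fcut lab {x | f x ∈ Z} ≤ q.net.cut Z
  cut_eq : ∀ Z : Set ℕ, 3 * n + 1 ∉ Z → 3 * n + 2 ∉ Z → 3 * n + 3 ∉ Z →
    q.net.cut Z = H.fcut lab {x | f x ∈ Z}

section

variable {κ : Kind} {M : Machine κ} {σ : State} {n m B P W : ℕ} {G : MGraph n m} {D : ℕ → Set ℕ}
  {c : Cfg}

theorem runs_build (hr : Regs M.w σ n m B P W) (hC : Contracted κ G c σ)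
    (hf : ∀ x < 3 * n, σ.arr 25 x < 3 * n + 2) :
    M.Runs buildProg σ (90 * m + 9) fun σ' => σ'.var 2 = 3 * n ∧
      ∃ q : MGraph (3 * n + 4) (2 * σ.var 10),
        IsQuery κ n σ.net (σ.arr 24) (σ.arr 25) q σ' := by
  have hbig := hr.big
  have hle := hC.le
  set a : ℕ → ℕ := fun j => if j % 2 = 0 then σ.arr 25 (σ.arr 19 (j / 2)) else
    σ.arr 25 (σ.arr 20 (j / 2)) with ha
  set b : ℕ → ℕ := fun j => if σ.arr 24 (σ.arr 19 (j / 2)) = σ.arr 24 (σ.arr 20 (j / 2)) then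
    σ.arr 25 (σ.arr 20 (j / 2)) else 3 * n + 1 with hb
  have hlt : ∀ j < 2 * σ.var 10, a j < 3 * n + 2 ∧ b j < 3 * n + 2 := by
    intro j hj
    have h1 := hC.x_lt (j / 2) (by omega)
    have h2 := hC.y_lt (j / 2) (by omega)
    have h3 := hf _ (show σ.arr 19 (j / 2) < 3 * n by omega)
    have h4 := hf _ h2
    simp only [ha, hb]
    constructor <;> split_ifs <;> omega
  have hone := M.one_lt
  refine (Machine.Runs.seq (t₁ := 2 * σ.var 10 * 3 + 2)
    (R := fun σ₁ => ∀ j < 2 * σ.var 10, σ₁.arr 0 j = if a j = b j then 3 * n + 2 else a j)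
    (t₂ := (2 * σ.var 10 * 3 + 2) + ((2 * σ.var 10 * 3 + 2) + 3))
    (Machine.runs_map (K := 2 * σ.var 10) (fun j => if a j = b j then 3 * n + 2 else a j) hr.fits
    (by simp (disch := omega) [Expr.eval, Nat.mod_eq_of_lt]) rfl rfl
    (fun i hi hfit => by
      simp (disch := omega) [Expr.eval, Expr.eval_ifEq M.one_lt hfit, State.setVar_var, hr.n_eq,
        firstEnd, secondEnd, three_n, parentEdge, Nat.mod_eq_of_lt, ha, hb])
    fun σ₁ _ _ h _ => h) ?_).mono (by omega) fun _ _ _ h => h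
  intro σ₁ hf1 hfit1 h1
  have hr1 := hr.frame hf1 hfit1 rfl
  refine Machine.Runs.seq
    (R := fun σ₂ => ∀ j < 2 * σ.var 10, σ₂.arr 1 j = if a j = b j then 3 * n + 3 else b j)
    (Machine.runs_map (K := 2 * σ.var 10) (fun j => if a j = b j then 3 * n + 3 else b j) hfit1
    (by simp (disch := omega) [Expr.eval, Nat.mod_eq_of_lt, hf1.var 10 rfl]) rfl rfl
    (fun i hi hfit => by
      simp (disch := omega) [Expr.eval, Expr.eval_ifEq M.one_lt hfit, State.setVar_var, hr1.n_eq,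
        firstEnd, secondEnd, three_n, parentEdge, Nat.mod_eq_of_lt, ha, hb, hf1.arr 19 rfl,
        hf1.arr 20 rfl, hf1.arr 24 rfl, hf1.arr 25 rfl])
    fun σ₁ _ _ h _ => h) ?_
  intro σ₂ hf2 hfit2 h2
  have hr2 := hr1.frame hf2 hfit2 rfl
  have e10 : σ₂.var 10 = σ.var 10 := (hf2.var 10 rfl).trans (hf1.var 10 rfl)
  refine Machine.Runs.seq
    (R := fun σ₃ => ∀ j < 2 * σ.var 10, σ₃.arr 2 j = σ.arr 21 (j / 2))
    (Machine.runs_map (K := 2 * σ.var 10) (fun j => σ.arr 21 (j / 2)) hfit2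
    (by simp (disch := omega) [Expr.eval, Nat.mod_eq_of_lt, e10]) rfl rfl
    (fun i hi hfit => by
      simp (disch := omega) [Expr.eval, State.setVar_var, parentEdge, Nat.mod_eq_of_lt,
        hf1.arr 21 rfl, hf2.arr 21 rfl])
    fun σ₁ _ _ h _ => h) ?_
  intro σ₃ hf3 hfit3 h3
  have hr3 := hr2.frame hf3 hfit3 rfl
  have e10 : σ₃.var 10 = σ.var 10 := (hf3.var 10 rfl).trans e10
  refine Machine.runs_straight hfit3 rfl fun _ => ⟨?_, ?_⟩
  · simp (disch := omega) [Prog.run, Expr.eval, State.setVar_var, three_n, hr3.n_eq,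
      Nat.mod_eq_of_lt]
  set q : MGraph (3 * n + 4) (2 * σ.var 10) :=
    { tail := fun j => ⟨if a j = b j then 3 * n + 2 else a j, by
        have := hlt j j.2; split_ifs <;> omega⟩
      head := fun j => ⟨if a j = b j then 3 * n + 3 else b j, by
        have := hlt j j.2; split_ifs <;> omega⟩
      weight := fun j => σ.arr 21 (j / 2)
      loopless := fun j => by
        rw [ne_eq, Fin.mk.injEq]; split_ifs with h; · omega
        exact h } with hq
  have hcut : ∀ Z : Set ℕ, q.net.cut Z = ∑ k ∈ Finset.range (σ.var 10), σ.arr 21 k *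
      (edgeCost (fun _ => 0) Z (if a (2 * k) = b (2 * k) then 3 * n + 2 else a (2 * k))
        (if a (2 * k) = b (2 * k) then 3 * n + 3 else b (2 * k)) +
      edgeCost (fun _ => 0) Z (if a (2 * k + 1) = b (2 * k + 1) then 3 * n + 2 else a (2 * k + 1))
        (if a (2 * k + 1) = b (2 * k + 1) then 3 * n + 3 else b (2 * k + 1))) := by
    intro Z
    have : q.net.cut Z = ∑ j : Fin (2 * σ.var 10), σ.arr 21 (j / 2) *
      edgeCost (fun _ => 0) Z (if a j = b j then 3 * n + 2 else a j)
        (if a j = b j then 3 * n + 3 else b j) := rfl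
    rw [this, ← Finset.sum_range (fun j => σ.arr 21 (j / 2) *
      edgeCost (fun _ => 0) Z (if a j = b j then 3 * n + 2 else a j)
        (if a j = b j then 3 * n + 3 else b j)), sum_range_two_mul]
    refine Finset.sum_congr rfl fun k _ => ?_
    rw [show 2 * k / 2 = k by omega, show (2 * k + 1) / 2 = k by omega, mul_add]
  -- Edge `k` of the contracted graph becomes the edges `2k` and `2k + 1`. They are the edge itself
  -- and a loop if its ends have the same label, and two edges to the sink otherwise.
  have hab : ∀ k, a (2 * k) = σ.arr 25 (σ.arr 19 k) ∧ a (2 * k + 1) = σ.arr 25 (σ.arr 20 k) ∧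
      b (2 * k + 1) = b (2 * k) ∧ b (2 * k) = if σ.arr 24 (σ.arr 19 k) = σ.arr 24 (σ.arr 20 k) then
    σ.arr 25 (σ.arr 20 k) else 3 * n + 1 := by
    intro k
    simp [ha, hb, show (2 * k + 1) / 2 = k by omega]
  refine ⟨q, ⟨?_, ?_, ?_⟩, ?_, fun e => ⟨e / 2, by simp [State.net]; omega, rfl⟩, ?_, ?_⟩
  · simp (disch := omega) [Prog.run, Expr.eval, State.setVar_var, three_n, hr3.n_eq,
      Nat.mod_eq_of_lt]
  · simp (disch := omega) [Prog.run, Expr.eval, State.setVar_var, e10, Nat.mod_eq_of_lt]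
  · intro e
    refine ⟨?_, ?_, h3 e e.2⟩
    · exact (congrFun ((hf3.arr 0 rfl).trans (hf2.arr 0 rfl)) e).trans (h1 e e.2)
    · exact (congrFun (hf3.arr 1 rfl) e).trans (h2 e e.2)
  · exact MGraph.ofKind_iff.2 fun e => hC.allows _ (by have := e.2; omega)
  · intro Z hZ
    rw [hcut, Net.fcut]
    refine Finset.sum_le_sum fun k _ => Nat.mul_le_mul_left _ ?_
    obtain ⟨h4, h5, h6, h7⟩ := hab k
    rw [h6, h4, h5, h7]
    exact edgeCost_query_le hZ
  · intro Z hZ hZ2 hZ3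
    rw [hcut, Net.fcut]
    refine Finset.sum_congr rfl fun k _ => congrArg _ ?_
    obtain ⟨h4, h5, h6, h7⟩ := hab k
    rw [h6, h4, h5, h7]
    exact edgeCost_query_eq hZ hZ2 hZ3

end

/-! ### Residual reachability -/

/-- The predecessor of `r` is the last index below `k` at which `S` has the value `v`; `r = 0` if
there is none. -/
def Last (S : ℕ → ℕ) (k v r : ℕ) : Prop :=
  (r = 0 ∨ (r ≤ k ∧ S (r - 1) = v)) ∧ ∀ j < k, S j = v → j < r

theorem Last.le {S : ℕ → ℕ} {k v r : ℕ} (h : Last S k v r) : r ≤ k := by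
  rcases h.1 with h | h <;> omega

section

variable {κ : Kind} {M : Machine κ} {σ : State} {N K : ℕ}

theorem runs_link (hσ : σ.Fits M.w) (h1 : σ.var 1 = K) (hK : 4 * K + 4 ≤ 2 ^ M.w)
    (hS : ∀ j < 2 * K, σ.arr 26 j ≤ N) (h0 : ∀ v ≤ N, σ.arr 29 v = 0) :
    M.Runs linkProg σ (2 * K * 4 + 2) fun σ' =>
      (∀ v ≤ N, Last (σ.arr 26) (2 * K) v (σ'.arr 29 v)) ∧
      ∀ j < 2 * K, Last (σ.arr 26) j (σ.arr 26 j) (σ'.arr 28 j) := by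
  have hone := M.one_lt
  refine Machine.runs_for (K := 2 * K) (c := 2) (fun k σ' =>
    (∀ v ≤ N, Last (σ.arr 26) k v (σ'.arr 29 v)) ∧
      ∀ j < k, Last (σ.arr 26) j (σ.arr 26 j) (σ'.arr 28 j)) hσ
    (by simp (disch := omega) [Expr.eval, h1, Nat.mod_eq_of_lt]) rfl rfl ?_ ?_ ?_
  · exact ⟨fun v hv => ⟨Or.inl (h0 v hv), by omega⟩, by omega⟩
  · rintro k hk σ₁ hfit hfr hx ⟨i1, i2⟩
    have e26 : σ₁.arr 26 = σ.arr 26 := hfr.arr 26 rfl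
    refine Machine.runs_straight hfit.tick rfl fun _ => ?_
    have hSk := hS k hk
    have h29 : ∀ v, (((Prog.seq (.store 28 (.var 15) (.load 29 (.load 26 (.var 15))))
        (.store 29 (.load 26 (.var 15)) (.add (.var 15) (.const 1)))).run M.w σ₁.tick).tick.setVar
          15 (k + 1)).arr 29 v = if v = σ.arr 26 k then k + 1 else σ₁.arr 29 v := by
      intro v
      simp (disch := omega) [Prog.run, Expr.eval, State.setArr_arr, hx, e26, Nat.mod_eq_of_lt]
    have h28 : ∀ j, (((Prog.seq (.store 28 (.var 15) (.load 29 (.load 26 (.var 15))))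
        (.store 29 (.load 26 (.var 15)) (.add (.var 15) (.const 1)))).run M.w σ₁.tick).tick.setVar
          15 (k + 1)).arr 28 j = if j = k then σ₁.arr 29 (σ.arr 26 k) else σ₁.arr 28 j := by
      intro v
      simp (disch := omega) [Prog.run, Expr.eval, State.setArr_arr, hx, e26, Nat.mod_eq_of_lt]
    constructor
    · intro v hv
      rw [h29]
      by_cases hvk : v = σ.arr 26 k
      · rw [if_pos hvk]
        exact ⟨Or.inr ⟨le_rfl, by simp [hvk]⟩, fun j hj _ => hj⟩
      · rw [if_neg hvk]
        obtain ⟨j1, j2⟩ := i1 v hv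
        refine ⟨by rcases j1 with h | h; exacts [Or.inl h, Or.inr ⟨by omega, h.2⟩],
          fun j hj hjv => ?_⟩
        rcases Nat.lt_succ_iff_lt_or_eq.1 hj with h | rfl
        exacts [j2 j h hjv, absurd hjv.symm hvk]
    · intro j hj
      rw [h28]
      by_cases hjk : j = k
      · rw [if_pos hjk, hjk]; exact i1 _ hSk
      · rw [if_neg hjk]; exact i2 j (by omega)
  · rintro σ₁ hfit hfr ⟨i1, i2⟩
    exact ⟨i1, i2⟩

/-- Lists run from high to low indices, so the arcs at or above the pointer have been followed.
Followed arcs lead to visited vertices, and a visited vertex that left the stack has an exhausted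
list. An unfollowed arc counts two in the potential, so following one pays for a push. -/
theorem runs_visit (hσ : σ.Fits M.w) {s : ℕ} (hs : s < N)
    (hK : 4 * K + 4 ≤ 2 ^ M.w) (hS : ∀ j < 2 * K, σ.arr 26 j ≤ N) (hT : ∀ j < 2 * K, σ.arr 27 j < N)
    (hF : ∀ v ≤ N, Last (σ.arr 26) (2 * K) v (σ.arr 29 v))
    (hX : ∀ j < 2 * K, Last (σ.arr 26) j (σ.arr 26 j) (σ.arr 28 j))
    (hV : ∀ v < N, σ.arr 30 v = if v = s then 1 else 0) (h31 : σ.arr 31 0 = s)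
    (h16 : σ.var 16 = 1) :
    M.Runs visitProg σ ((4 * K + 1) * 10 + 1) fun σ' =>
      (∀ v < N, σ'.arr 30 v ≤ 1) ∧ σ'.arr 30 s = 1 ∧
      (∀ j < 2 * K, σ.arr 26 j < N → σ'.arr 30 (σ.arr 26 j) = 1 → σ'.arr 30 (σ.arr 27 j) = 1) ∧
      ∀ Z : Set ℕ, s ∈ Z → (∀ j < 2 * K, σ.arr 26 j < N → σ.arr 26 j ∈ Z → σ.arr 27 j ∈ Z) →
        ∀ v < N, σ'.arr 30 v = 1 → v ∈ Z := by
  have hone := M.one_lt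
  have key := Machine.runs_loop (M := M) (σ := σ) (c := 9) (e := .lt (.const 0) (.var 16))
    (p := .seq (.assign 17 (.load 31 (.sub (.var 16) (.const 1)))) <|
    .seq (.assign 18 (.load 29 (.var 17))) <|
    .branch (.eq (.var 18) (.const 0)) (.assign 16 (.sub (.var 16) (.const 1))) <|
    .seq (.store 29 (.var 17) (.load 28 (.sub (.var 18) (.const 1)))) <|
    .seq (.assign 19 (.load 27 (.sub (.var 18) (.const 1)))) <|
    .branch (.eq (.load 30 (.var 19)) (.const 0))
      (.seq (.store 30 (.var 19) (.const 1)) <|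
       .seq (.store 31 (.var 16) (.var 19)) <|
       .assign 16 (.add (.var 16) (.const 1)))
      .skip)
    (Q := fun σ' => (∀ v < N, σ'.arr 30 v ≤ 1) ∧ σ'.arr 30 s = 1 ∧
      (∀ j < 2 * K, σ.arr 26 j < N → σ'.arr 30 (σ.arr 26 j) = 1 → σ'.arr 30 (σ.arr 27 j) = 1) ∧
      ∀ Z : Set ℕ, s ∈ Z → (∀ j < 2 * K, σ.arr 26 j < N → σ.arr 26 j ∈ Z → σ.arr 27 j ∈ Z) →
        ∀ v < N, σ'.arr 30 v = 1 → v ∈ Z)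
    (fun σ' => (∀ i < σ'.var 16, σ'.arr 31 i < N ∧ σ'.arr 30 (σ'.arr 31 i) = 1) ∧
      (∀ v < N, ∃ k ≤ 2 * K, Last (σ.arr 26) k v (σ'.arr 29 v)) ∧
      (∀ j < 2 * K, σ'.arr 29 (σ.arr 26 j) ≤ j → σ'.arr 30 (σ.arr 27 j) = 1) ∧
      (∀ v < N, σ'.arr 30 v = 1 → σ'.arr 29 v = 0 ∨ ∃ i < σ'.var 16, σ'.arr 31 i = v) ∧
      (∀ v < N, σ'.arr 30 v ≤ 1) ∧ σ'.arr 30 s = 1 ∧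
      (∀ Z : Set ℕ, s ∈ Z → (∀ j < 2 * K, σ.arr 26 j < N → σ.arr 26 j ∈ Z → σ.arr 27 j ∈ Z) →
        ∀ v < N, σ'.arr 30 v = 1 → v ∈ Z) ∧
      2 * ((Finset.range (2 * K)).filter fun j => j < σ'.arr 29 (σ.arr 26 j)).card + σ'.var 16 ≤
        4 * K + 1)
    (fun σ' => 2 * ((Finset.range (2 * K)).filter fun j => j < σ'.arr 29 (σ.arr 26 j)).card +
      σ'.var 16) hσ ?_ ?_ ?_
  · have hc := Finset.card_filter_le (Finset.range (2 * K)) fun j => j < σ.arr 29 (σ.arr 26 j)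
    rw [Finset.card_range] at hc
    refine key.mono ?_ fun _ _ _ h => h
    omega
  · refine ⟨?_, fun v hv => ⟨2 * K, le_rfl, hF v hv.le⟩, ?_, ?_, ?_, ?_, ?_, ?_⟩
    · intro i hi
      obtain rfl : i = 0 := by omega
      rw [h31]; exact ⟨hs, by simp [hV s hs]⟩
    · intro j hj hle
      have := (hF _ (hS j hj)).2 j hj rfl
      omega
    · intro v hv h1
      rw [hV v hv] at h1
      exact Or.inr ⟨0, by omega, by by_contra h; simp [show v ≠ s by rintro rfl; exact h h31] at h1⟩
    · intro v hv; rw [hV v hv]; split_ifs <;> omega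
    · simp [hV s hs]
    · intro Z hsZ _ v hv h1
      rw [hV v hv] at h1
      have : v = s := by by_contra h; simp [h] at h1
      exact this ▸ hsZ
    · have hc := Finset.card_filter_le (Finset.range (2 * K)) fun j => j < σ.arr 29 (σ.arr 26 j)
      rw [Finset.card_range] at hc
      omega
  · rintro τ hfit hfr ⟨i1, i2, i3, i4, i5, i6, i7, i8⟩ hc
    have e27 : τ.arr 27 = σ.arr 27 := hfr.arr 27 rfl
    have e28 : τ.arr 28 = σ.arr 28 := hfr.arr 28 rfl
    have hsp : 0 < τ.var 16 := by
      by_contra h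
      simp [Expr.eval, show τ.var 16 = 0 by omega] at hc
    obtain ⟨hx, hvx⟩ := i1 (τ.var 16 - 1) (by omega)
    generalize hxdef : τ.arr 31 (τ.var 16 - 1) = x at hx hvx
    refine Machine.Runs.mono (t := 1 + (1 + 7)) (Q := fun σ' => (τ.arr 29 x = 0 ∧
        σ'.arr = τ.arr ∧ σ'.var 16 = τ.var 16 - 1) ∨ (τ.arr 29 x ≠ 0 ∧
        (∀ v, σ'.arr 29 v = if v = x then σ.arr 28 (τ.arr 29 x - 1) else τ.arr 29 v) ∧
        ((τ.arr 30 (σ.arr 27 (τ.arr 29 x - 1)) = 0 ∧ σ'.var 16 = τ.var 16 + 1 ∧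
          (∀ i, σ'.arr 31 i = if i = τ.var 16 then σ.arr 27 (τ.arr 29 x - 1) else τ.arr 31 i) ∧
          (∀ v, σ'.arr 30 v = if v = σ.arr 27 (τ.arr 29 x - 1) then 1 else τ.arr 30 v)) ∨
          (τ.arr 30 (σ.arr 27 (τ.arr 29 x - 1)) ≠ 0 ∧ σ'.var 16 = τ.var 16 ∧
            σ'.arr 31 = τ.arr 31 ∧ σ'.arr 30 = τ.arr 30)))) ?_ le_rfl ?_
    · refine Machine.Runs.seq (R := fun σ₁ => σ₁.arr = τ.arr ∧ σ₁.var 16 = τ.var 16 ∧ σ₁.var 17 = x)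
        (Machine.runs_assign hfit.tick ?_) ?_
      · simp (disch := omega) [Expr.eval, State.setVar_var, Nat.mod_eq_of_lt, hxdef]
      rintro σ₁ - hf1 ⟨j1, j2, j3⟩
      refine Machine.Runs.seq (R := fun σ₁ => σ₁.arr = τ.arr ∧ σ₁.var 16 = τ.var 16 ∧
        σ₁.var 17 = x ∧ σ₁.var 18 = τ.arr 29 x) (Machine.runs_assign hf1 ?_) ?_
      · simp [Expr.eval, State.setVar_var, j1, j2, j3]
      clear hf1 j1 j2 j3
      rintro σ₁ - hf1 ⟨j1, j2, j3, j4⟩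
      refine Machine.runs_branch (t := 6) (fun he => ?_) (fun he => ?_)
      · have hz : τ.arr 29 x = 0 := by by_contra h; simp [Expr.eval, j4, h] at he
        refine Machine.Runs.mono (t := 1) (Machine.runs_assign hf1.tick (Q := fun σ' =>
          σ'.arr = τ.arr ∧ σ'.var 16 = τ.var 16 - 1) ?_) (by omega) fun σ' _ _ h => Or.inl ⟨hz, h⟩
        simp (disch := omega) [Expr.eval, State.setVar_var, Nat.mod_eq_of_lt, j1, j2]
      · have hz : τ.arr 29 x ≠ 0 := by
          intro h; simp (disch := omega) [Expr.eval, j4, h, Nat.mod_eq_of_lt] at he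
        refine Machine.Runs.seq (t₁ := 1) (t₂ := 5) (R := fun σ₂ => σ₂.var = σ₁.var ∧
          (∀ a, a ≠ 29 → σ₂.arr a = τ.arr a) ∧
          (∀ v, σ₂.arr 29 v = if v = x then σ.arr 28 (τ.arr 29 x - 1) else τ.arr 29 v))
          (Machine.runs_store hf1.tick ⟨rfl, ?_, ?_⟩) ?_
        · intro a ha; rw [← j1]; exact Function.update_of_ne ha _ _
        · simp (disch := omega) [Expr.eval, State.setArr_arr, Nat.mod_eq_of_lt, j1, j3, j4, e28]
        rintro σ₂ - hf2 ⟨k1, k2, k3⟩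
        refine Machine.Runs.seq (t₁ := 1) (t₂ := 4) (R := fun σ₃ => σ₃.var 16 = τ.var 16 ∧
          σ₃.var 19 = σ.arr 27 (τ.arr 29 x - 1) ∧ σ₃.arr = σ₂.arr) (Machine.runs_assign hf2 ?_) ?_
        · simp (disch := omega) [Expr.eval, State.setVar_var, Nat.mod_eq_of_lt, k1, k2, j2, j4, e27]
        rintro σ₃ - hf3 ⟨l1, l2, l3⟩
        refine Machine.runs_branch (t := 3) (fun he => ?_) (fun he => ?_)
        · have hzz : τ.arr 30 (σ.arr 27 (τ.arr 29 x - 1)) = 0 := by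
            by_contra h; simp [Expr.eval, l2, l3, k2, h] at he
          refine Machine.runs_straight hf3.tick rfl fun _ => Or.inr ⟨hz, ?_, Or.inl ⟨hzz, ?_, ?_, ?_⟩⟩
          · simp [Prog.run, Expr.eval, State.setArr_arr, l3, k3]
          · simp (disch := omega) [Prog.run, Expr.eval, State.setVar_var, l1, Nat.mod_eq_of_lt]
          · simp [Prog.run, Expr.eval, State.setArr_arr, l1, l2, l3, k2]
          · simp (disch := omega) [Prog.run, Expr.eval, State.setArr_arr, l2, l3, k2,
              Nat.mod_eq_of_lt]
        · have hzz : τ.arr 30 (σ.arr 27 (τ.arr 29 x - 1)) ≠ 0 := by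
            intro h; simp (disch := omega) [Expr.eval, l2, l3, k2, h, Nat.mod_eq_of_lt] at he
          refine Machine.Runs.mono (t := 0) (Machine.runs_skip hf3.tick (Q := fun σ' =>
            σ' = σ₃.tick) rfl) (by omega) ?_
          rintro _ - - rfl
          refine Or.inr ⟨hz, ?_, Or.inr ⟨hzz, ?_, ?_, ?_⟩⟩
          · simpa [l3] using k3
          · simpa using l1
          · simp [l3, k2]
          · simp [l3, k2]
    · rintro σ' - - (⟨hz, j1, j2⟩ | ⟨hz, j1, j2⟩)
      · rw [j1, j2]
        refine ⟨⟨fun i hi => i1 i (by omega), i2, i3, fun v hv h1 => ?_, i5, i6, i7, by omega⟩,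
          by omega⟩
        by_cases hvx' : v = x
        · exact Or.inl (hvx' ▸ hz)
        · rcases i4 v hv h1 with h | ⟨i, hi, hiv⟩
          · exact Or.inl h
          · refine Or.inr ⟨i, ?_, hiv⟩
            have : i ≠ τ.var 16 - 1 := by
              rintro rfl; exact hvx' (hiv.symm.trans hxdef)
            omega
      · obtain ⟨k, hk, hL⟩ := i2 x hx
        have hL1 := hL.1.resolve_left hz
        generalize hrdef : τ.arr 29 x - 1 = r at j1 j2 hL1
        have hr : r < 2 * K := by omega
        have hSr : σ.arr 26 r = x := hL1.2
        have hXr := hX r hr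
        rw [hSr] at hXr
        have hXle := hXr.le
        have hy := hT r hr
        have hV1 : ∀ v, τ.arr 30 v = 1 → σ'.arr 30 v = 1 := by
          intro v hv
          rcases j2 with ⟨_, _, _, h⟩ | ⟨_, _, _, h⟩
          · rw [h]; split_ifs <;> [rfl; exact hv]
          · rw [h]; exact hv
        have hVy : σ'.arr 30 (σ.arr 27 r) = 1 := by
          rcases j2 with ⟨_, _, _, h⟩ | ⟨h0, _, _, h⟩
          · simp [h]
          · rw [h]; have := i5 _ hy; omega
        have hV2 : ∀ v, σ'.arr 30 v = 1 → τ.arr 30 v = 1 ∨ v = σ.arr 27 r := by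
          intro v hv
          rcases j2 with ⟨_, _, _, h⟩ | ⟨_, _, _, h⟩
          · rw [h] at hv
            by_cases hvy : v = σ.arr 27 r
            · exact Or.inr hvy
            · exact Or.inl (by simpa [hvy] using hv)
          · exact Or.inl (h ▸ hv)
        have hst : ∀ i < τ.var 16, i < σ'.var 16 ∧ σ'.arr 31 i = τ.arr 31 i := by
          intro i hi
          rcases j2 with ⟨_, h1, h2, _⟩ | ⟨_, h1, h2, _⟩
          · exact ⟨by omega, by rw [h2, if_neg (by omega)]⟩
          · exact ⟨by omega, by rw [h2]⟩
        have hst2 : ∀ i < σ'.var 16, i < τ.var 16 ∨ σ'.arr 31 i = σ.arr 27 r := by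
          intro i hi
          rcases j2 with ⟨_, h1, h2, _⟩ | ⟨_, h1, h2, _⟩
          · by_cases h : i = τ.var 16
            · exact Or.inr (by simp [h2, h])
            · exact Or.inl (by omega)
          · exact Or.inl (by omega)
        have hnew : ∀ v < N, τ.arr 30 v ≠ 1 → σ'.arr 30 v = 1 → ∃ i < σ'.var 16, σ'.arr 31 i = v := by
          intro v hv h0 h1
          rcases j2 with ⟨_, h2, h3, h⟩ | ⟨_, _, _, h⟩
          · refine ⟨τ.var 16, by omega, ?_⟩
            rw [h] at h1
            by_cases hvy : v = σ.arr 27 r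
            · simp [h3, hvy]
            · simp [hvy] at h1; exact absurd h1 h0
          · rw [h] at h1; exact absurd h1 h0
        have hcard : ((Finset.range (2 * K)).filter fun j => j < σ'.arr 29 (σ.arr 26 j)).card + 1 ≤
            ((Finset.range (2 * K)).filter fun j => j < τ.arr 29 (σ.arr 26 j)).card := by
          refine Finset.card_lt_card (Finset.ssubset_iff_of_subset ?_ |>.2 ⟨r, ?_, ?_⟩)
          · intro j hj
            simp only [Finset.mem_filter, j1] at hj ⊢
            refine ⟨hj.1, ?_⟩
            have h2 := hj.2
            split_ifs at h2 with h
            · rw [h]; omega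
            · exact h2
          · simp only [Finset.mem_filter, Finset.mem_range, hSr]; omega
          · simp only [Finset.mem_filter, j1, hSr, if_true]; omega
        have hsp' : σ'.var 16 ≤ τ.var 16 + 1 := by
          rcases j2 with ⟨_, h, _⟩ | ⟨_, h, _⟩ <;> omega
        refine ⟨⟨?_, ?_, ?_, ?_, ?_, hV1 s i6, ?_, by omega⟩, by omega⟩
        · intro i hi
          rcases hst2 i hi with h | h
          · rw [(hst i h).2]; exact ⟨(i1 i h).1, hV1 _ (i1 i h).2⟩
          · rw [h]; exact ⟨hy, hVy⟩
        · intro v hv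
          rw [j1]
          by_cases hvx' : v = x
          · rw [if_pos hvx', hvx']; exact ⟨r, hr.le, hXr⟩
          · rw [if_neg hvx']; exact i2 v hv
        · intro j hj
          rw [j1]
          by_cases hjx : σ.arr 26 j = x
          · rw [if_pos hjx]
            intro hle
            rcases lt_trichotomy j r with h | h | h
            · have := hXr.2 j h hjx; omega
            · rw [h]; exact hVy
            · exact hV1 _ (i3 j hj (by rw [hjx]; omega))
          · rw [if_neg hjx]; exact fun h => hV1 _ (i3 j hj h)
        · intro v hv h1
          by_cases h0 : τ.arr 30 v = 1
          · rcases i4 v hv h0 with h | ⟨i, hi, hiv⟩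
            · refine Or.inl ?_
              rw [j1, if_neg (by rintro rfl; exact hz h)]
              exact h
            · exact Or.inr ⟨i, (hst i hi).1, (hst i hi).2.trans hiv⟩
          · exact Or.inr (hnew v hv h0 h1)
        · intro v hv
          rcases j2 with ⟨_, _, _, h⟩ | ⟨_, _, _, h⟩
          · rw [h]; have := i5 v hv; split_ifs <;> omega
          · rw [h]; exact i5 v hv
        · intro Z hsZ hcl v hv h1
          rcases hV2 v h1 with h | h
          · exact i7 Z hsZ hcl v hv h
          · rw [h]
            exact hcl r hr (hSr ▸ hx) (hSr ▸ i7 Z hsZ hcl x hx hvx)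
  · rintro τ hfit hfr ⟨i1, i2, i3, i4, i5, i6, i7, i8⟩ hc
    have hsp : τ.var 16 = 0 := by
      by_contra h
      simp (disch := omega) [Expr.eval, show 0 < τ.var 16 by omega, Nat.mod_eq_of_lt] at hc
    refine ⟨i5, i6, fun j hj hjN h1 => i3 j hj ?_, i7⟩
    rcases i4 _ hjN h1 with h | ⟨i, hi, -⟩
    · omega
    · omega

end

section

variable {κ : Kind} {M : Machine κ} {σ : State} {N K : ℕ}

theorem runs_search (hσ : σ.Fits M.w) {q : MGraph N K} (hq : σ.HoldsGraph q) {f : Fin K → ℤ}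
    (hf : ∀ e, |f e| ≤ q.weight e)
    (h3 : ∀ e : Fin K, σ.arr 3 e = (f e).toNat) (h4 : ∀ e : Fin K, σ.arr 4 e = (-f e).toNat)
    {s : Fin N} (hs : σ.var 2 = s) (hK : 4 * K + 4 ≤ 2 ^ M.w) (hN : N + 2 ≤ 2 ^ M.w)
    (hw : ∀ e, 2 * q.weight e < 2 ^ M.w) :
    M.Runs searchProg σ (100 * (K + N + 1)) fun σ' => ∃ X : Set ℕ, (s : ℕ) ∈ X ∧
      q.ResClosed f X ∧ (∀ Z, (s : ℕ) ∈ Z → q.ResClosed f Z → X ⊆ Z) ∧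
      ∀ v < N, (σ'.arr 30 v = 1 ↔ v ∈ X) := by
  obtain ⟨h0, h1, hg⟩ := hq
  have hone := M.one_lt
  have hsN := s.2
  set res : ℕ → Prop := fun j => if j % 2 = 0 then σ.arr 3 (j / 2) < σ.arr 2 (j / 2) + σ.arr 4 (j / 2)
    else σ.arr 4 (j / 2) < σ.arr 2 (j / 2) + σ.arr 3 (j / 2) with hres
  -- Arc `2e` leads from tail to head and `2e + 1` back. An arc without residual capacity starts at
  -- the dummy vertex `N`, which is never visited.
  set S : ℕ → ℕ := fun j => if j % 2 = 0 then
      (if σ.arr 3 (j / 2) < σ.arr 2 (j / 2) + σ.arr 4 (j / 2) then σ.arr 0 (j / 2) else N) else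
      (if σ.arr 4 (j / 2) < σ.arr 2 (j / 2) + σ.arr 3 (j / 2) then σ.arr 1 (j / 2) else N) with hS
  set T : ℕ → ℕ := fun j => if j % 2 = 0 then σ.arr 1 (j / 2) else σ.arr 0 (j / 2) with hT
  have hend : ∀ e < K, σ.arr 0 e < N ∧ σ.arr 1 e < N := fun e he => by
    obtain ⟨a1, a2, -⟩ := hg ⟨e, he⟩
    have := (q.tail ⟨e, he⟩).2
    have := (q.head ⟨e, he⟩).2
    simp only at a1 a2
    omega
  -- Words are nonnegative, so the flow is kept as its positive and negative parts and residual
  -- tests compare `f⁺` with `w + f⁻`, or `f⁻` with `w + f⁺`.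
  have hflow : ∀ e : Fin K, (σ.arr 3 e < σ.arr 2 e + σ.arr 4 e ↔ f e < q.weight e) ∧
      (σ.arr 4 e < σ.arr 2 e + σ.arr 3 e ↔ -f e < q.weight e) ∧
      σ.arr 2 e + σ.arr 4 e < 2 ^ M.w ∧ σ.arr 2 e + σ.arr 3 e < 2 ^ M.w := by
    intro e
    have := abs_le.1 (hf e)
    have := hw e
    rw [h3, h4, (hg e).2.2]
    zify at this ⊢
    generalize (2 : ℤ) ^ M.w = p at *
    omega
  have hSle : ∀ j < 2 * K, S j ≤ N := by
    intro j hj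
    have := hend (j / 2) (by omega)
    simp only [hS]
    split_ifs <;> omega
  have hTlt : ∀ j < 2 * K, T j < N := by
    intro j hj
    have := hend (j / 2) (by omega)
    simp only [hT]
    split_ifs <;> omega
  refine (Machine.Runs.seq (t₁ := 2 * K * 3 + 2) (R := fun σ₁ => ∀ j < 2 * K, σ₁.arr 26 j = S j)
    (t₂ := (2 * K * 3 + 2) + (((N + 1) * 3 + 2) + ((N * 3 + 2) + ((2 * K * 4 + 2) +
      (1 + (1 + (1 + ((4 * K + 1) * 10 + 1))))))))
    (Machine.runs_map (K := 2 * K) S hσ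
    (by simp (disch := omega) [Expr.eval, h1, Nat.mod_eq_of_lt]) rfl rfl
    (fun i hi hfit => by
      obtain ⟨-, -, hfl, hfl'⟩ := hflow ⟨i / 2, by omega⟩
      simp only at hfl hfl'
      simp (disch := omega) [Expr.eval, Expr.eval_ifEq M.one_lt hfit, Expr.eval_ifLt M.one_lt hfit,
        State.setVar_var, ifResidual, parentEdge, Nat.mod_eq_of_lt, hS, h0]
      by_cases hi2 : i % 2 = 0 <;> simp [hi2])
    fun σ₁ _ _ h _ => h) ?_).mono (by omega) fun _ _ _ h => h
  intro σ₁ hf1 hfit1 k1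
  refine Machine.Runs.seq (R := fun σ₂ => ∀ j < 2 * K, σ₂.arr 27 j = T j)
    (Machine.runs_map (K := 2 * K) T hfit1
    (by simp (disch := omega) [Expr.eval, h1, Nat.mod_eq_of_lt, hf1.var 1 rfl]) rfl rfl
    (fun i hi hfit => by
      simp (disch := omega) [Expr.eval, Expr.eval_ifEq M.one_lt hfit,
        State.setVar_var, parentEdge, Nat.mod_eq_of_lt, hT, hf1.arr 0 rfl, hf1.arr 1 rfl])
    fun σ₁ _ _ h _ => h) ?_
  intro σ₂ hf2 hfit2 k2
  refine Machine.Runs.seq (R := fun σ₃ => ∀ j < N + 1, σ₃.arr 29 j = 0)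
    (Machine.runs_map (K := N + 1) (fun _ => 0) hfit2
    (by simp (disch := omega) [Expr.eval, h0, Nat.mod_eq_of_lt, hf1.var 0 rfl, hf2.var 0 rfl]) rfl
    rfl (fun i hi hfit => by simp [Expr.eval]) fun σ₁ _ _ h _ => h) ?_
  intro σ₃ hf3 hfit3 k3
  refine Machine.Runs.seq (R := fun σ₃ => ∀ j < N, σ₃.arr 30 j = 0)
    (Machine.runs_map (K := N) (fun _ => 0) hfit3
    (by simp [Expr.eval, h0, hf1.var 0 rfl, hf2.var 0 rfl, hf3.var 0 rfl]) rfl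
    rfl (fun i hi hfit => by simp [Expr.eval]) fun σ₁ _ _ h _ => h) ?_
  intro σ₄ hf4 hfit4 k4
  have e26 : ∀ j < 2 * K, σ₄.arr 26 j = S j := by
    intro j hj; rw [hf4.arr 26 rfl, hf3.arr 26 rfl, hf2.arr 26 rfl, k1 j hj]
  refine Machine.Runs.seq (runs_link (N := N) hfit4
    (by rw [hf4.var 1 rfl, hf3.var 1 rfl, hf2.var 1 rfl, hf1.var 1 rfl, h1]) hK
    (fun j hj => by rw [e26 j hj]; exact hSle j hj)
    (fun v hv => by rw [hf4.arr 29 rfl]; exact k3 v (by omega))) ?_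
  intro σ₅ hf5 hfit5 ⟨k5, k6⟩
  have e2 : σ₅.var 2 = s := by
    rw [hf5.var 2 rfl, hf4.var 2 rfl, hf3.var 2 rfl, hf2.var 2 rfl, hf1.var 2 rfl, hs]
  refine Machine.Runs.seq (R := fun σ' => σ' = σ₅.tick.setArr 31 0 s)
    (Machine.runs_store hfit5 (by simp [Expr.eval, e2])) ?_
  rintro _ hf6 hfit6 rfl
  refine Machine.Runs.seq (R := fun σ' => σ' = (σ₅.tick.setArr 31 0 s).tick.setArr 30 s 1)
    (Machine.runs_store hfit6 (by simp [Expr.eval, e2, Nat.mod_eq_of_lt hone])) ?_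
  rintro _ hf7 hfit7 rfl
  refine Machine.Runs.seq (R := fun σ' => σ' =
    ((σ₅.tick.setArr 31 0 s).tick.setArr 30 s 1).tick.setVar 16 1)
    (Machine.runs_assign hfit7 (by simp [Expr.eval, Nat.mod_eq_of_lt hone])) ?_
  rintro σ₆ hf8 hfit8 h8
  have e26' : σ₆.arr 26 = σ₄.arr 26 := by
    rw [hf8.arr 26 rfl, hf7.arr 26 rfl, hf6.arr 26 rfl, hf5.arr 26 rfl]
  have e27' : ∀ j < 2 * K, σ₆.arr 27 j = T j := by
    intro j hj
    rw [hf8.arr 27 rfl, hf7.arr 27 rfl, hf6.arr 27 rfl, hf5.arr 27 rfl, hf4.arr 27 rfl,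
      hf3.arr 27 rfl, k2 j hj]
  refine (runs_visit (N := N) (K := K) (s := s) hfit8 s.2 hK
    (fun j hj => by rw [e26', e26 j hj]; exact hSle j hj)
    (fun j hj => by rw [e27' j hj]; exact hTlt j hj)
    (fun v hv => by rw [e26', hf8.arr 29 rfl, hf7.arr 29 rfl, hf6.arr 29 rfl]; exact k5 v hv)
    (fun j hj => by rw [e26', hf8.arr 28 rfl, hf7.arr 28 rfl, hf6.arr 28 rfl]; exact k6 j hj)
    (fun v hv => ?_) (by simp [h8, State.setArr_arr]) (by simp [h8, State.setVar_var])).mono le_rfl ?_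
  · have := k4 v hv
    rw [← hf5.arr 30 rfl] at this
    simp [h8, State.setArr_arr, this]
  intro σ' _ _ ⟨g1, g2, g3, g4⟩
  refine ⟨{v | v < N ∧ σ'.arr 30 v = 1}, ⟨s.2, g2⟩, ?_, ?_, fun v hv => by simp [hv]⟩
  · intro e
    have he := e.2
    obtain ⟨f1, f2, -⟩ := hflow e
    refine ⟨fun ht hlt => ?_, fun ht hlt => ?_⟩
    · have hSe : σ₆.arr 26 (2 * e) = q.tail e := by
        rw [e26', e26 _ (by omega)]
        simp [hS, f1.2 hlt, (hg e).1]
      have hTe : σ₆.arr 27 (2 * e) = q.head e := by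
        rw [e27' _ (by omega)]
        simp [hT, (hg e).2.1]
      have := g3 (2 * e) (by omega)
      rw [hSe, hTe] at this
      exact ⟨(q.head e).2, this (q.tail e).2 ht.2⟩
    · have hSe : σ₆.arr 26 (2 * e + 1) = q.head e := by
        rw [e26', e26 _ (by omega)]
        simp [hS, show (2 * (e : ℕ) + 1) / 2 = e by omega, f2.2 hlt, (hg e).2.1]
      have hTe : σ₆.arr 27 (2 * e + 1) = q.tail e := by
        rw [e27' _ (by omega)]
        simp [hT, show (2 * (e : ℕ) + 1) / 2 = e by omega, (hg e).1]
      have := g3 (2 * e + 1) (by omega)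
      rw [hSe, hTe] at this
      exact ⟨(q.tail e).2, this (q.head e).2 ht.2⟩
  · intro Z hsZ hZ v hv
    refine g4 Z hsZ (fun j hj hjN hjZ => ?_) v hv.1 hv.2
    rw [e26', e26 j hj] at hjN hjZ
    rw [e27' j hj]
    have hcl := hZ ⟨j / 2, by omega⟩
    obtain ⟨f1, f2, -⟩ := hflow ⟨j / 2, by omega⟩
    obtain ⟨a1, a2, -⟩ := hg ⟨j / 2, by omega⟩
    simp only at f1 f2 a1 a2
    simp only [hS, hT] at hjN hjZ ⊢
    by_cases hj2 : j % 2 = 0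
    · simp only [hj2, if_true] at hjN hjZ ⊢
      split_ifs at hjN hjZ with hlt
      · rw [a2]; rw [a1] at hjZ; exact hcl.1 hjZ (f1.1 hlt)
      · omega
    · simp only [hj2, if_false] at hjN hjZ ⊢
      split_ifs at hjN hjZ with hlt
      · rw [a1]; rw [a2] at hjZ; exact hcl.2 hjZ (f2.1 hlt)
      · omega

end

/-! ### Refinement of the labels by maximum flows. -/

theorem Net.fcut_congr {ι α : Type*} {N : Net ι α} {lab lab' : α → ℕ} {Z Z' : Set α}
    (hl : ∀ e ∈ N.s, lab (N.x e) = lab' (N.x e) ∧ lab (N.y e) = lab' (N.y e))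
    (hZ : ∀ e ∈ N.s, (N.x e ∈ Z ↔ N.x e ∈ Z') ∧ (N.y e ∈ Z ↔ N.y e ∈ Z')) :
    N.fcut lab Z = N.fcut lab' Z' := by
  unfold Net.fcut edgeCost
  refine Finset.sum_congr rfl fun e he => ?_
  rw [(hl e he).1, (hl e he).2, (hZ e he).1, (hZ e he).2]

section

variable {κ : Kind} {M : Machine κ} {σ : State} {Q : State → Prop} {n m B P W : ℕ} {G : MGraph n m}
  {c : Cfg}

theorem Machine.runs_callFlow (hσ : σ.Fits M.w) {N K : ℕ} (q : FlowQuery N K)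
    (hk : q.graph.OfKind κ) (hh : σ.HoldsFlowQuery q)
    (hQ : Q (((σ.tick.charge N K).fillArr 3 fun e => (M.O.flow q e).toNat).fillArr 4
      fun e => (-M.O.flow q e).toNat)) : M.Runs .callFlow σ 1 Q :=
  Machine.runs_of_exec (.callFlow q hk hh) hσ le_rfl hQ

theorem Contracted.weight_lt (hr : Regs M.w σ n m B P W) (hW : W = G.totalWeight)
    (hC : Contracted κ G c σ) {k : ℕ} (hk : k < σ.var 10) : 2 * σ.arr 21 k < 2 ^ M.w := by
  have h1 := Finset.single_le_sum (f := fun k => σ.arr 21 k) (fun _ _ => Nat.zero_le _)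
    (Finset.mem_range.2 hk)
  have h2 := hC.total
  have h3 := hr.prod
  rw [← hW] at h2
  have h4 : (2 * n + 1) * W ≤ 2 * ((n + 1) * (W + 1)) := by nlinarith
  have h5 : 1 ≤ (n + 1) * (W + 1) := Nat.mul_pos (by omega) (by omega)
  omega

/-- The vertices whose images are residually reachable from `3n` form the least minimizer of the
phase. Leastness among cuts of the query is leastness among admissible sets, because every
admissible set gives a cut of the query of the same cost. -/
theorem runs_phase (hr : Regs M.w σ n m B P W) (hW : W = G.totalWeight)
    (hC : Contracted κ G c σ) {b : ℕ} (hb : b ≤ B) (h14 : σ.var 14 = 2 ^ b)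
    (hlab : ∀ x < 3 * n, σ.arr 24 x < 2 ^ b) :
    M.Runs phaseProg σ (2000 * (n + m)) fun σ' => σ'.var 14 = 2 ^ (b + 1) ∧
      σ'.vertices = σ.vertices + (3 * n + 4) ∧ σ'.edges = σ.edges + 2 * σ.var 10 ∧
      ∃ X : Set ℕ, (∀ x ∈ X, x < 3 * n) ∧
        IsLeastMin (σ.net.fcut (σ.arr 24)) (fun Z => ∀ x, x < 3 * n → σ.arr 22 x = 1 →
          (x ∈ Z ↔ (σ.arr 23 x).testBit b = true)) X ∧
        ∀ x < 3 * n, (x ∈ X → σ'.arr 24 x = σ.arr 24 x + 2 ^ b) ∧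
          (x ∉ X → σ'.arr 24 x = σ.arr 24 x) := by
  have hbig := hr.big
  have hone := M.one_lt
  have hle := hC.le
  have hpos := hr.pos
  have hbP : 2 ^ b ≤ P := hr.two_pow ▸ Nat.pow_le_pow_right (by omega) hb
  generalize hp : 2 ^ b = p at *
  have hPn := hr.pow_le
  set F : ℕ → ℕ := fun x => if σ.arr 22 x = 1 then (if σ.arr 23 x / p % 2 = 1 then 3 * n
    else 3 * n + 1) else x with hF
  refine (Machine.Runs.seq (t₁ := 3 * n * 3 + 2) (R := fun σ₁ => ∀ x < 3 * n, σ₁.arr 25 x = F x)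
    (t₂ := (90 * m + 9) + (1 + (1 + (100 * (2 * σ.var 10 + (3 * n + 4) + 1) + ((3 * n * 3 + 2) + 1)))))
    (Machine.runs_map (K := 3 * n) F hr.fits
    (by simp (disch := omega) [three_n, Expr.eval, hr.n_eq, Nat.mod_eq_of_lt]) rfl rfl
    (fun i hi hfit => by
      simp (disch := omega) [Expr.eval, Expr.eval_ifEq M.one_lt hfit,
        State.setVar_var, three_n, Nat.mod_eq_of_lt, hF, hr.n_eq, h14])
    fun σ₁ _ _ h _ => h) ?_).mono (by omega) fun _ _ _ h => h
  intro σ₁ hf1 hfit1 h1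
  have hr1 := hr.frame hf1 hfit1 rfl
  have hC1 := hC.frame hf1 rfl
  have hnet : σ₁.net = σ.net := by
    simp only [State.net, hf1.var 10 rfl, hf1.arr 19 rfl, hf1.arr 20 rfl, hf1.arr 21 rfl]
  refine Machine.Runs.seq (runs_build hr1 hC1 (fun x hx => by
    rw [h1 x hx]; simp only [hF]; split_ifs <;> omega)) ?_
  rintro σ₂ hf2 hfit2 ⟨h2, q, hq⟩
  rw [hnet] at hq
  have hr2 := hr1.frame hf2 hfit2 rfl
  refine Machine.Runs.seq (R := fun σ' => σ' = σ₂.tick.setVar 3 (3 * n + 1))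
    (Machine.runs_assign hfit2
      (by simp (disch := omega) [Expr.eval, three_n, hr2.n_eq, Nat.mod_eq_of_lt])) ?_
  rintro _ hf3 hfit3 rfl
  have e10 : σ₁.var 10 = σ.var 10 := hf1.var 10 rfl
  let fq : FlowQuery (3 * n + 4) (2 * σ₁.var 10) :=
    ⟨q, ⟨3 * n, by omega⟩, ⟨3 * n + 1, by omega⟩, by simp⟩
  have hhold : (σ₂.tick.setVar 3 (3 * n + 1)).HoldsGraph q := by
    obtain ⟨a1, a2, a3⟩ := hq.holds
    exact ⟨by simpa [State.setVar_var] using a1, by simpa [State.setVar_var] using a2, a3⟩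
  refine Machine.Runs.seq (R := fun σ' => σ' =
    ((((σ₂.tick.setVar 3 (3 * n + 1)).tick.charge (3 * n + 4) (2 * σ₁.var 10)).fillArr 3
      fun e => (M.O.flow fq e).toNat).fillArr 4 fun e => (-M.O.flow fq e).toNat))
    (Machine.runs_callFlow hfit3 fq hq.kind
      ⟨hhold, by simp [State.setVar_var, h2, fq], by simp [State.setVar_var, fq]⟩ rfl) ?_
  rintro σ₃ hf4 hfit4 h4
  have hmax : q.IsMaxFlow ⟨3 * n, by omega⟩ ⟨3 * n + 1, by omega⟩ (M.O.flow fq) :=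
    M.correct.flow_correct fq hq.kind
  have hvar3 : σ₃.var = (σ₂.tick.setVar 3 (3 * n + 1)).var := funext fun x => hf4.var x rfl
  have hhold3 : σ₃.HoldsGraph q := by
    obtain ⟨a1, a2, a3⟩ := hhold
    refine ⟨hvar3 ▸ a1, hvar3 ▸ a2, ?_⟩
    rw [hf4.arr 0 rfl, hf4.arr 1 rfl, hf4.arr 2 rfl]
    exact a3
  have hv3 : σ₃.vertices = σ.vertices + (3 * n + 4) ∧ σ₃.edges = σ.edges + 2 * σ.var 10 := by
    rw [← hf1.vertices rfl, ← hf1.edges rfl, ← hf2.vertices rfl, ← hf2.edges rfl, ← e10, h4]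
    exact ⟨rfl, rfl⟩
  refine Machine.Runs.seq (R := fun σ₄ => ∃ X : Set ℕ, (3 * n : ℕ) ∈ X ∧
      q.ResClosed (M.O.flow fq) X ∧ (∀ Z, (3 * n : ℕ) ∈ Z → q.ResClosed (M.O.flow fq) Z → X ⊆ Z) ∧
      ∀ v < 3 * n + 4, (σ₄.arr 30 v = 1 ↔ v ∈ X)) (t₁ := 100 * (2 * σ.var 10 + (3 * n + 4) + 1))
      ((runs_search hfit4 hhold3 (s := ⟨3 * n, by omega⟩) hmax.1.1 ?_ ?_ ?_ (by omega) (by omega)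
        ?_).mono (by rw [e10]) fun _ _ _ h => h) ?_
  · intro e; simp [h4, State.fillArr]
  · intro e; simp [h4, State.fillArr]
  · rw [hvar3]; simpa [State.setVar_var] using h2
  · intro e
    obtain ⟨k, hk, hk'⟩ := hq.weight e
    rw [hk']
    exact hC.weight_lt hr hW (by simpa [State.net] using hk)
  rintro σ₄ hf5 hfit5 ⟨X, hsX, hXc, hXm, hX⟩
  obtain ⟨htX, hXmin⟩ := q.least_mincut_of_maxFlow hmax (by simp) hsX hXc hXm
  have e24 : σ₄.arr 24 = σ.arr 24 := by
    rw [hf5.arr 24 rfl, hf4.arr 24 rfl, hf3.arr 24 rfl, hf2.arr 24 rfl, hf1.arr 24 rfl]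
  have e25 : ∀ x < 3 * n, σ₄.arr 25 x = F x := by
    intro x hx
    rw [hf5.arr 25 rfl, hf4.arr 25 rfl, hf3.arr 25 rfl, hf2.arr 25 rfl, h1 x hx]
  have e14 : σ₄.var 14 = p := by
    rw [hf5.var 14 rfl, hf4.var 14 rfl, hf3.var 14 rfl, hf2.var 14 rfl, hf1.var 14 rfl, h14]
  have e4 : σ₄.var 4 = n := by
    rw [hf5.var 4 rfl, hf4.var 4 rfl, hf3.var 4 rfl, hr2.n_eq]
  have hFlt : ∀ x < 3 * n, F x < 3 * n + 2 := fun x hx => by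
    simp only [hF]; split_ifs <;> omega
  refine Machine.Runs.seq (R := fun σ₅ => ∀ x < 3 * n, σ₅.arr 24 x =
      if σ₄.arr 30 (F x) = 1 then σ.arr 24 x + p else σ.arr 24 x)
    (Machine.runs_map (K := 3 * n) (fun x =>
      if σ₄.arr 30 (F x) = 1 then σ.arr 24 x + p else σ.arr 24 x) hfit5
    (by simp (disch := omega) [three_n, Expr.eval, e4, Nat.mod_eq_of_lt]) rfl rfl
    (fun i hi hfit => by
      have := hlab i hi
      simp (disch := omega) [Expr.eval, Expr.eval_ifEq M.one_lt hfit,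
        State.setVar_var, Nat.mod_eq_of_lt, e14, e24, e25 i hi])
    fun σ₁ _ _ h _ => h) ?_
  intro σ₅ hf6 hfit6 h6
  have e14 : σ₅.var 14 = p := (hf6.var 14 rfl).trans e14
  have e25 : σ₁.arr 25 = σ₁.arr 25 := rfl
  have e24' : σ₁.arr 24 = σ.arr 24 := hf1.arr 24 rfl
  refine Machine.runs_assign hfit6 ⟨?_, ?_, ?_, {x | x < 3 * n ∧ F x ∈ X}, fun x hx => hx.1, ?_, ?_⟩
  · simp (disch := omega) [Expr.eval, State.setVar_var, e14, Nat.mod_eq_of_lt, pow_succ, hp,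
      Nat.mul_comm]
  · exact (hf6.vertices rfl).trans ((hf5.vertices rfl).trans hv3.1)
  · exact (hf6.edges rfl).trans ((hf5.edges rfl).trans hv3.2)
  · have hends : ∀ k ∈ σ.net.s, σ.net.x k < 3 * n ∧ σ.net.y k < 3 * n := by
      intro k hk
      have hk : k < σ.var 10 := by simpa [State.net] using hk
      have h1 := hC.x_lt k hk
      have h2 := hC.y_lt k hk
      exact ⟨by show σ.arr 19 k < _; omega, h2⟩
    have hcongr : ∀ Z : Set ℕ, σ.net.fcut (σ₁.arr 24) {x | σ₁.arr 25 x ∈ Z} =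
        σ.net.fcut (σ.arr 24) {x | x < 3 * n ∧ F x ∈ Z} := by
      intro Z
      rw [e24']
      refine Net.fcut_congr (fun _ _ => ⟨rfl, rfl⟩) fun k hk => ?_
      obtain ⟨a1, a2⟩ := hends k hk
      simp only [Set.mem_ofPred_eq, h1 _ a1, h1 _ a2, a1, a2, true_and]
    -- An inequality is enough here, since `X` is only compared with query cuts whose weight is
    -- known exactly.
    have hle := hq.le_cut X htX
    rw [hcongr] at hle
    have hbit : ∀ x, (σ.arr 23 x).testBit b = true ↔ σ.arr 23 x / p % 2 = 1 := by
      intro x; rw [Nat.testBit_eq_decide_div_mod_eq, hp]; simp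
    have key : ∀ Z : Set ℕ, (∀ x, x < 3 * n → σ.arr 22 x = 1 →
        (x ∈ Z ↔ (σ.arr 23 x).testBit b = true)) → σ.net.fcut (σ.arr 24) {x | x < 3 * n ∧ F x ∈ X} ≤
        σ.net.fcut (σ.arr 24) Z ∧ (σ.net.fcut (σ.arr 24) Z ≤
        σ.net.fcut (σ.arr 24) {x | x < 3 * n ∧ F x ∈ X} → {x | x < 3 * n ∧ F x ∈ X} ⊆ Z) := by
      intro Z hZ
      -- This cut contains the flow source but neither the sink nor the two vertices that carry the
      -- former loops, so its weight in the query is exactly the cost of `Z`.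
      set Z' : Set ℕ := {y | y = 3 * n ∨ (y < 3 * n ∧ y ∈ Z)} with hZ'
      have hFZ : ∀ x < 3 * n, (F x ∈ Z' ↔ x ∈ Z) := by
        intro x hx
        simp only [hF, hZ', Set.mem_ofPred_eq]
        by_cases h22 : σ.arr 22 x = 1
        · rw [hZ x hx h22, hbit]
          by_cases h23 : σ.arr 23 x / p % 2 = 1 <;> simp [h22, h23]
        · simp [h22, hx.ne, hx]
      have hn : ∀ j, 1 ≤ j → 3 * n + j ∉ Z' := by
        intro j hj h
        rcases h with h | h <;> omega
      have hcutZ := hq.cut_eq Z' (hn 1 le_rfl) (hn 2 (by omega)) (hn 3 (by omega))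
      rw [hcongr] at hcutZ
      have hZZ : σ.net.fcut (σ.arr 24) {x | x < 3 * n ∧ F x ∈ Z'} = σ.net.fcut (σ.arr 24) Z := by
        refine Net.fcut_congr (fun _ _ => ⟨rfl, rfl⟩) fun k hk => ?_
        obtain ⟨a1, a2⟩ := hends k hk
        simp only [Set.mem_ofPred_eq, hFZ _ a1, hFZ _ a2, a1, a2, true_and, and_self]
      obtain ⟨b1, b2⟩ := hXmin Z' (Or.inl rfl) (hn 1 le_rfl)
      refine ⟨by omega, fun hle' x hx => ?_⟩
      exact (hFZ x hx.1).1 (b2 (by omega) hx.2)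
    refine ⟨fun x hx h22 => ?_, fun Z hZ => (key Z hZ).1, fun Z hZ => (key Z hZ).2⟩
    rw [hbit]
    simp only [hF, Set.mem_ofPred_eq, h22, if_true, hx, true_and]
    by_cases h23 : σ.arr 23 x / p % 2 = 1
    · simp [h23, hsX]
    · simpa [h23] using htX
  · intro x hx
    have := hFlt x hx
    have h6 := h6 x hx
    refine ⟨fun hxX => ?_, fun hxX => ?_⟩
    · have : σ₄.arr 30 (F x) = 1 := (hX _ (by omega)).2 hxX.2
      simpa [this, hp] using h6
    · have : ¬σ₄.arr 30 (F x) = 1 := fun h => hxX ⟨hx, (hX _ (by omega)).1 h⟩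
      simpa [this] using h6

end

/-- The vertices whose label is prescribed. -/
def State.coded (n : ℕ) (σ : State) : Set ℕ := {x | x < 3 * n ∧ σ.arr 22 x = 1}

section

variable {κ : Kind} {M : Machine κ} {σ : State} {n m B P W : ℕ} {G : MGraph n m} {c : Cfg}

theorem Contracted.ends (hC : Contracted κ G c σ) {k : ℕ} (hk : k ∈ σ.net.s) :
    σ.net.x k < 3 * n ∧ σ.net.y k < 3 * n := by
  have hk : k < σ.var 10 := by simpa [State.net] using hk
  have h1 := hC.x_lt k hk
  exact ⟨by show σ.arr 19 k < _; omega, hC.y_lt k hk⟩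

theorem State.net_frame {σ' : State} {p : Prog} (hf : Frame p σ σ')
    (hp : (p.setsVar 10 || p.setsArr 19 || p.setsArr 20 || p.setsArr 21) = false) :
    σ'.net = σ.net := by
  simp only [Bool.or_eq_false_iff] at hp
  simp only [State.net, hf.var 10 hp.1.1.1, hf.arr 19 hp.1.1.2, hf.arr 20 hp.1.2, hf.arr 21 hp.2]

theorem runs_refine (hr : Regs M.w σ n m B P W) (hW : W = G.totalWeight)
    (hC : Contracted κ G c σ) (hlab : ∀ x < 3 * n, σ.arr 24 x = 0) :
    M.Runs refineProg σ ((B + 1) * (2000 * (n + m) + 2) + 3) fun σ' =>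
      σ'.vertices = σ.vertices + (B + 1) * (3 * n + 4) ∧
      σ'.edges = σ.edges + (B + 1) * (2 * σ.var 10) ∧
      ∃ (X : ℕ → Set ℕ) (lab : ℕ → ℕ → ℕ),
        Refinement σ.net (σ.coded n) (σ.arr 23) B X lab ∧
        (∀ x < 3 * n, σ'.arr 24 x = lab (B + 1) x) ∧ ∀ x, 3 * n ≤ x → lab (B + 1) x = 0 := by
  have hbig := hr.big
  refine (Machine.Runs.seq (t₁ := 1) (t₂ := (B + 1) * (2000 * (n + m) + 2) + 2)
    (R := fun σ₁ => σ₁ = σ.tick.setVar 14 1)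
    (Machine.runs_assign hr.fits (by simp [Expr.eval, Nat.mod_eq_of_lt M.one_lt])) ?_).mono
    (by omega) fun _ _ _ h => h
  rintro _ hf1 hfit1 rfl
  have hr1 := hr.frame hf1 hfit1 rfl
  have hC1 := hC.frame hf1 rfl
  refine Machine.runs_for (K := B + 1) (fun i σ₁ => σ₁.var 14 = 2 ^ i ∧
      σ₁.vertices = σ.vertices + i * (3 * n + 4) ∧
      σ₁.edges = σ.edges + i * (2 * σ.var 10) ∧
      ∃ (X : ℕ → Set ℕ) (lab : ℕ → ℕ → ℕ), (∀ x, lab 0 x = 0) ∧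
        (∀ b < i, (∀ x, (x ∈ X b → lab (b + 1) x = lab b x + 2 ^ b) ∧
          (x ∉ X b → lab (b + 1) x = lab b x)) ∧
          IsLeastMin (σ.net.fcut (lab b))
            (fun Z => ∀ x ∈ σ.coded n, (x ∈ Z ↔ (σ.arr 23 x).testBit b = true)) (X b)) ∧
        (∀ x, lab i x < 2 ^ i) ∧
        (∀ x < 3 * n, σ₁.arr 24 x = lab i x) ∧ ∀ x, 3 * n ≤ x → lab i x = 0) hfit1
    (by simp (disch := omega) [Expr.eval, hr1.B_eq, Nat.mod_eq_of_lt]) rfl rfl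
    ⟨rfl, by simp [State.setVar, State.tick], by simp [State.setVar, State.tick],
      fun _ => ∅, fun _ _ => 0, fun _ => rfl, by simp, by simp, hlab, by simp⟩ ?_ ?_
  · rintro i hi σ₁ hfit hf2 - ⟨h14, hv, he, X, lab, hl0, hl, hlt, h24, h0⟩
    have hr2 := hr1.frame hf2 hfit rfl
    have hC2 := hC1.frame hf2 rfl
    have hnet : σ₁.net = (σ.tick.setVar 14 1).net := State.net_frame hf2 rfl
    have e22 : σ₁.arr 22 = σ.arr 22 := hf2.arr 22 rfl
    have e23 : σ₁.arr 23 = σ.arr 23 := hf2.arr 23 rfl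
    have e10 : σ₁.var 10 = σ.var 10 := hf2.var 10 rfl
    have hT : Frame .skip σ₁ σ₁.tick := (Frame.refl _ _).tick
    refine (runs_phase (b := i) (hr2.frame hT hfit.tick rfl) hW (hC2.frame hT rfl) (by omega) h14
      (fun x hx => by rw [State.tick_arr, h24 x hx]; exact hlt x)).mono le_rfl ?_
    rintro σ₂ - - ⟨g14, gv, ge, Y, hY, hmin, hup⟩
    classical
    rw [show σ₁.tick.net = σ.net from hnet] at hmin
    simp only [State.tick_arr, e22, e23] at hmin hup
    have hfc : σ.net.fcut (σ₁.arr 24) = σ.net.fcut (lab i) := by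
      funext Z
      refine Net.fcut_congr (fun k hk => ?_) fun _ _ => ⟨Iff.rfl, Iff.rfl⟩
      obtain ⟨a1, a2⟩ := hC.ends hk
      exact ⟨h24 _ a1, h24 _ a2⟩
    rw [hfc] at hmin
    refine ⟨by simpa [State.setVar_var] using g14, ?_, ?_, Function.update X i Y,
      Function.update lab (i + 1) (fun x => if x ∈ Y then lab i x + 2 ^ i else lab i x), ?_, ?_,
      ?_, ?_, ?_⟩
    · show σ₂.vertices = _
      rw [gv]; show σ₁.vertices + _ = _
      rw [hv]; ring
    · show σ₂.edges = _
      rw [ge]; show σ₁.edges + 2 * σ₁.var 10 = _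
      rw [he, e10]; ring
    · intro x
      rw [Function.update_of_ne (by omega)]; exact hl0 x
    · intro b hb
      rcases Nat.lt_succ_iff_lt_or_eq.1 hb with hb | rfl
      · rw [Function.update_of_ne (by omega), Function.update_of_ne (by omega),
          Function.update_of_ne (by omega)]
        exact hl b hb
      · rw [Function.update_self, Function.update_self, Function.update_of_ne (by omega)]
        refine ⟨fun x => ⟨fun hx => if_pos hx, fun hx => if_neg hx⟩, ?_⟩
        simpa only [State.coded, Set.mem_ofPred_eq, and_imp] using hmin
    · intro x
      rw [Function.update_self, pow_succ]
      have := hlt x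
      split_ifs <;> omega
    · intro x hx
      rw [Function.update_self, State.setVar_arr, State.tick_arr, ← h24 x hx]
      split_ifs with h
      exacts [(hup x hx).1 h, (hup x hx).2 h]
    · intro x hx
      rw [Function.update_self, h0 x hx, if_neg fun h => by have := hY x h; omega]
  · rintro σ₁ - - ⟨-, hv, he, X, lab, hl0, hl, -, h24, h0⟩
    exact ⟨hv, he, X, lab, ⟨hl0, fun b hb x => ((hl b (by omega)).1 x).1,
      fun b hb x => ((hl b (by omega)).1 x).2, fun b hb => (hl b (by omega)).2⟩, h24, h0⟩

end

/-! ### Candidate cuts, their weights and their verification. -/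

section

variable {κ : Kind} {M : Machine κ} {σ : State} {Q : State → Prop} {n m B P W : ℕ} {G : MGraph n m}
  {c : Cfg}

/-- The two sums are those accumulated by the two passes of `ownersProg`, one for each end of the
edges. -/
theorem Net.cut_eq_sum {ι : Type*} (N : Net ι ℕ) (o : ℕ → ℕ) (v : ℕ) : N.cut {x | o x = v} =
    (∑ k ∈ N.s, if o (N.x k) = v then (if o (N.x k) = o (N.y k) then 0 else N.w k) else 0) +
    ∑ k ∈ N.s, if o (N.y k) = v then (if o (N.x k) = o (N.y k) then 0 else N.w k) else 0 := by
  classical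
  unfold Net.cut Net.fcut
  rw [← Finset.sum_add_distrib]
  refine Finset.sum_congr rfl fun k _ => ?_
  simp only [edgeCost, if_true, Set.mem_ofPred_eq]
  by_cases h1 : o (N.x k) = v <;> by_cases h2 : o (N.y k) = v
  · simp [h1, h2]
  · simp [h1, h2, Ne.symm h2]
  · simp [h1, h2]
  · simp [h1, h2]

theorem runs_owners (hr : Regs M.w σ n m B P W) (hW : W = G.totalWeight)
    (hC : Contracted κ G c σ) (hlab : ∀ x < 3 * n, σ.arr 24 x < 2 * P) :
    M.Runs ownersProg σ (18 * n + 30 * m + 22) fun σ' =>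
      (∀ x < 3 * n, σ'.arr 32 x = if σ.arr 24 x < P then n else σ.arr 24 x - P) ∧
      ∀ v < n, σ'.arr 6 v = σ.net.cut {x | σ'.arr 32 x = v} := by
  have hbig := hr.big
  have hle := hC.le
  have hpn := hr.pow_le
  have hone := M.one_lt
  have hpos := hr.pos
  set o : ℕ → ℕ := fun x => if σ.arr 24 x < P then n else σ.arr 24 x - P with ho
  refine (Machine.Runs.seq (t₁ := 3 * n * 3 + 2)
    (t₂ := ((3 * n + 4) * 3 + 2) + ((σ.var 10 * 3 + 2) + (σ.var 10 * 3 + 2)))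
    (R := fun σ₁ => ∀ x < 3 * n, σ₁.arr 32 x = o x)
    (Machine.runs_map (K := 3 * n) o hr.fits
    (by simp (disch := omega) [three_n, Expr.eval, hr.n_eq, Nat.mod_eq_of_lt]) rfl rfl
    (fun i hi hfit => by
      simp (disch := omega) [Expr.eval, Expr.eval_ifLt M.one_lt hfit, State.setVar_var, hr.n_eq,
        hr.pow_eq, ho])
    fun σ₁ _ _ h _ => h) ?_).mono (by omega) fun _ _ _ h => h
  intro σ₁ hf1 hfit1 h1
  have hr1 := hr.frame hf1 hfit1 rfl
  have e10 : σ₁.var 10 = σ.var 10 := hf1.var 10 rfl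
  refine Machine.Runs.seq (R := fun σ₂ => ∀ x < 3 * n + 4, σ₂.arr 6 x = 0)
    (Machine.runs_map (K := 3 * n + 4) (fun _ => 0) hfit1
    (by simp (disch := omega) [three_n, Expr.eval, hr1.n_eq, Nat.mod_eq_of_lt]) rfl rfl
    (fun i hi hfit => by simp [Expr.eval]) fun σ₁ _ _ h _ => h) ?_
  intro σ₂ hf2 hfit2 h2
  have e10 : σ₂.var 10 = σ.var 10 := (hf2.var 10 rfl).trans e10
  have e32 : σ₂.arr 32 = σ₁.arr 32 := hf2.arr 32 rfl
  have e19 : σ₂.arr 19 = σ.arr 19 := (hf2.arr 19 rfl).trans (hf1.arr 19 rfl)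
  have e20 : σ₂.arr 20 = σ.arr 20 := (hf2.arr 20 rfl).trans (hf1.arr 20 rfl)
  have e21 : σ₂.arr 21 = σ.arr 21 := (hf2.arr 21 rfl).trans (hf1.arr 21 rfl)
  set F : ℕ → ℕ := fun k => if σ₁.arr 32 (σ.arr 19 k) = σ₁.arr 32 (σ.arr 20 k) then 0 else σ.arr 21 k
    with hF
  have hI : ∀ k < σ.var 10, σ₁.arr 32 (σ.arr 19 k) < 3 * n + 4 ∧
      σ₁.arr 32 (σ.arr 20 k) < 3 * n + 4 := by
    intro k hk
    have a1 := hC.x_lt k hk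
    have a2 := hC.y_lt k hk
    rw [h1 _ (by omega), h1 _ a2]
    have a3 := hlab (σ.arr 19 k) (by omega)
    have a4 := hlab _ a2
    simp only [ho]
    constructor <;> split_ifs <;> omega
  have hsum : ∀ (I : ℕ → ℕ) (j : ℕ), 4 * (∑ k ∈ Finset.range (σ.var 10), if I k = j then F k else 0)
      < 2 ^ M.w := by
    intro I j
    have a1 : (∑ k ∈ Finset.range (σ.var 10), if I k = j then F k else 0) ≤
        ∑ k ∈ Finset.range (σ.var 10), σ.arr 21 k :=
      Finset.sum_le_sum fun k _ => by simp only [hF]; split_ifs <;> omega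
    have a2 := hC.total
    have h3 := hr.prod
    rw [← hW] at a2
    have h4 : (2 * n + 1) * W + 1 ≤ 2 * ((n + 1) * (W + 1)) := by nlinarith
    omega
  have hzero : ∀ (I : ℕ → ℕ) (j : ℕ), (∀ k < σ.var 10, I k < 3 * n + 4) → 3 * n + 4 ≤ j →
      (∑ k ∈ Finset.range (σ.var 10), if I k = j then F k else 0) = 0 := fun I j hI hj =>
    Finset.sum_eq_zero fun k hk => if_neg (by have := hI k (Finset.mem_range.1 hk); omega)
  refine Machine.Runs.seq (R := fun σ₃ => ∀ j, σ₃.arr 6 j = σ₂.arr 6 j +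
      ∑ k ∈ Finset.range (σ.var 10), if σ₁.arr 32 (σ.arr 19 k) = j then F k else 0)
    (Machine.runs_collect (K := σ.var 10) (fun k => σ₁.arr 32 (σ.arr 19 k)) F hfit2
    (by simp [Expr.eval, e10]) rfl rfl rfl
    (fun i hi hfit => by simp [Expr.eval, State.setVar_var, e19, e32])
    (fun i hi hfit => by
      simp [Expr.eval, Expr.eval_ifEq M.one_lt hfit, State.setVar_var, e19, e20, e21, e32, hF])
    (fun j => ?_) fun σ₁ _ _ h => h) ?_
  · by_cases hj : j < 3 * n + 4
    · rw [h2 j hj]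
      have := hsum (fun k => σ₁.arr 32 (σ.arr 19 k)) j
      omega
    · rw [hzero _ j (fun k hk => (hI k hk).1) (by omega)]
      exact hfit2.arr _ _
  intro σ₃ hf3 hfit3 h3
  have e10 : σ₃.var 10 = σ.var 10 := (hf3.var 10 rfl).trans e10
  have e32 : σ₃.arr 32 = σ₁.arr 32 := (hf3.arr 32 rfl).trans e32
  have e19 : σ₃.arr 19 = σ.arr 19 := (hf3.arr 19 rfl).trans e19
  have e20 : σ₃.arr 20 = σ.arr 20 := (hf3.arr 20 rfl).trans e20
  have e21 : σ₃.arr 21 = σ.arr 21 := (hf3.arr 21 rfl).trans e21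
  refine Machine.runs_collect (K := σ.var 10) (fun k => σ₁.arr 32 (σ.arr 20 k)) F hfit3
    (by simp [Expr.eval, e10]) rfl rfl rfl
    (fun i hi hfit => by simp [Expr.eval, State.setVar_var, e20, e32])
    (fun i hi hfit => by
      simp [Expr.eval, Expr.eval_ifEq M.one_lt hfit, State.setVar_var, e19, e20, e21, e32, hF])
    (fun j => ?_) fun σ₄ hfit4 hf4 h4 => ?_
  · by_cases hj : j < 3 * n + 4
    · rw [h3, h2 j hj]
      have := hsum (fun k => σ₁.arr 32 (σ.arr 19 k)) j
      have := hsum (fun k => σ₁.arr 32 (σ.arr 20 k)) j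
      omega
    · rw [hzero _ j (fun k hk => (hI k hk).2) (by omega)]
      exact hfit3.arr _ _
  · have e32 : σ₄.arr 32 = σ₁.arr 32 := (hf4.arr 32 rfl).trans e32
    rw [e32]
    refine ⟨h1, fun v hv => ?_⟩
    rw [h4, h3, h2 v (by omega), zero_add, Net.cut_eq_sum]
    rfl

theorem Machine.runs_callVerify (hσ : σ.Fits M.w) {N K : ℕ} (q : SSCQuery N K)
    (hk : q.graph.OfKind κ) (hh : σ.HoldsSSCQuery q)
    (hQ : Q ((σ.tick.charge N K).fillArr 7 fun v => if M.O.verify q v then 1 else 0)) :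
    M.Runs .callVerify σ 1 Q :=
  Machine.runs_of_exec (.callVerify q hk hh) hσ le_rfl hQ

end

/-- The sources of the instances. -/
def State.sources (n : ℕ) (σ : State) : Set ℕ := {x | x < n ∧ σ.arr 17 (σ.arr 14 x) = x}

section

variable {κ : Kind} {M : Machine κ} {σ : State} {n m B P W : ℕ} {G : MGraph n m} {c : Cfg}

open Classical in
/-- In the query in which a set of vertices is merged into the vertex `3 * n`, the connectivity
between `3 * n` and `v` is the least weight of a cut between this set and `v`. -/
theorem IsQuery.mincut {H : Net ℕ ℕ} {lab f : ℕ → ℕ} {K : ℕ} {q : MGraph (3 * n + 4) K} {σ : State}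
    (h : IsQuery κ n H lab f q σ) (hends : ∀ k ∈ H.s, H.x k < 3 * n ∧ H.y k < 3 * n)
    {A : Set ℕ} (hlab : ∀ x < 3 * n, lab x = 0)
    (hf : ∀ x < 3 * n, f x = if x ∈ A then 3 * n else x) {v : ℕ} (hv : v < 3 * n) (hvA : v ∉ A) :
    (∀ S : Set ℕ, v ∈ S → (∀ x ∈ A, x ∉ S) →
      q.mincut ⟨3 * n, by omega⟩ ⟨v, by omega⟩ ≤ H.cut S) ∧
    ∀ L, (∀ S : Set ℕ, v ∈ S → (∀ x ∈ A, x ∉ S) → L ≤ H.cut S) →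
      L ≤ q.mincut ⟨3 * n, by omega⟩ ⟨v, by omega⟩ := by
  have hcut : ∀ Z : Set ℕ, H.fcut lab {x | f x ∈ Z} = H.cut {x | if x ∈ A then 3 * n ∈ Z else x ∈ Z} := by
    intro Z
    refine Net.fcut_congr (fun k hk => ⟨hlab _ (hends k hk).1, hlab _ (hends k hk).2⟩)
      fun k hk => ?_
    simp only [Set.mem_ofPred_eq]
    rw [hf _ (hends k hk).1, hf _ (hends k hk).2]
    constructor <;> split_ifs <;> rfl
  constructor
  · intro S hvS hS
    set Z : Set ℕ := {y | y = 3 * n ∨ (y < 3 * n ∧ y ∉ S)} with hZ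
    have hn : ∀ j, 1 ≤ j → 3 * n + j ∉ Z := by
      intro j hj h
      rcases h with h | h <;> omega
    refine (q.mincut_le_cut (Z := Z) (Or.inl rfl) ?_).trans ?_
    · rintro (h | h)
      · simp only at h; omega
      · exact h.2 hvS
    · rw [h.cut_eq Z (hn 1 le_rfl) (hn 2 (by omega)) (hn 3 (by omega)), hcut, ← H.cut_compl S]
      refine (Net.cut_congr fun k hk => ?_).le
      have key : ∀ x < 3 * n, (x ∈ {x | if x ∈ A then 3 * n ∈ Z else x ∈ Z} ↔ x ∈ Sᶜ) := by
        intro x hx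
        simp only [Set.mem_ofPred_eq, Set.mem_compl_iff]
        by_cases hxA : x ∈ A
        · simp [hxA, hS x hxA, hZ]
        · simp [hxA, hZ, hx, hx.ne]
      exact ⟨key _ (hends k hk).1, key _ (hends k hk).2⟩
  · intro L hL
    refine q.le_mincut (by rw [ne_eq, Fin.mk.injEq]; omega) fun Z h1 h2 => ?_
    have hLS := hL {x | ¬if x ∈ A then 3 * n ∈ Z else x ∈ Z} (by simpa [hvA] using h2)
      (fun x hx => by simpa [hx] using h1)
    -- The comparison of weights is available only for sets without the sink, so otherwise the
    -- complement is used.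
    by_cases hZ : 3 * n + 1 ∈ Z
    · have := h.le_cut Zᶜ (by simpa using hZ)
      rw [hcut, q.net.cut_compl] at this
      refine le_trans (le_of_le_of_eq hLS ?_) this
      congr 1
      ext x
      simp only [Set.mem_ofPred_eq, Set.mem_compl_iff]
      split_ifs <;> rfl
    · have := h.le_cut Z hZ
      rw [hcut, ← H.cut_compl] at this
      exact hLS.trans this

/-- Every estimate is the weight of an actual cut and at most `W`. The promise thus holds, and
equality with the truncated connectivity just means that no cut between the terminal and the sources
is lighter. -/
theorem runs_verify (hr : Regs M.w σ n m B P W) (hC : Contracted κ G c σ)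
    (hest : ∀ v < n, σ.arr 22 v = 1 → v ∉ σ.sources n → σ.arr 6 v ≤ W ∧
      ∃ S, v ∈ S ∧ (∀ x ∈ σ.sources n, x ∉ S) ∧ σ.net.cut S = σ.arr 6 v) :
    M.Runs verifyProg σ (100 * (n + m + 1)) fun σ' =>
      σ'.vertices = σ.vertices + (3 * n + 4) ∧ σ'.edges = σ.edges + 2 * σ.var 10 ∧
      ∀ v < n, σ'.arr 5 v ≤ 1 ∧ (σ'.arr 5 v = 1 → σ'.arr 7 v ≤ 1) ∧
        (σ'.arr 5 v = 1 ∧ σ'.arr 7 v = 1 ↔ σ.arr 22 v = 1 ∧ v ∉ σ.sources n ∧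
          ∀ S, v ∈ S → (∀ x ∈ σ.sources n, x ∉ S) → σ.arr 6 v ≤ σ.net.cut S) := by
  classical
  have hbig := hr.big
  have hle := hC.le
  have hpos := hr.pos
  have hone := M.one_lt
  have hsrc : ∀ v, v ∈ σ.sources n ↔ v < n ∧ σ.arr 17 (σ.arr 14 v) = v := fun _ => Iff.rfl
  set F : ℕ → ℕ := fun x => if x ∈ σ.sources n then 3 * n else x with hF
  refine (Machine.Runs.seq (t₁ := 3 * n * 3 + 2)
    (t₂ := (3 * n * 3 + 2) + ((90 * m + 9) + (((3 * n + 4) * 3 + 2) + (1 + 1))))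
    (R := fun σ₁ => ∀ x < 3 * n, σ₁.arr 25 x = F x)
    (Machine.runs_map (K := 3 * n) F hr.fits
    (by simp (disch := omega) [three_n, Expr.eval, hr.n_eq, Nat.mod_eq_of_lt]) rfl rfl
    (fun i hi hfit => by
      simp (disch := omega) [Expr.eval, Expr.eval_ifLt M.one_lt hfit, Expr.eval_ifEq M.one_lt hfit,
        State.setVar_var, hr.n_eq, three_n, ifSource, Nat.mod_eq_of_lt, hF, hsrc]
      by_cases h1 : i < n <;> simp [h1])
    fun σ₁ _ _ h _ => h) ?_).mono (by omega) fun _ _ _ h => h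
  intro σ₁ hf1 hfit1 h1
  have hr1 := hr.frame hf1 hfit1 rfl
  refine Machine.Runs.seq (R := fun σ₂ => ∀ x < 3 * n, σ₂.arr 24 x = 0)
    (Machine.runs_map (K := 3 * n) (fun _ => 0) hfit1
    (by simp (disch := omega) [three_n, Expr.eval, hr1.n_eq, Nat.mod_eq_of_lt]) rfl rfl
    (fun i hi hfit => by simp [Expr.eval]) fun σ₁ _ _ h _ => h) ?_
  intro σ₂ hf2 hfit2 h2
  have hr2 := hr1.frame hf2 hfit2 rfl
  have hC2 := (hC.frame hf1 rfl).frame hf2 rfl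
  have hnet : σ₂.net = σ.net := (State.net_frame hf2 rfl).trans (State.net_frame hf1 rfl)
  have h25 : ∀ x < 3 * n, σ₂.arr 25 x = F x := fun x hx => by rw [hf2.arr 25 rfl, h1 x hx]
  refine Machine.Runs.seq (runs_build hr2 hC2 fun x hx => by
    rw [h25 x hx]; simp only [hF]; split_ifs <;> omega) ?_
  rintro σ₃ hf3 hfit3 ⟨hv2, q, hq⟩
  rw [hnet] at hq
  have e10 : σ₂.var 10 = σ.var 10 := (hf2.var 10 rfl).trans (hf1.var 10 rfl)
  have hr3 := hr2.frame hf3 hfit3 rfl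
  have e22 : σ₃.arr 22 = σ.arr 22 :=
    (hf3.arr 22 rfl).trans ((hf2.arr 22 rfl).trans (hf1.arr 22 rfl))
  have e17 : σ₃.arr 17 = σ.arr 17 :=
    (hf3.arr 17 rfl).trans ((hf2.arr 17 rfl).trans (hf1.arr 17 rfl))
  have e14 : σ₃.arr 14 = σ.arr 14 :=
    (hf3.arr 14 rfl).trans ((hf2.arr 14 rfl).trans (hf1.arr 14 rfl))
  have e6 : σ₃.arr 6 = σ.arr 6 :=
    (hf3.arr 6 rfl).trans ((hf2.arr 6 rfl).trans (hf1.arr 6 rfl))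
  set T : ℕ → ℕ := fun x => if x = 3 * n ∨ (x < n ∧ σ.arr 22 x = 1 ∧ x ∉ σ.sources n) then 1 else 0
    with hT
  refine Machine.Runs.seq (R := fun σ₄ => ∀ x < 3 * n + 4, σ₄.arr 5 x = T x)
    (Machine.runs_map (K := 3 * n + 4) T hfit3
    (by simp (disch := omega) [three_n, Expr.eval, hr3.n_eq, Nat.mod_eq_of_lt]) rfl rfl
    (fun i hi hfit => by
      simp (disch := omega) [Expr.eval, Expr.eval_ifLt M.one_lt hfit, Expr.eval_ifEq M.one_lt hfit,
        State.setVar_var, hr3.n_eq, three_n, ifSource, Nat.mod_eq_of_lt, hT, hsrc, e22, e17, e14]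
      by_cases h1 : i = 3 * n
      · simp [h1]
      by_cases h2 : i < n
      · by_cases h3 : σ.arr 22 i = 1 <;> by_cases h4 : σ.arr 17 (σ.arr 14 i) = i <;>
          simp [h1, h2, h3, h4]
      · simp [h1, h2])
    fun σ₁ _ _ h _ => h) ?_
  intro σ₄ hf4 hfit4 h4
  have hr4 := hr3.frame hf4 hfit4 rfl
  refine Machine.Runs.seq (R := fun σ' => σ' = σ₄.tick.setVar 3 W)
    (Machine.runs_assign hfit4 (by simp [Expr.eval, hr4.W_eq])) ?_
  rintro _ hf5 hfit5 rfl
  have hmin := fun (v : ℕ) (hv : v < n) (hvs : v ∉ σ.sources n) => hq.mincut (v := v)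
    (fun k hk => hC.ends hk) h2 h25 (by omega) hvs
  let sq : SSCQuery (3 * n + 4) (2 * σ₂.var 10) :=
    { graph := q
      k := W
      terminals := Finset.univ.filter fun x => x = (3 * n : ℕ) ∨
        ((x : ℕ) < n ∧ σ.arr 22 x = 1 ∧ (x : ℕ) ∉ σ.sources n)
      source := ⟨3 * n, by omega⟩
      source_mem := by simp
      est := fun x => σ.arr 6 x
      promise := by
        intro v hv hne
        rcases (Finset.mem_filter.1 hv).2 with h | ⟨h, h', h''⟩
        · exact absurd (Fin.ext h) hne
        · obtain ⟨-, S, hS, hS', hS''⟩ := hest v h h' h''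
          rw [← hS'']
          exact (min_le_left _ _).trans ((hmin v h h'').1 S hS hS') }
  have hhold : (σ₄.tick.setVar 3 W).HoldsSSCQuery sq := by
    obtain ⟨a1, a2, a3⟩ := hq.holds
    refine ⟨⟨?_, ?_, ?_⟩, ?_, ?_, fun v => ⟨?_, ?_⟩⟩
    · simpa [State.setVar_var, hf4.var 0 rfl] using a1
    · simpa [State.setVar_var, hf4.var 1 rfl] using a2
    · intro e
      simpa [hf4.arr 0 rfl, hf4.arr 1 rfl, hf4.arr 2 rfl] using a3 e
    · simpa [State.setVar_var, hf4.var 2 rfl, sq] using hv2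
    · simp [State.setVar_var, sq]
    · simp [h4 v v.2, sq, hT]
    · simp [hf4.arr 6 rfl, e6, sq]
  refine Machine.runs_callVerify hfit5 sq hq.kind hhold ⟨?_, ?_, fun v hv => ?_⟩
  · rw [← hf1.vertices rfl, ← hf2.vertices rfl, ← hf3.vertices rfl, ← hf4.vertices rfl]
    rfl
  · rw [← hf1.edges rfl, ← hf2.edges rfl, ← hf3.edges rfl, ← hf4.edges rfl, ← e10]
    rfl
  have h5 : ((σ₄.tick.setVar 3 W).tick.charge (3 * n + 4) (2 * σ₂.var 10) |>.fillArr 7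
      fun v => if M.O.verify sq v then 1 else 0).arr 5 v = T v := by
    simp [State.fillArr, State.charge, h4 v (by omega)]
  have h7 : ((σ₄.tick.setVar 3 W).tick.charge (3 * n + 4) (2 * σ₂.var 10) |>.fillArr 7
      fun v => if M.O.verify sq v then 1 else 0).arr 7 v =
      if M.O.verify sq ⟨v, by omega⟩ then 1 else 0 := by
    simp [State.fillArr, show v < 3 * n + 4 by omega]
  rw [h5, h7]
  refine ⟨by simp only [hT]; split_ifs <;> omega, fun _ => by split_ifs <;> omega, ?_⟩
  have hTv : T v = 1 ↔ σ.arr 22 v = 1 ∧ v ∉ σ.sources n := by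
    simp [hT, show v ≠ 3 * n by omega, hv]
  rw [hTv, and_assoc]
  refine and_congr_right fun h22 => and_congr_right fun hvs => ?_
  have hver := M.correct.verify_correct sq hq.kind ⟨v, by omega⟩
    (Finset.mem_filter.2 ⟨Finset.mem_univ _, Or.inr ⟨hv, h22, hvs⟩⟩)
    (by simp only [sq, ne_eq, Fin.mk.injEq]; omega)
  obtain ⟨m1, m2⟩ := hmin v hv hvs
  obtain ⟨hW, S, hS, hS', hS''⟩ := hest v hv h22 hvs
  have m3 := m1 S hS hS'
  have : (σ.arr 6 v = min (q.mincut ⟨3 * n, by omega⟩ ⟨v, by omega⟩) W) ↔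
      ∀ S, v ∈ S → (∀ x ∈ σ.sources n, x ∉ S) → σ.arr 6 v ≤ σ.net.cut S := by
    constructor
    · intro h S hS hS'
      exact h.le.trans ((min_le_left _ _).trans (m1 S hS hS'))
    · intro h
      have := m2 _ h
      omega
  rw [← this]
  simpa [sq] using hver

end

/-- The result of the verification for the vertex `v` is positive. -/
def State.Accepts (σ : State) (v : ℕ) : Prop := σ.arr 5 v = 1 ∧ σ.arr 7 v = 1

/-- The accepted vertices `v < i` get the new instances `σ₁.arr 33 v`. -/
structure Accepted (n : ℕ) (σ : State) (i : ℕ) (σ₁ : State) (hd : ℕ → ℕ) : Prop where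
  le : σ.var 9 ≤ σ₁.var 9
  le_add : σ₁.var 9 ≤ σ.var 9 + i
  hd_lt : ∀ j, σ.var 9 ≤ j → j < σ₁.var 9 → hd j < i
  id_hd : ∀ j, σ.var 9 ≤ j → j < σ₁.var 9 → σ₁.arr 33 (hd j) = j
  loc_new : ∀ j, σ.var 9 ≤ j → j < σ₁.var 9 → σ₁.arr 14 (n + j) = σ.arr 14 (hd j)
  dg_new : ∀ j, σ.var 9 ≤ j → j < σ₁.var 9 → σ₁.arr 13 (n + j) = σ.arr 6 (hd j)
  accepts : ∀ v < 3 * n + 1, σ₁.arr 33 v ≠ 0 → v < i ∧ σ.Accepts v ∧ σ.var 9 ≤ σ₁.arr 33 v ∧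
    σ₁.arr 33 v < σ₁.var 9 ∧ hd (σ₁.arr 33 v) = v
  ne_zero : ∀ v < i, σ.Accepts v → σ₁.arr 33 v ≠ 0
  old : ∀ x, x < n + σ.var 9 ∨ n + σ₁.var 9 ≤ x →
    σ₁.arr 14 x = σ.arr 14 x ∧ σ₁.arr 13 x = σ.arr 13 x

/-! ### Acceptance of candidates and update of the partition tree. -/

section

variable {κ : Kind} {M : Machine κ} {σ : State} {n m B P W : ℕ} {G : MGraph n m} {c : Cfg}

theorem runs_accept (hr : Regs M.w σ n m B P W) (h0 : 0 < σ.var 9) (hcnt : σ.var 9 ≤ n)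
    (hle : ∀ v < n, σ.arr 5 v ≤ 1 ∧ (σ.arr 5 v = 1 → σ.arr 7 v ≤ 1)) :
    M.Runs acceptProg σ (16 * n + 7) fun σ' => ∃ hd, Accepted n σ n σ' hd := by
  have hbig := hr.big
  have hone := M.one_lt
  refine (Machine.Runs.seq (t₁ := (3 * n + 1) * 3 + 2) (t₂ := n * (5 + 2) + 2)
    (R := fun σ₁ => ∀ x < 3 * n + 1, σ₁.arr 33 x = 0)
    (Machine.runs_map (K := 3 * n + 1) (fun _ => 0) hr.fits
    (by simp (disch := omega) [three_n, Expr.eval, hr.n_eq, Nat.mod_eq_of_lt]) rfl rfl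
    (fun i hi hfit => by simp [Expr.eval]) fun σ₁ _ _ h _ => h) ?_).mono (by omega) fun _ _ _ h => h
  intro σ₁ hf1 hfit1 h1
  have hr1 := hr.frame hf1 hfit1 rfl
  have e9 : σ₁.var 9 = σ.var 9 := hf1.var 9 rfl
  refine Machine.runs_for (K := n) (fun i σ₂ => ∃ hd, Accepted n σ i σ₂ hd) hfit1
    (by simp [Expr.eval, hr1.n_eq]) rfl rfl ?_ ?_ fun σ₂ _ _ h => ?_
  · refine ⟨fun _ => 0, ?_⟩
    have e9' : (σ₁.tick.setVar 15 0).var 9 = σ.var 9 := by simp [State.setVar_var, e9]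
    constructor
    · rw [e9']
    · rw [e9']; omega
    · intro j hj hj'; omega
    · intro j hj hj'; omega
    · intro j hj hj'; omega
    · intro j hj hj'; omega
    · intro v hv h; exact absurd (h1 v hv) h
    · intro v hv; omega
    · intro x _
      exact ⟨congrFun (hf1.arr 14 rfl) x, congrFun (hf1.arr 13 rfl) x⟩
  · rintro i hi σ₂ hfit2 hf2 h15 ⟨hd, hA⟩
    have hr2 := hr1.frame hf2 hfit2 rfl
    have e5 : σ₂.arr 5 = σ.arr 5 := (hf2.arr 5 rfl).trans (hf1.arr 5 rfl)
    have e7 : σ₂.arr 7 = σ.arr 7 := (hf2.arr 7 rfl).trans (hf1.arr 7 rfl)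
    have e6 : σ₂.arr 6 = σ.arr 6 := (hf2.arr 6 rfl).trans (hf1.arr 6 rfl)
    have hev : (Expr.mul (.load 5 (.var 15)) (.load 7 (.var 15))).eval M.w σ₂.tick ≠ 0 ↔
        σ.Accepts i := by
      obtain ⟨a1, a2⟩ := hle i hi
      simp only [Expr.eval, State.tick_var, State.tick_arr, h15, e5, e7, State.Accepts]
      rcases Nat.le_one_iff_eq_zero_or_eq_one.1 a1 with h | h
      · simp [h]
      · rcases Nat.le_one_iff_eq_zero_or_eq_one.1 (a2 h) with h' | h'
        · simp [h, h']
        · simp [h, h', Nat.mod_eq_of_lt hone]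
    have hc := hA.le_add
    have hc' := hA.le
    refine Machine.runs_branch (fun he => ?_) fun he => ?_
    · have hacc := hev.1 he
      refine Machine.runs_straight hfit2.tick.tick rfl fun _ => ⟨Function.update hd (σ₂.var 9) i, ?_⟩
      have g33 : σ₂.arr 33 i = 0 := by
        by_contra h
        have := (hA.accepts i (by omega) h).1
        omega
      have el : σ₂.arr 14 i = σ.arr 14 i := (hA.old i (Or.inl (by omega))).1
      generalize hτ : (((Prog.store 33 (Expr.var 15) (Expr.var 9)).seq
        ((Prog.store 14 ((Expr.var 4).add (Expr.var 9)) (Expr.load 14 (Expr.var 15))).seq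
        ((Prog.store 13 ((Expr.var 4).add (Expr.var 9)) (Expr.load 6 (Expr.var 15))).seq
        (Prog.assign 9 ((Expr.var 9).add (Expr.const 1)))))).run M.w σ₂.tick.tick).tick.setVar 15
        (i + 1) = τ
      have t9 : τ.var 9 = σ₂.var 9 + 1 := by
        rw [← hτ]
        simp (disch := omega) [Prog.run, Expr.eval, State.setVar_var, Nat.mod_eq_of_lt]
      have t33 : ∀ x, τ.arr 33 x = if x = i then σ₂.var 9 else σ₂.arr 33 x := by
        intro x
        rw [← hτ]
        simp [Prog.run, Expr.eval, State.setArr_arr, h15]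
      have t14 : ∀ x, τ.arr 14 x = if x = n + σ₂.var 9 then σ.arr 14 i else σ₂.arr 14 x := by
        intro x
        rw [← hτ]
        simp (disch := omega) [Prog.run, Expr.eval, State.setArr_arr, h15, hr2.n_eq, el,
          Nat.mod_eq_of_lt]
      have t13 : ∀ x, τ.arr 13 x = if x = n + σ₂.var 9 then σ.arr 6 i else σ₂.arr 13 x := by
        intro x
        rw [← hτ]
        simp (disch := omega) [Prog.run, Expr.eval, State.setArr_arr, h15, hr2.n_eq, e6,
          Nat.mod_eq_of_lt]
      constructor
      · omega
      · omega
      · intro j hj hj'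
        by_cases hjj : j = σ₂.var 9
        · simp [hjj]
        · rw [Function.update_of_ne hjj]
          have := hA.hd_lt j hj (by omega)
          omega
      · intro j hj hj'
        by_cases hjj : j = σ₂.var 9
        · simp [hjj, t33]
        · rw [Function.update_of_ne hjj, t33]
          have := hA.hd_lt j hj (by omega)
          rw [if_neg (by omega)]
          exact hA.id_hd j hj (by omega)
      · intro j hj hj'
        by_cases hjj : j = σ₂.var 9
        · simp [hjj, t14]
        · rw [Function.update_of_ne hjj, t14, if_neg (by omega)]
          exact hA.loc_new j hj (by omega)
      · intro j hj hj'
        by_cases hjj : j = σ₂.var 9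
        · simp [hjj, t13]
        · rw [Function.update_of_ne hjj, t13, if_neg (by omega)]
          exact hA.dg_new j hj (by omega)
      · intro v hv h
        rw [t33] at h ⊢
        by_cases hvi : v = i
        · subst hvi
          simp only [if_true, Function.update_self, and_true]
          exact ⟨by omega, hacc, hc', by omega⟩
        · rw [if_neg hvi] at h ⊢
          obtain ⟨b1, b2, b3, b4, b5⟩ := hA.accepts v hv h
          rw [Function.update_of_ne (by omega)]
          exact ⟨by omega, b2, b3, by omega, b5⟩
      · intro v hv h
        rw [t33]
        split_ifs with hvi
        · omega
        · exact hA.ne_zero v (by omega) h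
      · intro x hx
        rw [t14, t13, if_neg (by omega), if_neg (by omega)]
        exact hA.old x (by omega)
    · have hacc : ¬σ.Accepts i := fun h => hev.2 h he
      refine (Machine.runs_skip hfit2.tick.tick (Q := fun τ => τ = σ₂.tick.tick) rfl).mono
        (Nat.zero_le _) ?_
      rintro τ - - hτ
      refine ⟨hd, ?_⟩
      rw [hτ]
      have e9 : (σ₂.tick.tick.tick.setVar 15 (i + 1)).var 9 = σ₂.var 9 := by
        simp [State.setVar_var]
      constructor
      · rw [e9]; exact hA.le
      · rw [e9]; omega
      · intro j hj hj'; rw [e9] at hj'; have := hA.hd_lt j hj hj'; omega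
      · intro j hj hj'; rw [e9] at hj'; exact hA.id_hd j hj hj'
      · intro j hj hj'; rw [e9] at hj'; exact hA.loc_new j hj hj'
      · intro j hj hj'; rw [e9] at hj'; exact hA.dg_new j hj hj'
      · intro v hv h; rw [e9]; obtain ⟨b1, b2⟩ := hA.accepts v hv h; exact ⟨by omega, b2⟩
      · intro v hv h
        rcases Nat.lt_succ_iff_lt_or_eq.1 hv with hv | rfl
        exacts [hA.ne_zero v hv h, absurd h hacc]
      · intro x hx; rw [e9] at hx; exact hA.old x hx
  · obtain ⟨hd, hA⟩ := h
    exact ⟨hd, hA.le, hA.le_add, hA.hd_lt, hA.id_hd, hA.loc_new, hA.dg_new, hA.accepts, hA.ne_zero,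
      hA.old⟩

theorem runs_update (hr : Regs M.w σ n m B P W) (a : ℕ → ℕ)
    (ha : ∀ x < 3 * n, a x = σ.arr 33 (σ.arr 32 x)) (hlt : ∀ x < 3 * n, a x ≤ 2 * n)
    (hx : ∀ e < m, σ.arr 10 e < 3 * n ∧ σ.arr 11 e < 3 * n) :
    M.Runs updateProg σ (6 * n + 12 * m + 10) fun σ' =>
      (∀ e < m, σ'.arr 10 e = if a (σ.arr 10 e) ≠ a (σ.arr 11 e) ∧ a (σ.arr 10 e) ≠ 0 then
        n + a (σ.arr 10 e) else σ.arr 10 e) ∧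
      (∀ e < m, σ'.arr 11 e = if a (σ.arr 10 e) ≠ a (σ.arr 11 e) ∧ a (σ.arr 11 e) ≠ 0 then
        n + a (σ.arr 11 e) else σ.arr 11 e) ∧
      ∀ x, σ'.arr 14 x = if x < 2 * n ∧ a x ≠ 0 then a x else σ.arr 14 x := by
  have hbig := hr.big
  have hone := M.one_lt
  refine (Machine.Runs.seq (t₁ := m * 3 + 2)
    (t₂ := (m * 3 + 2) + ((m * 3 + 2) + ((m * 3 + 2) + (2 * n * 3 + 2))))
    (R := fun σ₁ => ∀ e < m, σ₁.arr 34 e =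
      if a (σ.arr 10 e) ≠ a (σ.arr 11 e) ∧ a (σ.arr 10 e) ≠ 0 then
        n + a (σ.arr 10 e) else σ.arr 10 e)
    (Machine.runs_map (K := m) (fun e =>
      if a (σ.arr 10 e) ≠ a (σ.arr 11 e) ∧ a (σ.arr 10 e) ≠ 0 then
        n + a (σ.arr 10 e) else σ.arr 10 e) hr.fits (by simp [Expr.eval, hr.m_eq]) rfl rfl
    (fun i hi hfit => by
      obtain ⟨h1, h2⟩ := hx i hi
      have h3 := hlt _ h1
      simp (disch := omega) [Expr.eval, Expr.eval_ifEq M.one_lt hfit,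
        State.setVar_var, hr.n_eq, newBlock, Nat.mod_eq_of_lt, ← ha _ h1, ← ha _ h2]
      by_cases h4 : a (σ.arr 10 i) = a (σ.arr 11 i) <;> by_cases h5 : a (σ.arr 10 i) = 0 <;>
        simp [h4, h5])
    fun σ₁ _ _ h _ => h) ?_).mono (by omega) fun _ _ _ h => h
  intro σ₁ hf1 hfit1 h1
  have hr1 := hr.frame hf1 hfit1 rfl
  refine Machine.Runs.seq
    (R := fun σ₁ => ∀ e < m, σ₁.arr 35 e =
      if a (σ.arr 10 e) ≠ a (σ.arr 11 e) ∧ a (σ.arr 11 e) ≠ 0 then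
        n + a (σ.arr 11 e) else σ.arr 11 e)
    (Machine.runs_map (K := m) (fun e =>
      if a (σ.arr 10 e) ≠ a (σ.arr 11 e) ∧ a (σ.arr 11 e) ≠ 0 then
        n + a (σ.arr 11 e) else σ.arr 11 e) hfit1 (by simp [Expr.eval, hr1.m_eq]) rfl rfl
    (fun i hi hfit => by
      obtain ⟨h1, h2⟩ := hx i hi
      have h3 := hlt _ h2
      simp (disch := omega) [Expr.eval, Expr.eval_ifEq M.one_lt hfit,
        State.setVar_var, hr1.n_eq, newBlock, Nat.mod_eq_of_lt, hf1.arr 10 rfl, hf1.arr 11 rfl,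
        hf1.arr 32 rfl, hf1.arr 33 rfl, ← ha _ h1, ← ha _ h2]
      rcases eq_or_ne (a (σ.arr 11 i)) (a (σ.arr 10 i)) with h4 | h4
      · by_cases h5 : a (σ.arr 11 i) = 0 <;> simp [h4]
      · by_cases h5 : a (σ.arr 11 i) = 0 <;> simp [h4, h4.symm, h5])
    fun σ₁ _ _ h _ => h) ?_
  intro σ₂ hf2 hfit2 h2
  have hr2 := hr1.frame hf2 hfit2 rfl
  have e34 : σ₂.arr 34 = σ₁.arr 34 := hf2.arr 34 rfl
  refine Machine.Runs.seq (R := fun σ₃ => ∀ e < m, σ₃.arr 10 e = σ₁.arr 34 e)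
    (Machine.runs_map (K := m) (fun e => σ₁.arr 34 e) hfit2 (by simp [Expr.eval, hr2.m_eq]) rfl rfl
    (fun i hi hfit => by simp [Expr.eval, State.setVar_var, e34])
    fun σ₁ _ _ h _ => h) ?_
  intro σ₃ hf3 hfit3 h3
  have hr3 := hr2.frame hf3 hfit3 rfl
  have e35 : σ₃.arr 35 = σ₂.arr 35 := hf3.arr 35 rfl
  refine Machine.Runs.seq (R := fun σ₄ => ∀ e < m, σ₄.arr 11 e = σ₂.arr 35 e)
    (Machine.runs_map (K := m) (fun e => σ₂.arr 35 e) hfit3 (by simp [Expr.eval, hr3.m_eq]) rfl rfl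
    (fun i hi hfit => by simp [Expr.eval, State.setVar_var, e35])
    fun σ₁ _ _ h _ => h) ?_
  intro σ₄ hf4 hfit4 h4
  have hr4 := hr3.frame hf4 hfit4 rfl
  have e14 : σ₄.arr 14 = σ.arr 14 := by
    rw [hf4.arr 14 rfl, hf3.arr 14 rfl, hf2.arr 14 rfl, hf1.arr 14 rfl]
  have e32 : σ₄.arr 32 = σ.arr 32 := by
    rw [hf4.arr 32 rfl, hf3.arr 32 rfl, hf2.arr 32 rfl, hf1.arr 32 rfl]
  have e33 : σ₄.arr 33 = σ.arr 33 := by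
    rw [hf4.arr 33 rfl, hf3.arr 33 rfl, hf2.arr 33 rfl, hf1.arr 33 rfl]
  refine Machine.runs_map (K := 2 * n) (fun x => if a x = 0 then σ.arr 14 x else a x) hfit4
    (by simp (disch := omega) [two_n, Expr.eval, hr4.n_eq, Nat.mod_eq_of_lt]) rfl rfl
    (fun i hi hfit => by
      simp (disch := omega) [Expr.eval, Expr.eval_ifEq M.one_lt hfit,
        State.setVar_var, e14, e32, e33, ← ha i (by omega)])
    fun σ₅ hfit5 hf5 h5 h5' => ⟨fun e he => ?_, fun e he => ?_, fun x => ?_⟩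
  · rw [hf5.arr 10 rfl, hf4.arr 10 rfl, h3 e he, h1 e he]
  · rw [hf5.arr 11 rfl, h4 e he, h2 e he]
  · by_cases hx : x < 2 * n
    · rw [h5 x hx]
      by_cases h : a x = 0 <;> simp [h, hx]
    · rw [h5' x (by omega), e14]
      simp [hx]

end

/-- The labels that are computed from the sources `src` and the sample `R`. -/
structure Labels {ι : Type*} (n B : ℕ) (c : Cfg) (H : Net ι ℕ) (src : ℕ → ℕ) (R : ℕ → Prop)
    (TM : Set ℕ) (cd : ℕ → ℕ) (X : ℕ → Set ℕ) (lab : ℕ → ℕ → ℕ) : Prop where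
  src_lt : ∀ i < c.cnt, src i < n
  src_loc : ∀ i < c.cnt, c.loc (src i) = i
  coded : ∀ x, x ∈ TM ↔ (x < n ∧ (src (c.loc x) = x ∨ R x)) ∨ (2 * n ≤ x ∧ x < 3 * n)
  code : ∀ x ∈ TM, cd x = if x < n ∧ src (c.loc x) ≠ x then 2 ^ B + x else 0
  lt_pow : n < 2 ^ B
  refinement : Refinement H TM cd B X lab

/-! ### From labels to splits. -/

namespace Labels

variable {n m : ℕ} {ι : Type*} {G : MGraph n m} {B : ℕ} {c : Cfg} {D : ℕ → Set ℕ} {H : Net ι ℕ}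
  {src : ℕ → ℕ} {R : ℕ → Prop} {TM : Set ℕ} {cd : ℕ → ℕ} {X : ℕ → Set ℕ} {lab : ℕ → ℕ → ℕ}

theorem code_eq (hl : Labels n B c H src R TM cd X lab) {v : ℕ} (hv : v < n) (hR : R v)
    (hs : src (c.loc v) ≠ v) : v ∈ TM ∧ cd v = 2 ^ B + v := by
  have : v ∈ TM := (hl.coded v).2 (Or.inl ⟨hv, Or.inr hR⟩)
  exact ⟨this, by rw [hl.code v this, if_pos ⟨hv, hs⟩]⟩

theorem code_inj (hl : Labels n B c H src R TM cd X lab) {v x : ℕ} (hx : x ∈ TM)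
    (hbit : (cd x).testBit B = true) (hmod : cd x % 2 ^ B = v) : x = v := by
  rw [hl.code x hx] at hbit hmod
  split_ifs at hbit hmod with h
  · have := hl.lt_pow
    rwa [Nat.add_mod_left, Nat.mod_eq_of_lt (by omega)] at hmod
  · simp at hbit

theorem mem_self (hl : Labels n B c H src R TM cd X lab) {v : ℕ} (hv : v < n) (hR : R v)
    (hs : src (c.loc v) ≠ v) : lab (B + 1) v = 2 ^ B + v := by
  obtain ⟨h1, h2⟩ := hl.code_eq hv hR hs
  have := hl.lt_pow
  rw [hl.refinement.lab_coded h1 _ le_rfl, h2, Nat.mod_eq_of_lt (by rw [pow_succ]; omega)]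

theorem source_lab (hl : Labels n B c H src R TM cd X lab) {x : ℕ} (hx : x < n)
    (hs : src (c.loc x) = x) : lab (B + 1) x = 0 := by
  have h1 : x ∈ TM := (hl.coded x).2 (Or.inl ⟨hx, Or.inl hs⟩)
  rw [hl.refinement.lab_coded h1 _ le_rfl, hl.code x h1, if_neg fun h => h.2 hs, Nat.zero_mod]

/-- The vertices with lower bits `v` that are not in the component of `v` include no terminal with
the top bit, so by `trim` the last phase does not select them. The outside vertex has code `0` and
is not selected either. -/
theorem sub (hl : Labels n B c H src R TM cd X lab) (h : CfgInv G c D) (hH : IsContraction G c H)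
    {v x : ℕ} (hv : v < n) (hx : lab (B + 1) x = 2 ^ B + v) :
    Valid n c.cnt x ∧ c.loc x = c.loc v := by
  have hxB : x ∈ X B := hl.refinement.mem_last (by omega)
  have hlow : lab B x = v := by
    have := hl.refinement.mem B le_rfl x hxB
    omega
  have hcomp : x ∈ Comp n c (c.loc v) := by
    by_contra hxc
    refine hl.refinement.trim (T := {y | lab B y = v ∧ y ∉ Comp n c (c.loc v)}) ?_ ?_ hxB ⟨hlow, hxc⟩
    · intro e he hne heq
      have := h.contraction_edge hH he (c.loc v)
      simp only [Set.mem_ofPred_eq, heq, this, iff_self, not_true] at hne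
    · intro y hy hyT
      by_contra hbit
      rw [Bool.not_eq_false] at hbit
      have h1 := hl.refinement.lab_coded hy B (by omega)
      have := hl.code_inj hy hbit (h1.symm.trans hyT.1)
      exact hyT.2 (Or.inl ⟨this ▸ valid_of_lt hv, this ▸ rfl⟩)
  rcases hcomp with hc | rfl
  · exact hc
  · have hlt := (h.loc_lt v (valid_of_lt hv)).trans_le h.cnt_le
    have h1 : 2 * n + c.loc v ∈ TM := (hl.coded _).2 (Or.inr ⟨by omega, by omega⟩)
    have h2 := hl.refinement.lab_coded h1 (B + 1) le_rfl
    rw [hl.code _ h1, if_neg (by omega), Nat.zero_mod] at h2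
    have := hl.lt_pow
    omega

/-- A good cut meets the hypotheses of `Refinement.eq_set`: it contains neither the source nor the
outside, and `v` is its only sampled vertex. A competitor without zero-coded terminals avoids the
source, hence is no lighter. -/
theorem eq_goodCut (hl : Labels n B c H src R TM cd X lab) (h : CfgInv G c D) {v : ℕ}
    {M : Set ℕ} (hv : v < n) (hR : R v)
    (hg : GoodCut n c H (src (c.loc v)) v M) (hM : ∀ u < n, u ∈ M → (R u ↔ u = v)) :
    {x | lab (B + 1) x = 2 ^ B + v} = M := by
  have hs : src (c.loc v) ≠ v := fun h => by
    have := hg.least.not_mem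
    rw [h] at this
    exact this hg.least.mem
  obtain ⟨h1, h2⟩ := hl.code_eq hv hR hs
  have hlt := hl.lt_pow
  have hbit : (2 ^ B + v).testBit B = true := by
    rw [Nat.testBit_two_pow_add_eq, Nat.testBit_lt_two_pow (by omega)]; rfl
  have hmod : (2 ^ B + v) % 2 ^ B = v := by
    rw [Nat.add_mod_left, Nat.mod_eq_of_lt (by omega)]
  have hlv := h.loc_lt v (valid_of_lt hv)
  rw [← h2]
  refine hl.refinement.eq_set h1 hg.least.mem (fun x hxM hx => ?_)
    (fun Z hZ hvZ => ⟨hg.least.min Z hvZ fun h => hg.least.not_mem (hZ h), fun hle =>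
      Set.Subset.antisymm hZ (hg.least.least Z hvZ (fun h => hg.least.not_mem (hZ h)) hle)⟩)
    (fun Z hvZ hZ => ?_) (by rw [h2, pow_succ]; omega) (by rw [h2, hbit])
    fun x hx hb hm => hl.code_inj hx hb (by rw [hm, h2, hmod])
  · rcases hg.least.sub hxM with hc | hc
    · have := h.valid_lt hc.1
      rcases (hl.coded x).1 hx with ⟨hxn, hxs | hxR⟩ | hx2
      · rw [hc.2] at hxs
        exact absurd hxM (hxs ▸ hg.least.not_mem)
      · exact (hM x hxn hxM).1 hxR
      · omega
    · exact absurd hxM (hc ▸ hg.outside)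
  · refine hg.least.min Z hvZ fun hsZ => ?_
    have hsl := hl.src_loc _ hlv
    have h3 : src (c.loc v) ∈ TM := (hl.coded _).2 (Or.inl ⟨hl.src_lt _ hlv, Or.inl (by rw [hsl])⟩)
    have h4 := hZ _ h3 hsZ
    rw [hl.code _ h3, if_neg (by rw [hsl]; simp)] at h4
    simp at h4

/-- The result of accepting the vertices `v` with `acc v ≠ 0`. -/
theorem split (hl : Labels n B c H src R TM cd X lab) (h : CfgInv G c D) (hH : IsContraction G c H)
    {cnt' : ℕ} {acc hd mv : ℕ → ℕ} (hcnt : c.cnt ≤ cnt')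
    (hmv : ∀ x, mv x = if 2 ^ B ≤ lab (B + 1) x then acc (lab (B + 1) x - 2 ^ B) else 0)
    (hacc : ∀ v, acc v ≠ 0 → v < n ∧ R v ∧ src (c.loc v) ≠ v ∧ c.cnt ≤ acc v ∧ acc v < cnt' ∧
      hd (acc v) = v ∧ ∀ S : Set ℕ, v ∈ S → (∀ x < n, src (c.loc x) = x → x ∉ S) →
        H.cut {x | lab (B + 1) x = 2 ^ B + v} ≤ H.cut S)
    (hhd : ∀ j, c.cnt ≤ j → j < cnt' → hd j < n ∧ acc (hd j) = j) :
    Split (n := n) c H src mv hd cnt' ∧ ∀ v, acc v ≠ 0 → mv v = acc v ∧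
      {x | mv x = acc v} = {x | lab (B + 1) x = 2 ^ B + v} := by
  have hpos := h.cnt_pos
  have hset : ∀ v, acc v ≠ 0 → {x | mv x = acc v} = {x | lab (B + 1) x = 2 ^ B + v} := by
    intro v hv
    ext x
    simp only [Set.mem_ofPred_eq, hmv]
    constructor
    · intro hx
      split_ifs at hx with h1
      · have h2 := (hacc v hv).2.2.2.2.2.1
        have h3 := (hacc _ (hx ▸ hv)).2.2.2.2.2.1
        rw [hx, h2] at h3
        omega
      · omega
    · intro hx
      rw [hx, if_pos (by omega), Nat.add_sub_cancel_left]
  have hself : ∀ v, acc v ≠ 0 → mv v = acc v := by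
    intro v hv
    obtain ⟨h1, h2, h3, -⟩ := hacc v hv
    have : v ∈ {x | mv x = acc v} := by
      rw [hset v hv]
      exact hl.mem_self h1 h2 h3
    exact this
  have hmv0 : ∀ x, mv x ≠ 0 → ∃ v, acc v ≠ 0 ∧ mv x = acc v ∧ lab (B + 1) x = 2 ^ B + v := by
    intro x hx
    have hx' := hx
    rw [hmv] at hx
    split_ifs at hx with h1
    · exact ⟨lab (B + 1) x - 2 ^ B, hx, by rw [hmv, if_pos h1], by omega⟩
    · exact absurd rfl hx
  refine ⟨⟨hcnt, hl.src_lt, hl.src_loc, fun i hi => ?_, fun x => ?_, fun x hx => ?_,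
    fun j hj hj' => (hhd j hj hj').1, fun j hj hj' => ?_, fun j hj hj' Z hZ hvZ hsZ => ?_⟩,
    fun v hv => ⟨hself v hv, hset v hv⟩⟩
  · rw [hmv, hl.source_lab (hl.src_lt i hi) (by rw [hl.src_loc i hi]), if_neg (by simp)]
  · by_cases hx : mv x = 0
    · exact Or.inl hx
    · obtain ⟨v, hv, hxv, -⟩ := hmv0 x hx
      obtain ⟨-, -, -, h4, h5, -⟩ := hacc v hv
      exact Or.inr ⟨by omega, by omega⟩
  · obtain ⟨v, hv, hxv, hlab⟩ := hmv0 x hx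
    obtain ⟨h1, -, -, -, -, h6, -⟩ := hacc v hv
    rw [hxv, h6]
    exact hl.sub h hH h1 hlab
  · obtain ⟨-, h2⟩ := hhd j hj hj'
    rw [hself _ (by omega), h2]
  · obtain ⟨h1, h2⟩ := hhd j hj hj'
    have h0 : acc (hd j) ≠ 0 := by omega
    have := hset _ h0
    rw [h2] at this
    rw [this]
    -- A set within the component of `hd j` that avoids the source of this component avoids all
    -- sources, so the verified bound applies to it.
    refine (hacc _ h0).2.2.2.2.2.2 Z hvZ fun x hx hxs hxZ => ?_
    rcases hZ hxZ with hc | hc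
    · rw [hc.2] at hxs
      exact hsZ (hxs ▸ hxZ)
    · omega

end Labels

/-- Runs with different random bits may list the contracted graph differently. As the cuts agree,
their progress can be measured in one common graph. -/
theorem IsContraction.cut_eq {n m : ℕ} {G : MGraph n m} {c : Cfg} {ι ι' : Type*} {H : Net ι ℕ}
    {H' : Net ι' ℕ} (h : IsContraction G c H) (h' : IsContraction G c H') : H.cut = H'.cut :=
  funext fun Z => (h.sum_eq (edgeCost (fun _ => 0) Z)).trans
    (h'.sum_eq (edgeCost (fun _ => 0) Z)).symm

theorem RoundResult.congr {n m : ℕ} {c c' : Cfg} {ι ι' : Type*} {H : Net ι ℕ} {H' : Net ι' ℕ}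
    (he : H.cut = H'.cut) {Q R Q' R' : ℕ → Prop} (hQ : ∀ u < n, (Q u ↔ Q' u))
    (hR : ∀ u < n, (R u ↔ R' u)) (h : RoundResult n m c c' H Q R) :
    RoundResult n m c c' H' Q' R' := by
  obtain ⟨src, mv, hd, s, t, hg⟩ := h
  refine ⟨src, mv, hd, ⟨s.le, s.src_lt, s.src_loc, s.mv_src, s.mv_range, s.mv_valid, s.hd_lt,
    s.mv_hd, he ▸ s.min⟩, ⟨t.loc_old, t.loc_new, t.dg_old, he ▸ t.dg_new, t.dg_zero, t.ex_eq,
    t.ey_eq⟩, fun x v M hv hx hM hs => hg x v M hv hx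
      ⟨⟨hM.least.mem, hM.least.not_mem, hM.least.sub, he ▸ hM.least.min, he ▸ hM.least.least⟩,
        hM.outside, hM.small⟩ ⟨fun u hu => ?_, fun u hu hM => ?_⟩⟩
  · rw [hQ u (mem_members.1 hu).1]; exact hs.1 u hu
  · rw [hR u hu]; exact hs.2 u hu hM

/-! ### One round of the algorithm. -/

section

variable {κ : Kind} {M : Machine κ} {σ : State} {n m B P W : ℕ} {G : MGraph n m} {D : ℕ → Set ℕ}

theorem State.cfg_frame {σ' : State} {p : Prog} (hf : Frame p σ σ')
    (hp : (p.setsVar 9 || p.setsArr 10 || p.setsArr 11 || p.setsArr 13 || p.setsArr 14) = false) :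
    σ'.cfg = σ.cfg := by
  simp only [Bool.or_eq_false_iff] at hp
  obtain ⟨⟨⟨⟨h9, h10⟩, h11⟩, h13⟩, h14⟩ := hp
  simp only [State.cfg, hf.var 9 h9, hf.arr 10 h10, hf.arr 11 h11, hf.arr 13 h13, hf.arr 14 h14]

/-- Whatever the samples are, accepted candidates are minimum cuts because they passed verification.
The samples matter only for the last clause of `RoundResult`, that singled-out pairs with a good cut
are realized. -/
theorem runs_round (hr : Regs M.w σ n m B P W) (hW : W = G.totalWeight) (hG : G.OfKind κ)
    (h : CfgInv G σ.cfg D) (hw : ∀ e : Fin m, σ.arr 12 e = G.weight e) {K : ℕ} (hK : 2 ^ K ≤ 2 * B)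
    (hBK : B < 2 ^ K) :
    M.Runs (roundProg κ) σ (10000 * ((B + 1) * (n + m))) fun σ' =>
      σ'.bits = σ.bits + (K + n * B + (K + n * B)) ∧
      σ'.vertices = σ.vertices + (B + 2) * (3 * n + 4) ∧
      σ'.edges ≤ σ.edges + (B + 2) * (10 * m) ∧
      ∃ H : Net ℕ ℕ, IsContraction G σ.cfg H ∧ RoundResult n m σ.cfg σ'.cfg H
        (Sampled M.ω σ.bits K B) (Sampled M.ω (σ.bits + (K + n * B)) K B) := by
  have hpos := hr.pos
  have hbig := hr.big
  have hcnt := h.cnt_le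
  have hcpos := h.cnt_pos
  have hlp := hr.lt_pow
  have hpl := hr.pow_le
  simp only [State.cfg_cnt] at hcnt hcpos
  have hKB : K ≤ 2 * B := (Nat.lt_two_pow_self (n := K)).le.trans hK
  refine (Machine.Runs.seq (runs_sample (a := 15) hr hK hBK)
    (t₂ := 100 * (n * B + K + n + 1) + ((n * 6 + 4) + ((12 * n + 6 * m + 8) + ((14 * n + 37 * m + 9) +
      ((27 * n + 6) + (((B + 1) * (2000 * (n + m) + 2) + 3) + ((18 * n + 30 * m + 22) +
      (100 * (n + m + 1) + ((16 * n + 7) + (6 * n + 12 * m + 10)))))))))) ?_).mono ?_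
      fun _ _ _ h => h
  swap
  · have h1 : (B + 1) * (n + m) = n * B + B * m + n + m := by ring
    have h2 : (B + 1) * (2000 * (n + m) + 2) = 2000 * ((B + 1) * (n + m)) + 2 * B + 2 := by ring
    have h3 : B ≤ n * B := Nat.le_mul_of_pos_left _ hpos
    rw [h2, h1]
    omega
  rintro σ₁ f1 g1 ⟨b1, q1⟩
  have r1 := hr.frame f1 g1 rfl
  refine Machine.Runs.seq (runs_sample (a := 16) r1 hK hBK) ?_
  rintro σ₂ f2 g2 ⟨b2, q2⟩
  have r2 := r1.frame f2 g2 rfl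
  have c2 : σ₂.cfg = σ.cfg := (State.cfg_frame f2 rfl).trans (State.cfg_frame f1 rfl)
  have c14 : σ₂.arr 14 = σ.arr 14 := congrArg Cfg.loc c2
  have c9 : σ₂.var 9 = σ.var 9 := congrArg Cfg.cnt c2
  refine Machine.Runs.seq (runs_sources r2 (by rw [c9, c14]; exact h.nonempty) (by rw [c9]; exact hcnt))
    ?_
  rintro σ₃ f3 g3 q3
  rw [c9, c14] at q3
  have r3 := r2.frame f3 g3 rfl
  have c3 : σ₃.cfg = σ.cfg := (State.cfg_frame f3 rfl).trans c2
  have w3 : σ₃.arr 12 = σ.arr 12 := (f3.arr 12 rfl).trans ((f2.arr 12 rfl).trans (f1.arr 12 rfl))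
  refine Machine.Runs.seq (runs_remainders (G := G) (D := D) r3 (c3.symm ▸ h)
    (by rw [w3]; exact hw) hW) ?_
  rintro σ₄ f4 g4 q4
  have r4 := r3.frame f4 g4 rfl
  have c4 : σ₄.cfg = σ.cfg := (State.cfg_frame f4 rfl).trans c3
  refine Machine.Runs.seq (runs_contract (G := G) (D := D) r4 (c4.symm ▸ h) hG
    (by rw [f4.arr 12 rfl, w3]; exact hw) (by rw [c4, ← c3]; exact q4)) ?_
  rintro σ₅ f5 g5 hC5
  rw [c4] at hC5
  have r5 := r4.frame f5 g5 rfl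
  have c5 : σ₅.cfg = σ.cfg := (State.cfg_frame f5 rfl).trans c4
  refine Machine.Runs.seq (runs_codes r5) ?_
  rintro σ₆ f6 g6 q6
  have r6 := r5.frame f6 g6 rfl
  have hC6 := hC5.frame f6 rfl
  have c6 : σ₆.cfg = σ.cfg := (State.cfg_frame f6 rfl).trans c5
  refine Machine.Runs.seq (runs_refine r6 hW hC6 fun x hx => (q6 x hx).2.2) ?_
  rintro σ₇ f7 g7 ⟨v7, e7, X, lab, href, q7, z7⟩
  have r7 := r6.frame f7 g7 rfl
  have hC7 := hC6.frame f7 rfl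
  have n7 : σ₇.net = σ₆.net := State.net_frame f7 rfl
  have hlablt := href.lab_lt (B + 1) le_rfl
  rw [pow_succ, ← hr.two_pow] at hlablt
  refine Machine.Runs.seq (runs_owners r7 hW hC7 fun x hx => by
    rw [q7 x hx]; have := hlablt x; omega) ?_
  rintro σ₈ f8 g8 ⟨o8, q8⟩
  have r8 := r7.frame f8 g8 rfl
  have hC8 := hC7.frame f8 rfl
  have n8 : σ₈.net = σ₆.net := (State.net_frame f8 rfl).trans n7
  have c8 : σ₈.cfg = σ.cfg := (State.cfg_frame f8 rfl).trans ((State.cfg_frame f7 rfl).trans c6)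
  set src : ℕ → ℕ := σ₃.arr 17 with hsrc
  set R : ℕ → Prop := fun u => σ₂.arr 16 u = 1 with hR
  have a17 : σ₅.arr 17 = src := (f5.arr 17 rfl).trans (f4.arr 17 rfl)
  have a16 : σ₅.arr 16 = σ₂.arr 16 := (f5.arr 16 rfl).trans ((f4.arr 16 rfl).trans (f3.arr 16 rfl))
  have a14 : σ₅.arr 14 = σ.arr 14 := congrArg Cfg.loc c5
  rw [a17, a16, a14, hr.two_pow] at q6
  have hl : Labels n B σ.cfg σ₆.net src R (σ₆.coded n) (σ₆.arr 23) X lab := by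
    refine ⟨fun i hi => (q3 i hi).1, fun i hi => (q3 i hi).2.1, fun x => ?_, fun x hx => ?_,
      hr.two_pow ▸ hlp, href⟩
    · simp only [State.coded, Set.mem_ofPred_eq, State.cfg_loc]
      by_cases hx : x < 3 * n
      · rw [(q6 x hx).1]
        by_cases h1 : x < n
        · by_cases h2 : src (σ.arr 14 x) = x <;> simp [h1, h2, hx, hR]; omega
        · by_cases h2 : x < 2 * n
          · simp [h1, h2]
          · simp [h1, h2, hx]; omega
      · simp [hx]; omega
    · have h22 := hx.2
      rw [(q6 x hx.1).1] at h22
      rw [(q6 x hx.1).2.1, State.cfg_loc]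
      by_cases h1 : x < n
      · by_cases h2 : src (σ.arr 14 x) = x
        · simp [h1, h2]
        · simp only [h1, h2, if_true, if_false] at h22
          simp [h1, h2, h22]
      · simp [h1]
  have hS : ∀ v < n, {x | x < 3 * n ∧ σ₈.arr 32 x = v} = {x | lab (B + 1) x = 2 ^ B + v} := by
    intro v hv
    rw [← hr.two_pow]
    ext x
    simp only [Set.mem_ofPred_eq]
    by_cases hx : x < 3 * n
    · rw [o8 x hx, q7 x hx]
      split_ifs <;> omega
    · rw [z7 x (by omega)]; omega
  have hest : ∀ v < n, σ₈.arr 6 v = σ₆.net.cut {x | lab (B + 1) x = 2 ^ B + v} := by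
    intro v hv
    rw [q8 v hv, n7, ← hS v hv]
    refine Net.cut_congr fun k hk => ?_
    obtain ⟨h1, h2⟩ := hC6.ends hk
    simp [h1, h2]
  have s8 : σ₈.sources n = {x | x < n ∧ src (σ.cfg.loc x) = x} := by
    rw [State.sources, f8.arr 17 rfl, f7.arr 17 rfl, f6.arr 17 rfl, a17,
      show σ₈.arr 14 = σ.cfg.loc from congrArg Cfg.loc c8]
  have hterm : ∀ v < n, (σ₈.arr 22 v = 1 ∧ v ∉ σ₈.sources n ↔ R v ∧ src (σ.cfg.loc v) ≠ v) := by
    intro v hv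
    rw [f8.arr 22 rfl, f7.arr 22 rfl, (q6 v (by omega)).1, s8]
    by_cases h2 : src (σ.arr 14 v) = v <;> simp [hv, h2, hR]
  -- Inside an instance a candidate set corresponds to a cut of `G`, so its weight is at most the
  -- bound `k = W` used in the verification.
  have hin : ∀ v < n, σ₆.net.cut {x | lab (B + 1) x = 2 ^ B + v} ≤ W := by
    intro v hv
    rw [h.contraction_cut hC6.isContraction (i := σ.cfg.loc v)
      (Z := {x | lab (B + 1) x = 2 ^ B + v}) fun x hx => hl.sub h hC6.isContraction hv hx, hW]
    exact cut_le_totalWeight _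
  refine Machine.Runs.seq (runs_verify r8 hC8 fun v hv h1 h2 => ?_) ?_
  · obtain ⟨hRv, hsv⟩ := (hterm v hv).1 ⟨h1, h2⟩
    rw [hest v hv]
    refine ⟨hin v hv, _, hl.mem_self hv hRv hsv, fun x hx hxS => ?_, by rw [n8]⟩
    rw [s8] at hx
    have := hl.source_lab hx.1 hx.2
    simp only [Set.mem_ofPred_eq, this] at hxS
    have := Nat.two_pow_pos B
    omega
  rintro σ₉ f9 g9 ⟨v9, e9, q9⟩
  have r9 := r8.frame f9 g9 rfl
  have c9' : σ₉.cfg = σ.cfg := (State.cfg_frame f9 rfl).trans c8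
  have cc9 : σ₉.var 9 = σ.var 9 := congrArg Cfg.cnt c9'
  have d9 : σ₉.arr 14 = σ.arr 14 := congrArg Cfg.loc c9'
  have d9' : σ₉.arr 13 = σ.arr 13 := congrArg Cfg.dg c9'
  refine Machine.Runs.seq (runs_accept r9 (by omega) (by omega)
    fun v hv => ⟨(q9 v hv).1, (q9 v hv).2.1⟩) ?_
  rintro σ₁₀ f10 g10 ⟨hd, hA⟩
  have r10 := r9.frame f10 g10 rfl
  set acc : ℕ → ℕ := fun v => if v < 3 * n + 1 then σ₁₀.arr 33 v else 0 with hacc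
  set mv : ℕ → ℕ := fun x => if 2 ^ B ≤ lab (B + 1) x then acc (lab (B + 1) x - 2 ^ B) else 0
    with hmv
  have a32 : ∀ x < 3 * n, σ₁₀.arr 32 x =
      if lab (B + 1) x < P then n else lab (B + 1) x - P := fun x hx => by
    rw [f10.arr 32 rfl, f9.arr 32 rfl, o8 x hx, q7 x hx]
  -- The dummy owner `n` is not a vertex and hence never accepted, so vertices without a candidate
  -- set stay.
  have hn0 : σ₁₀.arr 33 n = 0 := by
    by_contra h0
    exact absurd (hA.accepts n (by omega) h0).1 (lt_irrefl n)
  have hmva : ∀ x < 3 * n, mv x = σ₁₀.arr 33 (σ₁₀.arr 32 x) := by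
    intro x hx
    rw [a32 x hx]
    simp only [hmv, hacc, ← hr.two_pow]
    have := hlablt x
    by_cases h1 : lab (B + 1) x < P
    · rw [if_neg (by omega), if_pos h1, hn0]
    · rw [if_pos (by omega), if_neg h1, if_pos (by omega)]
  have hcl := hA.le
  have hcl' := hA.le_add
  rw [cc9] at hcl hcl'
  have haccv : ∀ v, acc v ≠ 0 → v < 3 * n + 1 ∧ acc v = σ₁₀.arr 33 v := by
    intro v hv
    by_cases hv3 : v < 3 * n + 1
    · exact ⟨hv3, if_pos hv3⟩
    · exact absurd (if_neg hv3) hv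
  have hsplit := hl.split (cnt' := σ₁₀.var 9) (acc := acc) (hd := hd) (mv := mv) h hC6.isContraction
    hcl (fun x => rfl) (fun v hv => by
      obtain ⟨hv3, hv33⟩ := haccv v hv
      rw [hv33] at hv ⊢
      obtain ⟨b1, b2, b3, b4, b5⟩ := hA.accepts v hv3 hv
      obtain ⟨d1, d2, d3⟩ := (q9 v b1).2.2.1 b2
      obtain ⟨hRv, hsv⟩ := (hterm v b1).1 ⟨d1, d2⟩
      refine ⟨b1, hRv, hsv, by rw [cc9] at b3; exact b3, b4, b5, fun S hvS hS => ?_⟩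
      rw [← hest v b1, ← n8]
      exact d3 S hvS fun x hx => by rw [s8] at hx; exact hS x hx.1 hx.2)
    (fun j hj hj' => by
      have h1 := hA.hd_lt j (by rw [cc9]; exact hj) hj'
      exact ⟨h1, (if_pos (by omega)).trans (hA.id_hd j (by rw [cc9]; exact hj) hj')⟩)
  obtain ⟨hsp, hset⟩ := hsplit
  have a10 : σ₁₀.arr 10 = σ.arr 10 := (f10.arr 10 rfl).trans (congrArg Cfg.ex c9')
  have a11 : σ₁₀.arr 11 = σ.arr 11 := (f10.arr 11 rfl).trans (congrArg Cfg.ey c9')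
  refine (runs_update r10 mv hmva (fun x _ => ?_) fun e he => ?_).mono le_rfl ?_
  · rcases hsp.mv_range x with h0 | ⟨-, h1⟩ <;> omega
  · have h1 := h.valid_lt (h.edge_valid ⟨e, he⟩).1
    have h2 := h.valid_lt (h.edge_valid ⟨e, he⟩).2.1
    simp only [State.cfg_ex, State.cfg_ey] at h1 h2
    rw [a10, a11]
    omega
  rintro σ' f11 - ⟨u10, u11, u14⟩
  rw [a10, a11] at u10 u11
  have k9 : σ'.var 9 = σ₁₀.var 9 := f11.var 9 rfl
  have k13 : σ'.arr 13 = σ₁₀.arr 13 := f11.arr 13 rfl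
  have hbits : σ'.bits = σ.bits + (K + n * B + (K + n * B)) := by
    rw [f11.bits rfl, f10.bits rfl, f9.bits rfl, f8.bits rfl, f7.bits rfl, f6.bits rfl,
      f5.bits (by cases κ <;> rfl), f4.bits rfl, f3.bits rfl, b2, b1]
    ring
  have hvert : σ'.vertices = σ.vertices + (B + 2) * (3 * n + 4) := by
    rw [f11.vertices rfl, f10.vertices rfl, v9, f8.vertices rfl, v7, f6.vertices rfl,
      f5.vertices (by cases κ <;> rfl), f4.vertices rfl, f3.vertices rfl, f2.vertices rfl,
      f1.vertices rfl]
    ring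
  have hedge : σ'.edges = σ.edges + (B + 2) * (2 * σ₆.var 10) := by
    rw [f11.edges rfl, f10.edges rfl, e9, f8.edges rfl, e7, f6.edges rfl,
      f5.edges (by cases κ <;> rfl), f4.edges rfl, f3.edges rfl, f2.edges rfl,
      f1.edges rfl, f8.var 10 rfl, f7.var 10 rfl]
    ring
  refine ⟨hbits, hvert, ?_, σ₆.net, hC6.isContraction, src, mv, hd, ?_, ⟨?_, ?_, ?_, ?_, ?_, ?_, ?_⟩,
    ?_⟩
  · rw [hedge]
    have := hC6.le
    exact Nat.add_le_add_left (Nat.mul_le_mul_left _ (by omega)) _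
  · rw [State.cfg_cnt, k9]; exact hsp
  · intro x hx
    have hx2 := h.valid_lt hx
    have := (hA.old x (Or.inl (by rw [cc9]; exact hx.1))).1
    simp only [State.cfg_loc, u14 x, hx2, true_and, this, d9]
    by_cases h0 : mv x = 0 <;> simp [h0]
  · intro j hj hj'
    rw [State.cfg_cnt] at hj hj'
    have h0 : mv (n + j) = 0 := by
      by_contra h0
      have := (hsp.mv_valid _ h0).1.1
      simp only [State.cfg_cnt] at this
      omega
    rw [State.cfg_loc, u14, h0, if_neg (by simp), hA.loc_new j (by omega) (by omega), d9]
    rfl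
  · intro x hx
    rw [State.cfg_dg, k13, (hA.old x (Or.inl (by rw [cc9]; exact hx.1))).2, d9']
    rfl
  · intro j hj hj'
    rw [State.cfg_cnt] at hj hj'
    have h1 := hA.hd_lt j (by omega) (by omega)
    have h2 : acc (hd j) = j := (if_pos (by omega)).trans (hA.id_hd j (by omega) (by omega))
    have h3 := (hset (hd j) (by omega)).2
    rw [h2] at h3
    rw [State.cfg_dg, k13, hA.dg_new j (by omega) (by omega), f9.arr 6 rfl, hest _ h1, h3]
  · intro x hx hv
    have hxn : ¬(x < n + σ₁₀.var 9 ∧ x ≠ n) := by rw [← k9]; exact hv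
    have hold : x < n + σ₉.var 9 ∨ n + σ₁₀.var 9 ≤ x := by omega
    rw [State.cfg_dg, k13, (hA.old x hold).2, d9']
    exact h.dg_zero x hx fun hv' => hxn ⟨by have := hv'.1; simp only [State.cfg_cnt] at this; omega,
      hv'.2⟩
  · exact fun e he => u10 e he
  · exact fun e he => u11 e he
  · intro s v Z hv hs hgood hsing
    have hlv := h.loc_lt v (valid_of_lt hv)
    obtain ⟨hsn, hsl⟩ := mem_members.1 hs
    have a15 : σ₂.arr 15 = σ₁.arr 15 := f2.arr 15 rfl
    -- If the first sample meets the instance only in `s`, the second pass of `sourcesProg` has no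
    -- other vertex to choose.
    have hsrcs : src (σ.cfg.loc v) = s := by
      obtain ⟨d1, d2, d3⟩ := q3 _ hlv
      refine (hsing.1 _ (mem_members.2 ⟨d1, d2⟩)).1 (((q1 _ d1).2).1 ?_)
      rw [a15] at d3
      exact d3 ⟨s, hsn, hsl, ((q1 s hsn).2).2 ((hsing.1 s hs).2 rfl)⟩
    rw [b1] at q2
    have hRs : ∀ u < n, u ∈ Z → (R u ↔ u = v) := fun u hu huZ => by
      rw [← hsing.2 u hu huZ]; exact (q2 u hu).2
    have hRv : R v := (hRs v hv hgood.least.mem).2 rfl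
    rw [← hsrcs] at hgood
    have hZ := hl.eq_goodCut h hv hRv hgood hRs
    have hsv : src (σ.cfg.loc v) ≠ v := fun h0 => by
      have := hgood.least.not_mem
      rw [h0] at this
      exact this hgood.least.mem
    obtain ⟨d1, d2⟩ := (hterm v hv).2 ⟨hRv, hsv⟩
    have hac : σ₁₀.arr 33 v ≠ 0 := by
      refine hA.ne_zero v hv ((q9 v hv).2.2.2 ⟨d1, d2, fun S hvS hS => ?_⟩)
      rw [hest v hv, hZ, n8]
      refine hgood.least.min S hvS (hS _ ?_)
      rw [s8]
      obtain ⟨e1, e2, -⟩ := q3 _ hlv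
      exact ⟨e1, congrArg src e2⟩
    have hav : acc v = σ₁₀.arr 33 v := if_pos (by omega)
    obtain ⟨h1, h2⟩ := hset v (by rw [hav]; exact hac)
    refine ⟨hsrcs, by rw [h1, hav]; exact hac, by rw [h1, h2, hZ], ?_⟩
    rw [h1, hav]
    exact (hA.accepts v (by omega) hac).2.2.2.2

end

/-! ### The initial partition tree and the initialization of the registers. -/

open Classical in
theorem net_cut_singleton {n m : ℕ} (G : MGraph n m) (x : ℕ) : G.net.cut {u | u = x} =
    (∑ e : Fin m, if (G.tail e : ℕ) = x then G.weight e else 0) +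
      ∑ e : Fin m, if (G.head e : ℕ) = x then G.weight e else 0 := by
  unfold Net.cut Net.fcut
  rw [← Finset.sum_add_distrib]
  refine Finset.sum_congr rfl fun e _ => ?_
  have hne : (G.tail e : ℕ) ≠ G.head e := fun h => G.loopless e (Fin.ext h)
  simp only [MGraph.net, edgeCost, if_true, Set.mem_ofPred_eq]
  by_cases h1 : (G.tail e : ℕ) = x
  · have h2 : (G.head e : ℕ) ≠ x := fun h => hne (h1.trans h.symm)
    simp [h1, h2]
  · by_cases h2 : (G.head e : ℕ) = x <;> simp [h1, h2]

/-- The configuration with a single instance. -/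
theorem CfgInv.single {n m : ℕ} {G : MGraph n m} {c : Cfg} (hn : 0 < n) (hcnt : c.cnt = 1)
    (hloc : ∀ x, c.loc x = 0) (hex : ∀ e : Fin m, c.ex e = G.tail e)
    (hey : ∀ e : Fin m, c.ey e = G.head e)
    (hdg : ∀ x, c.dg x = (∑ e : Fin m, if (G.tail e : ℕ) = x then G.weight e else 0) +
      ∑ e : Fin m, if (G.head e : ℕ) = x then G.weight e else 0) :
    CfgInv G c fun _ => {u | u < n} := by
  have hv : ∀ x, Valid n c.cnt x ↔ x < n := fun x => by unfold Valid; omega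
  have hb : ∀ x < n, blk n (fun _ => {u | u < n}) x = {u | u = x} := fun x hx => by
    ext u; exact mem_blk_of_lt hx
  refine ⟨by omega, fun x _ => by rw [hloc]; omega, fun j hj => ⟨0, hn, by rw [hloc]; omega⟩,
    fun u hu => hu, fun _ _ u hu => hu, fun i hi u => ?_, fun x x' u hx hx' _ hu hu' => ?_,
    fun x hx => ?_, fun x _ hx => ?_, fun j hj hj' => by omega, fun e => ?_,
    fun e x y hx hy _ _ hu hu' => ?_⟩
  · simp only [hv, hloc, Set.mem_ofPred_eq]
    constructor
    · exact fun hu => ⟨u, hu, by omega, (mem_blk_of_lt hu).2 rfl⟩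
    · rintro ⟨x, hx, -, hu⟩
      rw [(mem_blk_of_lt hx).1 hu]; exact hx
  · rw [← (mem_blk_of_lt ((hv _).1 hx)).1 hu, ← (mem_blk_of_lt ((hv _).1 hx')).1 hu']
  · rw [hb x ((hv x).1 hx), net_cut_singleton, hdg]
  · rw [hv] at hx
    have hne : ∀ a : Fin n, (a : ℕ) ≠ x := fun a => by have := a.2; omega
    simp [hdg, hne]
  · rw [hv, hv, hex, hey, hloc, hloc, mem_blk_of_lt (G.tail e).2, mem_blk_of_lt (G.head e).2]
    exact ⟨(G.tail e).2, (G.head e).2, fun h => G.loopless e (Fin.ext h), rfl, rfl, rfl⟩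
  · rw [hex, hey]
    exact ⟨(mem_blk_of_lt ((hv _).1 hx)).1 hu, (mem_blk_of_lt ((hv _).1 hy)).1 hu'⟩

section

variable {κ : Kind} {M : Machine κ} {n m : ℕ} {G : MGraph n m}

theorem State.start_fits {w : ℕ} (hn : n < 2 ^ w) (hm : m < 2 ^ w) (hW : G.totalWeight < 2 ^ w) :
    (State.start G).Fits w := by
  have h0 : (⟨fun _ => 0, fun _ _ => 0, 0, 0, 0, 0⟩ : State).Fits w :=
    ⟨fun _ => Nat.two_pow_pos w, fun _ _ => Nat.two_pow_pos w⟩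
  refine ((((h0.setVar hn).setVar hm).fillArr fun e => ?_).fillArr fun e => ?_).fillArr fun e => ?_
  · exact (G.tail e).2.trans hn
  · exact (G.head e).2.trans hn
  · exact (Finset.single_le_sum (fun _ _ => Nat.zero_le _) (Finset.mem_univ e)).trans_lt hW

theorem runs_doubling {σ : State} (hσ : σ.Fits M.w) (hn : 0 < n) (h4 : σ.var 4 = n)
    (h6 : σ.var 6 = 0) (h7 : σ.var 7 = 1) (hw : 4 * n + 4 ≤ 2 ^ M.w) :
    M.Runs (.loop (.lt (.var 7) (.add (.var 4) (.const 1)))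
      (.seq (.assign 7 (.mul (.const 2) (.var 7))) (.assign 6 (.add (.var 6) (.const 1))))) σ
      (3 * n + 1) fun σ' => σ'.var 7 = 2 ^ σ'.var 6 ∧ n < σ'.var 7 ∧ σ'.var 7 ≤ 2 * n := by
  have hone := M.one_lt
  have hev : ∀ σ₁ : State, σ₁.var 4 = n →
      ((Expr.lt (.var 7) (.add (.var 4) (.const 1))).eval M.w σ₁ ≠ 0 ↔ σ₁.var 7 ≤ n) := by
    intro σ₁ h
    simp (disch := omega) only [Expr.eval, h, Nat.mod_eq_of_lt]
    split_ifs <;> omega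
  refine (Machine.runs_loop (c := 2)
    (fun σ₁ => σ₁.var 7 = 2 ^ σ₁.var 6 ∧ σ₁.var 7 ≤ 2 * n ∧ σ₁.var 4 = n)
    (fun σ₁ => n + 1 - σ₁.var 7) hσ ⟨by rw [h6, h7]; rfl, by omega, h4⟩ ?_ ?_).mono
    (by rw [h7]; omega) fun _ _ _ h => h
  · rintro σ₁ hfit - ⟨h1, h2, h3⟩ he
    rw [hev _ h3] at he
    have hpos : 0 < σ₁.var 7 := h1 ▸ Nat.two_pow_pos _
    have hlt : σ₁.var 6 < σ₁.var 7 := by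
      have := Nat.lt_two_pow_self (n := σ₁.var 6)
      omega
    refine Machine.runs_straight hfit.tick rfl fun _ => ?_
    simp (disch := omega) [Prog.run, Expr.eval, State.setVar_var, Nat.mod_eq_of_lt, h3]
    exact ⟨⟨by rw [h1, pow_succ]; ring, he⟩, by omega⟩
  · rintro σ₁ hfit - ⟨h1, h2, h3⟩ he
    refine ⟨h1, ?_, h2⟩
    by_contra h
    exact (hev _ h3).2 (not_lt.1 h) he

theorem runs_init {r : ℕ} (hn : 0 < n) (hbig : 600 * (n + m + G.totalWeight + 2) ≤ 2 ^ M.w)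
    (hprod : 8 * ((n + 1) * (G.totalWeight + 1)) ≤ 2 ^ M.w) (hr : r * (2 * n) ^ 3 < 2 ^ M.w) :
    M.Runs (initProg r) (State.start G) (20 * (n + m + 1)) fun σ => ∃ B P,
      Regs M.w σ n m B P G.totalWeight ∧ 0 < B ∧ σ.var 8 = r * (B * (B * B)) ∧
      (∀ e : Fin m, σ.arr 12 e = G.weight e) ∧ CfgInv G σ.cfg fun _ => {u | u < n} := by
  have hone := M.one_lt
  have hfit0 : (State.start G).Fits M.w := State.start_fits (by omega) (by omega) (by omega)
  have hs0 : ∀ e : Fin m, (State.start G).arr 0 e = G.tail e := fun e => by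
    simp [State.start, State.fillArr]
  have hs1 : ∀ e : Fin m, (State.start G).arr 1 e = G.head e := fun e => by
    simp [State.start, State.fillArr]
  have hs2 : ∀ e : Fin m, (State.start G).arr 2 e = G.weight e := fun e => by
    simp [State.start, State.fillArr]
  have hsa : ∀ a, 3 ≤ a → ∀ x, (State.start G).arr a x = 0 := fun a ha x => by
    simp [State.start, State.fillArr, State.setVar, show a ≠ 0 by omega, show a ≠ 1 by omega,
      show a ≠ 2 by omega]
  have hsv : ∀ x, 2 ≤ x → (State.start G).var x = 0 := fun x hx => by
    simp [State.start, State.fillArr, State.setVar, show x ≠ 0 by omega, show x ≠ 1 by omega]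
  have hv0 : (State.start G).var 0 = n := by simp [State.start, State.fillArr, State.setVar]
  have hv1 : (State.start G).var 1 = m := by simp [State.start, State.fillArr, State.setVar]
  generalize State.start G = σ at *
  generalize hWdef : G.totalWeight = W at *
  have hsum : ∀ f : ℕ → ℕ, (∑ e ∈ Finset.range m, if f e = f e then σ.arr 2 e else 0) = W := by
    intro f
    simp only [if_true]
    rw [Finset.sum_range, ← hWdef]
    exact Finset.sum_congr rfl fun e _ => hs2 e
  have hle : ∀ (f : ℕ → ℕ) (j : ℕ), (∑ e ∈ Finset.range m, if f e = j then σ.arr 2 e else 0) ≤ W := by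
    intro f j
    rw [← hsum f]
    exact Finset.sum_le_sum fun e _ => by split_ifs <;> simp_all
  refine (Machine.Runs.seq (t₁ := 1) (t₂ := 1 + ((m * 3 + 2) + ((m * 3 + 2) + ((m * 3 + 2) +
    ((m * 3 + 2) + ((m * 3 + 2) + ((m * 3 + 2) + (1 + (1 + (1 + ((3 * n + 1) + 1))))))))))
    ) (R := fun σ₁ => σ₁.var 4 = n)
    (Machine.runs_assign hfit0 (by simp [Expr.eval, State.setVar_var, hv0])) ?_).mono (by omega)
    fun _ _ _ h => h
  intro σ₁ f1 g1 q1
  refine Machine.Runs.seq (R := fun σ₁ => σ₁.var 5 = m)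
    (Machine.runs_assign g1 (by simp [Expr.eval, State.setVar_var, f1.var 1 rfl, hv1])) ?_
  intro σ₂ f2 g2 q2
  refine Machine.Runs.seq (R := fun σ' => ∀ e < m, σ'.arr 10 e = σ.arr 0 e)
    (Machine.runs_map (K := m) (σ.arr 0) g2 (by simp [Expr.eval, q2]) rfl rfl
    (fun i hi _ => by simp [Expr.eval, State.setVar_var, f2.arr 0 rfl, f1.arr 0 rfl])
    fun σ₁ _ _ h _ => h) ?_
  intro σ₃ f3 g3 q3
  have e5 : σ₃.var 5 = m := (f3.var 5 rfl).trans q2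
  refine Machine.Runs.seq (R := fun σ' => ∀ e < m, σ'.arr 11 e = σ.arr 1 e)
    (Machine.runs_map (K := m) (σ.arr 1) g3 (by simp [Expr.eval, e5]) rfl rfl
    (fun i hi _ => by
      simp [Expr.eval, State.setVar_var, f3.arr 1 rfl, f2.arr 1 rfl, f1.arr 1 rfl])
    fun σ₁ _ _ h _ => h) ?_
  intro σ₄ f4 g4 q4
  have e5 : σ₄.var 5 = m := (f4.var 5 rfl).trans e5
  refine Machine.Runs.seq (R := fun σ' => ∀ e < m, σ'.arr 12 e = σ.arr 2 e)
    (Machine.runs_map (K := m) (σ.arr 2) g4 (by simp [Expr.eval, e5]) rfl rfl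
    (fun i hi _ => by
      simp [Expr.eval, State.setVar_var, f4.arr 2 rfl, f3.arr 2 rfl, f2.arr 2 rfl, f1.arr 2 rfl])
    fun σ₁ _ _ h _ => h) ?_
  intro σ₅ f5 g5 q5
  have e5 : σ₅.var 5 = m := (f5.var 5 rfl).trans e5
  have e10 : ∀ e < m, σ₅.arr 10 e = σ.arr 0 e := fun e he => by
    rw [f5.arr 10 rfl, f4.arr 10 rfl, q3 e he]
  have e11 : ∀ e < m, σ₅.arr 11 e = σ.arr 1 e := fun e he => by
    rw [f5.arr 11 rfl, q4 e he]
  have e13 : ∀ x, σ₅.arr 13 x = 0 := fun x => by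
    rw [f5.arr 13 rfl, f4.arr 13 rfl, f3.arr 13 rfl, f2.arr 13 rfl, f1.arr 13 rfl, hsa 13 (by omega)]
  refine Machine.Runs.seq (R := fun σ' => ∀ j, σ'.arr 13 j =
      ∑ e ∈ Finset.range m, if σ.arr 0 e = j then σ.arr 2 e else 0)
    (Machine.runs_collect (K := m) (σ.arr 0) (σ.arr 2) g5 (by simp [Expr.eval, e5]) rfl rfl rfl
    (fun i hi _ => by simp [Expr.eval, State.setVar_var, e10 i hi])
    (fun i hi _ => by simp [Expr.eval, State.setVar_var, q5 i hi])
    (fun j => by rw [e13]; have := hle (σ.arr 0) j; omega)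
    fun σ₁ _ _ h j => by rw [h, e13, zero_add]) ?_
  intro σ₆ f6 g6 q6
  have e5 : σ₆.var 5 = m := (f6.var 5 rfl).trans e5
  refine Machine.Runs.seq (R := fun σ' => ∀ j, σ'.arr 13 j =
      (∑ e ∈ Finset.range m, if σ.arr 0 e = j then σ.arr 2 e else 0) +
      ∑ e ∈ Finset.range m, if σ.arr 1 e = j then σ.arr 2 e else 0)
    (Machine.runs_collect (K := m) (σ.arr 1) (σ.arr 2) g6 (by simp [Expr.eval, e5]) rfl rfl rfl
    (fun i hi _ => by simp [Expr.eval, State.setVar_var, f6.arr 11 rfl, e11 i hi])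
    (fun i hi _ => by simp [Expr.eval, State.setVar_var, f6.arr 12 rfl, q5 i hi])
    (fun j => by
      rw [q6]; have := hle (σ.arr 0) j; have := hle (σ.arr 1) j; omega)
    fun σ₁ _ _ h j => by rw [h, q6]) ?_
  intro σ₇ f7 g7 q7
  have e5 : σ₇.var 5 = m := (f7.var 5 rfl).trans e5
  have e37 : ∀ j, σ₇.arr 37 j = 0 := fun j => by
    rw [f7.arr 37 rfl, f6.arr 37 rfl, f5.arr 37 rfl, f4.arr 37 rfl, f3.arr 37 rfl, f2.arr 37 rfl,
      f1.arr 37 rfl, hsa 37 (by omega)]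
  refine Machine.Runs.seq (R := fun σ' => σ'.arr 37 0 = W)
    (Machine.runs_collect (K := m) (fun _ => 0) (σ.arr 2) g7 (by simp [Expr.eval, e5]) rfl rfl rfl
    (fun i hi _ => by simp [Expr.eval])
    (fun i hi _ => by simp [Expr.eval, State.setVar_var, f7.arr 12 rfl, f6.arr 12 rfl, q5 i hi])
    (fun j => by
      rw [e37]; have := hle (fun _ => 0) j; omega)
    fun σ₁ _ _ h => by rw [h, e37, zero_add]; exact hsum fun _ => 0) ?_
  intro σ₈ f8 g8 q8
  refine Machine.Runs.seq (R := fun σ' => σ'.var 11 = W)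
    (Machine.runs_assign g8 (by simp [Expr.eval, State.setVar_var, q8])) ?_
  intro σ₉ f9 g9 q9
  refine Machine.Runs.seq (R := fun σ' => σ'.var 9 = 1)
    (Machine.runs_assign g9 (by simp [Expr.eval, State.setVar_var, Nat.mod_eq_of_lt hone])) ?_
  intro σ₁₀ f10 g10 q10
  refine Machine.Runs.seq (R := fun σ' => σ'.var 7 = 1)
    (Machine.runs_assign g10 (by simp [Expr.eval, State.setVar_var, Nat.mod_eq_of_lt hone])) ?_
  intro σ₁₁ f11 g11 q11
  have hv : ∀ x, 2 ≤ x → x ≠ 4 → x ≠ 5 → x ≠ 15 → x ≠ 11 → x ≠ 9 → x ≠ 7 → σ₁₁.var x = 0 := by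
    intro x h2 h4 h5 h15 h11 h9 h7
    have s : ∀ a b : ℕ, b ≠ a → (a == b) = false := fun a b h => by simpa using Ne.symm h
    rw [f11.var x (s _ _ h7), f10.var x (s _ _ h9), f9.var x (s _ _ h11),
      f8.var x (by simp [Prog.collect, Prog.for, Prog.setsVar, s _ _ h15]),
      f7.var x (by simp [Prog.collect, Prog.for, Prog.setsVar, s _ _ h15]),
      f6.var x (by simp [Prog.collect, Prog.for, Prog.setsVar, s _ _ h15]),
      f5.var x (by simp [Prog.map, Prog.for, Prog.setsVar, s _ _ h15]),
      f4.var x (by simp [Prog.map, Prog.for, Prog.setsVar, s _ _ h15]),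
      f3.var x (by simp [Prog.map, Prog.for, Prog.setsVar, s _ _ h15]), f2.var x (s _ _ h5),
      f1.var x (s _ _ h4), hsv x h2]
  have hv4 : σ₁₁.var 4 = n := by
    rw [f11.var 4 rfl, f10.var 4 rfl, f9.var 4 rfl, f8.var 4 rfl, f7.var 4 rfl, f6.var 4 rfl,
      f5.var 4 rfl, f4.var 4 rfl, f3.var 4 rfl, f2.var 4 rfl, q1]
  refine Machine.Runs.seq (runs_doubling g11 hn hv4
    (hv 6 (by omega) (by omega) (by omega) (by omega) (by omega) (by omega) (by omega)) q11
    (by omega)) ?_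
  rintro σ₁₂ f12 g12 ⟨p1, p2, p3⟩
  generalize hB : σ₁₂.var 6 = B at *
  generalize hP : σ₁₂.var 7 = P at *
  have hBP : B < P := p1 ▸ Nat.lt_two_pow_self
  have hBpos : 0 < B := by
    rcases Nat.eq_zero_or_pos B with rfl | h
    · simp at p1; omega
    · exact h
  -- `B < 2 ^ B ≤ 2n`, so the number of rounds fits into a word.
  have hcube : B * (B * B) ≤ (2 * n) ^ 3 := by
    rw [pow_succ, pow_two, Nat.mul_assoc]
    gcongr <;> omega
  have hrB : r * (B * (B * B)) < 2 ^ M.w := (Nat.mul_le_mul_left _ hcube).trans_lt hr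
  have hval : (Expr.mul (.const r) (.mul (.var 6) (.mul (.var 6) (.var 6)))).eval M.w σ₁₂ =
      r * (B * (B * B)) := by
    rcases Nat.eq_zero_or_pos r with rfl | hrpos
    · simp [Expr.eval]
    · have h1 : B * (B * B) ≤ r * (B * (B * B)) := Nat.le_mul_of_pos_left _ hrpos
      have h2 : B * B ≤ B * (B * B) := Nat.le_mul_of_pos_left _ hBpos
      have h3 : r ≤ r * (B * (B * B)) := Nat.le_mul_of_pos_right _ (by positivity)
      simp only [Expr.eval, hB]
      rw [Nat.mod_eq_of_lt (by omega : B * B < 2 ^ M.w),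
        Nat.mod_eq_of_lt (by omega : B * (B * B) < 2 ^ M.w),
        Nat.mod_eq_of_lt (by omega : r < 2 ^ M.w), Nat.mod_eq_of_lt hrB]
  refine Machine.runs_assign g12 ⟨B, P, ?_, hBpos, ?_, fun e => ?_, ?_⟩
  · refine ⟨g12.tick.setVar (Expr.eval_lt g12 _), ?_, ?_, ?_, ?_, p1, p2, p3, ?_, hn, by omega,
      hprod⟩ <;> simp only [State.setVar_var, State.tick_var] <;> norm_num
    · rw [f12.var 4 rfl, hv4]
    · rw [f12.var 5 rfl, f11.var 5 rfl, f10.var 5 rfl, f9.var 5 rfl, f8.var 5 rfl, e5]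
    · exact hB
    · exact hP
    · rw [f12.var 11 rfl, f11.var 11 rfl, f10.var 11 rfl, q9]
  · simp only [State.setVar_var, hval, if_true]
  · rw [State.setVar_arr, State.tick_arr, f12.arr 12 rfl, f11.arr 12 rfl, f10.arr 12 rfl,
      f9.arr 12 rfl, f8.arr 12 rfl, f7.arr 12 rfl, f6.arr 12 rfl, q5 e e.2, hs2]
  · refine CfgInv.single hn ?_ (fun x => ?_) (fun e => ?_) (fun e => ?_) fun x => ?_
    · rw [State.cfg_cnt]; simp only [State.setVar_var, State.tick_var]; norm_num
      rw [f12.var 9 rfl, f11.var 9 rfl, q10]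
    · rw [State.cfg_loc, State.setVar_arr, State.tick_arr, f12.arr 14 rfl, f11.arr 14 rfl,
        f10.arr 14 rfl, f9.arr 14 rfl, f8.arr 14 rfl, f7.arr 14 rfl, f6.arr 14 rfl, f5.arr 14 rfl,
        f4.arr 14 rfl, f3.arr 14 rfl, f2.arr 14 rfl, f1.arr 14 rfl, hsa 14 (by omega)]
    · rw [State.cfg_ex, State.setVar_arr, State.tick_arr, f12.arr 10 rfl, f11.arr 10 rfl,
        f10.arr 10 rfl, f9.arr 10 rfl, f8.arr 10 rfl, f7.arr 10 rfl, f6.arr 10 rfl, e10 e e.2, hs0]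
    · rw [State.cfg_ey, State.setVar_arr, State.tick_arr, f12.arr 11 rfl, f11.arr 11 rfl,
        f10.arr 11 rfl, f9.arr 11 rfl, f8.arr 11 rfl, f7.arr 11 rfl, f6.arr 11 rfl, e11 e e.2, hs1]
    · rw [State.cfg_dg, State.setVar_arr, State.tick_arr, f12.arr 13 rfl, f11.arr 13 rfl,
        f10.arr 13 rfl, f9.arr 13 rfl, f8.arr 13 rfl, q7, Finset.sum_range, Finset.sum_range]
      simp only [hs0, hs1, hs2]

end

/-! ### Output of the tree. -/

section

variable {κ : Kind} {M : Machine κ} {σ : State} {n m B P W : ℕ} {G : MGraph n m} {D : ℕ → Set ℕ}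

/-- The root has no tree edge above it, so edge `i` belongs to the instance `i + 1` and joins its
vertex to that of its parent. -/
theorem runs_output (hr : Regs M.w σ n m B P W) (h : CfgInv G σ.cfg D) :
    M.Runs outputProg σ (12 * n + 10) fun σ' =>
      (∀ u < n, ∀ v < n, σ.cfg.loc u = σ.cfg.loc v → u = v) →
        ∃ T : MGraph n (n - 1), σ'.HoldsGraph T ∧ G.IsGomoryHuTree T := by
  have hbig := hr.big
  have hone := M.one_lt
  have hpos := hr.pos
  refine (Machine.Runs.seq (t₁ := n * 3 + 2)
    (t₂ := ((n - 1) * 3 + 2) + (((n - 1) * 3 + 2) + (((n - 1) * 3 + 2) + (1 + 1))))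
    (Machine.runs_scatter (K := n) (fun u => σ.arr 14 u) (fun u => u) hr.fits
    (by simp [Expr.eval, hr.n_eq]) rfl rfl rfl
    (by intro i hi hf; simp [Expr.eval, State.setVar_var])
    (by intro i hi hf; simp [Expr.eval, State.setVar_var])
    (fun σ₁ hf hfr h => h)) ?_).mono (by omega) fun _ _ _ h => h
  intro σ₁ f1 g1 q1
  have r1 := hr.frame f1 g1 rfl
  refine Machine.Runs.seq (R := fun σ' => ∀ i < n - 1, σ'.arr 0 i = σ₁.arr 35 (i + 1))
    (Machine.runs_map (K := n - 1) (fun i => σ₁.arr 35 (i + 1)) g1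
    (by simp (disch := omega) [Expr.eval, r1.n_eq, Nat.mod_eq_of_lt]) rfl rfl
    (fun i hi _ => by simp (disch := omega) [Expr.eval, State.setVar_var, Nat.mod_eq_of_lt])
    fun σ₁ _ _ h _ => h) ?_
  intro σ₂ f2 g2 q2
  have r2 := r1.frame f2 g2 rfl
  have e14 : σ₂.arr 14 = σ.arr 14 := (f2.arr 14 rfl).trans (f1.arr 14 rfl)
  refine Machine.Runs.seq
    (R := fun σ' => ∀ i < n - 1, σ'.arr 1 i = σ₁.arr 35 (σ.arr 14 (n + (i + 1))))
    (Machine.runs_map (K := n - 1) (fun i => σ₁.arr 35 (σ.arr 14 (n + (i + 1)))) g2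
    (by simp (disch := omega) [Expr.eval, r2.n_eq, Nat.mod_eq_of_lt]) rfl rfl
    (fun i hi _ => by
      simp (disch := omega) [Expr.eval, State.setVar_var, Nat.mod_eq_of_lt, r2.n_eq, e14,
        f2.arr 35 rfl])
    fun σ₁ _ _ h _ => h) ?_
  intro σ₃ f3 g3 q3
  have r3 := r2.frame f3 g3 rfl
  have e13 : σ₃.arr 13 = σ.arr 13 := (f3.arr 13 rfl).trans ((f2.arr 13 rfl).trans (f1.arr 13 rfl))
  refine Machine.Runs.seq
    (R := fun σ' => ∀ i < n - 1, σ'.arr 2 i = σ.arr 13 (n + (i + 1)))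
    (Machine.runs_map (K := n - 1) (fun i => σ.arr 13 (n + (i + 1))) g3
    (by simp (disch := omega) [Expr.eval, r3.n_eq, Nat.mod_eq_of_lt]) rfl rfl
    (fun i hi _ => by
      simp (disch := omega) [Expr.eval, State.setVar_var, Nat.mod_eq_of_lt, r3.n_eq, e13])
    fun σ₁ _ _ h _ => h) ?_
  intro σ₄ f4 g4 q4
  have r4 := r3.frame f4 g4 rfl
  refine Machine.runs_straight g4 rfl fun _ hinj => ?_
  have hinj : ∀ u < n, ∀ v < n, σ.arr 14 u = σ.arr 14 v → u = v := hinj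
  have hcnt : σ.var 9 = n := by
    refine le_antisymm h.cnt_le ?_
    have := Finset.card_le_card_of_injOn (s := Finset.range n) (t := Finset.range (σ.var 9))
      (σ.arr 14) (fun u hu => by
        simpa using h.loc_lt u (valid_of_lt (Finset.mem_range.1 hu)))
      (fun u hu v hv huv => hinj u (by simpa using hu) v (by simpa using hv) huv)
    simpa using this
  have hrep : ∀ j < n, σ₁.arr 35 j < n ∧ σ.arr 14 (σ₁.arr 35 j) = j := by
    intro j hj
    rcases q1 j with ⟨-, h1⟩ | ⟨u, hu, h1, h2⟩
    · obtain ⟨u, hu, h2⟩ := h.nonempty j (by rw [State.cfg_cnt, hcnt]; exact hj)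
      exact absurd h2 (h1 u hu)
    · rw [h2]; exact ⟨hu, h1⟩
  have hpar : ∀ e : Fin (n - 1), σ.arr 14 (n + (e + 1)) < n ∧ σ.arr 14 (n + (e + 1)) ≠ e + 1 := by
    intro e
    have he := e.2
    have h1 := h.loc_lt (n + (e + 1)) (valid_add (by omega) (by rw [State.cfg_cnt, hcnt]; omega))
    have h2 := h.ncard_below_lt (j := e + 1) (by omega) (by rw [State.cfg_cnt, hcnt]; omega)
    rw [State.cfg_cnt, hcnt] at h1
    exact ⟨h1, fun h3 => by rw [State.cfg_loc, h3] at h2; exact lt_irrefl _ h2⟩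
  let T : MGraph n (n - 1) :=
    { tail := fun e => ⟨σ₁.arr 35 (e + 1), (hrep _ (by omega)).1⟩
      head := fun e => ⟨σ₁.arr 35 (σ.arr 14 (n + (e + 1))), (hrep _ (hpar e).1).1⟩
      weight := fun e => σ.arr 13 (n + (e + 1))
      loopless := fun e he => by
        rw [Fin.mk.injEq] at he
        have h1 := (hrep (e + 1) (by omega)).2
        rw [he, (hrep _ (hpar e).1).2] at h1
        exact (hpar e).2 h1 }
  refine ⟨T, ⟨?_, ?_, fun e => ⟨?_, ?_, ?_⟩⟩, h.gomoryHu_of_injective hpos hinj T fun e =>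
    ⟨(hrep (e + 1) (by omega)).2, (hrep _ (hpar e).1).2, rfl⟩⟩
  · simp [Prog.run, Expr.eval, State.setVar_var, r4.n_eq]
  · simp (disch := omega) [Prog.run, Expr.eval, State.setVar_var, r4.n_eq, Nat.mod_eq_of_lt]
  · exact (congrFun ((f4.arr 0 rfl).trans (f3.arr 0 rfl)) e).trans (q2 e e.2)
  · exact (congrFun (f4.arr 1 rfl) e).trans (q3 e e.2)
  · exact q4 e e.2

end

/-- The machine with other random bits. -/
def Machine.withBits {κ : Kind} (M : Machine κ) (ω : ℕ → Bool) : Machine κ := { M with ω := ω }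

/-- The main loop. -/
def roundsProg (κ : Kind) : Prog :=
  .loop (.lt (.var 12) (.var 8)) (.seq (roundProg κ) (.assign 12 (.add (.var 12) (.const 1))))

/-- What holds between two rounds. -/
structure Ready (w : ℕ) {n m : ℕ} (G : MGraph n m) (B P : ℕ) (σ : State) : Prop where
  regs : Regs w σ n m B P G.totalWeight
  weight : ∀ e : Fin m, σ.arr 12 e = G.weight e
  inv : ∃ D, CfgInv G σ.cfg D

/-! ### Iterated rounds as functions of the random bits. -/

section

variable {κ : Kind} {M : Machine κ} {n m B P W : ℕ} {G : MGraph n m}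

/-- The round is run with the bits of `b` continued by zeros. It reads exactly as many bits as `b`
has, so by `Exec.congr` the same run occurs for every `ω` that agrees with `b` there. -/
theorem exec_round {σ : State} (hσ : Ready M.w G B P σ) (hG : G.OfKind κ) {K : ℕ}
    (hK : 2 ^ K ≤ 2 * B) (hBK : B < 2 ^ K) (hlt : σ.var 12 < σ.var 8)
    (b : Fin (K + n * B + (K + n * B)) → Bool) : ∃ (σ' : State) (H : Net ℕ ℕ),
      (∀ ω : ℕ → Bool, (∀ i : Fin _, ω (σ.bits + i) = b i) →
        Exec κ M.w M.O ω (.seq (roundProg κ) (.assign 12 (.add (.var 12) (.const 1)))) σ.tick σ') ∧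
      Ready M.w G B P σ' ∧ σ'.var 12 = σ.var 12 + 1 ∧ σ'.var 8 = σ.var 8 ∧
      σ'.bits = σ.bits + (K + n * B + (K + n * B)) ∧
      σ'.vertices = σ.vertices + (B + 2) * (3 * n + 4) ∧
      σ'.edges ≤ σ.edges + (B + 2) * (10 * m) ∧
      σ'.time ≤ σ.time + (10000 * ((B + 1) * (n + m)) + 2) ∧
      IsContraction G σ.cfg H ∧ RoundResult n m σ.cfg σ'.cfg H (Sampled (extend b) 0 K B)
        (Sampled (extend b) (K + n * B) K B) := by
  obtain ⟨D, hD⟩ := hσ.inv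
  have hT : Frame .skip σ σ.tick := (Frame.refl _ _).tick
  have hr := hσ.regs.frame hT hσ.regs.fits.tick rfl
  have h8 := hσ.regs.fits.var 8
  set β : ℕ → Bool := fun i => extend b (i - σ.bits) with hβ
  have hβb : ∀ i, β (σ.bits + i) = extend b i := fun i => by rw [hβ]; simp
  obtain ⟨σ₁, hex, hf, hfit, ht, hb, hv, he, H, hH, hR⟩ := runs_round (M := M.withBits β) (κ := κ)
    (G := G) (D := D) (σ := σ.tick) hr rfl hG hD hσ.weight hK hBK
  have h12 : σ₁.var 12 = σ.var 12 := hf.var 12 (by cases κ <;> rfl)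
  have hval : (Expr.add (.var 12) (.const 1)).eval M.w σ₁ = σ.var 12 + 1 := by
    simp (disch := omega) [Expr.eval, h12, Nat.mod_eq_of_lt]
  have hcfg : (σ₁.tick.setVar 12 (σ.var 12 + 1)).cfg = σ₁.cfg := by
    simp [State.cfg, State.setVar_var]
  have hf2 : Frame (.assign 12 (.const 0)) σ₁ (σ₁.tick.setVar 12 (σ.var 12 + 1)) :=
    ⟨fun y hy => Function.update_of_ne (Ne.symm (by simpa [Prog.setsVar] using hy)) _ _,
      fun _ _ => rfl, fun _ => rfl, fun _ => rfl, fun _ => rfl⟩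
  have hr1 := (hr.frame hf hfit (by cases κ <;> rfl)).frame hf2
    (hfit.tick.setVar (by show _ < 2 ^ M.w; omega)) rfl
  have hR' := hR
  obtain ⟨src, mv, hd, hs, hst, -⟩ := hR'
  refine ⟨σ₁.tick.setVar 12 (σ.var 12 + 1), H, fun ω hω => ?_,
    ⟨hr1, fun e => ?_, ⟨_, by rw [hcfg]; exact hs.cfgInv hD hH hst⟩⟩, ?_, ?_, hb, hv, he, ?_, hH, ?_⟩
  · refine Exec.seq (hex.congr fun i h1 h2 => ?_) (hval ▸ Exec.assign ..)
    rw [hb] at h2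
    have h1 : σ.bits ≤ i := h1
    have h2 : i < σ.bits + (K + n * B + (K + n * B)) := h2
    have h3 := hω ⟨i - σ.bits, by omega⟩
    simp only [Nat.add_sub_cancel' h1] at h3
    rw [h3]
    show extend b (i - σ.bits) = _
    rw [extend, dif_pos]
  · rw [State.setVar_arr, State.tick_arr, hf.arr 12 (by cases κ <;> rfl)]
    exact hσ.weight e
  · simp [State.setVar_var]
  · rw [hf2.var 8 rfl, hf.var 8 (by cases κ <;> rfl)]; rfl
  · show σ₁.time + 1 ≤ _
    have ht : σ₁.time ≤ σ.time + 1 + _ := ht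
    omega
  · rw [hcfg]
    refine hR.congr rfl (fun u hu => ?_) fun u hu => ?_
    · refine sampled_congr hu fun i _ => ?_
      rw [zero_add]; exact hβb i
    · refine sampled_congr hu fun i _ => ?_
      show β (σ.bits + (K + n * B) + i) = _
      rw [Nat.add_assoc]; exact hβb _

/-- The number `T` of bits is chosen before the state, so the outcomes are indexed by vectors of a
fixed length. The first bits of a vector determine the state after one round and the others the rest
of the run; averaging over both gives one factor `1 - 1 / (4096 B ^ 2)` per round. -/
theorem exec_rounds (hG : G.OfKind κ) {K : ℕ} (hK : 2 ^ K ≤ 2 * B) (hBK : B < 2 ^ K) (k : ℕ) :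
    ∃ T, ∀ σ, Ready M.w G B P σ → σ.var 12 + k = σ.var 8 →
      ∃ S : (Fin T → Bool) → State,
        (∀ (ω : ℕ → Bool) (b : Fin T → Bool), (∀ i : Fin T, ω (σ.bits + i) = b i) →
          Exec κ M.w M.O ω (roundsProg κ) σ (S b)) ∧
        (∀ b, Ready M.w G B P (S b) ∧
          (S b).vertices ≤ σ.vertices + k * ((B + 2) * (3 * n + 4)) ∧
          (S b).edges ≤ σ.edges + k * ((B + 2) * (10 * m)) ∧
          (S b).time ≤ σ.time + k * (10000 * ((B + 1) * (n + m)) + 2) + 1 ∧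
          (S b).bits = σ.bits + T) ∧
        (4096 * B ^ 2) ^ k * ∑ b, (unsplit n (S b).cfg).card ≤
          (4096 * B ^ 2 - 1) ^ k * (2 ^ T * (unsplit n σ.cfg).card) := by
  induction k with
  | zero =>
    refine ⟨0, fun σ hσ hk => ⟨fun _ => σ.tick, fun ω b _ => ?_, fun b =>
      ⟨⟨hσ.regs.frame (p := .skip) (Frame.refl _ _).tick hσ.regs.fits.tick rfl, hσ.weight, hσ.inv⟩,
      ?_, ?_, ?_, rfl⟩, ?_⟩⟩
    · exact .loop_false (if_neg (show ¬σ.var 12 < σ.var 8 by omega))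
    · simp [State.tick]
    · simp [State.tick]
    · simp [State.tick]
    · simp [State.cfg]
  | succ k ih =>
    obtain ⟨T, hT⟩ := ih
    set N := K + n * B + (K + n * B) with hN
    refine ⟨N + T, fun σ hσ hk => ?_⟩
    choose σ₁ H h1 h2 h3 h4 h5 h6 h7 h8 h9 h10 using
      exec_round hσ hG hK hBK (by omega)
    choose S g1 g2 g3 using fun b => hT (σ₁ b) (h2 b) (by have := h3 b; have := h4 b; omega)
    obtain ⟨D, hD⟩ := hσ.inv
    set b₀ : Fin N → Bool := fun _ => false
    -- The progress bound concerns one graph, so the contraction produced by the bits `b₀` is used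
    -- for all outcomes.
    have hprog := expected_progress (c' := fun b => (σ₁ b).cfg) hD (h9 b₀)
      (hσ.regs.two_pow ▸ hσ.regs.lt_pow) hK hBK
      fun b => (h10 b).congr ((h9 b).cut_eq (h9 b₀)) (fun _ _ => Iff.rfl) fun _ _ => Iff.rfl
    refine ⟨fun b => S (fun i => b (Fin.castAdd T i)) (fun i => b (Fin.natAdd N i)),
      fun ω b hω => ?_, fun b => ?_, ?_⟩
    · refine .loop_true ?_ (h1 _ ω fun i => hω (Fin.castAdd T i)) (g1 _ ω _ fun i => ?_)
      · have : (Expr.lt (.var 12) (.var 8)).eval M.w σ = 1 % 2 ^ M.w :=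
          if_pos (show σ.var 12 < σ.var 8 by omega)
        rw [this, Nat.mod_eq_of_lt M.one_lt]
        exact one_ne_zero
      · rw [h5, Nat.add_assoc]
        exact hω (Fin.natAdd N i)
    · obtain ⟨a1, a2, a3, a4, a5⟩ := g2 (fun i => b (Fin.castAdd T i)) (fun i => b (Fin.natAdd N i))
      have d5 := h5 (fun i => b (Fin.castAdd T i))
      have d6 := h6 (fun i => b (Fin.castAdd T i))
      have d7 := h7 (fun i => b (Fin.castAdd T i))
      have d8 := h8 (fun i => b (Fin.castAdd T i))
      refine ⟨a1, ?_, ?_, ?_, ?_⟩ <;> beta_reduce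
      · rw [Nat.succ_mul]; omega
      · rw [Nat.succ_mul]; omega
      · rw [Nat.succ_mul]; omega
      · omega
    · rw [← (Fin.appendEquiv N T).sum_comp, Fintype.sum_prod_type]
      simp only [Fin.appendEquiv, Equiv.coe_fn_mk, Fin.append_left, Fin.append_right]
      have hA : 0 < 4096 * B ^ 2 := by
        have : 0 < B := by
          rcases Nat.eq_zero_or_pos B with rfl | h
          · simp at hK
          · exact h
        positivity
      set A := 4096 * B ^ 2 with hAdef
      have hp2 : A * ∑ b, (unsplit n (σ₁ b).cfg).card ≤
          (A - 1) * (2 ^ N * (unsplit n σ.cfg).card) := by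
        rw [Nat.sub_mul, one_mul]
        exact Nat.le_sub_of_add_le hprog
      calc A ^ (k + 1) * ∑ x, ∑ y, (unsplit n (S x y).cfg).card
          = A * ∑ x, A ^ k * ∑ y, (unsplit n (S x y).cfg).card := by
            rw [pow_succ, ← Finset.mul_sum]; ring
        _ ≤ A * ∑ x, (A - 1) ^ k * (2 ^ T * (unsplit n (σ₁ x).cfg).card) :=
            Nat.mul_le_mul_left _ (Finset.sum_le_sum fun x _ => g3 x)
        _ = (A - 1) ^ k * 2 ^ T * (A * ∑ x, (unsplit n (σ₁ x).cfg).card) := by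
            rw [← Finset.mul_sum, ← Finset.mul_sum]; ring
        _ ≤ (A - 1) ^ k * 2 ^ T * ((A - 1) * (2 ^ N * (unsplit n σ.cfg).card)) :=
            Nat.mul_le_mul_left _ hp2
        _ = _ := by rw [pow_succ, pow_add]; ring

end

/-! ### The success probability. -/

theorem card_unsplit_le (n : ℕ) (c : Cfg) : (unsplit n c).card ≤ n ^ 2 := by
  refine (Finset.card_filter_le _ _).trans ?_
  rw [Finset.offDiag_card, Finset.card_range, sq]
  exact Nat.sub_le _ _

theorem loc_injective_of_unsplit {n : ℕ} {c : Cfg} (h : (unsplit n c).card = 0) :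
    ∀ u < n, ∀ v < n, c.loc u = c.loc v → u = v := by
  intro u hu v hv huv
  by_contra hne
  have : (u, v) ∈ unsplit n c := by
    simp only [unsplit, Finset.mem_filter, Finset.mem_offDiag, Finset.mem_range]
    exact ⟨⟨hu, hv, hne⟩, huv⟩
  rw [Finset.card_eq_zero.1 h] at this
  exact absurd this (Finset.notMem_empty _)

/-- The outcome of the algorithm as a function of the random bits that it uses. -/
theorem exec_main {κ : Kind} (M : Machine κ) {n m r : ℕ} {G : MGraph n m} (hG : G.OfKind κ)
    (hn : 0 < n) (hbig : 600 * (n + m + G.totalWeight + 2) ≤ 2 ^ M.w)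
    (hprod : 8 * ((n + 1) * (G.totalWeight + 1)) ≤ 2 ^ M.w) (hr : r * (2 * n) ^ 3 < 2 ^ M.w) :
    ∃ B T, 0 < B ∧ n < 2 ^ B ∧ 2 ^ B ≤ 2 * n ∧ ∃ F : (Fin T → Bool) → State,
      (∀ (ω : ℕ → Bool) (b : Fin T → Bool), (∀ i : Fin T, ω i = b i) →
        Exec κ M.w M.O ω (mainProg κ r) (State.start G) (F b)) ∧
      (∀ b, (F b).vertices ≤ r * (B * (B * B)) * ((B + 2) * (3 * n + 4)) ∧
        (F b).edges ≤ r * (B * (B * B)) * ((B + 2) * (10 * m)) ∧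
        (F b).time ≤ 20 * (n + m + 1) + r * (B * (B * B)) * (10000 * ((B + 1) * (n + m)) + 2) +
          (12 * n + 12)) ∧
      ∃ u : (Fin T → Bool) → ℕ,
        (∀ b, u b = 0 → ∃ T : MGraph n (n - 1), (F b).HoldsGraph T ∧ G.IsGomoryHuTree T) ∧
        (4096 * B ^ 2) ^ (r * (B * (B * B))) * ∑ b, u b ≤
          (4096 * B ^ 2 - 1) ^ (r * (B * (B * B))) * (2 ^ T * n ^ 2) := by
  obtain ⟨σ₁, ex1, hf1, hfit1, ht1, B, P, hr1, hB, h8, h12, hinv⟩ :=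
    runs_init (M := M) (r := r) hn hbig hprod hr
  have hb1 : σ₁.bits = 0 := hf1.bits rfl
  have hv1 : σ₁.vertices = 0 := hf1.vertices rfl
  have he1 : σ₁.edges = 0 := hf1.edges rfl
  have ht1 : σ₁.time ≤ 0 + 20 * (n + m + 1) := ht1
  -- `K = ⌊log₂ B⌋ + 1` is the number with `2 ^ (K - 1) ≤ B < 2 ^ K`.
  obtain ⟨T, hT⟩ := exec_rounds (M := M) (G := G) (B := B) (P := P) hG (K := Nat.log 2 B + 1)
    (by rw [pow_succ, mul_comm]; exact Nat.mul_le_mul_left _ (Nat.pow_log_le_self 2 hB.ne'))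
    (Nat.lt_pow_succ_log_self (by norm_num) B) (r * (B * (B * B)))
  set σ₂ := σ₁.tick.setVar 12 0 with hσ₂
  have hf2 : Frame (.assign 12 (.const 0)) σ₁ σ₂ :=
    ⟨fun y hy => Function.update_of_ne (Ne.symm (by simpa [Prog.setsVar] using hy)) _ _,
      fun _ _ => rfl, fun _ => rfl, fun _ => rfl, fun _ => rfl⟩
  have ex2 : ∀ ω, Exec κ M.w M.O ω (.assign 12 (.const 0)) σ₁ σ₂ := fun ω => by
    have := Exec.assign (κ := κ) (w := M.w) (O := M.O) (ω := ω) 12 (.const 0) σ₁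
    rwa [show (Expr.const 0).eval M.w σ₁ = 0 from Nat.zero_mod _] at this
  have hcfg : σ₂.cfg = σ₁.cfg := by simp [hσ₂, State.cfg, State.setVar_var]
  obtain ⟨S, g1, g2, g3⟩ := hT σ₂
    ⟨hr1.frame hf2 (hfit1.tick.setVar (by positivity)) rfl, h12, _, by rw [hcfg]; exact hinv⟩
    (by rw [hf2.var 8 rfl, h8]; simp [hσ₂, State.setVar_var])
  have hout : ∀ b, ∃ σ', (∀ ω, Exec κ M.w M.O ω outputProg (S b) σ') ∧
      σ'.vertices = (S b).vertices ∧ σ'.edges = (S b).edges ∧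
      σ'.time ≤ (S b).time + (12 * n + 10) ∧ ((unsplit n (S b).cfg).card = 0 →
        ∃ T : MGraph n (n - 1), σ'.HoldsGraph T ∧ G.IsGomoryHuTree T) := by
    intro b
    obtain ⟨hS, -⟩ := g2 b
    obtain ⟨D, hD⟩ := hS.inv
    obtain ⟨σ', ex3, hf3, -, ht3, h3⟩ := runs_output hS.regs hD
    have hb3 : σ'.bits = (S b).bits := hf3.bits rfl
    exact ⟨σ', fun ω => ex3.congr fun i _ _ => by omega, hf3.vertices rfl, hf3.edges rfl, ht3,
      fun h => h3 (loc_injective_of_unsplit h)⟩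
  choose F f1 f2 f3 f4 f5 using hout
  refine ⟨B, T, hB, ?_, ?_, F, fun ω b hω => ?_, fun b => ?_,
    fun b => (unsplit n (S b).cfg).card, f5, g3.trans ?_⟩
  · rw [← hr1.two_pow]; exact hr1.lt_pow
  · rw [← hr1.two_pow]; exact hr1.pow_le
  · refine .seq (ex1.congr fun i h1 h2 => absurd h2 (by omega)) (.seq (.seq (ex2 ω)
      (g1 ω b fun i => ?_)) (f1 b ω))
    rw [show σ₂.bits = 0 from hb1, zero_add]
    exact hω i
  · obtain ⟨-, a1, a2, a3, -⟩ := g2 b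
    have e1 : σ₂.vertices = 0 := hv1
    have e2 : σ₂.edges = 0 := he1
    have e3 : σ₂.time = σ₁.time + 1 := rfl
    rw [f2, f3]
    have := f4 b
    refine ⟨by omega, by omega, by omega⟩
  · exact Nat.mul_le_mul_left _ (Nat.mul_le_mul_left _ (card_unsplit_le _ _))

/-- With probability exponentially close to one all pairs have been separated. -/
theorem card_bad_le {c n B T : ℕ} (hn : 0 < n) (hB : 0 < B) (hnB : n < 2 ^ B)
    (u : (Fin T → Bool) → ℕ)
    (hu : (4096 * B ^ 2) ^ (4096 * (c + 2) * (B * (B * B))) * ∑ b, u b ≤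
      (4096 * B ^ 2 - 1) ^ (4096 * (c + 2) * (B * (B * B))) * (2 ^ T * n ^ 2)) :
    1 - 1 / (n : ℝ) ^ c ≤ ((Finset.univ.filter fun b => u b = 0).card : ℝ) / 2 ^ T := by
  have hcard : (Finset.univ.filter fun b => u b = 0).card +
      (Finset.univ.filter fun b => ¬u b = 0).card = 2 ^ T := by
    rw [Finset.card_filter_add_card_filter_not]; simp
  -- Markov's inequality for a natural-valued variable: failure means that at least one pair is
  -- unseparated.
  have hbad : (Finset.univ.filter fun b => ¬u b = 0).card ≤ ∑ b, u b := by
    rw [Finset.card_filter]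
    exact Finset.sum_le_sum fun b _ => by split_ifs <;> omega
  set A : ℝ := 4096 * (B : ℝ) ^ 2 with hA
  set L := 4096 * (c + 2) * (B * (B * B)) with hL
  have hB1 : (1 : ℝ) ≤ B := by exact_mod_cast hB
  have hApos : 1 ≤ A := by rw [hA]; nlinarith
  have hn0 : (0 : ℝ) < n := by exact_mod_cast hn
  have hu' : A ^ L * (∑ b, u b : ℕ) ≤ (A - 1) ^ L * (2 ^ T * (n : ℝ) ^ 2) := by
    have h1 : 1 ≤ 4096 * B ^ 2 := Nat.mul_pos (by norm_num) (pow_pos hB 2)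
    have := Nat.cast_le (α := ℝ) |>.2 hu
    push_cast [Nat.cast_sub h1] at this ⊢
    exact this
  -- `(1 - 1/A) ^ L ≤ exp (-L/A)`, and the number of rounds is chosen such that `L / A = (c + 2) B`.
  have hexp : (A - 1) ^ L ≤ A ^ L * Real.exp (-((c + 2) * B)) := by
    have h1 : A - 1 ≤ A * Real.exp (-(1 / A)) := by
      have := Real.add_one_le_exp (-(1 / A))
      calc A - 1 = A * (-(1 / A) + 1) := by field_simp; ring
        _ ≤ _ := mul_le_mul_of_nonneg_left this (by linarith)
    refine (pow_le_pow_left₀ (by linarith) h1 L).trans_eq ?_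
    rw [mul_pow, ← Real.exp_nat_mul]
    congr 2
    rw [hL, hA]
    push_cast
    field_simp
  -- From `n < 2 ^ B ≤ e ^ B`. Two of the `c + 2` powers of `n` pay for the at most `n ^ 2` initial
  -- pairs.
  have hnexp : (n : ℝ) ^ (c + 2) ≤ Real.exp ((c + 2) * B) := by
    have h1 : (n : ℝ) ≤ Real.exp B := by
      have h2 : (n : ℝ) ≤ 2 ^ B := by exact_mod_cast hnB.le
      refine h2.trans ?_
      rw [← mul_one (B : ℝ), Real.exp_nat_mul]
      exact pow_le_pow_left₀ (by norm_num) (by linarith [Real.add_one_le_exp (1 : ℝ)]) _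
    calc (n : ℝ) ^ (c + 2) ≤ Real.exp B ^ (c + 2) := pow_le_pow_left₀ hn0.le h1 _
      _ = _ := by rw [← Real.exp_nat_mul]; push_cast; ring_nf
  have hmain : ((Finset.univ.filter fun b => ¬u b = 0).card : ℝ) ≤ 2 ^ T * (1 / (n : ℝ) ^ c) := by
    have hs : ((Finset.univ.filter fun b => ¬u b = 0).card : ℝ) ≤ (∑ b, u b : ℕ) := by
      exact_mod_cast hbad
    refine hs.trans ?_
    have h2 : A ^ L * (∑ b, u b : ℕ) ≤ A ^ L * (Real.exp (-((c + 2) * B)) * (2 ^ T * (n : ℝ) ^ 2)) := by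
      refine hu'.trans ?_
      rw [← mul_assoc (A ^ L)]
      exact mul_le_mul_of_nonneg_right hexp (by positivity)
    refine (le_of_mul_le_mul_left h2 (by positivity)).trans ?_
    rw [Real.exp_neg]
    calc (Real.exp ((c + 2) * B))⁻¹ * (2 ^ T * (n : ℝ) ^ 2)
        ≤ ((n : ℝ) ^ (c + 2))⁻¹ * (2 ^ T * (n : ℝ) ^ 2) := by gcongr
      _ = _ := by rw [pow_add]; field_simp
  rw [le_div_iff₀ (by positivity)]
  have hc : ((Finset.univ.filter fun b => u b = 0).card : ℝ) +
      (Finset.univ.filter fun b => ¬u b = 0).card = 2 ^ T := by exact_mod_cast hcard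
  linarith

/-- The law of the first random bits is uniform. -/
theorem coins_real_ge {T : ℕ} (s : Finset (Fin T → Bool)) {E : Set (ℕ → Bool)}
    (h : ∀ ω : ℕ → Bool, (fun i : Fin T => ω i) ∈ s → ω ∈ E) :
    (s.card : ℝ) / 2 ^ T ≤ coins.real E := by
  have hp : MeasureTheory.IsProbabilityMeasure coins := by unfold coins; infer_instance
  set Cyl : (Fin T → Bool) → Set (ℕ → Bool) := fun b =>
    Set.pi (Finset.range T : Set ℕ) fun i => {extend b i} with hCyl
  have hmem : ∀ b ω, ω ∈ Cyl b ↔ (fun i : Fin T => ω i) = b := by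
    intro b ω
    simp only [hCyl, Set.mem_pi, Finset.coe_range, Set.mem_Iio, Set.mem_singleton_iff]
    constructor
    · intro h
      funext i
      rw [h i i.2, extend, dif_pos i.2]
    · rintro rfl i hi
      rw [extend, dif_pos hi]
  have hmeas : ∀ b, MeasurableSet (Cyl b) := fun b =>
    MeasurableSet.pi (Finset.countable_toSet _) fun i _ => MeasurableSet.singleton _
  have hcyl : ∀ b, coins.real (Cyl b) = 1 / 2 ^ T := by
    intro b
    rw [MeasureTheory.measureReal_def, coins, hCyl,
      MeasureTheory.Measure.infinitePi_pi _ fun i _ => MeasurableSet.singleton _]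
    have h1 : ∀ x : Bool, (PMF.uniformOfFintype Bool).toMeasure {x} = 2⁻¹ := by
      intro x
      rw [PMF.toMeasure_apply_singleton _ _ (MeasurableSet.singleton _),
        PMF.uniformOfFintype_apply]
      simp
    simp only [h1, Finset.prod_const, Finset.card_range]
    simp
  calc (s.card : ℝ) / 2 ^ T = ∑ b ∈ s, coins.real (Cyl b) := by
        simp only [hcyl, Finset.sum_const, nsmul_eq_mul]; ring
    _ = coins.real (⋃ b ∈ s, Cyl b) := by
        rw [MeasureTheory.measureReal_biUnion_finset (fun a _ b _ hab => ?_) fun b _ => hmeas b]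
        refine Set.disjoint_left.2 fun ω ha hb => hab ?_
        rw [← (hmem a ω).1 ha, (hmem b ω).1 hb]
    _ ≤ coins.real E := by
        refine MeasureTheory.measureReal_mono fun ω hω => h ω ?_
        obtain ⟨b, hb, hω⟩ := Set.mem_iUnion₂.1 hω
        rwa [(hmem b ω).1 hω]

/-! ### Resource bounds, the word length and the final theorem. -/

/-- There are `R B ^ 3` rounds, each with a cost of order `B` times the size of the graph. With `B ≤
ℓ` this gives a fourth power of `ℓ`, well below the allowed exponent. -/
theorem resources_le {R B n m ℓ : ℕ} (hR : 0 < R) (hn : 0 < n) (hB : B ≤ ℓ) (hℓ : 0 < ℓ) :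
    R * (B * (B * B)) * ((B + 2) * (3 * n + 4)) ≤ 100000 * R * n * ℓ ^ (100000 * R) ∧
      R * (B * (B * B)) * ((B + 2) * (10 * m)) ≤ 100000 * R * m * ℓ ^ (100000 * R) ∧
      20 * (n + m + 1) + R * (B * (B * B)) * (10000 * ((B + 1) * (n + m)) + 2) + (12 * n + 12) ≤
        100000 * R * (n + m) * ℓ ^ (100000 * R) := by
  have hp : ℓ ^ 4 ≤ ℓ ^ (100000 * R) := Nat.pow_le_pow_right hℓ (by omega)
  have hB3 : R * (B * (B * B)) ≤ R * (ℓ * (ℓ * ℓ)) := by gcongr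
  have h1 : 1 ≤ R * (ℓ * (ℓ * ℓ)) * ℓ := Nat.mul_pos (Nat.mul_pos hR (by positivity)) hℓ
  have key : ∀ a k : ℕ, k ≤ 100000 * a → R * (ℓ * (ℓ * ℓ)) * (ℓ * k) ≤
      100000 * R * a * ℓ ^ (100000 * R) := by
    intro a k hk
    calc R * (ℓ * (ℓ * ℓ)) * (ℓ * k) ≤ R * (ℓ * (ℓ * ℓ)) * (ℓ * (100000 * a)) := by gcongr
      _ = 100000 * R * a * ℓ ^ 4 := by ring
      _ ≤ _ := Nat.mul_le_mul_left _ hp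
  refine ⟨(Nat.mul_le_mul hB3 ?_).trans (key n (21 * n) (by omega)),
    (Nat.mul_le_mul hB3 ?_).trans (key m (30 * m) (by omega)), ?_⟩
  · calc (B + 2) * (3 * n + 4) ≤ (3 * ℓ) * (7 * n) := by gcongr <;> omega
      _ = _ := by ring
  · calc (B + 2) * (10 * m) ≤ (3 * ℓ) * (10 * m) := by gcongr; omega
      _ = _ := by ring
  · have h2 : R * (B * (B * B)) * (10000 * ((B + 1) * (n + m)) + 2) ≤
        R * (ℓ * (ℓ * ℓ)) * (ℓ * (20002 * (n + m))) := by
      refine Nat.mul_le_mul hB3 ?_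
      have : (B + 1) * (n + m) ≤ (2 * ℓ) * (n + m) := by gcongr; omega
      have : 1 ≤ ℓ * (n + m) := Nat.mul_pos hℓ (by omega)
      nlinarith
    have h3 : 64 * (n + m) ≤ R * (ℓ * (ℓ * ℓ)) * (ℓ * (64 * (n + m))) := by
      rw [← mul_assoc]; exact Nat.le_mul_of_pos_left _ h1
    refine le_trans ?_ (key (n + m) (20066 * (n + m)) (by omega))
    have h4 : R * (ℓ * (ℓ * ℓ)) * (ℓ * (20066 * (n + m))) = R * (ℓ * (ℓ * ℓ)) * (ℓ * (64 * (n + m)))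
      + R * (ℓ * (ℓ * ℓ)) * (ℓ * (20002 * (n + m))) := by ring
    rw [h4]
    omega

/-- The base is at least three, so constant factors and also `R` itself, as `R < x ^ R`, are
absorbed into the exponent. -/
theorem word_length {R n m W w : ℕ} (hR : 0 < R) (hn : 0 < n)
    (hw : (n + m + W + 2) ^ (100000 * R) ≤ 2 ^ w) :
    600 * (n + m + W + 2) ≤ 2 ^ w ∧ 8 * ((n + 1) * (W + 1)) ≤ 2 ^ w ∧ R * (2 * n) ^ 3 < 2 ^ w := by
  set x := n + m + W + 2 with hx
  have hx3 : 3 ≤ x := by omega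
  have key : ∀ k ≤ 100000 * R, x ^ k ≤ 2 ^ w := fun k hk =>
    (Nat.pow_le_pow_right (by omega) hk).trans hw
  refine ⟨le_trans ?_ (key (6 + 1) (by omega)), le_trans ?_ (key (2 + 2) (by omega)),
    lt_of_lt_of_le ?_ (key (R + (3 + 3)) (by omega))⟩
  · rw [pow_add, pow_one]
    exact Nat.mul_le_mul_right _ ((by norm_num : 600 ≤ 3 ^ 6).trans (Nat.pow_le_pow_left hx3 6))
  · rw [pow_add]
    refine Nat.mul_le_mul ((by norm_num : 8 ≤ 3 ^ 2).trans (Nat.pow_le_pow_left hx3 2)) ?_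
    rw [sq]
    exact Nat.mul_le_mul (by omega) (by omega)
  · rw [pow_add, pow_add, mul_pow]
    refine Nat.mul_lt_mul_of_lt_of_le ((Nat.lt_pow_self (by omega : 1 < x))) ?_ (by positivity)
    exact Nat.mul_le_mul ((by norm_num : 2 ^ 3 ≤ 3 ^ 3).trans (Nat.pow_le_pow_left hx3 3))
      (Nat.pow_le_pow_left (by omega) 3)

end GomoryHu

theorem mainTheorem7 (κ : GomoryHu.Kind) (c : ℕ) :
    ∃ (p : GomoryHu.Prog) (C : ℕ),
      ∀ (n m : ℕ) (G : GomoryHu.MGraph n m), 0 < n → G.OfKind κ →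
      ∀ w : ℕ, (n + m + G.totalWeight + 2) ^ C ≤ 2 ^ w →
      ∀ O : GomoryHu.Oracles, O.Correct κ →
        (∀ ω : ℕ → Bool, ∃ σ : GomoryHu.State,
          GomoryHu.Exec κ w O ω p (GomoryHu.State.start G) σ ∧
          σ.vertices ≤ C * n * GomoryHu.polylog C n ∧
          σ.edges ≤ C * m * GomoryHu.polylog C n ∧
          σ.time ≤ C * (n + m) * GomoryHu.polylog C n) ∧
        1 - 1 / (n : ℝ) ^ c ≤
          GomoryHu.coins.real {ω | ∃ σ : GomoryHu.State,
            GomoryHu.Exec κ w O ω p (GomoryHu.State.start G) σ ∧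
            ∃ T : GomoryHu.MGraph n (n - 1), σ.HoldsGraph T ∧ G.IsGomoryHuTree T} := by
  have hR : 0 < 4096 * (c + 2) := by omega
  refine ⟨GomoryHu.mainProg κ (4096 * (c + 2)), 100000 * (4096 * (c + 2)),
    fun n m G hn hG w hw O hO => ?_⟩
  obtain ⟨hw1, hw2, hw3⟩ := GomoryHu.word_length hR hn hw
  obtain ⟨B, T, hB, hnB, hBn, F, h1, h2, u, h3, h4⟩ := GomoryHu.exec_main
    (⟨w, O, fun _ => false, hO, by omega⟩ : GomoryHu.Machine κ) hG hn hw1 hw2 hw3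
  have hBl : B ≤ Nat.log 2 n + 1 := by
    rw [← Nat.log_mul_base (by norm_num) hn.ne', mul_comm]
    exact Nat.le_log_of_pow_le (by norm_num) hBn
  obtain ⟨r1, r2, r3⟩ := GomoryHu.resources_le (m := m) hR hn hBl (Nat.succ_pos _)
  refine ⟨fun ω => ⟨F fun i => ω i, h1 ω _ fun _ => rfl, ?_⟩,
    (GomoryHu.card_bad_le hn hB hnB u h4).trans (GomoryHu.coins_real_ge _ fun ω hω => ?_)⟩
  · obtain ⟨a1, a2, a3⟩ := h2 fun i => ω i
    exact ⟨a1.trans r1, a2.trans r2, a3.trans r3⟩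
  · exact ⟨_, h1 ω _ fun _ => rfl, h3 _ (Finset.mem_filter.1 hω).2⟩
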